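/- Let $d\ge 2$ and $n=d-1$. Write $\langle\xi\rangle=(1+|\xi|^2)^{1/2}$ and, for $0<h\le 1$ and a symbol $a(x,\xi)$ on $\mathbb{R}^{n}\times\mathbb{R}^{n}$, $$(\mathrm{Op}_h(a)f)(x)=(2\pi h)^{-n}\int\!\!\int e^{-\frac ih\langle x-y,\xi\rangle}a(x,\xi)f(y)\,dy\,d\xi$$ for Schwartz functions $f$; the same notation is used for the bounded extensions of this operator to $L^2=L^2(\mathbb{R}^n)$ and to the Sobolev space $H_h^k=H_h^k(\mathbb{R}^n)$ of tempered distributions $u$ with $\|u\|_{H_h^k}:=\|\mathrm{Op}_h(\langle\xi\rangle^k)u\|_{L^2}<\infty$. Given $k\in\mathbb{R}$ and constants $C_{\alpha,\beta}$ indexed by multi-indices, consider the bounds $$(*)_k\qquad |\partial_\xi^\alpha\partial_x^\beta a(x,\xi)|\le C_{\alpha,\beta}\langle\xi\rangle^{k-|\alpha|}.$$ "$a$ satisfies $(*)_k$ for all $\alpha,\beta$" means that $a\in C^\infty(\mathbb{R}^n\times\mathbb{R}^n)$ and $(*)_k$ holds for all multi-indices $\alpha,\beta$. "$a$ satisfies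 $(*)_k$ for $|\beta|\le\mu$" means that $a$ is $C^\infty$ in $\xi$, that the $x$-derivatives $\partial_x^\beta a$, $|\beta|\le\mu$, exist in the sense of distributions and are represented by functions that are $C^\infty$ in $\xi$, and that $(*)_k$ holds for all $\alpha$ and all $|\beta|\le\mu$ (so only bounded, not necessarily continuous, derivatives in $x$ of order $\mu$ are required). Then there is an integer $s_d\ge 0$ depending only on $d$ such that, with $s_d'=2d+5+s_d$, the following hold for every integer $\mu\ge 1$. In each case the operators involved are bounded, $\mathrm{Op}_h(a_1)$ on $L^2$ and $\mathrm{Op}_h(a_2),\mathrm{Op}_h(a_1a_2)$ from the indicated space to $L^2$, and the implicit constant in $\lesssim$ depends only on $d$, $\mu$ and the orders of the symbols and of the Sobolev space (not on $h\in(0,1]$, the symbols or the constants $C^{(j)}$). (i) Let $k_1<0$ and $k\in\mathbb{R}$. If $a_1$ satisfies $(*)_{k_1}$ for $|\beta|\le\mu$ with constants $C^{(1)}_{\alpha,\beta}$ and $a_2$ satisfies $(*)_k$ for all $\alpha,\beta$ with constants $C^{(2)}_{\alpha,\beta}$, then $$\|\mathrm{Op}_h(a_1)\mathrm{Op}_h(a_2)-\mathrm{Op}_h(a_1a_2)\|_{H_h^k\to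 L^2}\lesssim \sum_{\substack{|\alpha_1|+|\beta_1|+|\alpha_2|+|\beta_2|\le s_d',\ |\beta_1|\le\mu\\ |\alpha_1|+|\beta_1|\ge1,\ |\alpha_2|+|\beta_2|\ge1}}h^{\frac{|\alpha_1|+|\beta_1|+|\alpha_2|+|\beta_2|}{2}}C^{(1)}_{\alpha_1,\beta_1}C^{(2)}_{\alpha_2,\beta_2}$$ $$+h^{\mu/2}\log(1+h^{-1})\sum_{|\alpha_1|\le d,\ |\beta_1|=\mu,\ |\alpha_2|+|\beta_2|\le s_d}h^{\frac{|\alpha_2|+|\beta_2|}{2}}C^{(1)}_{\alpha_1,\beta_1}C^{(2)}_{\alpha_2,\beta_2}+h^{\mu/2}\log(1+h^{-1})\sum_{|\alpha_1|+|\alpha_2|\le d,\ |\beta_1|=\mu}C^{(1)}_{\alpha_1,\beta_1}C^{(2)}_{\alpha_2,0}.$$ (ii) Let $k<k'$. If $a_1$ satisfies $(*)_0$ for all $\alpha,\beta$ with constants $C^{(1)}_{\alpha,\beta}$ and $a_2$ satisfies $(*)_k$ for $|\beta|\le\mu$ with constants $C^{(2)}_{\alpha,\beta}$, then $$\|\mathrm{Op}_h(a_1)\mathrm{Op}_h(a_2)-\mathrm{Op}_h(a_1a_2)\|_{H_h^{k'}\to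 L^2}\lesssim \sum_{\substack{|\alpha_1|+|\beta_1|+|\alpha_2|+|\beta_2|\le s_d',\ |\beta_2|\le\mu\\ |\alpha_1|+|\beta_1|\ge1,\ |\alpha_2|+|\beta_2|\ge1}}h^{\frac{|\alpha_1|+|\beta_1|+|\alpha_2|+|\beta_2|}{2}}C^{(1)}_{\alpha_1,\beta_1}C^{(2)}_{\alpha_2,\beta_2}$$ $$+h^{\mu/2}\log(1+h^{-1})\sum_{|\alpha_1|+|\beta_1|\le s_d,\ |\alpha_2|\le d,\ |\beta_2|=\mu}h^{\frac{|\alpha_1|+|\beta_1|}{2}}C^{(1)}_{\alpha_1,\beta_1}C^{(2)}_{\alpha_2,\beta_2}+h^{\mu/2}\log(1+h^{-1})\sum_{|\alpha_1|+|\alpha_2|\le d,\ |\beta_2|=\mu}C^{(1)}_{\alpha_1,0}C^{(2)}_{\alpha_2,\beta_2}.$$ (iii) If $a_1$ satisfies $(*)_0$ for all $\alpha,\beta$ with constants $C^{(1)}_{\alpha,\beta}$ and $a_2=a_2(x)$ is independent of $\xi$, with derivatives in the sense of distributions satisfying $|\partial_x^\beta a_2(x)|\le C^{(2)}_\beta$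 for all $|\beta|\le\mu$, then $$\|\mathrm{Op}_h(a_1)\mathrm{Op}_h(a_2)-\mathrm{Op}_h(a_1a_2)\|_{L^2\to L^2}\lesssim \sum_{\substack{|\alpha_1|+|\beta_1|+|\beta_2|\le s_d'\\ |\alpha_1|+|\beta_1|\ge1,\ 1\le|\beta_2|\le\mu}}h^{\frac{|\alpha_1|+|\beta_1|+|\beta_2|}{2}}C^{(1)}_{\alpha_1,\beta_1}C^{(2)}_{\beta_2}+h^{\mu/2}\sum_{|\alpha_1|+|\beta_1|\le s_d,\ |\beta_2|=\mu}h^{\frac{|\alpha_1|+|\beta_1|}{2}}C^{(1)}_{\alpha_1,\beta_1}C^{(2)}_{\beta_2}.$$ -/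

import Mathlib

open MeasureTheory Real
open scoped SchwartzMap ContDiff FourierTransform

noncomputable section

namespace RoughPsiDO

/-- The Euclidean space `ℝⁿ`. -/
abbrev Eu (n : ℕ) : Type := EuclideanSpace ℝ (Fin n)

/-- The Hilbert space `L²(ℝⁿ)` of complex-valued functions. -/
abbrev L2 (n : ℕ) : Type := Lp ℂ 2 (volume : Measure (Eu n))

/-! ### Multi-indices and derivatives -/

/-- Multi-indices in `n` variables. -/
abbrev MIdx (n : ℕ) : Type := Fin n → ℕ

/-- The length `|α|` of a multi-index. -/
def len {n : ℕ} (α : MIdx n) : ℕ := ∑ i, α i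

/-- The `i`-th first order partial derivative. -/
def partialD {n : ℕ} (i : Fin n) (f : Eu n → ℂ) : Eu n → ℂ :=
  fun x => fderiv ℝ f x (EuclideanSpace.single i 1)

/-- The partial derivative `∂^α f = ∂₁^{α₁} ⋯ ∂ₙ^{αₙ} f` (used for smooth functions only). -/
def multiD {n : ℕ} (α : MIdx n) (f : Eu n → ℂ) : Eu n → ℂ :=
  (List.finRange n).foldr (fun i g => (partialD i)^[α i] g) f

/-- `v` is the weak derivative `∂^β u`. -/
def IsWeakDeriv {n : ℕ} (β : MIdx n) (u v : Eu n → ℂ) : Prop :=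
  LocallyIntegrable u ∧ LocallyIntegrable v ∧
    ∀ φ : Eu n → ℂ, ContDiff ℝ ∞ φ → HasCompactSupport φ →
      ∫ x, u x * multiD β φ x = (-1) ^ len β * ∫ x, v x * φ x

/-- The finite set of multi-indices with `|α| ≤ N`. -/
def midxLE (n N : ℕ) : Finset (MIdx n) :=
  (Fintype.piFinset fun _ => Finset.range (N + 1)).filter fun α => len α ≤ N

/-- The finite set of multi-indices with `|α| = N`. -/
def midxEq (n N : ℕ) : Finset (MIdx n) := (midxLE n N).filter fun α => len α = N

/-- The finite set of pairs of multi-indices with `|α| + |β| ≤ N`. -/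
def pairLE (n N : ℕ) : Finset (MIdx n × MIdx n) :=
  (midxLE n N ×ˢ midxLE n N).filter fun p => len p.1 + len p.2 ≤ N

theorem mem_midxLE {n N : ℕ} {α : MIdx n} : α ∈ midxLE n N ↔ len α ≤ N := by
  simp only [midxLE, Finset.mem_filter, Fintype.mem_piFinset, Finset.mem_range,
    and_iff_right_iff_imp]
  intro h i
  have : α i ≤ len α := Finset.single_le_sum (f := α) (fun _ _ => Nat.zero_le _) (Finset.mem_univ i)
  omega

theorem mem_midxEq {n N : ℕ} {α : MIdx n} : α ∈ midxEq n N ↔ len α = N := by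
  simp only [midxEq, Finset.mem_filter, mem_midxLE, and_iff_right_iff_imp]
  omega

theorem mem_pairLE {n N : ℕ} {p : MIdx n × MIdx n} :
    p ∈ pairLE n N ↔ len p.1 + len p.2 ≤ N := by
  simp only [pairLE, Finset.mem_filter, Finset.mem_product, mem_midxLE, and_iff_right_iff_imp]
  omega

/-! ### Symbols -/

/-- `⟨ξ⟩ = (1 + |ξ|²)^{1/2}`. -/
def bracket {n : ℕ} (ξ : Eu n) : ℝ := √(1 + ‖ξ‖ ^ 2)

/-- `a ∈ C^∞(ℝⁿ × ℝⁿ)` and `|∂_ξ^α ∂_x^β a(x,ξ)| ≤ C_{α,β} ⟨ξ⟩^{k-|α|}` for all `α`, `β`. -/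
def IsSmoothSymbol {n : ℕ} (k : ℝ) (C : MIdx n → MIdx n → ℝ) (a : Eu n → Eu n → ℂ) : Prop :=
  ContDiff ℝ ∞ (fun p : Eu n × Eu n => a p.1 p.2) ∧
    ∀ (α β : MIdx n) (x ξ : Eu n),
      ‖multiD α (fun η => multiD β (fun y => a y η) x) ξ‖ ≤ C α β * bracket ξ ^ (k - len α)

/-- `a(x,ξ)` is `C^∞` in `ξ`, has derivatives `∂_x^β a`, `|β| ≤ μ`, in the sense of
distributions in `x`, and `|∂_ξ^α ∂_x^β a(x,ξ)| ≤ C_{α,β} ⟨ξ⟩^{k-|α|}` for all `α` and all `β` with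
`|β| ≤ μ`. Here `A β` is a representative of `∂_x^β a`. Symbols whose `x`-derivatives of order
`≤ μ` exist in the classical sense and are continuous are included. -/
def IsRoughSymbol {n : ℕ} (k : ℝ) (μ : ℕ) (C : MIdx n → MIdx n → ℝ) (a : Eu n → Eu n → ℂ) :
    Prop :=
  ∃ A : MIdx n → Eu n → Eu n → ℂ, A 0 = a ∧
    ∀ β : MIdx n, len β ≤ μ →
      (∀ x, ContDiff ℝ ∞ (A β x)) ∧
      (∀ ξ, IsWeakDeriv β (fun x => a x ξ) (fun x => A β x ξ)) ∧
      ∀ (α : MIdx n) (x ξ : Eu n), ‖multiD α (A β x) ξ‖ ≤ C α β * bracket ξ ^ (k - len α)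

/-- `b(x)` has derivatives `∂^β b`, `|β| ≤ μ`, in the sense of distributions, and
`|∂^β b(x)| ≤ C_β` for all `β` with `|β| ≤ μ`. Here `B β` is a representative of `∂^β b`. -/
def IsRoughFunction {n : ℕ} (μ : ℕ) (C : MIdx n → ℝ) (b : Eu n → ℂ) : Prop :=
  ∃ B : MIdx n → Eu n → ℂ, B 0 = b ∧
    ∀ β : MIdx n, len β ≤ μ → IsWeakDeriv β b (B β) ∧ ∀ x, ‖B β x‖ ≤ C β

/-! ### Semiclassical quantization -/

/-- `(Op_h(a) f)(x) = (2πh)^{-n} ∫∫ e^{-(i/h)⟨x-y,ξ⟩} a(x,ξ) f(y) dy dξ`, for Schwartz `f`. -/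
def opH {n : ℕ} (h : ℝ) (a : Eu n → Eu n → ℂ) (f : 𝓢(Eu n, ℂ)) (x : Eu n) : ℂ :=
  (((2 * π * h) ^ n : ℝ) : ℂ)⁻¹ *
    ∫ ξ : Eu n, ∫ y : Eu n,
      Complex.exp (-(Complex.I / (h : ℂ)) * ((inner ℝ (x - y) ξ : ℝ) : ℂ)) * a x ξ * f y

/-- The Fourier multiplier of `⟨hD⟩^k = Op_h(⟨ξ⟩^k)` with respect to the Fourier transform
`∫ e^{-2πi⟨x,η⟩} f(x) dx`, that is, `⟨ξ⟩^k` at `ξ = -2πhη`. -/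
def sobolevWeight {n : ℕ} (h k : ℝ) (η : Eu n) : ℂ :=
  ((bracket (-(2 * π * h) • η) ^ k : ℝ) : ℂ)

/-- `Op_h(⟨ξ⟩^k)` on tempered distributions. -/
def besselH (n : ℕ) (h k : ℝ) : 𝓢'(Eu n, ℂ) →L[ℂ] 𝓢'(Eu n, ℂ) :=
  TemperedDistribution.fourierMultiplierCLM ℂ (sobolevWeight h k)

/-- The pairs `(u, v)` of a tempered distribution `u` and `v ∈ L²` with `Op_h(⟨ξ⟩^k) u = v`. -/
def sobolevGraph (n : ℕ) (h k : ℝ) : Submodule ℂ (𝓢'(Eu n, ℂ) × L2 n) where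
  carrier := {p | besselH n h k p.1 = Lp.toTemperedDistributionCLM ℂ volume 2 p.2}
  add_mem' {p q} hp hq := by
    simp only [Set.mem_ofPred_eq, Prod.fst_add, Prod.snd_add, map_add] at hp hq ⊢
    rw [hp, hq]
  zero_mem' := by simp only [Set.mem_ofPred_eq, Prod.fst_zero, Prod.snd_zero, map_zero]
  smul_mem' c p hp := by
    simp only [Set.mem_ofPred_eq, Prod.smul_fst, Prod.smul_snd, map_smul] at hp ⊢
    rw [hp]

/-- The semiclassical Sobolev space `H_h^k(ℝⁿ)`: the tempered distributions `u` with
`Op_h(⟨ξ⟩^k) u ∈ L²`. An element is stored with the (unique) `L²` function `Op_h(⟨ξ⟩^k) u`. -/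
def SobolevH (n : ℕ) (h k : ℝ) : Type := ↥(sobolevGraph n h k)

instance (n : ℕ) (h k : ℝ) : AddCommGroup (SobolevH n h k) :=
  inferInstanceAs (AddCommGroup ↥(sobolevGraph n h k))

instance (n : ℕ) (h k : ℝ) : Module ℂ (SobolevH n h k) :=
  inferInstanceAs (Module ℂ ↥(sobolevGraph n h k))

/-- The underlying tempered distribution `u` of an element of `H_h^k`. -/
def SobolevH.toDistribution {n : ℕ} {h k : ℝ} (u : SobolevH n h k) : 𝓢'(Eu n, ℂ) := u.1.1

/-- The map `u ↦ Op_h(⟨ξ⟩^k) u` from `H_h^k` to `L²`. -/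
def SobolevH.bessel (n : ℕ) (h k : ℝ) : SobolevH n h k →ₗ[ℂ] L2 n :=
  (LinearMap.snd ℂ 𝓢'(Eu n, ℂ) (L2 n)).comp (sobolevGraph n h k).subtype

theorem bracket_rpow {n : ℕ} (ξ : Eu n) (k : ℝ) :
    bracket ξ ^ k = (1 + ‖ξ‖ ^ 2) ^ (k / 2) := by
  rw [bracket, Real.sqrt_eq_rpow, ← Real.rpow_mul (by positivity)]
  ring_nf

theorem bracket_pos {n : ℕ} (ξ : Eu n) : 0 < bracket ξ := by
  unfold bracket
  positivity

theorem sobolevWeight_temperate (n : ℕ) (h k : ℝ) :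
    (sobolevWeight h k : Eu n → ℂ).HasTemperateGrowth := by
  have h1 := Function.hasTemperateGrowth_one_add_norm_sq_rpow (Eu n) (k / 2)
  have h2 : (fun η : Eu n => (-(2 * π * h)) • η).HasTemperateGrowth := by fun_prop
  have h4 : (sobolevWeight h k : Eu n → ℂ) =
      Complex.ofReal ∘ ((fun x : Eu n => (1 + ‖x‖ ^ 2) ^ (k / 2)) ∘ fun η => -(2 * π * h) • η) := by
    funext η
    simp only [sobolevWeight, bracket_rpow, Function.comp]
  rw [h4]
  exact Function.HasTemperateGrowth.comp Complex.ofRealCLM.hasTemperateGrowth (h1.comp h2)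

theorem besselH_neg_besselH (n : ℕ) (h k : ℝ) (u : 𝓢'(Eu n, ℂ)) :
    besselH n h (-k) (besselH n h k u) = u := by
  rw [besselH, besselH, TemperedDistribution.fourierMultiplierCLM_fourierMultiplierCLM_apply
    (sobolevWeight_temperate n h k) (sobolevWeight_temperate n h (-k))]
  have : (sobolevWeight h k * sobolevWeight h (-k) : Eu n → ℂ) = fun _ => 1 := by
    funext η
    simp only [Pi.mul_apply, sobolevWeight, ← Complex.ofReal_mul]
    rw [← Real.rpow_add (bracket_pos _)]
    simp
  rw [this, TemperedDistribution.fourierMultiplierCLM_const]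
  simp

theorem SobolevH.bessel_injective (n : ℕ) (h k : ℝ) :
    Function.Injective (SobolevH.bessel n h k) := by
  intro u v huv
  have h2 : u.1.2 = v.1.2 := huv
  have hu : besselH n h k u.1.1 = Lp.toTemperedDistributionCLM ℂ volume 2 u.1.2 := u.2
  have hv : besselH n h k v.1.1 = Lp.toTemperedDistributionCLM ℂ volume 2 v.1.2 := v.2
  have h1 : u.1.1 = v.1.1 := by
    rw [← besselH_neg_besselH n h k u.1.1, ← besselH_neg_besselH n h k v.1.1, hu, hv, h2]
  exact Subtype.ext (Prod.ext h1 h2)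

/-- The norm `‖u‖_{H_h^k} = ‖Op_h(⟨ξ⟩^k) u‖_{L²}`. -/
instance (n : ℕ) (h k : ℝ) : NormedAddCommGroup (SobolevH n h k) :=
  NormedAddCommGroup.induced (SobolevH n h k) (L2 n) (SobolevH.bessel n h k)
    (SobolevH.bessel_injective n h k)

instance (n : ℕ) (h k : ℝ) : NormedSpace ℂ (SobolevH n h k) :=
  NormedSpace.induced ℂ (SobolevH n h k) (L2 n) (SobolevH.bessel n h k)

theorem SobolevH.norm_def {n : ℕ} {h k : ℝ} (u : SobolevH n h k) :
    ‖u‖ = ‖SobolevH.bessel n h k u‖ := rfl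

/-- The inclusion of the Schwartz space into `H_h^k`. -/
def schwartzToSobolev {n : ℕ} (h k : ℝ) (f : 𝓢(Eu n, ℂ)) : SobolevH n h k :=
  ⟨((f : 𝓢'(Eu n, ℂ)), (SchwartzMap.fourierMultiplierCLM ℂ (sobolevWeight h k) f).toLp 2), by
    change besselH n h k (f : 𝓢'(Eu n, ℂ)) = Lp.toTemperedDistribution _
    rw [besselH, TemperedDistribution.fourierMultiplierCLM_toTemperedDistributionCLM_eq
      (sobolevWeight_temperate n h k), Lp.toTemperedDistribution_toLp_eq]⟩

/-- The inclusion of the Schwartz space into `L²`. -/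
def schwartzToL2 {n : ℕ} (f : 𝓢(Eu n, ℂ)) : L2 n := f.toLp 2

/-- The bounded operator `T : X → L²` is `Op_h(a)`, that is, it is given by the defining integral on
the Schwartz space, where `ι` is the inclusion of the (dense) Schwartz space into `X`. -/
def IsOpH {n : ℕ} {X : Type} [NormedAddCommGroup X] [NormedSpace ℂ X] (ι : 𝓢(Eu n, ℂ) → X)
    (h : ℝ) (a : Eu n → Eu n → ℂ) (T : X →L[ℂ] L2 n) : Prop :=
  ∀ f : 𝓢(Eu n, ℂ), (T (ι f) : Eu n → ℂ) =ᵐ[volume] opH h a f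

/-- `Op_h(a₁) : L² → L²`, `Op_h(a₂) : X → L²` and `Op_h(a₁a₂) : X → L²` are bounded, and
`‖Op_h(a₁) Op_h(a₂) - Op_h(a₁a₂)‖_{X → L²} ≤ M`. -/
def CompositionBound {n : ℕ} {X : Type} [NormedAddCommGroup X] [NormedSpace ℂ X]
    (ι : 𝓢(Eu n, ℂ) → X) (h : ℝ) (a₁ a₂ : Eu n → Eu n → ℂ) (M : ℝ) : Prop :=
  ∃ (T₁ : L2 n →L[ℂ] L2 n) (T₂ T₁₂ : X →L[ℂ] L2 n),
    IsOpH schwartzToL2 h a₁ T₁ ∧ IsOpH ι h a₂ T₂ ∧ IsOpH ι h (fun x ξ => a₁ x ξ * a₂ x ξ) T₁₂ ∧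
      ‖T₁ ∘L T₂ - T₁₂‖ ≤ M

end RoughPsiDO

end

/-! Everything is done with the Kohn–Nirenberg form `form c f g`, the integral of c(x,ξ)
e^{2πi⟨x,ξ⟩} f̂(ξ) times the conjugate of g(x). After substituting ξ → -2πhξ the operator Op_h(a)
has the symbol `quant h a` (`opH_eq_opF`), and the Sobolev norm is removed by replacing a₂ with
⟨ξ⟩^{-k} a₂, respectively ⟨ξ⟩^{-k'} a₂ (`opF_fourierMultiplier`). The unitary dilation by √h turns
`quant h a` into a(√h x, -2π√h ξ), so every derivative in x or ξ costs one factor √h. This is the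
origin of all powers h^{(|α|+|β|)/2}.

Smooth symbols. The Calderón–Vaillancourt theorem (`exists_formBound`) bounds the operator by
finitely many derivatives of its symbol. For the composition, consider c_s(x,ξ) = ∫ a(x, ξ+sv)
b̂(v,ξ) e^{2πi⟨x,v⟩} dv, where b̂ is the Fourier transform in x. At s = 0 this is ab and at s = 1 it
is the symbol of Op(a)Op(b). Its s-derivative is (2πi)^{-1} times the sum over j of the same
expressions with ∂_{ξ_j}a and ∂_{x_j}b in place of a and b. These are bounded uniformly in s
(`exists_formBound_compSym`), so the error Op(a)Op(b) - Op(ab) is controlled by derivatives of ∂_ξ a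
times derivatives of ∂_x b (`exists_norm_comp_sub_le`).

Rough symbols. The symbol F with μ controlled x-derivatives is split by mollification in x at the
scale √h (`exists_decomposition`) as F = F₁ + F₂, where F₂ = (1 - ρ∗)^μ F has size h^{μ/2}|∂_x^μ F|,
while x-derivatives of F₁ of order above μ lose only one factor h^{-1/2} each. That loss is exactly
compensated by the √h that accompanies each derivative, so the smooth composition estimate for F₁
yields the first sum using no more than μ x-derivatives of F. For F₂ there is no cancellation: the
composition and the operator of the product are bounded separately. This needs an operator bound
without any x-regularity, which holds for symbols of negative order
(`exists_formBound_of_freqSymbol`): each dyadic piece in ξ is bounded by a kernel estimate with n +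
1 = d derivatives in ξ, and the pieces sum as a geometric series. The strict inequalities k₁ < 0 and
k < k' supply the negative order. When a₂ depends on x only, F₂ is a multiplication operator,
bounded by its supremum.

The logarithm plays no role beyond log(1 + 1/h) ≥ 1/2: the estimates hold without it.

All estimates are first proved for compactly supported, respectively mollified, symbols. The general
case follows because the forms converge by dominated convergence, the operators converge weakly, and
operator norms are lower semicontinuous under weak limits (`WeakTendsto.norm_le`). In this passage
the constants that the theorem controls stay uniform; all others serve only qualitatively. -/

noncomputable section

namespace RoughPsiDO

section

/-! ### Functions with weighted derivative bounds -/

section DerivBound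

variable {V V' : Type*} [NormedAddCommGroup V] [NormedSpace ℝ V]
  [NormedAddCommGroup V'] [NormedSpace ℝ V']

/-- `G` is smooth and its derivatives of order at most `N` are bounded by the weight `W`. -/
def DerivBound (N : ℕ) (W : V → ℝ) (G : V → ℂ) : Prop :=
  ContDiff ℝ ∞ G ∧ ∀ m ≤ N, ∀ z, ‖iteratedFDeriv ℝ m G z‖ ≤ W z

/-- The derivative of `G` in the direction `v`. -/
def dirD (v : V) (G : V → ℂ) : V → ℂ := fun z => fderiv ℝ G z v

theorem contDiff_dirD {G : V → ℂ} (hG : ContDiff ℝ ∞ G) (v : V) : ContDiff ℝ ∞ (dirD v G) :=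
  (hG.fderiv_right (m := ∞) (by simp)).clm_apply contDiff_const

theorem hasCompactSupport_dirD {G : V → ℂ} (hG : HasCompactSupport G) (v : V) :
    HasCompactSupport (dirD v G) :=
  hG.fderiv_apply (𝕜 := ℝ) v

namespace DerivBound

variable {N : ℕ} {W W₁ W₂ : V → ℝ} {F G : V → ℂ}

theorem norm_le (h : DerivBound N W G) (z : V) : ‖G z‖ ≤ W z := by
  simpa using h.2 0 (Nat.zero_le _) z

theorem nonneg (h : DerivBound N W G) (z : V) : 0 ≤ W z := (norm_nonneg _).trans (h.norm_le z)

theorem mono (h : DerivBound N W₁ G) (hW : ∀ z, W₁ z ≤ W₂ z) : DerivBound N W₂ G :=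
  ⟨h.1, fun m hm z => (h.2 m hm z).trans (hW z)⟩

theorem of_le {N' : ℕ} (h : DerivBound N W G) (hN : N' ≤ N) : DerivBound N' W G :=
  ⟨h.1, fun m hm z => h.2 m (hm.trans hN) z⟩

theorem add (hF : DerivBound N W₁ F) (hG : DerivBound N W₂ G) :
    DerivBound N (fun z => W₁ z + W₂ z) (fun z => F z + G z) := by
  refine ⟨hF.1.add hG.1, fun m hm z => ?_⟩
  have := iteratedFDeriv_add_apply (𝕜 := ℝ) (x := z) (i := m) (hF.1.contDiffAt.of_le (by exact_mod_cast le_top))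
    (hG.1.contDiffAt.of_le (by exact_mod_cast le_top))
  change ‖iteratedFDeriv ℝ m (F + G) z‖ ≤ _
  rw [this]
  exact (norm_add_le _ _).trans (add_le_add (hF.2 m hm z) (hG.2 m hm z))

theorem const_mul (hG : DerivBound N W G) (c : ℂ) :
    DerivBound N (fun z => ‖c‖ * W z) (fun z => c * G z) := by
  refine ⟨contDiff_const.mul hG.1, fun m hm z => ?_⟩
  have := iteratedFDeriv_const_smul_apply (𝕜 := ℝ) (a := c) (x := z) (i := m)
    (hG.1.contDiffAt.of_le (by exact_mod_cast le_top))
  change ‖iteratedFDeriv ℝ m (c • G) z‖ ≤ _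
  rw [this, norm_smul]
  exact mul_le_mul_of_nonneg_left (hG.2 m hm z) (norm_nonneg _)

theorem sub (hF : DerivBound N W₁ F) (hG : DerivBound N W₂ G) :
    DerivBound N (fun z => W₁ z + W₂ z) (fun z => F z - G z) := by
  have := hF.add (hG.const_mul (-1))
  simpa [sub_eq_add_neg] using this

theorem sum {ι : Type*} (s : Finset ι) {W : ι → V → ℝ} {F : ι → V → ℂ}
    (h : ∀ i ∈ s, DerivBound N (W i) (F i)) :
    DerivBound N (fun z => ∑ i ∈ s, W i z) (fun z => ∑ i ∈ s, F i z) := by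
  classical
  induction s using Finset.induction_on with
  | empty =>
    refine ⟨by simpa using contDiff_const, fun m hm z => ?_⟩
    simp only [Finset.sum_empty]
    have : iteratedFDeriv ℝ m (fun _ : V => (0 : ℂ)) z = 0 := by simp
    rw [this, norm_zero]
  | insert i s hi ih =>
    simp only [Finset.sum_insert hi]
    exact (h i (Finset.mem_insert_self _ _)).add
      (ih fun j hj => h j (Finset.mem_insert_of_mem hj))

theorem mul (hF : DerivBound N W₁ F) (hG : DerivBound N W₂ G) :
    DerivBound N (fun z => 2 ^ N * (W₁ z * W₂ z)) (fun z => F z * G z) := by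
  refine ⟨hF.1.mul hG.1, fun m hm z => ?_⟩
  refine (norm_iteratedFDeriv_mul_le (N := ∞) hF.1 hG.1 z (by exact_mod_cast le_top)).trans ?_
  calc _ ≤ ∑ i ∈ Finset.range (m + 1), (m.choose i : ℝ) * (W₁ z * W₂ z) := by
        refine Finset.sum_le_sum fun i hi => ?_
        rw [mul_assoc]
        gcongr
        · exact hF.nonneg z
        · exact hF.2 i (by simp at hi; omega) z
        · exact hG.2 _ (by omega) z
    _ = 2 ^ m * (W₁ z * W₂ z) := by
        rw [← Finset.sum_mul]; norm_cast; rw [Nat.sum_range_choose]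
    _ ≤ _ := by
        have := mul_nonneg (hF.nonneg z) (hG.nonneg z)
        exact mul_le_mul_of_nonneg_right (pow_le_pow_right₀ (by norm_num) hm) this

theorem dirD (h : DerivBound (N + 1) W G) (v : V) :
    DerivBound N (fun z => ‖v‖ * W z) (dirD v G) := by
  refine ⟨contDiff_dirD h.1 v, fun m hm z => ?_⟩
  refine (norm_iteratedFDeriv_clm_apply_const (N := ∞) (f := fderiv ℝ G)
    (h.1.fderiv_right (m := ∞) (by simp)).contDiffAt (by exact_mod_cast le_top)).trans ?_
  rw [norm_iteratedFDeriv_fderiv]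
  exact mul_le_mul_of_nonneg_left (h.2 _ (by omega) z) (norm_nonneg _)

theorem comp_affine (h : DerivBound N W G) (L : V' →L[ℝ] V) (v : V) {l : ℝ} (hl : 1 ≤ l)
    (hL : ‖L‖ ≤ l) :
    DerivBound N (fun z => l ^ N * W (L z + v)) (fun z => G (L z + v)) := by
  have hs : ContDiff ℝ ∞ (fun z => G (z + v)) := h.1.comp (contDiff_id.add contDiff_const)
  refine ⟨hs.comp L.contDiff, fun m hm z => ?_⟩
  have := L.iteratedFDeriv_comp_right (i := m) hs z (by exact_mod_cast le_top)
  change ‖iteratedFDeriv ℝ m ((fun z => G (z + v)) ∘ L) z‖ ≤ _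
  rw [this, iteratedFDeriv_comp_add_right]
  refine (ContinuousMultilinearMap.norm_compContinuousLinearMap_le _ _).trans ?_
  rw [Finset.prod_const, Finset.card_univ, Fintype.card_fin, mul_comm]
  have h0 := h.nonneg (L z + v)
  have h1 := h.2 m hm (L z + v)
  have h2 : ‖L‖ ^ m ≤ l ^ N := (pow_le_pow_left₀ (norm_nonneg _) hL m).trans (pow_le_pow_right₀ hl hm)
  exact mul_le_mul h2 h1 (norm_nonneg _) (by positivity)

theorem translate (h : DerivBound N W G) (v : V) :
    DerivBound N (fun z => W (z + v)) (fun z => G (z + v)) := by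
  simpa using h.comp_affine (ContinuousLinearMap.id ℝ V) v le_rfl ContinuousLinearMap.norm_id_le

theorem comp_linear (h : DerivBound N W G) (L : V' →L[ℝ] V) (hL : ‖L‖ ≤ 1) :
    DerivBound N (fun z => W (L z)) (fun z => G (L z)) := by
  simpa using h.comp_affine L 0 le_rfl hL

theorem congr (h : DerivBound N W G) (hF : ∀ z, F z = G z) : DerivBound N W F := by
  rwa [show F = G from funext hF]

end DerivBound

theorem exists_derivBound_of_hasCompactSupport {G : V → ℂ} (hG : ContDiff ℝ ∞ G)
    (hc : HasCompactSupport G) (N : ℕ) : ∃ M : ℝ, 0 ≤ M ∧ DerivBound N (fun _ => M) G := by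
  have h : ∀ m : ℕ, ∃ C : ℝ, ∀ z, ‖iteratedFDeriv ℝ m G z‖ ≤ C := fun m =>
    (hc.iteratedFDeriv m).exists_bound_of_continuous
      (hG.continuous_iteratedFDeriv (by exact_mod_cast le_top))
  choose C hC using h
  refine ⟨∑ m ∈ Finset.range (N + 1), |C m|, by positivity, hG, fun m hm z => ?_⟩
  exact ((hC m z).trans (le_abs_self _)).trans (Finset.single_le_sum (f := fun m => |C m|)
    (fun _ _ => abs_nonneg _) (Finset.mem_range.2 (by omega)))

end DerivBound

/-! ### The weights `⟨ξ⟩^k` -/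

variable {n : ℕ}

theorem one_le_bracket (ξ : Eu n) : 1 ≤ bracket ξ := by
  rw [bracket, Real.one_le_sqrt]; nlinarith [sq_nonneg ‖ξ‖]

theorem norm_le_bracket (ξ : Eu n) : ‖ξ‖ ≤ bracket ξ := by
  rw [bracket]; exact Real.le_sqrt_of_sq_le (by linarith)

theorem bracket_sq (ξ : Eu n) : bracket ξ ^ 2 = 1 + ‖ξ‖ ^ 2 := by
  rw [bracket, Real.sq_sqrt (by positivity)]

theorem bracket_le (ξ : Eu n) : bracket ξ ≤ 1 + ‖ξ‖ := by
  rw [bracket, Real.sqrt_le_left (by positivity)]; nlinarith [norm_nonneg ξ]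

theorem continuous_bracket : Continuous (bracket : Eu n → ℝ) := by
  unfold bracket; fun_prop

theorem continuous_bracket_rpow (k : ℝ) : Continuous (fun ξ : Eu n => bracket ξ ^ k) :=
  continuous_bracket.rpow_const fun ξ => Or.inl (bracket_pos ξ).ne'

theorem contDiff_bracket_rpow (k : ℝ) :
    ContDiff ℝ ∞ (fun ξ : Eu n => ((bracket ξ ^ k : ℝ) : ℂ)) := by
  simp_rw [bracket_rpow]
  refine Complex.ofRealCLM.contDiff.comp ?_
  refine (contDiff_const.add (contDiff_norm_sq ℝ)).rpow_const_of_ne fun x => ?_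
  positivity

/-- Divided by its value at ξ, the quadratic polynomial 1 + |η|² has first derivative of size 2/⟨ξ⟩,
second derivative of size 2/⟨ξ⟩² and no higher ones. This is the input of the Faà di Bruno estimate
for ⟨·⟩^k. -/
theorem norm_iteratedFDeriv_norm_sq_scaled_le (ξ : Eu n) (i : ℕ) (hi : 1 ≤ i) :
    ‖iteratedFDeriv ℝ i (fun η : Eu n => (1 + ‖η‖ ^ 2) / bracket ξ ^ 2) ξ‖
      ≤ (2 / bracket ξ) ^ i := by
  set r := bracket ξ with hr
  have hr1 : 1 ≤ r := one_le_bracket ξ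
  have hr0 : 0 < r := by linarith
  let L : Eu n →L[ℝ] Eu n →L[ℝ] ℝ := innerSL ℝ
  have hF : fderiv ℝ (fun η : Eu n => (1 + ‖η‖ ^ 2) / r ^ 2) = fun η => ((2 / r ^ 2) • L) η := by
    funext η
    have h1 : HasFDerivAt (fun η : Eu n => 1 + ‖η‖ ^ 2) (2 • innerSL ℝ η) η :=
      (hasStrictFDerivAt_norm_sq η).hasFDerivAt.const_add 1
    have h2 := h1.mul_const ((r ^ 2)⁻¹)
    simp_rw [div_eq_mul_inv]
    rw [h2.fderiv]
    ext v
    have hv : L η v = inner ℝ η v := rfl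
    simp only [_root_.smul_apply, hv, smul_eq_mul, nsmul_eq_mul,
      innerSL_apply_apply ℝ]
    push_cast
    ring
  obtain ⟨j, rfl⟩ : ∃ j, i = j + 1 := ⟨i - 1, by omega⟩
  rw [← norm_iteratedFDeriv_fderiv, hF]
  have hnorm : ‖(2 / r ^ 2) • L‖ ≤ 2 / r ^ 2 := by
    refine (ContinuousLinearMap.opNorm_smul_le _ _).trans ?_
    rw [Real.norm_of_nonneg (by positivity)]
    exact mul_le_of_le_one_right (by positivity) (norm_innerSL_le (E := Eu n) ℝ)
  match j with
  | 0 =>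
    simp only [norm_iteratedFDeriv_zero, zero_add, pow_one]
    refine (ContinuousLinearMap.le_of_opNorm_le _ hnorm ξ).trans ?_
    have := norm_le_bracket ξ
    rw [← hr] at this
    calc 2 / r ^ 2 * ‖ξ‖ ≤ 2 / r ^ 2 * r := by gcongr
      _ = 2 / r := by field_simp
  | j + 1 =>
    rw [← norm_iteratedFDeriv_fderiv]
    have : fderiv ℝ (fun η => ((2 / r ^ 2) • L) η) =
        fun _ => ((2 / r ^ 2) • L) := by
      funext η
      exact ((2 / r ^ 2) • L).fderiv
    rw [this]
    match j with
    | 0 =>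
      simp only [norm_iteratedFDeriv_zero]
      refine hnorm.trans ?_
      rw [div_pow]
      gcongr
      norm_num
    | j + 1 =>
      rw [iteratedFDeriv_const_of_ne (by omega)]
      simp only [Pi.zero_apply, norm_zero]
      positivity

/-- With r = ⟨ξ⟩ fixed, ⟨η⟩^k = r^k g((1+|η|²)/r²) for g(t) = t^{k/2}. The inner function equals 1
at η = ξ, so only the derivatives of g at 1 enter, and the constant does not depend on ξ. -/
theorem exists_norm_iteratedFDeriv_bracket_rpow_le (n : ℕ) (k : ℝ) (m : ℕ) : ∃ K : ℝ, 0 ≤ K ∧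
    ∀ ξ : Eu n, ‖iteratedFDeriv ℝ m (fun ξ : Eu n => ((bracket ξ ^ k : ℝ) : ℂ)) ξ‖
      ≤ K * bracket ξ ^ (k - m) := by
  set g : ℝ → ℂ := fun t => ((t ^ (k / 2) : ℝ) : ℂ) with hg
  set C : ℝ := ∑ i ∈ Finset.range (m + 1), ‖iteratedFDerivWithin ℝ i g (Set.Ioi 0) 1‖
  have hC0 : 0 ≤ C := by positivity
  refine ⟨m.factorial * C * 2 ^ m, by positivity, fun ξ => ?_⟩
  set r := bracket ξ with hr
  have hr0 : 0 < r := bracket_pos ξ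
  have hgs : ContDiffOn ℝ ∞ g (Set.Ioi 0) := by
    refine Complex.ofRealCLM.contDiff.comp_contDiffOn ?_
    exact contDiffOn_id.rpow_const_of_ne fun x hx => (Set.mem_Ioi.1 hx).ne'
  have hF : ContDiff ℝ ∞ (fun η : Eu n => (1 + ‖η‖ ^ 2) / r ^ 2) :=
    (contDiff_const.add (contDiff_norm_sq ℝ)).div_const _
  have hFξ : (1 + ‖ξ‖ ^ 2) / r ^ 2 = 1 := by
    rw [hr, bracket_sq]; exact div_self (by positivity)
  have key := norm_iteratedFDeriv_comp_le' (𝕜 := ℝ) (N := ∞) (n := m) (g := g)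
    (f := fun η : Eu n => (1 + ‖η‖ ^ 2) / r ^ 2) (t := Set.Ioi 0)
    (by rintro _ ⟨η, rfl⟩; simp only [Set.mem_Ioi]; positivity) (uniqueDiffOn_Ioi 0) hgs hF
    (by exact_mod_cast le_top) ξ (C := C) (D := 2 / r)
    (fun i hi => by
      rw [hFξ]
      exact Finset.single_le_sum (f := fun i => ‖iteratedFDerivWithin ℝ i g (Set.Ioi 0) 1‖)
        (fun _ _ => norm_nonneg _) (Finset.mem_range.2 (by omega)))
    (fun i hi _ => norm_iteratedFDeriv_norm_sq_scaled_le ξ i hi)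
  have heq : (fun ξ : Eu n => ((bracket ξ ^ k : ℝ) : ℂ)) =
      (r ^ k) • (g ∘ fun η : Eu n => (1 + ‖η‖ ^ 2) / r ^ 2) := by
    funext η
    simp only [hg, Pi.smul_apply, Function.comp, Complex.real_smul, ← Complex.ofReal_mul]
    rw [Real.div_rpow (by positivity) (by positivity), ← Real.rpow_natCast r 2,
      ← Real.rpow_mul hr0.le, bracket_rpow]
    congr 1
    have : r ^ (((2 : ℕ) : ℝ) * (k / 2)) = r ^ k := by congr 1; push_cast; ring
    rw [this]
    field_simp
  have hs : ContDiff ℝ ∞ (g ∘ fun η : Eu n => (1 + ‖η‖ ^ 2) / r ^ 2) :=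
    hgs.comp_contDiff hF fun η => by simp only [Set.mem_Ioi]; positivity
  rw [heq, iteratedFDeriv_const_smul_apply (hs.contDiffAt.of_le (by exact_mod_cast le_top)),
    norm_smul, Real.norm_of_nonneg (by positivity)]
  calc r ^ k * _ ≤ r ^ k * (m.factorial * C * (2 / r) ^ m) := by gcongr
    _ = m.factorial * C * 2 ^ m * r ^ (k - m) := by
        rw [Real.rpow_sub hr0, Real.rpow_natCast, div_pow]; ring

/-- The weight `⟨x⟩^k`, as a complex valued function. -/
def brC (k : ℝ) (x : Eu n) : ℂ := ((bracket x ^ k : ℝ) : ℂ)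

theorem norm_brC (k : ℝ) (x : Eu n) : ‖brC k x‖ = bracket x ^ k := by
  rw [brC, Complex.norm_real, Real.norm_of_nonneg (Real.rpow_nonneg (bracket_pos x).le _)]

theorem brC_add (k l : ℝ) (x : Eu n) : brC (k + l) x = brC k x * brC l x := by
  rw [brC, Real.rpow_add (bracket_pos x), Complex.ofReal_mul]; rfl

theorem brC_zero (x : Eu n) : brC 0 x = 1 := by simp [brC]

theorem exists_derivBound_brC (n : ℕ) (k : ℝ) (N : ℕ) :
    ∃ K : ℝ, 0 < K ∧ DerivBound N (fun x : Eu n => K * bracket x ^ k) (brC k) := by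
  choose K hK0 hK using exists_norm_iteratedFDeriv_bracket_rpow_le n k
  refine ⟨1 + ∑ m ∈ Finset.range (N + 1), K m, ?_, contDiff_bracket_rpow k, fun m hm z => ?_⟩
  · have : 0 ≤ ∑ m ∈ Finset.range (N + 1), K m := Finset.sum_nonneg fun i _ => hK0 i
    linarith
  · refine (hK m z).trans ?_
    have h1 : K m ≤ ∑ m ∈ Finset.range (N + 1), K m :=
      Finset.single_le_sum (fun i _ => hK0 i) (Finset.mem_range.2 (by omega))
    have h2 : bracket z ^ (k - m) ≤ bracket z ^ k :=
      Real.rpow_le_rpow_of_exponent_le (one_le_bracket z) (by linarith [(Nat.cast_nonneg m : (0:ℝ) ≤ m)])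
    have := hK0 m
    exact mul_le_mul (by linarith) h2 (Real.rpow_nonneg (bracket_pos z).le _) (by linarith)

end

section

/-! ### The sesquilinear form of a symbol -/

variable {n : ℕ}

/-- `e^{2πi⟨x,ξ⟩}`. -/
def osc (x ξ : Eu n) : ℂ := Complex.exp (((2 * π * inner ℝ x ξ : ℝ) : ℂ) * Complex.I)

theorem norm_osc (x ξ : Eu n) : ‖osc x ξ‖ = 1 := Complex.norm_exp_ofReal_mul_I _

theorem osc_add_left (x y ξ : Eu n) : osc (x + y) ξ = osc x ξ * osc y ξ := by
  rw [osc, osc, osc, ← Complex.exp_add, inner_add_left]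
  congr 1; push_cast; ring

theorem osc_add_right (x ξ η : Eu n) : osc x (ξ + η) = osc x ξ * osc x η := by
  rw [osc, osc, osc, ← Complex.exp_add, inner_add_right]
  congr 1; push_cast; ring

theorem osc_zero_left (ξ : Eu n) : osc 0 ξ = 1 := by simp [osc]

theorem osc_comm (x ξ : Eu n) : osc x ξ = osc ξ x := by rw [osc, osc, real_inner_comm]

theorem osc_neg_left (x ξ : Eu n) : osc (-x) ξ = osc x (-ξ) := by
  rw [osc, osc, inner_neg_left, inner_neg_right]

theorem conj_osc (x ξ : Eu n) : (starRingEnd ℂ) (osc x ξ) = osc (-x) ξ := by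
  rw [osc, osc, ← Complex.exp_conj, inner_neg_left]
  congr 1
  rw [map_mul, Complex.conj_ofReal, Complex.conj_I]
  push_cast
  ring

theorem contDiff_osc : ContDiff ℝ ∞ (fun z : Eu n × Eu n => osc z.1 z.2) := by
  unfold osc
  refine Complex.contDiff_exp.comp (ContDiff.mul ?_ contDiff_const)
  exact Complex.ofRealCLM.contDiff.comp (contDiff_const.mul (contDiff_fst.inner ℝ contDiff_snd))

theorem continuous_osc : Continuous (fun z : Eu n × Eu n => osc z.1 z.2) := contDiff_osc.continuous

theorem _root_.Continuous.osc {X : Type*} [TopologicalSpace X] {f g : X → Eu n}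
    (hf : Continuous f) (hg : Continuous g) : Continuous fun x => osc (f x) (g x) :=
  continuous_osc.comp (hf.prodMk hg)

theorem fourier_eq_osc (f : Eu n → ℂ) (ξ : Eu n) : 𝓕 f ξ = ∫ y, osc (-y) ξ * f y := by
  rw [Real.fourier_eq']
  simp only [osc, inner_neg_left, smul_eq_mul, mul_neg, neg_mul]

theorem fourierInv_eq_osc (f : Eu n → ℂ) (x : Eu n) : 𝓕⁻ f x = ∫ ξ, osc x ξ * f ξ := by
  rw [Real.fourierInv_eq']
  simp only [osc, smul_eq_mul, real_inner_comm x]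

/-- The Kohn-Nirenberg quantization of `c`. -/
def opF (c : Eu n × Eu n → ℂ) (f : 𝓢(Eu n, ℂ)) (x : Eu n) : ℂ :=
  ∫ ξ, c (x, ξ) * osc x ξ * 𝓕 f ξ

/-- The sesquilinear form of the Kohn-Nirenberg quantization of `c`. -/
def form (c : Eu n × Eu n → ℂ) (f g : 𝓢(Eu n, ℂ)) : ℂ :=
  ∫ z : Eu n × Eu n, c z * osc z.1 z.2 * 𝓕 f z.2 * (starRingEnd ℂ) (g z.1)

theorem integrable_schwartz_prod (f g : 𝓢(Eu n, ℂ)) :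
    Integrable (fun z : Eu n × Eu n => ‖𝓕 f z.2‖ * ‖g z.1‖) := by
  have := (g.integrable (μ := volume)).norm.mul_prod ((𝓕 f).integrable (μ := volume)).norm
  refine this.congr (Filter.Eventually.of_forall fun z => ?_)
  simp only [mul_comm]

theorem continuous_fourier_schwartz (f : 𝓢(Eu n, ℂ)) : Continuous (fun ξ => 𝓕 f ξ) :=
  (𝓕 f).continuous

theorem integrable_form {c : Eu n × Eu n → ℂ} {M : ℝ} (hc : AEStronglyMeasurable c)
    (hM : ∀ z, ‖c z‖ ≤ M) (f g : 𝓢(Eu n, ℂ)) :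
    Integrable fun z : Eu n × Eu n =>
      c z * osc z.1 z.2 * 𝓕 f z.2 * (starRingEnd ℂ) (g z.1) := by
  refine ((integrable_schwartz_prod f g).const_mul M).mono ?_ (Filter.Eventually.of_forall ?_)
  · refine ((hc.mul continuous_osc.aestronglyMeasurable).mul ?_).mul ?_
    · exact ((continuous_fourier_schwartz f).comp continuous_snd).aestronglyMeasurable
    · exact (Complex.continuous_conj.comp (g.continuous.comp continuous_fst)).aestronglyMeasurable
  · intro z
    have hM0 : 0 ≤ M := (norm_nonneg _).trans (hM z)
    simp only [norm_mul, norm_osc, mul_one, RCLike.norm_conj, norm_norm, Real.norm_of_nonneg hM0]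
    rw [mul_assoc]
    gcongr
    exact hM z

theorem form_congr {c c' : Eu n × Eu n → ℂ} (h : ∀ z, c z = c' z) (f g : 𝓢(Eu n, ℂ)) :
    form c f g = form c' f g := by rw [show c = c' from funext h]

theorem form_add {c c' : Eu n × Eu n → ℂ} {M M' : ℝ} (hc : AEStronglyMeasurable c)
    (hM : ∀ z, ‖c z‖ ≤ M) (hc' : AEStronglyMeasurable c') (hM' : ∀ z, ‖c' z‖ ≤ M')
    (f g : 𝓢(Eu n, ℂ)) :
    form (fun z => c z + c' z) f g = form c f g + form c' f g := by
  rw [form, form, form, ← integral_add (integrable_form hc hM f g) (integrable_form hc' hM' f g)]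
  congr 1; funext z; ring

theorem form_const_mul (a : ℂ) (c : Eu n × Eu n → ℂ) (f g : 𝓢(Eu n, ℂ)) :
    form (fun z => a * c z) f g = a * form c f g := by
  rw [form, form, ← integral_const_mul]
  congr 1; funext z; ring

theorem form_add_left {c : Eu n × Eu n → ℂ} {M : ℝ} (hc : AEStronglyMeasurable c)
    (hM : ∀ z, ‖c z‖ ≤ M) (f f' g : 𝓢(Eu n, ℂ)) :
    form c (f + f') g = form c f g + form c f' g := by
  rw [form, form, form, ← integral_add (integrable_form hc hM f g) (integrable_form hc hM f' g)]
  congr 1; funext z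
  rw [FourierTransform.fourier_add, _root_.add_apply]; ring

theorem form_zero_left (c : Eu n × Eu n → ℂ) (g : 𝓢(Eu n, ℂ)) : form c 0 g = 0 := by
  have h : (𝓕 (0 : 𝓢(Eu n, ℂ))) = 0 := map_zero (FourierTransform.fourierCLM ℂ 𝓢(Eu n, ℂ))
  simp [form, h]

/-! ### Moments and derivatives -/

theorem hasFDerivAt_osc (z : Eu n × Eu n) :
    HasFDerivAt (fun z : Eu n × Eu n => osc z.1 z.2)
      (fderiv ℝ (fun z : Eu n × Eu n => osc z.1 z.2) z) z :=
  ((contDiff_osc.differentiable (by simp)) z).hasFDerivAt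

theorem dirD_osc (u w : Eu n) (z : Eu n × Eu n) :
    dirD (u, w) (fun z : Eu n × Eu n => osc z.1 z.2) z =
      2 * π * Complex.I * ((inner ℝ z.1 w + inner ℝ u z.2 : ℝ) : ℂ) * osc z.1 z.2 := by
  have h1 : HasFDerivAt (fun z : Eu n × Eu n => (inner ℝ z.1 z.2 : ℝ)) _ z :=
    hasFDerivAt_fst.inner ℝ (hasFDerivAt_snd (p := z))
  have h2 := (((Complex.ofRealCLM.hasFDerivAt).comp z (h1.const_mul (2 * π))).mul_const
    Complex.I).cexp
  have h3 : HasFDerivAt (fun z : Eu n × Eu n => osc z.1 z.2) _ z := h2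
  rw [dirD, h3.fderiv]
  simp [osc, fderivInnerCLM_apply]
  ring

theorem dirD_mul {V : Type*} [NormedAddCommGroup V] [NormedSpace ℝ V] {F G : V → ℂ}
    (hF : ContDiff ℝ ∞ F) (hG : ContDiff ℝ ∞ G) (v z : V) :
    dirD v (fun z => F z * G z) z = dirD v F z * G z + F z * dirD v G z := by
  have h := ((hF.differentiable (by simp)) z).hasFDerivAt.mul
    ((hG.differentiable (by simp)) z).hasFDerivAt
  have h' : HasFDerivAt (fun z => F z * G z) _ z := h
  rw [dirD, h'.fderiv, dirD, dirD]
  simp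
  ring

/-- The `j`-th standard basis vector. -/
abbrev eb (j : Fin n) : Eu n := EuclideanSpace.single j 1

theorem inner_eb (x : Eu n) (j : Fin n) : inner ℝ x (eb j) = x j := by
  simp [EuclideanSpace.inner_single_right]

theorem eb_inner (x : Eu n) (j : Fin n) : inner ℝ (eb j) x = x j := by
  simp [EuclideanSpace.inner_single_left]

theorem norm_eb (j : Fin n) : ‖eb j‖ = 1 := by simp

instance : (volume : Measure (Eu n × Eu n)).IsAddHaarMeasure :=
  inferInstanceAs (((volume : Measure (Eu n)).prod volume).IsAddHaarMeasure)

/-- The action on symbols of multiplying the argument of the operator by the coordinate `y_j`. -/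
def coordOp (j : Fin n) (c : Eu n × Eu n → ℂ) : Eu n × Eu n → ℂ := fun z =>
  ((z.1 j : ℝ) : ℂ) * c z + -(Complex.I / (2 * π)) * dirD ((0 : Eu n), eb j) c z

theorem contDiff_coord (j : Fin n) : ContDiff ℝ ∞ (fun x : Eu n => ((x j : ℝ) : ℂ)) :=
  Complex.ofRealCLM.contDiff.comp (EuclideanSpace.proj (𝕜 := ℝ) j).contDiff

theorem contDiff_coordOp {c : Eu n × Eu n → ℂ} (hc : ContDiff ℝ ∞ c) (j : Fin n) :
    ContDiff ℝ ∞ (coordOp j c) :=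
  (((contDiff_coord j).comp contDiff_fst).mul hc).add (contDiff_const.mul (contDiff_dirD hc _))

theorem hasCompactSupport_coordOp {c : Eu n × Eu n → ℂ} (hc : HasCompactSupport c) (j : Fin n) :
    HasCompactSupport (coordOp j c) :=
  (hc.mul_left).add ((hasCompactSupport_dirD hc _).mul_left)

theorem hasTemperateGrowth_coord (j : Fin n) :
    (fun x : Eu n => ((x j : ℝ) : ℂ)).HasTemperateGrowth := by
  have : (fun x : Eu n => ((x j : ℝ) : ℂ)) =
      (Complex.ofRealCLM ∘L (EuclideanSpace.proj (𝕜 := ℝ) j : Eu n →L[ℝ] ℝ)) := by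
    funext x; simp
  rw [this]
  exact ContinuousLinearMap.hasTemperateGrowth _

/-- Multiplication by the coordinate `y_j`. -/
def coordMul (j : Fin n) (f : 𝓢(Eu n, ℂ)) : 𝓢(Eu n, ℂ) :=
  SchwartzMap.smulLeftCLM ℂ (fun x : Eu n => ((x j : ℝ) : ℂ)) f

theorem coordMul_apply (j : Fin n) (f : 𝓢(Eu n, ℂ)) (x : Eu n) :
    coordMul j f x = ((x j : ℝ) : ℂ) * f x := by
  rw [coordMul, SchwartzMap.smulLeftCLM_apply_apply (hasTemperateGrowth_coord j), smul_eq_mul]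

theorem fourier_coordMul (j : Fin n) (f : 𝓢(Eu n, ℂ)) (ξ : Eu n) :
    𝓕 (coordMul j f) ξ = Complex.I / (2 * π) * fderiv ℝ (𝓕 f : 𝓢(Eu n, ℂ)) ξ (eb j) := by
  have h := SchwartzMap.lineDerivOp_fourier_eq f (eb j)
  have hs : SchwartzMap.smulLeftCLM ℂ (fun x : Eu n => (inner ℝ x (eb j) : ℝ)) f = coordMul j f := by
    ext x
    rw [SchwartzMap.smulLeftCLM_apply_apply (by fun_prop), coordMul_apply, inner_eb,
      Complex.real_smul]
  rw [hs] at h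
  have h2 := congrArg (fun φ : 𝓢(Eu n, ℂ) => φ ξ) h
  simp only [SchwartzMap.lineDerivOp_apply_eq_fderiv] at h2
  have h3 : 𝓕 (-(2 * (π : ℂ) * Complex.I) • coordMul j f) =
      -(2 * (π : ℂ) * Complex.I) • 𝓕 (coordMul j f) :=
    FourierTransform.fourier_smul _ _
  rw [h3, _root_.smul_apply, smul_eq_mul] at h2
  rw [h2]
  have : (π : ℂ) ≠ 0 := by exact_mod_cast Real.pi_ne_zero
  field_simp
  rw [Complex.I_sq]
  ring

/-- On the Fourier side y_j acts as (i/2π)∂_{ξ_j}. Integration by parts in ξ, without boundary terms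
since c has compact support, moves this derivative to c(x,ξ)e^{2πi⟨x,ξ⟩}: the exponential
contributes x_j c, and c contributes -(i/2π)∂_{ξ_j}c. -/
theorem form_coordMul {c : Eu n × Eu n → ℂ} (hc : ContDiff ℝ ∞ c) (hcc : HasCompactSupport c)
    (j : Fin n) (f g : 𝓢(Eu n, ℂ)) : form c (coordMul j f) g = form (coordOp j c) f g := by
  set G : Eu n × Eu n → ℂ := fun z => (starRingEnd ℂ) (g z.1) with hG
  set Φ : Eu n × Eu n → ℂ := fun z => 𝓕 f z.2 with hΦ
  set U : Eu n × Eu n → ℂ := fun z => c z * osc z.1 z.2 with hU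
  have hGs : ContDiff ℝ ∞ G :=
    Complex.conjCLE.contDiff.comp ((g.smooth ⊤).comp contDiff_fst)
  have hΦs : ContDiff ℝ ∞ Φ := ((𝓕 f).smooth ⊤).comp contDiff_snd
  have hUs : ContDiff ℝ ∞ U := hc.mul contDiff_osc
  have hUc : HasCompactSupport U := hcc.mul_right
  set v : Eu n × Eu n := (0, eb j) with hv
  have hGv : ∀ z, dirD v G z = 0 := fun z => by
    have h1 : HasFDerivAt G _ z :=
      Complex.conjCLE.hasFDerivAt.comp z ((g.hasFDerivAt z.1).comp z hasFDerivAt_fst)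
    rw [dirD, h1.fderiv]
    simp [hv]
  have hΦv : ∀ z, dirD v Φ z = fderiv ℝ (𝓕 f : 𝓢(Eu n, ℂ)) z.2 (eb j) := fun z => by
    have h1 : HasFDerivAt Φ _ z := ((𝓕 f).hasFDerivAt z.2).comp z hasFDerivAt_snd
    rw [dirD, h1.fderiv]
    simp [hv]
  have hUG : ContDiff ℝ ∞ (fun z => U z * G z) := hUs.mul hGs
  have hUGc : HasCompactSupport (fun z => U z * G z) := hUc.mul_right
  have ibp := integral_mul_fderiv_eq_neg_fderiv_mul_of_integrable
    (μ := (volume : Measure (Eu n × Eu n))) (f := fun z => U z * G z) (g := Φ) (v := v)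
    (((contDiff_dirD hUG v).continuous.mul hΦs.continuous).integrable_of_hasCompactSupport
      ((hasCompactSupport_dirD hUGc v).mul_right))
    ((hUG.continuous.mul (contDiff_dirD hΦs v).continuous).integrable_of_hasCompactSupport
      hUGc.mul_right)
    ((hUG.continuous.mul hΦs.continuous).integrable_of_hasCompactSupport hUGc.mul_right)
    (fun z _ => hUG.differentiable (by simp) z) (fun z _ => hΦs.differentiable (by simp) z)
  have hL : form c (coordMul j f) g =
      Complex.I / (2 * π) * ∫ z, (U z * G z) * fderiv ℝ Φ z v := by
    rw [form, ← integral_const_mul]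
    congr 1; funext z
    rw [fourier_coordMul, ← hΦv z]
    simp only [dirD, hU, hG]
    ring
  rw [hL, ibp, ← integral_neg, ← integral_const_mul, form]
  congr 1; funext z
  have h1 : fderiv ℝ (fun z => U z * G z) z v = dirD v U z * G z := by
    have := dirD_mul hUs hGs v z
    rw [hGv z, mul_zero, add_zero] at this
    exact this
  have h2 : dirD v U z = dirD v c z * osc z.1 z.2 + c z * dirD v (fun z => osc z.1 z.2) z :=
    dirD_mul hc contDiff_osc v z
  rw [h1, h2, hv, dirD_osc, inner_eb, inner_zero_left, add_zero, coordOp]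
  simp only [hG, hΦ]
  have : (π : ℂ) ≠ 0 := by exact_mod_cast Real.pi_ne_zero
  field_simp
  ring_nf
  rw [Complex.I_sq]
  ring

/-- The action on symbols of multiplying the argument of the operator by `⟨y⟩²`. -/
def bracketOp (c : Eu n × Eu n → ℂ) : Eu n × Eu n → ℂ := fun z =>
  c z + ∑ j, coordOp j (coordOp j c) z

theorem contDiff_bracketOp {c : Eu n × Eu n → ℂ} (hc : ContDiff ℝ ∞ c) :
    ContDiff ℝ ∞ (bracketOp c) :=
  hc.add (ContDiff.sum fun j _ => contDiff_coordOp (contDiff_coordOp hc j) j)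

theorem hasCompactSupport_finset_sum {X ι : Type*} [TopologicalSpace X] (s : Finset ι)
    {F : ι → X → ℂ} (h : ∀ i ∈ s, HasCompactSupport (F i)) :
    HasCompactSupport (fun z => ∑ i ∈ s, F i z) := by
  classical
  induction s using Finset.induction_on with
  | empty => simp only [Finset.sum_empty]; exact HasCompactSupport.zero
  | insert i s hi ih =>
    simp only [Finset.sum_insert hi]
    exact (h i (Finset.mem_insert_self _ _)).add
      (ih fun j hj => h j (Finset.mem_insert_of_mem hj))

theorem hasCompactSupport_bracketOp {c : Eu n × Eu n → ℂ} (hc : HasCompactSupport c) :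
    HasCompactSupport (bracketOp c) :=
  hc.add (hasCompactSupport_finset_sum _ fun j _ =>
    hasCompactSupport_coordOp (hasCompactSupport_coordOp hc j) j)

theorem hasTemperateGrowth_brC (k : ℝ) : (brC k : Eu n → ℂ).HasTemperateGrowth := by
  have h1 := Function.hasTemperateGrowth_one_add_norm_sq_rpow (Eu n) (k / 2)
  have h4 : (brC k : Eu n → ℂ) = Complex.ofReal ∘ fun x : Eu n => (1 + ‖x‖ ^ 2) ^ (k / 2) := by
    funext η
    simp only [brC, bracket_rpow, Function.comp]
  rw [h4]
  exact Function.HasTemperateGrowth.comp Complex.ofRealCLM.hasTemperateGrowth h1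

/-- Multiplication by `⟨y⟩^k`. -/
def brMul (k : ℝ) (f : 𝓢(Eu n, ℂ)) : 𝓢(Eu n, ℂ) := SchwartzMap.smulLeftCLM ℂ (brC k) f

theorem brMul_apply (k : ℝ) (f : 𝓢(Eu n, ℂ)) (x : Eu n) : brMul k f x = brC k x * f x := by
  rw [brMul, SchwartzMap.smulLeftCLM_apply_apply (hasTemperateGrowth_brC k), smul_eq_mul]

theorem brMul_brMul (k l : ℝ) (f : 𝓢(Eu n, ℂ)) : brMul k (brMul l f) = brMul (k + l) f := by
  ext x; simp only [brMul_apply, brC_add]; ring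

theorem brMul_zero (f : 𝓢(Eu n, ℂ)) : brMul 0 f = f := by
  ext x; simp only [brMul_apply, brC_zero, one_mul]

theorem brMul_two (f : 𝓢(Eu n, ℂ)) : brMul 2 f = f + ∑ j, coordMul j (coordMul j f) := by
  ext x
  rw [_root_.add_apply, _root_.sum_apply, brMul_apply, brC]
  simp only [coordMul_apply]
  have : (bracket x ^ (2 : ℝ)) = 1 + ∑ j, x j ^ 2 := by
    rw [Real.rpow_two, bracket_sq, EuclideanSpace.real_norm_sq_eq]
  rw [this]
  push_cast
  rw [add_mul, one_mul, Finset.sum_mul]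
  congr 1
  refine Finset.sum_congr rfl fun j _ => by ring

theorem exists_bound_of_compact {c : Eu n × Eu n → ℂ} (hc : ContDiff ℝ ∞ c)
    (hcc : HasCompactSupport c) : ∃ M, ∀ z, ‖c z‖ ≤ M :=
  hcc.exists_bound_of_continuous hc.continuous

theorem form_sum_left {c : Eu n × Eu n → ℂ} {M : ℝ} (hc : AEStronglyMeasurable c)
    (hM : ∀ z, ‖c z‖ ≤ M) {ι : Type*} (s : Finset ι) (f : ι → 𝓢(Eu n, ℂ)) (g : 𝓢(Eu n, ℂ)) :
    form c (∑ i ∈ s, f i) g = ∑ i ∈ s, form c (f i) g := by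
  classical
  induction s using Finset.induction_on with
  | empty => simp [form_zero_left]
  | insert i s hi ih => rw [Finset.sum_insert hi, Finset.sum_insert hi, form_add_left hc hM, ih]

theorem form_sum {ι : Type*} (s : Finset ι) {c : ι → Eu n × Eu n → ℂ}
    (hc : ∀ i, ContDiff ℝ ∞ (c i)) (hcc : ∀ i, HasCompactSupport (c i)) (f g : 𝓢(Eu n, ℂ)) :
    form (fun z => ∑ i ∈ s, c i z) f g = ∑ i ∈ s, form (c i) f g := by
  have hi : ∀ i ∈ s, Integrable fun z : Eu n × Eu n =>
      c i z * osc z.1 z.2 * 𝓕 f z.2 * (starRingEnd ℂ) (g z.1) := fun i _ => by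
    obtain ⟨M, hM⟩ := exists_bound_of_compact (hc i) (hcc i)
    exact integrable_form (hc i).continuous.aestronglyMeasurable hM f g
  simp only [form]
  rw [← integral_finsetSum s hi]
  congr 1; funext z
  simp only [Finset.sum_mul]

theorem form_brMul_two {c : Eu n × Eu n → ℂ} (hc : ContDiff ℝ ∞ c) (hcc : HasCompactSupport c)
    (f g : 𝓢(Eu n, ℂ)) : form c (brMul 2 f) g = form (bracketOp c) f g := by
  obtain ⟨M, hM⟩ := exists_bound_of_compact hc hcc
  have hm := hc.continuous.aestronglyMeasurable (μ := volume)
  rw [brMul_two, form_add_left hm hM, form_sum_left hm hM]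
  have hs : ∀ j, ContDiff ℝ ∞ (coordOp j (coordOp j c)) := fun j =>
    contDiff_coordOp (contDiff_coordOp hc j) j
  have hsc : ∀ j, HasCompactSupport (coordOp j (coordOp j c)) := fun j =>
    hasCompactSupport_coordOp (hasCompactSupport_coordOp hcc j) j
  have hsum : ContDiff ℝ ∞ (fun z => ∑ j, coordOp j (coordOp j c) z) :=
    ContDiff.sum fun j _ => hs j
  obtain ⟨M', hM'⟩ := exists_bound_of_compact hsum (hasCompactSupport_finset_sum _ fun j _ => hsc j)
  unfold bracketOp
  rw [form_add hm hM hsum.continuous.aestronglyMeasurable hM', form_sum _ hs hsc]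
  congr 1
  refine Finset.sum_congr rfl fun j _ => ?_
  rw [form_coordMul hc hcc, form_coordMul (contDiff_coordOp hc j) (hasCompactSupport_coordOp hcc j)]

theorem contDiff_bracketOp_iterate {c : Eu n × Eu n → ℂ} (hc : ContDiff ℝ ∞ c) (m : ℕ) :
    ContDiff ℝ ∞ (bracketOp^[m] c) := by
  induction m with
  | zero => exact hc
  | succ m ih => rw [Function.iterate_succ_apply']; exact contDiff_bracketOp ih

theorem hasCompactSupport_bracketOp_iterate {c : Eu n × Eu n → ℂ} (hc : HasCompactSupport c)
    (m : ℕ) : HasCompactSupport (bracketOp^[m] c) := by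
  induction m with
  | zero => exact hc
  | succ m ih => rw [Function.iterate_succ_apply']; exact hasCompactSupport_bracketOp ih

/-- A weight on the argument f can be traded for derivatives and weights on the symbol. In the
Calderón–Vaillancourt argument this transfers the localization of the symbol in x to a localization
of f. -/
theorem form_brMul_nat {c : Eu n × Eu n → ℂ} (hc : ContDiff ℝ ∞ c) (hcc : HasCompactSupport c)
    (m : ℕ) (f g : 𝓢(Eu n, ℂ)) :
    form c (brMul (2 * m : ℝ) f) g = form (bracketOp^[m] c) f g := by
  induction m generalizing f with
  | zero => simp [brMul_zero]
  | succ m ih =>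
    have : brMul (2 * ((m + 1 : ℕ) : ℝ)) f = brMul (2 * m : ℝ) (brMul 2 f) := by
      rw [brMul_brMul]; congr 1; push_cast; ring
    rw [this, ih, Function.iterate_succ_apply', form_brMul_two (contDiff_bracketOp_iterate hc m)
      (hasCompactSupport_bracketOp_iterate hcc m)]

end

section

/-! ### The Calderón-Vaillancourt theorem for compactly supported symbols -/

variable {n : ℕ}

theorem derivBound_coord (j : Fin n) (N : ℕ) :
    DerivBound N (bracket : Eu n → ℝ) (fun x : Eu n => ((x j : ℝ) : ℂ)) := by
  let L : Eu n →L[ℝ] ℂ := Complex.ofRealCLM ∘L (EuclideanSpace.proj (𝕜 := ℝ) j : Eu n →L[ℝ] ℝ)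
  have hL : ∀ x, L x = ((x j : ℝ) : ℂ) := fun x => by simp [L]
  have hn : ∀ x, ‖L x‖ ≤ 1 * ‖x‖ := fun x => by
    rw [hL, Complex.norm_real, one_mul]
    exact PiLp.norm_apply_le x j
  refine DerivBound.congr (F := fun x : Eu n => ((x j : ℝ) : ℂ)) (G := L) ?_ fun x => (hL x).symm
  refine ⟨L.contDiff, fun m _ z => ?_⟩
  match m with
  | 0 =>
    rw [norm_iteratedFDeriv_zero]
    exact (hn z).trans (by rw [one_mul]; exact norm_le_bracket z)
  | m + 1 =>
    rw [← norm_iteratedFDeriv_fderiv]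
    have : fderiv ℝ L = fun _ => L := by funext x; exact L.fderiv
    rw [this]
    match m with
    | 0 =>
      rw [norm_iteratedFDeriv_zero]
      exact (L.opNorm_le_bound zero_le_one hn).trans (one_le_bracket z)
    | m + 1 =>
      rw [iteratedFDeriv_const_of_ne (by omega)]
      simpa using (bracket_pos z).le

theorem norm_fst_le : ‖ContinuousLinearMap.fst ℝ (Eu n) (Eu n)‖ ≤ 1 :=
  ContinuousLinearMap.norm_fst_le ..

theorem rpow_bracket_nonneg (k : ℝ) (x : Eu n) : 0 ≤ bracket x ^ k :=
  Real.rpow_nonneg (bracket_pos x).le _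

theorem bracket_rpow_mono {k l : ℝ} (h : k ≤ l) (x : Eu n) : bracket x ^ k ≤ bracket x ^ l :=
  Real.rpow_le_rpow_of_exponent_le (one_le_bracket x) h

/-- Multiplication by x_j raises the exponent of the weight by one, and the ξ-derivative uses up one
order of differentiability. The factor |i/2π| is at most 1. -/
theorem derivBound_coordOp {N : ℕ} {k M : ℝ} {c : Eu n × Eu n → ℂ} (j : Fin n)
    (hc : DerivBound (N + 1) (fun z => M * bracket z.1 ^ k) c) :
    DerivBound N (fun z => (2 ^ N + 1) * M * bracket z.1 ^ (k + 1)) (coordOp j c) := by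
  have hM : 0 ≤ M := by simpa [bracket] using hc.nonneg 0
  have h1 := ((derivBound_coord j N).comp_linear _ (norm_fst_le (n := n))).mul
    (hc.of_le (Nat.le_succ N))
  have h2 := (hc.dirD ((0 : Eu n), eb j)).const_mul (-(Complex.I / (2 * π)))
  refine (h1.add h2).mono fun z => ?_
  have hb := bracket_pos z.1
  have e1 : bracket z.1 ^ (k + 1) = bracket z.1 * bracket z.1 ^ k := by
    rw [Real.rpow_add_one hb.ne', mul_comm]
  have e2 := rpow_bracket_nonneg k z.1
  have e3 : ‖-(Complex.I / (2 * (π : ℂ)))‖ ≤ 1 := by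
    rw [norm_neg, norm_div, Complex.norm_I, norm_mul, Complex.norm_real, Real.norm_of_nonneg pi_pos.le]
    have := Real.pi_gt_three
    rw [RCLike.norm_ofNat, div_le_one (by positivity)]
    linarith
  have e4 : ‖((0 : Eu n), eb j)‖ = 1 := by
    rw [Prod.norm_def, norm_eb]; simp
  simp only [ContinuousLinearMap.coe_fst'] at *
  rw [e4, e1, one_mul]
  have h5 : M * bracket z.1 ^ k ≤ M * (bracket z.1 * bracket z.1 ^ k) := by
    gcongr
    exact le_mul_of_one_le_left e2 (one_le_bracket _)
  have h6 : ‖-(Complex.I / (2 * (π : ℂ)))‖ * (M * bracket z.1 ^ k)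
      ≤ 1 * (M * (bracket z.1 * bracket z.1 ^ k)) :=
    mul_le_mul e3 h5 (by positivity) zero_le_one
  nlinarith [h6]

theorem exists_derivBound_bracketOp (n N : ℕ) : ∃ K : ℝ, 0 < K ∧
    ∀ (k M : ℝ) (c : Eu n × Eu n → ℂ), DerivBound (N + 2) (fun z => M * bracket z.1 ^ k) c →
      DerivBound N (fun z => K * M * bracket z.1 ^ (k + 2)) (bracketOp c) := by
  refine ⟨1 + n * ((2 ^ N + 1) * (2 ^ (N + 1) + 1)), by positivity, fun k M c hc => ?_⟩
  have hM : 0 ≤ M := by simpa [bracket] using hc.nonneg 0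
  have h1 := DerivBound.sum Finset.univ fun j _ =>
    derivBound_coordOp j (derivBound_coordOp j hc)
  refine ((hc.of_le (Nat.le_add_right N 2)).add h1).mono fun z => ?_
  rw [Finset.sum_const, Finset.card_univ, Fintype.card_fin, nsmul_eq_mul,
    show k + 1 + 1 = k + 2 by ring]
  have := mul_le_mul_of_nonneg_left (bracket_rpow_mono (show k ≤ k + 2 by linarith) z.1) hM
  linarith

theorem exists_derivBound_bracketOp_iterate (n N m : ℕ) : ∃ K : ℝ, 0 < K ∧
    ∀ (k M : ℝ) (c : Eu n × Eu n → ℂ), DerivBound (N + 2 * m) (fun z => M * bracket z.1 ^ k) c →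
      DerivBound N (fun z => K * M * bracket z.1 ^ (k + 2 * m)) (bracketOp^[m] c) := by
  induction m with
  | zero => exact ⟨1, one_pos, fun k M c hc => by simpa using hc⟩
  | succ m ih =>
    obtain ⟨K₁, hK₁, h₁⟩ := ih
    obtain ⟨K₂, hK₂, h₂⟩ := exists_derivBound_bracketOp n (N + 2 * m)
    refine ⟨K₁ * K₂, by positivity, fun k M c hc => ?_⟩
    rw [Function.iterate_succ_apply]
    have := h₁ _ _ _ (h₂ k M c hc)
    refine this.mono fun z => le_of_eq ?_
    rw [mul_assoc K₁ K₂ M]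
    congr 2
    push_cast
    ring

theorem integrable_bracket_rpow {r : ℝ} (hr : (n : ℝ) < r) :
    Integrable (fun x : Eu n => bracket x ^ (-r)) := by
  simp_rw [bracket_rpow]
  exact integrable_rpow_neg_one_add_norm_sq (by simpa using hr)

theorem derivBound_slice_left {N : ℕ} {W : Eu n × Eu n → ℝ} {c : Eu n × Eu n → ℂ}
    (hc : DerivBound N W c) (ξ : Eu n) : DerivBound N (fun x => W (x, ξ)) (fun x => c (x, ξ)) := by
  have := hc.comp_affine (ContinuousLinearMap.inl ℝ (Eu n) (Eu n)) (0, ξ) le_rfl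
    (ContinuousLinearMap.norm_inl_le_one ..)
  simpa using this

theorem integrable_of_derivBound {V : Type*} [NormedAddCommGroup V] [NormedSpace ℝ V]
    [MeasurableSpace V] [BorelSpace V] [FiniteDimensional ℝ V] {μ : Measure V}
    {N : ℕ} {W : V → ℝ} {G : V → ℂ} (hG : DerivBound N W G) (hW : Integrable W μ) {m : ℕ}
    (hm : m ≤ N) : Integrable (iteratedFDeriv ℝ m G) μ :=
  hW.mono' (hG.1.continuous_iteratedFDeriv (by exact_mod_cast le_top)).aestronglyMeasurable
    (Filter.Eventually.of_forall fun z => hG.2 m hm z)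

/-- Both |Ĝ| and |θ|^N |Ĝ| are bounded by L¹ norms of derivatives of G, and ⟨θ⟩^N ≤ 2^N (1 + |θ|^N).
-/
theorem norm_fourier_le_of_derivBound {N : ℕ} {W : Eu n → ℝ} {G : Eu n → ℂ}
    (hG : DerivBound N W G) (hW : Integrable W) (θ : Eu n) :
    ‖𝓕 G θ‖ ≤ 4 ^ N * (N + 2) * (∫ x, W x) * bracket θ ^ (-(N : ℝ)) := by
  have hi : ∀ m ≤ N, ∫ v, ‖iteratedFDeriv ℝ m G v‖ ≤ ∫ x, W x := fun m hm =>
    integral_mono (integrable_of_derivBound hG hW hm).norm hW fun z => hG.2 m hm z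
  have hI : 0 ≤ ∫ x, W x := integral_nonneg fun z => hG.nonneg z
  have key := Real.pow_mul_norm_iteratedFDeriv_fourier_le (K := 0) (N := N) (f := G)
    (hG.1.of_le (by exact_mod_cast le_top)) (fun k m hk hm => by
      have hk0 : k = 0 := by simpa using hk
      subst hk0
      simpa using (integrable_of_derivBound hG hW (by exact_mod_cast hm)).norm)
    (k := 0) (n := N) (by simp) (by simp) θ
  have h0 : ‖𝓕 G θ‖ ≤ ∫ x, W x := by
    rw [fourier_eq_osc]
    refine (norm_integral_le_integral_norm _).trans ?_
    simpa only [norm_mul, norm_osc, one_mul, norm_iteratedFDeriv_zero] using hi 0 (Nat.zero_le _)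
  have h1 : ‖θ‖ ^ N * ‖𝓕 G θ‖ ≤ 2 ^ N * ((N + 1) * ∫ x, W x) := by
    simp only [norm_iteratedFDeriv_zero] at key
    refine key.trans ?_
    simp only [pow_zero, one_mul, Nat.cast_zero, mul_zero, zero_add]
    gcongr
    rw [Finset.sum_product]
    simp only [Finset.range_one, Finset.sum_singleton, pow_zero, one_mul]
    refine (Finset.sum_le_card_nsmul _ _ _ fun m hm => hi m (by simp at hm; omega)).trans ?_
    simp
  have hb := bracket_pos θ
  rw [Real.rpow_neg hb.le, Real.rpow_natCast, ← div_eq_mul_inv, le_div_iff₀ (by positivity)]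
  have h2 : bracket θ ^ N ≤ 2 ^ N * (1 + ‖θ‖ ^ N) := by
    calc bracket θ ^ N ≤ (1 + ‖θ‖) ^ N := by gcongr; exact bracket_le θ
      _ ≤ (2 * max 1 ‖θ‖) ^ N := by
          gcongr
          linarith [le_max_left 1 ‖θ‖, le_max_right 1 ‖θ‖]
      _ = 2 ^ N * (max 1 ‖θ‖) ^ N := mul_pow _ _ _
      _ ≤ 2 ^ N * (1 + ‖θ‖ ^ N) := by
          gcongr
          rcases le_total 1 ‖θ‖ with h | h
          · rw [max_eq_right h]; linarith
          · rw [max_eq_left h, one_pow]; linarith [pow_nonneg (norm_nonneg θ) N]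
  calc ‖𝓕 G θ‖ * bracket θ ^ N ≤ ‖𝓕 G θ‖ * (2 ^ N * (1 + ‖θ‖ ^ N)) := by gcongr
    _ = 2 ^ N * (‖𝓕 G θ‖ + ‖θ‖ ^ N * ‖𝓕 G θ‖) := by ring
    _ ≤ 2 ^ N * ((∫ x, W x) + 2 ^ N * ((N + 1) * ∫ x, W x)) := by gcongr
    _ ≤ 2 ^ N * (2 ^ N * (∫ x, W x) + 2 ^ N * ((N + 1) * ∫ x, W x)) := by
        gcongr
        exact le_mul_of_one_le_left hI (one_le_pow₀ (by norm_num))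
    _ = 4 ^ N * (N + 2) * ∫ x, W x := by
        rw [show (4 : ℝ) = 2 * 2 by norm_num, mul_pow]; ring

/-! ### Cauchy-Schwarz -/

theorem integral_norm_mul_norm_le {V : Type*} [MeasurableSpace V] {μ : Measure V} {u v : V → ℂ}
    (hu : MemLp u 2 μ) (hv : MemLp v 2 μ) :
    ∫ x, ‖u x‖ * ‖v x‖ ∂μ ≤ √(∫ x, ‖u x‖ ^ 2 ∂μ) * √(∫ x, ‖v x‖ ^ 2 ∂μ) := by
  have h2 : ENNReal.ofReal 2 = 2 := by norm_num
  have := integral_mul_norm_le_Lp_mul_Lq (μ := μ) (f := u) (g := v) (p := 2) (q := 2)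
    Real.HolderConjugate.two_two (by rwa [h2]) (by rwa [h2])
  simpa [Real.sqrt_eq_rpow] using this

theorem norm_schwartzToL2 (f : 𝓢(Eu n, ℂ)) : ‖schwartzToL2 f‖ = √(∫ x, ‖f x‖ ^ 2) := by
  rw [schwartzToL2, SchwartzMap.norm_toLp' (by norm_num) (by norm_num), Real.sqrt_eq_rpow]
  simp

theorem sq_norm_schwartzToL2 (f : 𝓢(Eu n, ℂ)) : ‖schwartzToL2 f‖ ^ 2 = ∫ x, ‖f x‖ ^ 2 := by
  rw [norm_schwartzToL2, Real.sq_sqrt (integral_nonneg fun _ => by positivity)]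

theorem norm_schwartzToL2_fourier (f : 𝓢(Eu n, ℂ)) :
    ‖schwartzToL2 (𝓕 f)‖ = ‖schwartzToL2 f‖ := SchwartzMap.norm_fourier_toL2_eq f

end

/-! ### Calderón–Vaillancourt: symbols decaying in x, then averaging over translations. -/

section

variable {n : ℕ}

theorem integral_osc_mul_conj (g : 𝓢(Eu n, ℂ)) (η : Eu n) :
    ∫ x, osc x η * (starRingEnd ℂ) (g x) = (starRingEnd ℂ) (𝓕 g η) := by
  rw [SchwartzMap.fourier_coe, fourier_eq_osc, ← integral_conj]
  congr 1; funext x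
  rw [map_mul, conj_osc, neg_neg]

theorem integral_schwartz_mul_translate_le (f g : 𝓢(Eu n, ℂ)) (θ : Eu n) :
    Integrable (fun ξ => ‖f ξ‖ * ‖g (ξ + θ)‖) ∧
    ∫ ξ, ‖f ξ‖ * ‖g (ξ + θ)‖ ≤ ‖schwartzToL2 f‖ * ‖schwartzToL2 g‖ := by
  have hg : MemLp (fun ξ => g (ξ + θ)) 2 :=
    (g.memLp 2).comp_measurePreserving (measurePreserving_add_right volume θ)
  refine ⟨(f.memLp 2).norm.integrable_mul hg.norm, (integral_norm_mul_norm_le (f.memLp 2) hg).trans ?_⟩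
  rw [norm_schwartzToL2, norm_schwartzToL2, integral_add_right_eq_self (fun ξ => ‖g ξ‖ ^ 2)]

set_option maxHeartbeats 400000 in
/-- Boundedness of the quantization of a symbol which decays in `x`. -/
theorem exists_norm_form_le_of_decay (n : ℕ) : ∃ K : ℝ, 0 < K ∧
    ∀ (M : ℝ) (c : Eu n × Eu n → ℂ),
      DerivBound (n + 1) (fun z => M * bracket z.1 ^ (-((n + 1 : ℕ) : ℝ))) c →
      ∀ f g, ‖form c f g‖ ≤ K * M * (‖schwartzToL2 f‖ * ‖schwartzToL2 g‖) := by
  have hI : Integrable (fun x : Eu n => bracket x ^ (-((n + 1 : ℕ) : ℝ))) :=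
    integrable_bracket_rpow (by push_cast; linarith)
  set I : ℝ := ∫ x : Eu n, bracket x ^ (-((n + 1 : ℕ) : ℝ)) with hIdef
  have hI0 : 0 ≤ I := integral_nonneg fun x => rpow_bracket_nonneg _ x
  obtain ⟨K₀, hK₀⟩ : ∃ K₀ : ℝ, K₀ = 4 ^ (n + 1) * ((n + 1 : ℕ) + 2) := ⟨_, rfl⟩
  have hK₀0 : 0 ≤ K₀ := by rw [hK₀]; positivity
  refine ⟨K₀ * I * I + 1, by positivity, fun M c hc f g => ?_⟩
  have hM : 0 ≤ M := by simpa [bracket] using hc.nonneg 0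
  obtain ⟨ch, hch⟩ : ∃ ch : Eu n → Eu n → ℂ, ch = fun θ ξ => 𝓕 (fun x => c (x, ξ)) θ :=
    ⟨_, rfl⟩
  have hslice : ∀ ξ, DerivBound (n + 1) (fun x => M * bracket x ^ (-((n + 1 : ℕ) : ℝ)))
      (fun x => c (x, ξ)) := fun ξ => derivBound_slice_left hc ξ
  have hWi : Integrable (fun x : Eu n => M * bracket x ^ (-((n + 1 : ℕ) : ℝ))) := hI.const_mul M
  have hbd : ∀ θ ξ, ‖ch θ ξ‖ ≤ K₀ * (M * I) * bracket θ ^ (-((n + 1 : ℕ) : ℝ)) := fun θ ξ => by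
    have := norm_fourier_le_of_derivBound (hslice ξ) hWi θ
    rw [hch, hK₀]
    rwa [integral_const_mul, ← hIdef] at this
  have hcont : Continuous (fun p : Eu n × Eu n => ch p.1 p.2) := by
    simp only [hch, fourier_eq_osc]
    refine continuous_of_dominated (bound := fun x => M * bracket x ^ (-((n + 1 : ℕ) : ℝ)))
      (fun p => ?_) (fun p => Filter.Eventually.of_forall fun x => ?_) hWi
      (Filter.Eventually.of_forall fun x => ?_)
    · exact ((continuous_neg.osc continuous_const).mul
        (hc.1.continuous.comp (Continuous.prodMk_left p.2))).aestronglyMeasurable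
    · rw [norm_mul, norm_osc, one_mul]
      exact hc.norm_le (x, p.2)
    · exact (continuous_const.osc continuous_fst).mul
        (hc.1.continuous.comp (continuous_const.prodMk continuous_snd))
  -- Fourier inversion in x only: c is a superposition of modes e^{2πi⟨x,θ⟩} ĉ(θ,ξ), and n + 1
  -- derivatives in x make ĉ integrable in θ uniformly in ξ.
  have hinv : ∀ z : Eu n × Eu n, c z = ∫ θ, osc z.1 θ * ch θ z.2 := fun z => by
    have h1 : Integrable (fun x => c (x, z.2)) := hWi.mono'
      (hslice z.2).1.continuous.aestronglyMeasurable
      (Filter.Eventually.of_forall fun x => (hslice z.2).norm_le x)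
    have h2 : Integrable (𝓕 (fun x => c (x, z.2))) := (hI.const_mul (K₀ * (M * I))).mono'
      (by simpa only [hch, Function.comp_def] using
        (hcont.comp (Continuous.prodMk_left z.2)).aestronglyMeasurable)
      (Filter.Eventually.of_forall fun θ => by simpa only [hch] using hbd θ z.2)
    have h3 := (hslice z.2).1.continuous.fourierInv_fourier_eq h1 h2
    rw [← fourierInv_eq_osc]
    simp only [hch]
    exact (congrFun h3 z.1).symm
  set H : Eu n × Eu n → Eu n → ℂ := fun z θ =>
    osc z.1 θ * ch θ z.2 * (osc z.1 z.2 * 𝓕 f z.2 * (starRingEnd ℂ) (g z.1)) with hH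
  have hHi : Integrable (Function.uncurry H) := by
    refine (((integrable_schwartz_prod f g).mul_prod (hI.const_mul (K₀ * (M * I)))).mono' ?_
      (Filter.Eventually.of_forall fun p => ?_))
    · refine Continuous.aestronglyMeasurable ?_
      refine (Continuous.mul ?_ ?_).mul ((Continuous.mul ?_ ?_).mul ?_)
      · exact (continuous_fst.comp continuous_fst).osc continuous_snd
      · exact hcont.comp (continuous_snd.prodMk (continuous_snd.comp continuous_fst))
      · exact continuous_osc.comp continuous_fst
      · exact (continuous_fourier_schwartz f).comp (continuous_snd.comp continuous_fst)
      · exact Complex.continuous_conj.comp (g.continuous.comp (continuous_fst.comp continuous_fst))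
    · simp only [Function.uncurry, hH, norm_mul, norm_osc, one_mul, RCLike.norm_conj]
      rw [mul_comm]
      gcongr
      exact hbd _ _
  have h1 : form c f g = ∫ θ, ∫ z, H z θ := by
    rw [← integral_integral_swap hHi, form]
    congr 1; funext z
    simp only [hH]
    rw [integral_mul_const, ← hinv z]
    ring
  have h2 : ∀ θ, ‖∫ z, H z θ‖ ≤ K₀ * (M * I) * (‖schwartzToL2 f‖ * ‖schwartzToL2 g‖) *
      bracket θ ^ (-((n + 1 : ℕ) : ℝ)) := fun θ => by
    have hi : Integrable (fun z => H z θ) (volume.prod volume) := by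
      refine ((integrable_schwartz_prod f g).const_mul
        (K₀ * (M * I) * bracket θ ^ (-((n + 1 : ℕ) : ℝ)))).mono' ?_
        (Filter.Eventually.of_forall fun z => ?_)
      · refine Continuous.aestronglyMeasurable ?_
        refine (Continuous.mul ?_ ?_).mul ((Continuous.mul ?_ ?_).mul ?_)
        · exact continuous_fst.osc continuous_const
        · exact hcont.comp (continuous_const.prodMk continuous_snd)
        · exact continuous_osc
        · exact (continuous_fourier_schwartz f).comp continuous_snd
        · exact Complex.continuous_conj.comp (g.continuous.comp continuous_fst)
      · simp only [hH, norm_mul, norm_osc, one_mul, RCLike.norm_conj]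
        gcongr
        exact hbd _ _
    -- A single mode is a Fourier multiplier followed by a frequency shift by θ. Cauchy–Schwarz and
    -- Plancherel bound it by sup_ξ |ĉ(θ,ξ)|.
    have e1 : ∫ z, H z θ = ∫ ξ, ch θ ξ * 𝓕 f ξ * (starRingEnd ℂ) (𝓕 g (ξ + θ)) := by
      rw [Measure.volume_eq_prod, integral_prod_symm _ hi]
      congr 1; funext ξ
      rw [← integral_osc_mul_conj, ← integral_const_mul]
      congr 1; funext x
      simp only [hH, osc_add_right]
      ring
    obtain ⟨i1, i2⟩ := integral_schwartz_mul_translate_le (𝓕 f) (𝓕 g) θ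
    rw [norm_schwartzToL2_fourier, norm_schwartzToL2_fourier] at i2
    rw [e1]
    have hp := rpow_bracket_nonneg (-((n + 1 : ℕ) : ℝ)) θ
    calc _ ≤ ∫ ξ, K₀ * (M * I) * bracket θ ^ (-((n + 1 : ℕ) : ℝ)) *
          (‖𝓕 f ξ‖ * ‖𝓕 g (ξ + θ)‖) := by
          refine norm_integral_le_of_norm_le (i1.const_mul _) (Filter.Eventually.of_forall fun ξ => ?_)
          rw [norm_mul, norm_mul, RCLike.norm_conj, mul_assoc]
          gcongr
          exact hbd _ _
      _ = K₀ * (M * I) * bracket θ ^ (-((n + 1 : ℕ) : ℝ)) *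
          ∫ ξ, (‖𝓕 f ξ‖ * ‖𝓕 g (ξ + θ)‖) := integral_const_mul _ _
      _ ≤ K₀ * (M * I) * bracket θ ^ (-((n + 1 : ℕ) : ℝ)) *
          (‖schwartzToL2 f‖ * ‖schwartzToL2 g‖) :=
          mul_le_mul_of_nonneg_left i2 (mul_nonneg (mul_nonneg hK₀0 (mul_nonneg hM hI0)) hp)
      _ = _ := by ring
  rw [h1]
  clear_value H
  have h3 := norm_integral_le_of_norm_le (hI.const_mul (K₀ * (M * I) *
    (‖schwartzToL2 f‖ * ‖schwartzToL2 g‖))) (Filter.Eventually.of_forall h2)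
  rw [integral_const_mul, ← hIdef] at h3
  refine h3.trans ?_
  have h4 : 0 ≤ M * (‖schwartzToL2 f‖ * ‖schwartzToL2 g‖) := by positivity
  generalize hS : ‖schwartzToL2 f‖ * ‖schwartzToL2 g‖ = S at h4 ⊢
  linarith

/-- The order of differentiability used in the Calderón-Vaillancourt theorem. -/
def cvOrder (n : ℕ) : ℕ := 3 * (n + 1)

/-- Translation of a Schwartz function. -/
def shift (k : Eu n) (f : 𝓢(Eu n, ℂ)) : 𝓢(Eu n, ℂ) := SchwartzMap.compSubConstCLM ℂ (-k) f

theorem shift_apply (k : Eu n) (f : 𝓢(Eu n, ℂ)) (x : Eu n) : shift k f x = f (x + k) := by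
  rw [shift, SchwartzMap.compSubConstCLM_apply, sub_neg_eq_add]

theorem fourier_shift (k : Eu n) (f : 𝓢(Eu n, ℂ)) (ξ : Eu n) :
    𝓕 (shift k f) ξ = osc k ξ * 𝓕 f ξ := by
  rw [SchwartzMap.fourier_coe, SchwartzMap.fourier_coe, fourier_eq_osc, fourier_eq_osc,
    ← integral_const_mul]
  rw [← integral_add_right_eq_self (fun x => osc k ξ * (osc (-x) ξ * f x)) k]
  congr 1; funext x
  rw [shift_apply, ← mul_assoc, ← osc_add_left]
  congr 2
  abel

theorem form_shift (c : Eu n × Eu n → ℂ) (k : Eu n) (f g : 𝓢(Eu n, ℂ)) :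
    form (fun z => c (z.1 + k, z.2)) (shift k f) (shift k g) = form c f g := by
  rw [form, form, ← integral_add_right_eq_self
    (fun z : Eu n × Eu n => c z * osc z.1 z.2 * 𝓕 f z.2 * (starRingEnd ℂ) (g z.1)) (k, 0)]
  congr 1; funext z
  simp only [fourier_shift, shift_apply, Prod.fst_add, Prod.snd_add, add_zero, osc_add_left]
  have : z + (k, (0 : Eu n)) = (z.1 + k, z.2) := by ext1 <;> simp
  rw [this]
  ring

theorem form_brMul_right (c : Eu n × Eu n → ℂ) (k : ℝ) (f g : 𝓢(Eu n, ℂ)) :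
    form c f (brMul k g) = form (fun z => brC k z.1 * c z) f g := by
  rw [form, form]
  congr 1; funext z
  rw [brMul_apply, map_mul]
  have : (starRingEnd ℂ) (brC k z.1) = brC k z.1 := Complex.conj_ofReal _
  rw [this]; ring

theorem integrable_window (f : 𝓢(Eu n, ℂ)) {r : ℝ} (hr : (n : ℝ) < r) :
    Integrable (fun z : Eu n × Eu n => bracket z.1 ^ (-r) * ‖f (z.1 + z.2)‖ ^ 2) := by
  have h1 : Integrable (fun y => ‖f y‖ ^ 2) := (f.memLp 2).integrable_norm_pow (by norm_num)
  have h2 := (integrable_bracket_rpow hr).mul_prod h1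
  exact (measurePreserving_prod_add (volume : Measure (Eu n)) volume).integrable_comp_of_integrable h2

theorem sq_norm_brMul_shift (f : 𝓢(Eu n, ℂ)) (r : ℝ) (k : Eu n) :
    ‖schwartzToL2 (brMul r (shift k f))‖ ^ 2 = ∫ x, bracket x ^ (2 * r) * ‖f (x + k)‖ ^ 2 := by
  rw [sq_norm_schwartzToL2]
  congr 1; funext x
  rw [brMul_apply, norm_mul, norm_brC, shift_apply, mul_pow, ← Real.rpow_natCast (bracket x ^ r) 2,
    ← Real.rpow_mul (bracket_pos x).le]
  congr 2; push_cast; ring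

/-- By Tonelli, integrating the localized norms over all translations gives every point the same
total weight ∫⟨x⟩^{-2r}. This square integrability in k takes the place of almost orthogonality. -/
theorem memLp_norm_brMul_shift (f : 𝓢(Eu n, ℂ)) {r : ℝ} (hr : (n : ℝ) < 2 * r) :
    MemLp (fun k => ((‖schwartzToL2 (brMul (-r) (shift k f))‖ : ℝ) : ℂ)) 2 ∧
    ∫ k, ‖schwartzToL2 (brMul (-r) (shift k f))‖ ^ 2 =
      (∫ x : Eu n, bracket x ^ (-(2 * r))) * ‖schwartzToL2 f‖ ^ 2 := by
  have hi := integrable_window f hr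
  have hi' : Integrable (fun k => ∫ x, bracket x ^ (-(2 * r)) * ‖f (x + k)‖ ^ 2) :=
    Integrable.integral_prod_right hi
  have e : ∀ k, ‖schwartzToL2 (brMul (-r) (shift k f))‖ ^ 2 =
      ∫ x, bracket x ^ (-(2 * r)) * ‖f (x + k)‖ ^ 2 := fun k => by
    rw [sq_norm_brMul_shift, mul_neg]
  have e' : ∀ k, ‖schwartzToL2 (brMul (-r) (shift k f))‖ =
      √(∫ x, bracket x ^ (-(2 * r)) * ‖f (x + k)‖ ^ 2) := fun k => by
    rw [← e, Real.sqrt_sq (norm_nonneg _)]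
  constructor
  · rw [memLp_two_iff_integrable_sq_norm]
    · simp only [Complex.norm_real, norm_norm, e]
      exact hi'
    · simp only [e']
      exact Complex.continuous_ofReal.comp_aestronglyMeasurable
        (Real.continuous_sqrt.comp_aestronglyMeasurable hi'.aestronglyMeasurable)
  · simp only [e]
    rw [← integral_integral_swap (f := fun x k => bracket x ^ (-(2 * r)) * ‖f (x + k)‖ ^ 2) hi,
      ← integral_mul_const]
    congr 1; funext x
    rw [integral_const_mul, sq_norm_schwartzToL2]
    congr 1
    exact integral_add_left_eq_self (fun y => ‖f y‖ ^ 2) x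

/-- The Calderón-Vaillancourt theorem for compactly supported symbols. -/
theorem exists_norm_form_le_of_hasCompactSupport (n : ℕ) : ∃ K : ℝ, 0 < K ∧
    ∀ (M : ℝ) (c : Eu n × Eu n → ℂ), HasCompactSupport c →
      DerivBound (cvOrder n) (fun _ => M) c →
      ∀ f g, ‖form c f g‖ ≤ K * M * (‖schwartzToL2 f‖ * ‖schwartzToL2 g‖) := by
  -- The weight ⟨x⟩^{-r} with r = 2m put on f is undone by ⟨y⟩^{2m}, that is by `bracketOp^[m]` on
  -- the symbol. This raises the exponent in x by 2m, so L = (n+1) + 2m leaves precisely the decay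
  -- ⟨x⟩^{-(n+1)}.
  set m : ℕ := n + 1 with hm
  set L : ℝ := ((n + 1 : ℕ) : ℝ) + 2 * m with hL
  set r : ℝ := 2 * m with hr
  obtain ⟨K₁, hK₁, h₁⟩ := exists_norm_form_le_of_decay n
  obtain ⟨K₂, hK₂, h₂⟩ := exists_derivBound_bracketOp_iterate n (n + 1) m
  obtain ⟨K₃, hK₃, h₃⟩ := exists_derivBound_brC n (-L) (cvOrder n)
  have hrn : (n : ℝ) < 2 * r := by rw [hr, hm]; push_cast; linarith
  set J : ℝ := ∫ x : Eu n, bracket x ^ (-(2 * r)) with hJ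
  have hJ0 : 0 ≤ J := integral_nonneg fun x => rpow_bracket_nonneg _ x
  -- the averaging weight
  have hwi : Integrable (fun x : Eu n => bracket x ^ (-(L + r))) :=
    integrable_bracket_rpow (by rw [hL, hr, hm]; push_cast; linarith)
  set A : ℝ := ∫ x : Eu n, bracket x ^ (-(L + r)) with hA
  have hA0 : 0 < A := by
    rw [hA, integral_pos_iff_support_of_nonneg (fun x => rpow_bracket_nonneg _ x) hwi]
    have : Function.support (fun x : Eu n => bracket x ^ (-(L + r))) = Set.univ := by
      ext x
      simpa using (Real.rpow_pos_of_pos (bracket_pos x) _).ne'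
    rw [this]
    exact NeZero.pos _
  refine ⟨A⁻¹ * (K₁ * (K₂ * (2 ^ cvOrder n * K₃)) * J) + 1, by positivity, fun M c hcc hc f g => ?_⟩
  have hM : 0 ≤ M := hc.nonneg 0
  -- the localized pieces
  have hpiece : ∀ k : Eu n, ‖form (fun z => brC (-(L + r)) (z.1 - k) * c z) f g‖ ≤
      K₁ * (K₂ * (2 ^ cvOrder n * K₃)) * M * (‖schwartzToL2 (brMul (-r) (shift k f))‖ *
        ‖schwartzToL2 (brMul (-r) (shift k g))‖) := fun k => by
    set b : Eu n × Eu n → ℂ := fun z => brC (-L) z.1 * c (z.1 + k, z.2) with hb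
    have hbD : DerivBound (cvOrder n) (fun z => 2 ^ cvOrder n * K₃ * M * bracket z.1 ^ (-L)) b := by
      refine ((h₃.comp_linear _ norm_fst_le).mul (hc.translate (k, 0))).congr ?_ |>.mono fun z => ?_
      · intro z
        simp only [hb, ContinuousLinearMap.coe_fst']
        congr 2
        ext1 <;> simp
      · simp only [ContinuousLinearMap.coe_fst']
        exact le_of_eq (by ring)
    have hbc : HasCompactSupport b := by
      refine HasCompactSupport.mul_left ?_
      have := hcc.comp_homeomorph (Homeomorph.addRight ((k, 0) : Eu n × Eu n))
      convert! this using 1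
      funext z
      simp only [Function.comp, Homeomorph.coe_addRight]
      congr 1
      ext1 <;> simp
    -- After recentring at k, the weight ⟨x⟩^{-(L+r)} splits: ⟨x⟩^{-r} goes to g, ⟨x⟩^{-L} stays on
    -- the symbol, and f is written as ⟨y⟩^{2m} times ⟨y⟩^{-r} f.
    have e1 : form (fun z => brC (-(L + r)) (z.1 - k) * c z) f g =
        form (bracketOp^[m] b) (brMul (-r) (shift k f)) (brMul (-r) (shift k g)) := by
      rw [← form_shift _ k, ← form_brMul_nat hbD.1 hbc, ← hr, brMul_brMul, add_neg_cancel,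
        brMul_zero, form_brMul_right]
      refine form_congr (fun z => ?_) _ _
      simp only [hb, add_sub_cancel_right]
      rw [show -(L + r) = -r + -L by ring, brC_add, mul_assoc]
    rw [e1]
    -- This accounts for the order 3(n+1): n + 1 derivatives for the decaying case and 2(n+1) used
    -- up by `bracketOp^[m]`.
    have hD := h₂ _ _ _ (hbD.of_le (show n + 1 + 2 * m ≤ cvOrder n by rw [cvOrder, hm]; omega))
    have e2 : -L + 2 * (m : ℝ) = -((n + 1 : ℕ) : ℝ) := by rw [hL]; ring
    rw [e2] at hD
    refine (h₁ _ _ hD _ _).trans (le_of_eq ?_)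
    ring
  -- averaging over the pieces
  obtain ⟨mf, If⟩ := memLp_norm_brMul_shift f hrn
  obtain ⟨mg, Ig⟩ := memLp_norm_brMul_shift g hrn
  have hCS : ∫ k, ‖schwartzToL2 (brMul (-r) (shift k f))‖ * ‖schwartzToL2 (brMul (-r) (shift k g))‖
      ≤ J * (‖schwartzToL2 f‖ * ‖schwartzToL2 g‖) := by
    have := integral_norm_mul_norm_le mf mg
    simp only [Complex.norm_real, norm_norm] at this
    refine this.trans (le_of_eq ?_)
    rw [If, Ig, Real.sqrt_mul hJ0, Real.sqrt_mul hJ0, Real.sqrt_sq (norm_nonneg _),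
      Real.sqrt_sq (norm_nonneg _)]
    rw [mul_mul_mul_comm, Real.mul_self_sqrt hJ0]
  have hCSi : Integrable fun k => ‖schwartzToL2 (brMul (-r) (shift k f))‖ *
      ‖schwartzToL2 (brMul (-r) (shift k g))‖ := by
    have := mf.norm.integrable_mul mg.norm
    simpa only [Complex.norm_real, norm_norm] using! this
  -- The translates of the weight integrate to the constant A, so the localized pieces reassemble to
  -- A times the original form.
  have havg : (A : ℂ) * form c f g = ∫ k, form (fun z => brC (-(L + r)) (z.1 - k) * c z) f g := by
    have hi : Integrable (Function.uncurry fun (k : Eu n) (z : Eu n × Eu n) =>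
        brC (-(L + r)) (z.1 - k) * c z * osc z.1 z.2 * 𝓕 f z.2 * (starRingEnd ℂ) (g z.1))
        (volume.prod volume) := by
      have hF := integrable_form (M := M) hc.1.continuous.aestronglyMeasurable hc.norm_le f g
      have hcw : Continuous (brC (-(L + r)) : Eu n → ℂ) := (contDiff_bracket_rpow _).continuous
      have hcF : Continuous fun z : Eu n × Eu n =>
          c z * osc z.1 z.2 * 𝓕 f z.2 * (starRingEnd ℂ) (g z.1) :=
        ((hc.1.continuous.mul continuous_osc).mul
          ((continuous_fourier_schwartz f).comp continuous_snd)).mul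
          (Complex.continuous_conj.comp (g.continuous.comp continuous_fst))
      rw [integrable_prod_iff']
      · refine ⟨Filter.Eventually.of_forall fun z => ?_, ?_⟩
        · simp only [Function.uncurry, mul_assoc]
          refine Integrable.mul_const ?_ _
          refine ((hwi.comp_sub_left z.1).mono' ?_ (Filter.Eventually.of_forall fun k => ?_))
          · exact (hcw.comp (continuous_const.sub continuous_id)).aestronglyMeasurable
          · exact (norm_brC _ _).le
        · have : (fun z : Eu n × Eu n => ∫ k : Eu n, ‖Function.uncurry (fun (k : Eu n)
              (z : Eu n × Eu n) => brC (-(L + r)) (z.1 - k) * c z * osc z.1 z.2 * 𝓕 f z.2 *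
                (starRingEnd ℂ) (g z.1)) (k, z)‖) = fun z => A * ‖c z * osc z.1 z.2 * 𝓕 f z.2 *
                (starRingEnd ℂ) (g z.1)‖ := by
            funext z
            simp only [Function.uncurry, mul_assoc]
            simp only [norm_mul (brC _ _), norm_brC]
            rw [integral_mul_const, integral_sub_left_eq_self (fun x => bracket x ^ (-(L + r)))]
          rw [this]
          exact hF.norm.const_mul A
      · refine Continuous.aestronglyMeasurable ?_
        have : Continuous fun p : Eu n × (Eu n × Eu n) => brC (-(L + r)) (p.2.1 - p.1) *
            (c p.2 * osc p.2.1 p.2.2 * 𝓕 f p.2.2 * (starRingEnd ℂ) (g p.2.1)) :=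
          (hcw.comp ((continuous_fst.comp continuous_snd).sub continuous_fst)).mul
            (hcF.comp continuous_snd)
        simpa only [Function.uncurry_def, mul_assoc] using this
    unfold form
    rw [integral_integral_swap hi, ← integral_const_mul]
    congr 1; funext z
    simp only [mul_assoc]
    rw [integral_mul_const]
    congr 1
    rw [integral_sub_left_eq_self (fun x => brC (-(L + r)) x)]
    simp only [brC, integral_complex_ofReal, hA]
  have hnorm : A * ‖form c f g‖ ≤ K₁ * (K₂ * (2 ^ cvOrder n * K₃)) * M *
      (J * (‖schwartzToL2 f‖ * ‖schwartzToL2 g‖)) := by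
    have : A * ‖form c f g‖ = ‖(A : ℂ) * form c f g‖ := by
      rw [norm_mul, Complex.norm_real, Real.norm_of_nonneg hA0.le]
    rw [this, havg]
    refine (norm_integral_le_of_norm_le (hCSi.const_mul _)
      (Filter.Eventually.of_forall hpiece)).trans ?_
    rw [integral_const_mul]
    gcongr
  calc ‖form c f g‖ = A⁻¹ * (A * ‖form c f g‖) := by field_simp
    _ ≤ A⁻¹ * (K₁ * (K₂ * (2 ^ cvOrder n * K₃)) * M *
      (J * (‖schwartzToL2 f‖ * ‖schwartzToL2 g‖))) := by gcongr
    _ = A⁻¹ * (K₁ * (K₂ * (2 ^ cvOrder n * K₃)) * J) * M *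
      (‖schwartzToL2 f‖ * ‖schwartzToL2 g‖) := by ring
    _ ≤ _ := by gcongr; linarith

end

section

/-! ### Operators on `L²` represented by symbols -/

variable {n : ℕ}

open Filter Topology

/-- The inclusion of the Schwartz space into `L²` as a linear map. -/
def schwartzToL2L (n : ℕ) : 𝓢(Eu n, ℂ) →ₗ[ℂ] L2 n :=
  (SchwartzMap.toLpCLM ℂ ℂ 2 (volume : Measure (Eu n))).toLinearMap

theorem schwartzToL2L_apply (f : 𝓢(Eu n, ℂ)) : schwartzToL2L n f = schwartzToL2 f := rfl

theorem denseRange_schwartzToL2L : DenseRange (schwartzToL2L n) :=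
  SchwartzMap.denseRange_toLpCLM (by simp)

theorem inner_schwartzToL2 (g : 𝓢(Eu n, ℂ)) (v : L2 n) :
    inner ℂ (schwartzToL2 g) v = ∫ x, v x * (starRingEnd ℂ) (g x) := by
  rw [L2.inner_def]
  refine integral_congr_ae ?_
  filter_upwards [g.coeFn_toLp 2 volume] with x hx
  rw [schwartzToL2, hx, RCLike.inner_apply]

/-- `T` is the bounded operator on `L²` with symbol `c`, in the weak sense. -/
def Represents (T : L2 n →L[ℂ] L2 n) (c : Eu n × Eu n → ℂ) : Prop :=
  ∀ f g : 𝓢(Eu n, ℂ), inner ℂ (schwartzToL2 g) (T (schwartzToL2 f)) = form c f g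

/-- The form of `c` is bounded by `M` with respect to the `L²` norm. -/
def FormBound (M : ℝ) (c : Eu n × Eu n → ℂ) : Prop :=
  ∀ f g : 𝓢(Eu n, ℂ), ‖form c f g‖ ≤ M * (‖schwartzToL2 f‖ * ‖schwartzToL2 g‖)

theorem ext_of_inner_schwartz {v w : L2 n}
    (h : ∀ g : 𝓢(Eu n, ℂ), inner ℂ (schwartzToL2 g) v = inner ℂ (schwartzToL2 g) w) : v = w := by
  refine ext_inner_left ℂ fun u => ?_
  refine denseRange_schwartzToL2L.induction_on (p := fun u => inner ℂ u v = inner ℂ u w) u ?_ h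
  exact isClosed_eq (by fun_prop) (by fun_prop)

theorem Represents.norm_form_le {T : L2 n →L[ℂ] L2 n} {c : Eu n × Eu n → ℂ} (hT : Represents T c) :
    FormBound ‖T‖ c := fun f g => by
  rw [← hT f g]
  refine (norm_inner_le_norm _ _).trans ?_
  calc _ ≤ ‖schwartzToL2 g‖ * (‖T‖ * ‖schwartzToL2 f‖) := by gcongr; exact T.le_opNorm _
    _ = _ := by ring

theorem norm_le_of_inner_schwartz {T : L2 n →L[ℂ] L2 n} {M : ℝ} (hM : 0 ≤ M)
    (h : ∀ f g : 𝓢(Eu n, ℂ), ‖inner ℂ (schwartzToL2 g) (T (schwartzToL2 f))‖ ≤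
      M * (‖schwartzToL2 f‖ * ‖schwartzToL2 g‖)) : ‖T‖ ≤ M := by
  have h2 : ∀ u v : L2 n, ‖inner ℂ v (T u)‖ ≤ M * (‖u‖ * ‖v‖) := fun u v => by
    refine denseRange_schwartzToL2L.induction_on₂
      (p := fun u v => ‖inner ℂ v (T u)‖ ≤ M * (‖u‖ * ‖v‖)) ?_ (fun f g => h f g) u v
    exact isClosed_le (by fun_prop) (by fun_prop)
  refine T.opNorm_le_bound hM fun u => ?_
  have h3 := h2 u (T u)
  rw [inner_self_eq_norm_sq_to_K, ← RCLike.ofReal_pow, RCLike.norm_ofReal,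
    abs_of_nonneg (by positivity)] at h3
  rcases (norm_nonneg (T u)).eq_or_lt with h0 | h0
  · rw [← h0]; positivity
  · nlinarith

theorem Represents.norm_le {T : L2 n →L[ℂ] L2 n} {c : Eu n × Eu n → ℂ} (hT : Represents T c)
    {M : ℝ} (hM : 0 ≤ M) (h : FormBound M c) : ‖T‖ ≤ M :=
  norm_le_of_inner_schwartz hM fun f g => by rw [hT f g]; exact h f g

theorem Represents.unique {T T' : L2 n →L[ℂ] L2 n} {c : Eu n × Eu n → ℂ} (hT : Represents T c)
    (hT' : Represents T' c) : T = T' := by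
  ext1 u
  refine denseRange_schwartzToL2L.induction_on (p := fun u => T u = T' u) u
    (isClosed_eq (by fun_prop) (by fun_prop)) fun f => ext_of_inner_schwartz fun g => ?_
  exact (hT f g).trans (hT' f g).symm

theorem form_conj_right_add {c : Eu n × Eu n → ℂ} {M : ℝ} (hc : AEStronglyMeasurable c)
    (hM : ∀ z, ‖c z‖ ≤ M) (f g g' : 𝓢(Eu n, ℂ)) :
    form c f (g + g') = form c f g + form c f g' := by
  rw [form, form, form, ← integral_add (integrable_form hc hM f g) (integrable_form hc hM f g')]
  congr 1; funext z
  rw [_root_.add_apply, map_add]; ring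

theorem form_smul_right (c : Eu n × Eu n → ℂ) (a : ℂ) (f g : 𝓢(Eu n, ℂ)) :
    form c f (a • g) = (starRingEnd ℂ) a * form c f g := by
  rw [form, form, ← integral_const_mul]
  congr 1; funext z
  rw [_root_.smul_apply, smul_eq_mul, map_mul]; ring

theorem form_smul_left (c : Eu n × Eu n → ℂ) (a : ℂ) (f g : 𝓢(Eu n, ℂ)) :
    form c (a • f) g = a * form c f g := by
  rw [form, form, ← integral_const_mul]
  congr 1; funext z
  rw [FourierTransform.fourier_smul, _root_.smul_apply, smul_eq_mul]; ring

/-- A bounded form is the form of a bounded operator. -/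
theorem FormBound.exists_represents {M C : ℝ} {c : Eu n × Eu n → ℂ} (h : FormBound M c)
    (hM : 0 ≤ M) (hc : AEStronglyMeasurable c) (hC : ∀ z, ‖c z‖ ≤ C) :
    ∃ T : L2 n →L[ℂ] L2 n, Represents T c ∧ ‖T‖ ≤ M := by
  -- Conjugation makes the form linear in g. It then extends by density to a bounded functional on
  -- L², which the Riesz theorem turns into the vector `v f`.
  let l : 𝓢(Eu n, ℂ) → 𝓢(Eu n, ℂ) →ₗ[ℂ] ℂ := fun f =>
    { toFun := fun g => (starRingEnd ℂ) (form c f g)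
      map_add' := fun g g' => by rw [form_conj_right_add hc hC, map_add]
      map_smul' := fun a g => by simp [form_smul_right] }
  have hl : ∀ f g, ‖l f g‖ ≤ M * ‖schwartzToL2 f‖ * ‖schwartzToL2L n g‖ := fun f g => by
    change ‖(starRingEnd ℂ) (form c f g)‖ ≤ _
    rw [RCLike.norm_conj, mul_assoc]
    exact h f g
  let v : 𝓢(Eu n, ℂ) → L2 n := fun f =>
    (InnerProductSpace.toDual ℂ (L2 n)).symm ((l f).extendOfNorm (schwartzToL2L n))
  have hv : ∀ f g, inner ℂ (schwartzToL2 g) (v f) = form c f g := fun f g => by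
    rw [← inner_conj_symm, InnerProductSpace.toDual_symm_apply, ← schwartzToL2L_apply,
      LinearMap.extendOfNorm_eq denseRange_schwartzToL2L ⟨_, hl f⟩]
    change (starRingEnd ℂ) ((starRingEnd ℂ) _) = _
    rw [Complex.conj_conj]
  have hvn : ∀ f, ‖v f‖ ≤ M * ‖schwartzToL2L n f‖ := fun f => by
    rw [LinearIsometryEquiv.norm_map]
    exact LinearMap.opNorm_extendOfNorm_le denseRange_schwartzToL2L (by positivity) (hl f)
  let V : 𝓢(Eu n, ℂ) →ₗ[ℂ] L2 n :=
    { toFun := v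
      map_add' := fun f f' => ext_of_inner_schwartz fun g => by
        rw [inner_add_right, hv, hv, hv, form_add_left hc hC]
      map_smul' := fun a f => ext_of_inner_schwartz fun g => by
        rw [inner_smul_right, hv, hv, RingHom.id_apply, form_smul_left] }
  refine ⟨V.extendOfNorm (schwartzToL2L n), fun f g => ?_,
    LinearMap.opNorm_extendOfNorm_le denseRange_schwartzToL2L hM hvn⟩
  rw [← schwartzToL2L_apply f, LinearMap.extendOfNorm_eq denseRange_schwartzToL2L ⟨M, hvn⟩]
  exact hv f g

theorem norm_opF_le {c : Eu n × Eu n → ℂ} {M : ℝ} (hM : ∀ z, ‖c z‖ ≤ M) (f : 𝓢(Eu n, ℂ))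
    (x : Eu n) : ‖opF c f x‖ ≤ M * ∫ ξ, ‖𝓕 f ξ‖ := by
  rw [← integral_const_mul]
  refine norm_integral_le_of_norm_le (((𝓕 f).integrable (μ := volume)).norm.const_mul M)
    (Eventually.of_forall fun ξ => ?_)
  rw [norm_mul, norm_mul, norm_osc, mul_one]
  gcongr
  exact hM _

theorem aestronglyMeasurable_opF {c : Eu n × Eu n → ℂ} (hc : AEStronglyMeasurable c)
    (f : 𝓢(Eu n, ℂ)) : AEStronglyMeasurable (opF c f) := by
  have : AEStronglyMeasurable (fun z : Eu n × Eu n => c z * osc z.1 z.2 * 𝓕 f z.2)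
      ((volume : Measure (Eu n)).prod volume) := by
    rw [← Measure.volume_eq_prod]
    exact (hc.mul continuous_osc.aestronglyMeasurable).mul
      ((continuous_fourier_schwartz f).comp continuous_snd).aestronglyMeasurable
  exact this.integral_prod_right'

theorem form_eq_integral_opF {c : Eu n × Eu n → ℂ} {M : ℝ} (hc : AEStronglyMeasurable c)
    (hM : ∀ z, ‖c z‖ ≤ M) (f g : 𝓢(Eu n, ℂ)) :
    form c f g = ∫ x, opF c f x * (starRingEnd ℂ) (g x) := by
  have hi := integrable_form hc hM f g
  rw [Measure.volume_eq_prod] at hi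
  rw [form, Measure.volume_eq_prod, integral_prod _ hi]
  congr 1; funext x
  rw [opF, ← integral_mul_const]

theorem locallyIntegrable_of_bounded {u : Eu n → ℂ} {M : ℝ} (hu : AEStronglyMeasurable u)
    (hM : ∀ x, ‖u x‖ ≤ M) : LocallyIntegrable u := by
  refine (locallyIntegrable_const M).mono hu (Eventually.of_forall fun x => ?_)
  exact (hM x).trans (le_abs_self _)

/-- Both sides are locally integrable and agree when tested against real smooth compactly supported
functions. This upgrades the weak representation to the pointwise formula required by `IsOpH`. -/
theorem Represents.ae_eq_opF {T : L2 n →L[ℂ] L2 n} {c : Eu n × Eu n → ℂ} {M : ℝ}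
    (hT : Represents T c) (hc : AEStronglyMeasurable c) (hM : ∀ z, ‖c z‖ ≤ M) (f : 𝓢(Eu n, ℂ)) :
    (T (schwartzToL2 f) : Eu n → ℂ) =ᵐ[volume] opF c f := by
  refine ae_eq_of_integral_contDiff_smul_eq
    ((Lp.memLp (T (schwartzToL2 f))).locallyIntegrable (by norm_num))
    (locallyIntegrable_of_bounded (aestronglyMeasurable_opF hc f) (norm_opF_le hM f))
    fun g hg hgc => ?_
  let G : 𝓢(Eu n, ℂ) := HasCompactSupport.toSchwartzMap (f := fun x => ((g x : ℝ) : ℂ))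
    (hgc.comp_left (g := fun t : ℝ => (t : ℂ)) Complex.ofReal_zero) (Complex.ofRealCLM.contDiff.comp hg)
  have hG : ∀ x, G x = ((g x : ℝ) : ℂ) := fun x => rfl
  have h := hT f G
  rw [inner_schwartzToL2, form_eq_integral_opF hc hM] at h
  simp only [hG, Complex.conj_ofReal] at h
  simp only [Complex.real_smul, mul_comm ((g _ : ℝ) : ℂ)]
  exact h

theorem Represents.add {T T' : L2 n →L[ℂ] L2 n} {c c' : Eu n × Eu n → ℂ} {M M' : ℝ}
    (hT : Represents T c) (hT' : Represents T' c') (hc : AEStronglyMeasurable c)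
    (hM : ∀ z, ‖c z‖ ≤ M) (hc' : AEStronglyMeasurable c') (hM' : ∀ z, ‖c' z‖ ≤ M') :
    Represents (T + T') (fun z => c z + c' z) := fun f g => by
  rw [form_add hc hM hc' hM', ← hT, ← hT', _root_.add_apply, inner_add_right]

theorem Represents.congr {T : L2 n →L[ℂ] L2 n} {c c' : Eu n × Eu n → ℂ}
    (hT : Represents T c) (h : ∀ z, c' z = c z) : Represents T c' := by
  rwa [show c' = c from funext h]

/-! ### Weak limits -/

theorem tendsto_form {c : ℕ → Eu n × Eu n → ℂ} {c' : Eu n × Eu n → ℂ} {M : ℝ}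
    (hc : ∀ m, AEStronglyMeasurable (c m)) (hM : ∀ m z, ‖c m z‖ ≤ M)
    (h : ∀ᵐ z, Tendsto (fun m => c m z) atTop (𝓝 (c' z))) (f g : 𝓢(Eu n, ℂ)) :
    Tendsto (fun m => form (c m) f g) atTop (𝓝 (form c' f g)) := by
  refine tendsto_integral_of_dominated_convergence
    (fun z : Eu n × Eu n => M * (‖𝓕 f z.2‖ * ‖g z.1‖))
    (fun m => (integrable_form (hc m) (hM m) f g).aestronglyMeasurable)
    ((integrable_schwartz_prod f g).const_mul M) (fun m => Eventually.of_forall fun z => ?_) ?_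
  · simp only [norm_mul, norm_osc, mul_one, RCLike.norm_conj]
    rw [mul_assoc]
    gcongr
    exact hM m z
  · filter_upwards [h] with z hz
    exact ((hz.mul_const _).mul_const _).mul_const _

/-- Convergence in the weak operator topology. -/
def WeakTendsto (T : ℕ → L2 n →L[ℂ] L2 n) (T' : L2 n →L[ℂ] L2 n) : Prop :=
  ∀ u v : L2 n, Tendsto (fun m => inner ℂ v (T m u)) atTop (𝓝 (inner ℂ v (T' u)))

namespace WeakTendsto

variable {T S : ℕ → L2 n →L[ℂ] L2 n} {T' S' : L2 n →L[ℂ] L2 n}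

/-- Uniform boundedness extends convergence from the dense Schwartz vectors to all of L², by an ε/3
argument. -/
theorem of_schwartz {M : ℝ} (hM : ∀ m, ‖T m‖ ≤ M)
    (h : ∀ f g : 𝓢(Eu n, ℂ), Tendsto (fun m => inner ℂ (schwartzToL2 g) (T m (schwartzToL2 f)))
      atTop (𝓝 (inner ℂ (schwartzToL2 g) (T' (schwartzToL2 f))))) : WeakTendsto T T' := by
  intro u v
  have hM0 : 0 ≤ M := (norm_nonneg _).trans (hM 0)
  have key : ∀ (A : L2 n →L[ℂ] L2 n) (B : ℝ), ‖A‖ ≤ B → ∀ u v u' v' : L2 n,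
      ‖inner ℂ v (A u) - inner ℂ v' (A u')‖ ≤ B * (‖v - v'‖ * ‖u‖ + ‖v'‖ * ‖u - u'‖) := by
    intro A B hB u v u' v'
    have e : inner ℂ v (A u) - inner ℂ v' (A u') = inner ℂ (v - v') (A u) + inner ℂ v' (A (u - u')) := by
      rw [inner_sub_left, map_sub, inner_sub_right]; ring
    have hA : ∀ w, ‖A w‖ ≤ B * ‖w‖ := fun w => A.le_of_opNorm_le hB w
    rw [e]
    calc _ ≤ ‖v - v'‖ * ‖A u‖ + ‖v'‖ * ‖A (u - u')‖ :=
          (norm_add_le _ _).trans (add_le_add (norm_inner_le_norm _ _) (norm_inner_le_norm _ _))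
      _ ≤ ‖v - v'‖ * (B * ‖u‖) + ‖v'‖ * (B * ‖u - u'‖) := by gcongr <;> exact hA _
      _ = _ := by ring
  rw [Metric.tendsto_atTop]
  intro ε hε
  set B : ℝ := M + ‖T'‖ with hB
  have hB0 : 0 ≤ B := by positivity
  have hcont : Tendsto (fun p : L2 n × L2 n => B * (‖v - p.2‖ * ‖u‖ + ‖p.2‖ * ‖u - p.1‖))
      (𝓝 (u, v)) (𝓝 0) := by
    have : Continuous (fun p : L2 n × L2 n => B * (‖v - p.2‖ * ‖u‖ + ‖p.2‖ * ‖u - p.1‖)) := by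
      fun_prop
    have h2 := this.tendsto (u, v)
    simpa using h2
  have hd : DenseRange (Prod.map (schwartzToL2L n) (schwartzToL2L n)) :=
    denseRange_schwartzToL2L.prodMap denseRange_schwartzToL2L
  obtain ⟨⟨f, g⟩, hfg⟩ := hd.exists_mem_open (s := interior
      {p : L2 n × L2 n | B * (‖v - p.2‖ * ‖u‖ + ‖p.2‖ * ‖u - p.1‖) < ε / 3}) isOpen_interior
    ⟨(u, v), mem_interior_iff_mem_nhds.2 (hcont.eventually_lt_const (by positivity))⟩
  have hfg' : B * (‖v - schwartzToL2 g‖ * ‖u‖ + ‖schwartzToL2 g‖ * ‖u - schwartzToL2 f‖) < ε / 3 := by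
    have h0 := interior_subset hfg
    exact h0
  obtain ⟨N, hN⟩ := Metric.tendsto_atTop.1 (h f g) (ε / 3) (by positivity)
  refine ⟨N, fun m hm => ?_⟩
  have h1 := key (T m) B ((hM m).trans (by simp [hB])) u v (schwartzToL2 f) (schwartzToL2 g)
  have h2 := key T' B (by linarith) u v (schwartzToL2 f) (schwartzToL2 g)
  have h3 := hN m hm
  rw [dist_eq_norm] at h3 ⊢
  have e : inner ℂ v (T m u) - inner ℂ v (T' u) =
      (inner ℂ v (T m u) - inner ℂ (schwartzToL2 g) (T m (schwartzToL2 f)))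
      + (inner ℂ (schwartzToL2 g) (T m (schwartzToL2 f))
        - inner ℂ (schwartzToL2 g) (T' (schwartzToL2 f)))
      - (inner ℂ v (T' u) - inner ℂ (schwartzToL2 g) (T' (schwartzToL2 f))) := by ring
  rw [e]
  refine (norm_sub_le _ _).trans_lt ?_
  have := norm_add_le (inner ℂ v (T m u) - inner ℂ (schwartzToL2 g) (T m (schwartzToL2 f)))
    (inner ℂ (schwartzToL2 g) (T m (schwartzToL2 f))
        - inner ℂ (schwartzToL2 g) (T' (schwartzToL2 f)))
  linarith

theorem of_represents {M : ℝ} {c : ℕ → Eu n × Eu n → ℂ} {c' : Eu n × Eu n → ℂ}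
    (hM : ∀ m, ‖T m‖ ≤ M) (hT : ∀ m, Represents (T m) (c m)) (hT' : Represents T' c')
    (h : ∀ f g, Tendsto (fun m => form (c m) f g) atTop (𝓝 (form c' f g))) : WeakTendsto T T' :=
  of_schwartz hM fun f g => by
    simp only [hT _ f g, hT' f g]
    exact h f g

theorem sub (h : WeakTendsto T T') (h' : WeakTendsto S S') :
    WeakTendsto (fun m => T m - S m) (T' - S') := fun u v => by
  simp only [_root_.sub_apply, inner_sub_right]
  exact (h u v).sub (h' u v)

theorem comp_right (h : WeakTendsto T T') (A : L2 n →L[ℂ] L2 n) :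
    WeakTendsto (fun m => T m ∘L A) (T' ∘L A) := fun u v => h (A u) v

theorem comp_left (h : WeakTendsto T T') (A : L2 n →L[ℂ] L2 n) :
    WeakTendsto (fun m => A ∘L T m) (A ∘L T') := fun u v => by
  have := h u (ContinuousLinearMap.adjoint A v)
  simp only [ContinuousLinearMap.adjoint_inner_left] at this
  exact this

/-- Lower semicontinuity of the operator norm. It carries the estimates for cut off or mollified
symbols to the limit; letting the bounds vary with m allows error terms which tend to zero. -/
theorem norm_le (h : WeakTendsto T T') {M : ℕ → ℝ} {M' : ℝ} (hM : ∀ m, ‖T m‖ ≤ M m)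
    (hM' : Tendsto M atTop (𝓝 M')) : ‖T'‖ ≤ M' := by
  have h0 : 0 ≤ M' := ge_of_tendsto' hM' fun m => (norm_nonneg _).trans (hM m)
  refine norm_le_of_inner_schwartz h0 fun f g => ?_
  refine le_of_tendsto_of_tendsto' (h (schwartzToL2 f) (schwartzToL2 g)).norm
    (hM'.mul_const (‖schwartzToL2 f‖ * ‖schwartzToL2 g‖)) fun m => ?_
  refine (norm_inner_le_norm _ _).trans ?_
  calc _ ≤ ‖schwartzToL2 g‖ * (M m * ‖schwartzToL2 f‖) := by
        gcongr; exact (T m).le_of_opNorm_le (hM m) _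
    _ = _ := by ring

end WeakTendsto

theorem FormBound.of_tendsto {c : ℕ → Eu n × Eu n → ℂ} {c' : Eu n × Eu n → ℂ} {M : ℕ → ℝ} {M' : ℝ}
    (hc : ∀ m, FormBound (M m) (c m)) (hM : Tendsto M atTop (𝓝 M'))
    (h : ∀ f g, Tendsto (fun m => form (c m) f g) atTop (𝓝 (form c' f g))) : FormBound M' c' :=
  fun f g => le_of_tendsto_of_tendsto' (h f g).norm (hM.mul_const _) fun m => hc m f g

end

section

/-! ### Symbols without compact support -/

variable {n : ℕ}

open Filter Topology

theorem dirD_comp_smul {V : Type*} [NormedAddCommGroup V] [NormedSpace ℝ V] {G : V → ℂ}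
    (hG : ContDiff ℝ ∞ G) (r : ℝ) (v z : V) :
    dirD v (fun z => G (r • z)) z = (r : ℂ) * dirD v G (r • z) := by
  have h1 : HasFDerivAt (fun z : V => r • z) (r • ContinuousLinearMap.id ℝ V) z :=
    (hasFDerivAt_id z).const_smul r
  have h2 := ((hG.differentiable (by simp)) (r • z)).hasFDerivAt.comp z h1
  have h3 : HasFDerivAt (fun z => G (r • z)) _ z := h2
  rw [dirD, h3.fderiv, dirD]
  simp

/-- Smooth cutoff functions with derivative bounds. -/
theorem exists_cutoff (V : Type*) [NormedAddCommGroup V] [NormedSpace ℝ V] [FiniteDimensional ℝ V]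
    (N : ℕ) : ∃ (K : ℝ) (χ : ℕ → V → ℂ), 0 < K ∧ (∀ m, HasCompactSupport (χ m)) ∧
      (∀ m, DerivBound N (fun _ => K) (χ m)) ∧
      (∀ (m : ℕ) v, DerivBound N (fun _ => ‖v‖ * K * (1 / ((m : ℝ) + 1))) (dirD v (χ m))) ∧
      (∀ m z, ‖χ m z‖ ≤ 1) ∧ ∀ z, Tendsto (fun m => χ m z) atTop (𝓝 1) := by
  let φ : ContDiffBump (0 : V) := ⟨1, 2, one_pos, one_lt_two⟩
  let χ : V → ℂ := fun z => ((φ z : ℝ) : ℂ)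
  have hχ : ContDiff ℝ ∞ χ := Complex.ofRealCLM.contDiff.comp φ.contDiff
  have hχc : HasCompactSupport χ :=
    φ.hasCompactSupport.comp_left (g := fun t : ℝ => (t : ℂ)) Complex.ofReal_zero
  obtain ⟨K, hK, hb⟩ := exists_derivBound_of_hasCompactSupport hχ hχc (N + 1)
  have hr : ∀ m : ℕ, (0 : ℝ) < 1 / ((m : ℝ) + 1) := fun m => by positivity
  have hr1 : ∀ m : ℕ, 1 / ((m : ℝ) + 1) ≤ 1 := fun m => by
    rw [div_le_one (by positivity)]; linarith [(Nat.cast_nonneg m : (0 : ℝ) ≤ m)]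
  let L : ℕ → V →L[ℝ] V := fun m => (1 / ((m : ℝ) + 1)) • ContinuousLinearMap.id ℝ V
  have hL : ∀ m, ‖L m‖ ≤ 1 := fun m => by
    refine (ContinuousLinearMap.opNorm_smul_le _ _).trans ?_
    rw [Real.norm_of_nonneg (hr m).le]
    exact mul_le_one₀ (hr1 m) (norm_nonneg _) ContinuousLinearMap.norm_id_le
  have hlim : Tendsto (fun m : ℕ => 1 / ((m : ℝ) + 1)) atTop (𝓝 0) :=
    tendsto_one_div_add_atTop_nhds_zero_nat
  refine ⟨K + 1, fun m z => χ ((1 / ((m : ℝ) + 1)) • z), by linarith, fun m => ?_, fun m => ?_,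
    fun m v => ?_, fun m z => ?_, fun z => ?_⟩
  · exact hχc.comp_homeomorph (Homeomorph.smulOfNeZero _ (hr m).ne')
  · exact ((hb.of_le (Nat.le_succ N)).comp_linear (L m) (hL m)).mono fun z => by simp
  -- The chain rule factor 1/(m+1) makes the derivatives of the cutoff vanish in the limit. This
  -- keeps undifferentiated symbols out of the composition error.
  · refine DerivBound.congr ?_ fun z => dirD_comp_smul hχ _ v z
    refine (((hb.dirD v).comp_linear (L m) (hL m)).const_mul _).mono fun z => ?_
    rw [Complex.norm_real, Real.norm_of_nonneg (hr m).le, mul_comm]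
    have := (hr m).le
    gcongr
    linarith
  · change ‖((φ _ : ℝ) : ℂ)‖ ≤ 1
    rw [Complex.norm_real, Real.norm_of_nonneg φ.nonneg]
    exact φ.le_one
  · refine tendsto_const_nhds.congr' ?_
    have h1 : Tendsto (fun m : ℕ => (1 / ((m : ℝ) + 1)) • z) atTop (𝓝 0) := by
      simpa using hlim.smul_const z
    filter_upwards [h1.eventually (Metric.closedBall_mem_nhds 0 (one_pos))] with m hm
    change (1 : ℂ) = ((φ _ : ℝ) : ℂ)
    rw [φ.one_of_mem_closedBall hm, Complex.ofReal_one]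

theorem DerivBound.measurable {N : ℕ} {W : Eu n × Eu n → ℝ} {c : Eu n × Eu n → ℂ}
    (h : DerivBound N W c) : AEStronglyMeasurable c := h.1.continuous.aestronglyMeasurable

/-- **Calderón-Vaillancourt theorem**. -/
theorem exists_formBound (n : ℕ) : ∃ K : ℝ, 0 < K ∧ ∀ (M : ℝ) (c : Eu n × Eu n → ℂ),
    DerivBound (cvOrder n) (fun _ => M) c → FormBound (K * M) c := by
  obtain ⟨K, hK, h⟩ := exists_norm_form_le_of_hasCompactSupport n
  obtain ⟨K₁, χ, hK₁, hχc, hχ, -, hχ1, hχt⟩ := exists_cutoff (Eu n × Eu n) (cvOrder n)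
  refine ⟨K * (2 ^ cvOrder n * K₁), by positivity, fun M c hc => ?_⟩
  refine FormBound.of_tendsto (c := fun m z => χ m z * c z) (M := fun _ => _) (fun m f g => ?_)
    tendsto_const_nhds (tendsto_form (M := 1 * M) (fun m => ?_) (fun m z => ?_)
      (Eventually.of_forall fun z => ?_))
  · refine (h _ _ (hχc m).mul_right ((hχ m).mul hc) f g).trans (le_of_eq ?_)
    ring
  · exact ((hχ m).mul hc).measurable
  · rw [norm_mul]
    exact mul_le_mul (hχ1 m z) (hc.norm_le z) (norm_nonneg _) zero_le_one
  · simpa using (hχt z).mul_const (c z)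

theorem exists_represents (n : ℕ) : ∃ K : ℝ, 0 < K ∧ ∀ (M : ℝ) (c : Eu n × Eu n → ℂ),
    DerivBound (cvOrder n) (fun _ => M) c →
      ∃ T : L2 n →L[ℂ] L2 n, Represents T c ∧ ‖T‖ ≤ K * M := by
  obtain ⟨K, hK, h⟩ := exists_formBound n
  refine ⟨K, hK, fun M c hc => ?_⟩
  have := hc.nonneg 0
  exact (h M c hc).exists_represents (by positivity) hc.measurable hc.norm_le

end

section

/-! ### Smoothness of parametric integrals -/

open Filter Topology

section ParametricIntegral

variable {α : Type*} [MeasurableSpace α] {μ : Measure α}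

/-- Each directional derivative is a limit of difference quotients, hence measurable in the
parameter. Finitely many of them, along a basis, determine the full derivative. -/
theorem aestronglyMeasurable_fderiv_param {V E : Type} [NormedAddCommGroup V] [NormedSpace ℝ V]
    [FiniteDimensional ℝ V] [NormedAddCommGroup E] [NormedSpace ℝ E] {F : V → α → E}
    (hF : ∀ a, Differentiable ℝ (F · a)) (hm : ∀ v, AEStronglyMeasurable (F v) μ) (v : V) :
    AEStronglyMeasurable (fun a => fderiv ℝ (F · a) v) μ := by
  let b := Module.finBasis ℝ V
  have h1 : ∀ w : V, AEStronglyMeasurable (fun a => fderiv ℝ (F · a) v w) μ := fun w => by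
    refine aestronglyMeasurable_of_tendsto_ae (u := atTop)
      (f := fun (m : ℕ) a => (m : ℝ) • (F (v + (m : ℝ)⁻¹ • w) a - F v a))
      (fun m => ((hm _).sub (hm _)).const_smul _) (Eventually.of_forall fun a => ?_)
    exact ((hF a v).hasFDerivAt.lim_real w).comp tendsto_natCast_atTop_atTop
  have h2 : ∀ a, fderiv ℝ (F · a) v = ∑ i, ContinuousLinearMap.smulRightL ℝ V E
      (LinearMap.toContinuousLinearMap (b.coord i)) (fderiv ℝ (F · a) v (b i)) := fun a => by
    ext w
    conv_lhs => rw [← b.sum_repr w, map_sum]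
    simp [_root_.sum_apply]
  rw [show (fun a => fderiv ℝ (F · a) v) = _ from funext h2]
  refine Finset.aestronglyMeasurable_fun_sum _ fun i _ => ?_
  exact (ContinuousLinearMap.continuous _).comp_aestronglyMeasurable (h1 _)

theorem hasFDerivAt_integral_param {V E : Type} [NormedAddCommGroup V] [NormedSpace ℝ V]
    [FiniteDimensional ℝ V] [NormedAddCommGroup E] [NormedSpace ℝ E] {F : V → α → E}
    (hF : ∀ a, ContDiff ℝ ∞ (F · a)) (hm : ∀ v, AEStronglyMeasurable (F v) μ)
    (hb : ∀ (m : ℕ) (v₀ : V), ∃ s ∈ 𝓝 v₀, ∃ bound : α → ℝ, Integrable bound μ ∧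
      ∀ v ∈ s, ∀ a, ‖iteratedFDeriv ℝ m (F · a) v‖ ≤ bound a) (v₀ : V) :
    HasFDerivAt (fun v => ∫ a, F v a ∂μ) (∫ a, fderiv ℝ (F · a) v₀ ∂μ) v₀ ∧
      Integrable (fun a => fderiv ℝ (F · a) v₀) μ := by
  have hd : ∀ a, Differentiable ℝ (F · a) := fun a => (hF a).differentiable (by simp)
  obtain ⟨s, hs, bound, hbi, hbd⟩ := hb 1 v₀
  obtain ⟨s', hs', bound', hbi', hbd'⟩ := hb 0 v₀
  have h1 : ∀ v ∈ s, ∀ a, ‖fderiv ℝ (F · a) v‖ ≤ bound a := fun v hv a => by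
    have := hbd v hv a
    rwa [norm_iteratedFDeriv_one] at this
  have hmf := aestronglyMeasurable_fderiv_param hd hm v₀
  refine ⟨hasFDerivAt_integral_of_dominated_of_fderiv_le (F := F)
    (F' := fun v a => fderiv ℝ (F · a) v) (bound := bound) hs (Eventually.of_forall hm) ?_ hmf
    (Eventually.of_forall fun a v hv => h1 v hv a) hbi
    (Eventually.of_forall fun a v _ => (hd a v).hasFDerivAt), ?_⟩
  · refine hbi'.mono' (hm v₀) (Eventually.of_forall fun a => ?_)
    simpa using hbd' v₀ (mem_of_mem_nhds hs') a
  · exact hbi.mono' hmf (Eventually.of_forall fun a => h1 v₀ (mem_of_mem_nhds hs) a)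

/-- Induction on the order of differentiability with the target space E generalized, because the
derivative is again a parametric integral, now with values in V →L[ℝ] E. -/
theorem contDiff_integral_param {V E : Type} [NormedAddCommGroup V] [NormedSpace ℝ V]
    [FiniteDimensional ℝ V] [NormedAddCommGroup E] [NormedSpace ℝ E] {F : V → α → E}
    (hF : ∀ a, ContDiff ℝ ∞ (F · a)) (hm : ∀ v, AEStronglyMeasurable (F v) μ)
    (hb : ∀ (m : ℕ) (v₀ : V), ∃ s ∈ 𝓝 v₀, ∃ bound : α → ℝ, Integrable bound μ ∧
      ∀ v ∈ s, ∀ a, ‖iteratedFDeriv ℝ m (F · a) v‖ ≤ bound a) :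
    ContDiff ℝ ∞ (fun v => ∫ a, F v a ∂μ) := by
  rw [contDiff_infty]
  intro N
  induction N generalizing E with
  | zero =>
    refine contDiff_zero.2 (continuous_iff_continuousAt.2 fun v => ?_)
    exact (hasFDerivAt_integral_param hF hm hb v).1.continuousAt
  | succ N ih =>
    have hd : ∀ a, Differentiable ℝ (F · a) := fun a => (hF a).differentiable (by simp)
    have h := fun v => (hasFDerivAt_integral_param hF hm hb v).1
    rw [Nat.cast_succ, contDiff_succ_iff_fderiv]
    refine ⟨fun v => (h v).differentiableAt, by simp, ?_⟩
    rw [show fderiv ℝ (fun v => ∫ a, F v a ∂μ) = _ from funext fun v => (h v).fderiv]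
    refine ih (F := fun v a => fderiv ℝ (F · a) v)
      (fun a => (hF a).fderiv_right (m := ∞) (by simp))
      (aestronglyMeasurable_fderiv_param hd hm) fun m v₀ => ?_
    obtain ⟨s, hs, bound, hbi, hbd⟩ := hb (m + 1) v₀
    refine ⟨s, hs, bound, hbi, fun v hv a => ?_⟩
    have := hbd v hv a
    rwa [← norm_iteratedFDeriv_fderiv] at this

theorem dirD_integral_param {V : Type} [NormedAddCommGroup V] [NormedSpace ℝ V]
    [FiniteDimensional ℝ V] {F : V → α → ℂ}
    (hF : ∀ a, ContDiff ℝ ∞ (F · a)) (hm : ∀ v, AEStronglyMeasurable (F v) μ)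
    (hb : ∀ (m : ℕ) (v₀ : V), ∃ s ∈ 𝓝 v₀, ∃ bound : α → ℝ, Integrable bound μ ∧
      ∀ v ∈ s, ∀ a, ‖iteratedFDeriv ℝ m (F · a) v‖ ≤ bound a) (w v : V) :
    dirD w (fun v => ∫ a, F v a ∂μ) v = ∫ a, dirD w (F · a) v ∂μ := by
  obtain ⟨h1, h2⟩ := hasFDerivAt_integral_param hF hm hb v
  rw [dirD, h1.fderiv, ContinuousLinearMap.integral_apply h2]
  rfl

end ParametricIntegral

/-! ### Composition of operators with compactly supported symbols -/

variable {n : ℕ}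

/-- The product of c with ⟨x⟩^r⟨ξ⟩^r is still smooth and compactly supported. Dividing the weights
out again gives the decay. -/
theorem exists_derivBound_decay {c : Eu n × Eu n → ℂ} (hc : ContDiff ℝ ∞ c)
    (hcc : HasCompactSupport c) (N : ℕ) (r : ℝ) : ∃ M : ℝ, 0 ≤ M ∧
      DerivBound N (fun z => M * (bracket z.1 ^ (-r) * bracket z.2 ^ (-r))) c := by
  have hbr : ∀ k : ℝ, ContDiff ℝ ∞ (brC k : Eu n → ℂ) := contDiff_bracket_rpow
  obtain ⟨M, hM, hd⟩ := exists_derivBound_of_hasCompactSupport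
    (G := fun z : Eu n × Eu n => (brC r z.1 * brC r z.2) * c z)
    ((((hbr r).comp contDiff_fst).mul ((hbr r).comp contDiff_snd)).mul hc) hcc.mul_left N
  obtain ⟨K, hK, hw⟩ := exists_derivBound_brC n (-r) N
  have h1 := (hw.comp_linear (ContinuousLinearMap.fst ℝ (Eu n) (Eu n)) norm_fst_le).mul
    (hw.comp_linear (ContinuousLinearMap.snd ℝ (Eu n) (Eu n)) (ContinuousLinearMap.norm_snd_le ..))
  refine ⟨2 ^ N * (2 ^ N * (K * K) * M), by positivity, ((h1.mul hd).congr fun z => ?_).mono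
    fun z => le_of_eq ?_⟩
  · simp only [ContinuousLinearMap.coe_fst', ContinuousLinearMap.coe_snd']
    have h : ∀ x : Eu n, brC (-r) x * brC r x = 1 := fun x => by
      rw [← brC_add, neg_add_cancel, brC_zero]
    calc c z = (brC (-r) z.1 * brC r z.1) * (brC (-r) z.2 * brC r z.2) * c z := by rw [h, h]; ring
      _ = _ := by ring
  · simp only [ContinuousLinearMap.coe_fst', ContinuousLinearMap.coe_snd']
    ring

/-- The partial Fourier transform in the first variable. -/
def fourierFst (b : Eu n × Eu n → ℂ) (v ξ : Eu n) : ℂ := 𝓕 (fun y => b (y, ξ)) v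

theorem fourierFst_eq (b : Eu n × Eu n → ℂ) (v ξ : Eu n) :
    fourierFst b v ξ = ∫ y, osc (-y) v * b (y, ξ) := fourier_eq_osc _ _

theorem continuous_fourierFst {b : Eu n × Eu n → ℂ} (hb : ContDiff ℝ ∞ b)
    (hbc : HasCompactSupport b) : Continuous fun z : Eu n × Eu n => fourierFst b z.1 z.2 := by
  obtain ⟨M, hM, h⟩ := exists_derivBound_decay hb hbc 0 ((n + 1 : ℕ) : ℝ)
  simp only [fourierFst_eq]
  refine continuous_of_dominated (bound := fun y => M * bracket y ^ (-((n + 1 : ℕ) : ℝ)))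
    (fun z => ?_) (fun z => Eventually.of_forall fun y => ?_)
    ((integrable_bracket_rpow (by push_cast; linarith)).const_mul M)
    (Eventually.of_forall fun y => ?_)
  · exact ((continuous_neg.osc continuous_const).mul
      (hb.continuous.comp (by fun_prop))).aestronglyMeasurable
  · rw [norm_mul, norm_osc, one_mul]
    refine (h.norm_le _).trans ?_
    have h1 : bracket z.2 ^ (-((n + 1 : ℕ) : ℝ)) ≤ 1 :=
      Real.rpow_le_one_of_one_le_of_nonpos (one_le_bracket _) (neg_nonpos.2 (Nat.cast_nonneg _))
    have h2 := rpow_bracket_nonneg (-((n + 1 : ℕ) : ℝ)) y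
    exact mul_le_mul_of_nonneg_left (mul_le_of_le_one_right h2 h1) hM
  · exact (continuous_const.osc continuous_fst).mul (hb.continuous.comp (by fun_prop))

theorem exists_norm_fourierFst_le {b : Eu n × Eu n → ℂ} (hb : ContDiff ℝ ∞ b)
    (hbc : HasCompactSupport b) (r : ℕ) : ∃ M : ℝ, 0 ≤ M ∧ ∀ v ξ,
      ‖fourierFst b v ξ‖ ≤ M * (bracket v ^ (-(r : ℝ)) * bracket ξ ^ (-(r : ℝ))) := by
  obtain ⟨M, hM, h⟩ := exists_derivBound_decay hb hbc r ((n + 1 + r : ℕ) : ℝ)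
  set I : ℝ := ∫ x : Eu n, bracket x ^ (-((n + 1 + r : ℕ) : ℝ)) with hI
  have hI0 : 0 ≤ I := integral_nonneg fun x => rpow_bracket_nonneg _ x
  have hint : Integrable fun x : Eu n => bracket x ^ (-((n + 1 + r : ℕ) : ℝ)) :=
    integrable_bracket_rpow (by push_cast; linarith [(Nat.cast_nonneg r : (0 : ℝ) ≤ r)])
  refine ⟨4 ^ r * (r + 2) * (M * I), by positivity, fun v ξ => ?_⟩
  have h1 := norm_fourier_le_of_derivBound (derivBound_slice_left h ξ)
    ((hint.mul_const (bracket ξ ^ (-((n + 1 + r : ℕ) : ℝ)))).const_mul M) v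
  refine h1.trans ?_
  simp only
  rw [integral_const_mul, integral_mul_const]
  clear_value I
  rw [← hI]
  have h2 : bracket ξ ^ (-((n + 1 + r : ℕ) : ℝ)) ≤ bracket ξ ^ (-(r : ℝ)) :=
    bracket_rpow_mono (by push_cast; linarith [(Nat.cast_nonneg n : (0 : ℝ) ≤ n)]) ξ
  have h3 := rpow_bracket_nonneg (-(r : ℝ)) v
  have h4 : (0 : ℝ) ≤ 4 ^ r * (r + 2) * (M * I) := by positivity
  rw [show ∀ p q A B : ℝ, p * (M * (A * q)) * B = p * (M * A) * (B * q) from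
    fun p q A B => by ring]
  exact mul_le_mul_of_nonneg_left (mul_le_mul_of_nonneg_left h2 h3) h4

theorem contDiff_opF {b : Eu n × Eu n → ℂ} (hb : ContDiff ℝ ∞ b)
    (hbc : HasCompactSupport b) (f : 𝓢(Eu n, ℂ)) : ContDiff ℝ ∞ (opF b f) := by
  set Φ : Eu n × Eu n → ℂ := fun z => b z * osc z.1 z.2 * 𝓕 f z.2 with hΦ
  have hs : ContDiff ℝ ∞ Φ := (hb.mul contDiff_osc).mul (((𝓕 f).smooth ⊤).comp contDiff_snd)
  have hc : HasCompactSupport Φ := hbc.mul_right.mul_right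
  refine contDiff_integral_param (F := fun x ξ => Φ (x, ξ))
    (fun ξ => hs.comp (by fun_prop)) (fun x => ?_) fun m x₀ => ?_
  · exact (hs.continuous.comp (by fun_prop)).aestronglyMeasurable
  · obtain ⟨M, hM, h⟩ := exists_derivBound_decay hs hc m ((n + 1 : ℕ) : ℝ)
    refine ⟨Set.univ, univ_mem, fun ξ => M * bracket ξ ^ (-((n + 1 : ℕ) : ℝ)),
      (integrable_bracket_rpow (by push_cast; linarith)).const_mul M, fun x _ ξ => ?_⟩
    refine ((derivBound_slice_left h ξ).2 m le_rfl x).trans ?_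
    have h1 : bracket x ^ (-((n + 1 : ℕ) : ℝ)) ≤ 1 :=
      Real.rpow_le_one_of_one_le_of_nonpos (one_le_bracket _) (neg_nonpos.2 (Nat.cast_nonneg _))
    have h2 := rpow_bracket_nonneg (-((n + 1 : ℕ) : ℝ)) ξ
    exact mul_le_mul_of_nonneg_left (mul_le_of_le_one_left h2 h1) hM

theorem hasCompactSupport_opF {b : Eu n × Eu n → ℂ} (hbc : HasCompactSupport b)
    (f : 𝓢(Eu n, ℂ)) : HasCompactSupport (opF b f) := by
  refine HasCompactSupport.intro (hbc.image continuous_fst) fun x hx => ?_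
  have : ∀ ξ, b (x, ξ) = 0 := fun ξ => by
    by_contra hne
    exact hx ⟨(x, ξ), subset_tsupport b hne, rfl⟩
  simp [opF, this]

/-- The value of the quantization of a compactly supported symbol is a Schwartz function. -/
def opSchwartz {b : Eu n × Eu n → ℂ} (hb : ContDiff ℝ ∞ b) (hbc : HasCompactSupport b)
    (f : 𝓢(Eu n, ℂ)) : 𝓢(Eu n, ℂ) := (hasCompactSupport_opF hbc f).toSchwartzMap (contDiff_opF hb hbc f)

theorem opSchwartz_apply {b : Eu n × Eu n → ℂ} (hb : ContDiff ℝ ∞ b) (hbc : HasCompactSupport b)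
    (f : 𝓢(Eu n, ℂ)) (x : Eu n) : opSchwartz hb hbc f x = opF b f x := rfl

theorem integrable_slice {b : Eu n × Eu n → ℂ} (hb : ContDiff ℝ ∞ b) (hbc : HasCompactSupport b)
    (x : Eu n) : Integrable fun ξ => b (x, ξ) := by
  obtain ⟨M, hM, h⟩ := exists_derivBound_decay hb hbc 0 ((n + 1 : ℕ) : ℝ)
  refine (((integrable_bracket_rpow (n := n) (r := ((n + 1 : ℕ) : ℝ))
    (by push_cast; linarith)).const_mul (bracket x ^ (-((n + 1 : ℕ) : ℝ)))).const_mul M).mono'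
    (hb.continuous.comp (by fun_prop)).aestronglyMeasurable (Eventually.of_forall fun ξ => ?_)
  exact h.norm_le _

/-- On the Fourier side the quantization of b is the integral operator with kernel b̂(η-ξ, ξ). -/
theorem fourier_opSchwartz {b : Eu n × Eu n → ℂ} (hb : ContDiff ℝ ∞ b) (hbc : HasCompactSupport b)
    (f : 𝓢(Eu n, ℂ)) (η : Eu n) :
    𝓕 (opSchwartz hb hbc f) η = ∫ ξ, fourierFst b (η - ξ) ξ * 𝓕 f ξ := by
  have hcont : Continuous fun z : Eu n × Eu n => osc (-z.1) η * (b z * osc z.1 z.2 * 𝓕 f z.2) :=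
    (continuous_fst.neg.osc continuous_const).mul ((hb.continuous.mul continuous_osc).mul
      ((continuous_fourier_schwartz f).comp continuous_snd))
  have hi : Integrable (fun z : Eu n × Eu n => osc (-z.1) η * (b z * osc z.1 z.2 * 𝓕 f z.2))
      ((volume : Measure (Eu n)).prod volume) := by
    rw [← Measure.volume_eq_prod]
    exact hcont.integrable_of_hasCompactSupport hbc.mul_right.mul_right.mul_left
  rw [SchwartzMap.fourier_coe, fourier_eq_osc]
  calc ∫ y, osc (-y) η * opSchwartz hb hbc f y
      = ∫ y, ∫ ξ, osc (-y) η * (b (y, ξ) * osc y ξ * 𝓕 f ξ) := by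
        congr 1; funext y
        rw [opSchwartz_apply, opF, ← integral_const_mul]
    _ = ∫ ξ, ∫ y, osc (-y) η * (b (y, ξ) * osc y ξ * 𝓕 f ξ) := integral_integral_swap hi
    _ = _ := by
        congr 1; funext ξ
        rw [fourierFst_eq, ← integral_mul_const]
        congr 1; funext y
        rw [sub_eq_add_neg, osc_add_right, osc_neg_left y (-ξ), neg_neg]
        ring

/-- The symbols interpolating between the product (`s = 0`) and the composition (`s = 1`). -/
def compSym (s : ℝ) (a b : Eu n × Eu n → ℂ) (z : Eu n × Eu n) : ℂ :=
  ∫ v, a (z.1, z.2 + s • v) * fourierFst b v z.2 * osc z.1 v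

theorem compSym_zero {a b : Eu n × Eu n → ℂ} (hb : ContDiff ℝ ∞ b) (hbc : HasCompactSupport b)
    (z : Eu n × Eu n) : compSym 0 a b z = a z * b z := by
  have hs : HasCompactSupport fun y => b (y, z.2) := by
    refine HasCompactSupport.intro (hbc.image continuous_fst) fun x hx => ?_
    by_contra hne
    exact hx ⟨(x, z.2), subset_tsupport b hne, rfl⟩
  let φ : 𝓢(Eu n, ℂ) := hs.toSchwartzMap (hb.comp (by fun_prop))
  have hφ : (φ : Eu n → ℂ) = fun y => b (y, z.2) := rfl
  have h1 : 𝓕⁻ (𝓕 φ) = φ := FourierTransform.fourierInv_fourier_eq φ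
  have h2 := congrArg (fun u : 𝓢(Eu n, ℂ) => u z.1) h1
  simp only [SchwartzMap.fourierInv_coe, SchwartzMap.fourier_coe, hφ, fourierInv_eq_osc] at h2
  rw [compSym]
  simp only [zero_smul, add_zero]
  rw [← h2, ← integral_const_mul]
  congr 1; funext v
  rw [fourierFst]; ring

/-- Insert the Fourier-side kernel of b, exchange the integrals and put η = ξ + v. The phase
e^{2πi⟨x,ξ+v⟩} splits, and the inner integral over v is the symbol of the composition. -/
theorem opF_opSchwartz {a b : Eu n × Eu n → ℂ} (ha : ContDiff ℝ ∞ a) (hac : HasCompactSupport a)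
    (hb : ContDiff ℝ ∞ b) (hbc : HasCompactSupport b) (f : 𝓢(Eu n, ℂ)) (x : Eu n) :
    opF a (opSchwartz hb hbc f) x = opF (compSym 1 a b) f x := by
  obtain ⟨M, hM, hMb⟩ := exists_norm_fourierFst_le hb hbc (n + 1)
  have hr : (n : ℝ) < ((n + 1 : ℕ) : ℝ) := by push_cast; linarith
  have hf : Continuous fun ξ => 𝓕 f ξ := continuous_fourier_schwartz f
  have hi : Integrable (fun z : Eu n × Eu n =>
      a (x, z.1) * osc x z.1 * (fourierFst b (z.1 - z.2) z.2 * 𝓕 f z.2))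
      ((volume : Measure (Eu n)).prod volume) := by
    refine Integrable.mono' (((integrable_slice ha hac x).norm).mul_prod
      ((((𝓕 f).integrable (μ := volume)).norm).const_mul M)) ?_ (Eventually.of_forall fun z => ?_)
    · refine Continuous.aestronglyMeasurable ?_
      refine ((ha.continuous.comp (by fun_prop)).mul (continuous_const.osc continuous_fst)).mul ?_
      exact ((continuous_fourierFst hb hbc).comp
        (f := fun z : Eu n × Eu n => (z.1 - z.2, z.2)) (by fun_prop)).mul (hf.comp continuous_snd)
    · rw [norm_mul, norm_mul, norm_mul, norm_osc, mul_one]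
      have h1 : ‖fourierFst b (z.1 - z.2) z.2‖ ≤ M := by
        refine (hMb _ _).trans (mul_le_of_le_one_right hM ?_)
        have h : ∀ y : Eu n, bracket y ^ (-((n + 1 : ℕ) : ℝ)) ≤ 1 := fun y =>
          Real.rpow_le_one_of_one_le_of_nonpos (one_le_bracket _) (neg_nonpos.2 (Nat.cast_nonneg _))
        exact mul_le_one₀ (h _) (rpow_bracket_nonneg _ _) (h _)
      gcongr
  calc opF a (opSchwartz hb hbc f) x
      = ∫ η, ∫ ξ, a (x, η) * osc x η * (fourierFst b (η - ξ) ξ * 𝓕 f ξ) := by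
        rw [opF]
        congr 1; funext η
        rw [fourier_opSchwartz, ← integral_const_mul]
    _ = ∫ ξ, ∫ η, a (x, η) * osc x η * (fourierFst b (η - ξ) ξ * 𝓕 f ξ) :=
        integral_integral_swap hi
    _ = _ := by
        rw [opF]
        congr 1; funext ξ
        rw [compSym, ← integral_mul_const, ← integral_mul_const,
          ← integral_add_right_eq_self _ ξ]
        congr 1; funext v
        rw [add_sub_cancel_right, osc_add_right, one_smul, add_comm ξ v]
        ring

end

section

/-! ### Oscillatory integrals -/

variable {n : ℕ}

open Filter Topology

theorem integral_fourier_mul {P Q : Eu n → ℂ} (hP : Integrable P) (hQ : Integrable Q) :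
    ∫ ξ, 𝓕 P ξ * Q ξ = ∫ x, P x * 𝓕 Q x := by
  simpa using! VectorFourier.integral_bilin_fourierIntegral_eq_flip (.mul ℂ ℂ) (L := innerₗ (Eu n))
    continuous_fourierChar continuous_inner hP hQ

theorem fourier_dirD {N : ℕ} {W : Eu n → ℝ} {G : Eu n → ℂ} (hG : DerivBound (N + 1) W G)
    (hW : Integrable W) (v ξ : Eu n) :
    𝓕 (dirD v G) ξ = 2 * π * Complex.I * (inner ℝ v ξ : ℝ) * 𝓕 G ξ := by
  have h0 : Integrable G := hW.mono' hG.1.continuous.aestronglyMeasurable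
    (Eventually.of_forall hG.norm_le)
  have hc : Continuous (fderiv ℝ G) := hG.1.continuous_fderiv (by simp)
  have h1 : Integrable (fderiv ℝ G) := hW.mono' hc.aestronglyMeasurable
    (Eventually.of_forall fun z => by
      have := hG.2 1 (by omega) z
      rwa [norm_iteratedFDeriv_one] at this)
  have h2 := Real.fourier_fderiv h0 (hG.1.differentiable (by simp)) h1
  have h3 := Real.fourier_continuousLinearMap_apply (a := v) (v := ξ) h1
  rw [h2] at h3
  change _ = 𝓕 (dirD v G) ξ at h3
  rw [← h3, VectorFourier.fourierSMulRight_apply]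
  have h4 : innerSL ℝ ξ v = inner ℝ v ξ := by rw [innerSL_apply_apply, real_inner_comm]
  simp [h4]
  ring

/-- The operator `1 - (4π²)⁻¹ ∑ⱼ ∂²` in the directions `e`. -/
def lam {V : Type*} [NormedAddCommGroup V] [NormedSpace ℝ V] (e : Fin n → V) (G : V → ℂ) (z : V) :
    ℂ := G z - ((1 / (4 * π ^ 2) : ℝ) : ℂ) * ∑ j, dirD (e j) (dirD (e j) G) z

theorem derivBound_lam {V : Type*} [NormedAddCommGroup V] [NormedSpace ℝ V] {e : Fin n → V}
    (he : ∀ j, ‖e j‖ ≤ 1) {N : ℕ} {W : V → ℝ} {G : V → ℂ} (hG : DerivBound (N + 2) W G) :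
    DerivBound N (fun z => (n + 1) * W z) (lam e G) := by
  have h1 : ∀ j, DerivBound N W (dirD (e j) (dirD (e j) G)) := fun j => by
    refine ((hG.dirD (e j)).dirD (e j)).mono fun z => ?_
    have := hG.nonneg z
    have h := he j
    have h0 := norm_nonneg (e j)
    exact (mul_le_of_le_one_left (by positivity) h).trans (mul_le_of_le_one_left this h)
  refine ((hG.of_le (by omega)).sub
    ((DerivBound.sum Finset.univ fun j _ => h1 j).const_mul _)).mono fun z => ?_
  have h2 := hG.nonneg z
  have h3 : ‖((1 / (4 * π ^ 2) : ℝ) : ℂ)‖ ≤ 1 := by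
    rw [Complex.norm_real, Real.norm_of_nonneg (by positivity), div_le_one (by positivity)]
    nlinarith [Real.pi_gt_three]
  have h4 : ‖((1 / (4 * π ^ 2) : ℝ) : ℂ)‖ * (n * W z) ≤ n * W z :=
    mul_le_of_le_one_left (by positivity) h3
  simp only [Finset.sum_const, Finset.card_univ, Fintype.card_fin, nsmul_eq_mul]
  linarith

theorem derivBound_lam_iterate {V : Type*} [NormedAddCommGroup V] [NormedSpace ℝ V] {e : Fin n → V}
    (he : ∀ j, ‖e j‖ ≤ 1) {N : ℕ} (m : ℕ) {W : V → ℝ} {G : V → ℂ}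
    (hG : DerivBound (N + 2 * m) W G) :
    DerivBound N (fun z => ((n : ℝ) + 1) ^ m * W z) ((lam e)^[m] G) := by
  induction m generalizing W G with
  | zero => simpa using hG
  | succ m ih =>
    rw [Function.iterate_succ_apply]
    refine (ih (derivBound_lam he (hG.of_le (by omega)))).mono fun z => le_of_eq ?_
    ring

theorem dirD_comp_affine {V V' : Type*} [NormedAddCommGroup V] [NormedSpace ℝ V]
    [NormedAddCommGroup V'] [NormedSpace ℝ V'] {G : V → ℂ} (hG : ContDiff ℝ ∞ G) (L : V' →L[ℝ] V)
    (p : V) (v z : V') : dirD v (fun z => G (L z + p)) z = dirD (L v) G (L z + p) := by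
  have h1 : HasFDerivAt (fun z : V' => L z + p) L z := L.hasFDerivAt.add_const p
  have h2 := ((hG.differentiable (by simp)) (L z + p)).hasFDerivAt.comp z h1
  have h3 : HasFDerivAt (fun z => G (L z + p)) _ z := h2
  rw [dirD, h3.fderiv, dirD]
  simp

theorem contDiff_lam {V : Type*} [NormedAddCommGroup V] [NormedSpace ℝ V] (e : Fin n → V)
    {G : V → ℂ} (hG : ContDiff ℝ ∞ G) : ContDiff ℝ ∞ (lam e G) :=
  hG.sub (contDiff_const.mul (ContDiff.sum fun _ _ => contDiff_dirD (contDiff_dirD hG _) _))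

theorem contDiff_lam_iterate {V : Type*} [NormedAddCommGroup V] [NormedSpace ℝ V] (e : Fin n → V)
    {G : V → ℂ} (hG : ContDiff ℝ ∞ G) (m : ℕ) : ContDiff ℝ ∞ ((lam e)^[m] G) := by
  induction m generalizing G with
  | zero => exact hG
  | succ m ih => exact ih (contDiff_lam e hG)

theorem lam_comp_affine {V V' : Type*} [NormedAddCommGroup V] [NormedSpace ℝ V]
    [NormedAddCommGroup V'] [NormedSpace ℝ V'] {G : V → ℂ} (hG : ContDiff ℝ ∞ G) (L : V' →L[ℝ] V)
    (p : V) {e : Fin n → V} {e' : Fin n → V'} (he : ∀ j, L (e' j) = e j) (m : ℕ) :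
    (lam e')^[m] (fun z => G (L z + p)) = fun z => (lam e)^[m] G (L z + p) := by
  induction m generalizing G with
  | zero => rfl
  | succ m ih =>
    rw [Function.iterate_succ_apply, Function.iterate_succ_apply, ← ih (contDiff_lam e hG)]
    congr 1
    funext z
    rw [lam, lam]
    congr 2
    refine Finset.sum_congr rfl fun j _ => ?_
    rw [show dirD (e' j) (fun z => G (L z + p)) = fun z => dirD (e j) G (L z + p) from
      funext fun z => by rw [dirD_comp_affine hG, he],
      dirD_comp_affine (contDiff_dirD hG _), he]

/-- The normalization by 4π² makes the Fourier multiplier equal to ⟨ξ⟩² itself, so that m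
applications of `lam` buy a factor ⟨ξ⟩^{-2m} for the transform. -/
theorem fourier_lam {G : Eu n → ℂ} {W : Eu n → ℝ} (hG : DerivBound 2 W G) (hW : Integrable W)
    (ξ : Eu n) : 𝓕 (lam eb G) ξ = brC 2 ξ * 𝓕 G ξ := by
  have hi : ∀ F : Eu n → ℂ, DerivBound 0 W F → Integrable fun y => osc (-y) ξ * F y := fun F hF => by
    refine hW.mono' ((continuous_neg.osc continuous_const).mul
      hF.1.continuous).aestronglyMeasurable (Eventually.of_forall fun y => ?_)
    rw [norm_mul, norm_osc, one_mul]
    exact hF.norm_le y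
  have h1 : ∀ j : Fin n, DerivBound 1 W (dirD (eb j) G) := fun j =>
    (hG.dirD (eb j)).mono fun z => by rw [norm_eb, one_mul]
  have h2 : ∀ j : Fin n, DerivBound 0 W (dirD (eb j) (dirD (eb j) G)) := fun j =>
    ((h1 j).dirD (eb j)).mono fun z => by rw [norm_eb, one_mul]
  have h3 : ∀ j : Fin n, 𝓕 (dirD (eb j) (dirD (eb j) G)) ξ = -(4 * π ^ 2 * (ξ j : ℂ) ^ 2) * 𝓕 G ξ :=
    fun j => by
    rw [fourier_dirD (N := 0) (h1 j) hW, fourier_dirD (N := 1) hG hW, eb_inner]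
    ring_nf
    rw [Complex.I_sq]; ring
  have h4 : 𝓕 (lam eb G) ξ = 𝓕 G ξ - ((1 / (4 * π ^ 2) : ℝ) : ℂ) *
      ∑ j : Fin n, 𝓕 (dirD (eb j) (dirD (eb j) G)) ξ := by
    simp only [fourier_eq_osc]
    rw [← integral_finsetSum _ fun j _ => hi _ (h2 j), ← integral_const_mul, ← integral_sub
      (hi _ (hG.of_le (by omega))) ((integrable_finsetSum _ fun j _ => hi _ (h2 j)).const_mul _)]
    congr 1; funext y
    rw [lam, mul_sub, ← Finset.mul_sum]
    ring
  rw [h4]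
  simp only [h3]
  rw [← Finset.sum_mul, Finset.sum_neg_distrib, ← Finset.mul_sum, brC, Real.rpow_two, bracket_sq,
    EuclideanSpace.real_norm_sq_eq]
  have : (π : ℂ) ≠ 0 := by exact_mod_cast Real.pi_ne_zero
  push_cast
  field_simp
  ring

theorem fourier_lam_iterate (m : ℕ) {G : Eu n → ℂ} {W : Eu n → ℝ} (hG : DerivBound (2 * m) W G)
    (hW : Integrable W) (ξ : Eu n) : 𝓕 ((lam eb)^[m] G) ξ = brC (2 * m : ℝ) ξ * 𝓕 G ξ := by
  induction m generalizing G W with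
  | zero => simp [brC_zero]
  | succ m ih =>
    rw [Function.iterate_succ_apply, ih (derivBound_lam (fun j => (norm_eb j).le)
      (hG.of_le (by omega))) (hW.const_mul _), fourier_lam (hG.of_le (by omega)) hW, ← mul_assoc,
      ← brC_add]
    congr 2
    push_cast; ring

/-! ### Superposition of symbols -/

/-- By Fubini the form of an integral of symbols is the integral of their forms. The pointwise
majorant Q serves only to justify the exchange; the resulting bound involves P alone. -/
theorem norm_form_le_of_superposition {T : Type*} [MeasurableSpace T] {ν : Measure T} [SFinite ν]
    {q : T → Eu n × Eu n → ℂ} {c : Eu n × Eu n → ℂ} {Q P : T → ℝ}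
    (hc : ∀ z, c z = ∫ t, q t z ∂ν)
    (hq : AEStronglyMeasurable (fun p : T × (Eu n × Eu n) => q p.1 p.2) (ν.prod volume))
    (hQ : ∀ t z, ‖q t z‖ ≤ Q t) (hQi : Integrable Q ν)
    (f g : 𝓢(Eu n, ℂ)) (hP : ∀ᵐ t ∂ν, ‖form (q t) f g‖ ≤ P t) (hPi : Integrable P ν) :
    ‖form c f g‖ ≤ ∫ t, P t ∂ν := by
  have hm : AEStronglyMeasurable (fun p : T × (Eu n × Eu n) =>
      q p.1 p.2 * osc p.2.1 p.2.2 * 𝓕 f p.2.2 * (starRingEnd ℂ) (g p.2.1)) (ν.prod volume) := by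
    have h1 : AEStronglyMeasurable (fun z : Eu n × Eu n =>
        osc z.1 z.2 * 𝓕 f z.2 * (starRingEnd ℂ) (g z.1)) volume :=
      ((continuous_osc.mul ((continuous_fourier_schwartz f).comp continuous_snd)).mul
        (Complex.continuous_conj.comp (g.continuous.comp continuous_fst))).aestronglyMeasurable
    refine (hq.mul (h1.comp_snd (μ := ν))).congr (Eventually.of_forall fun p => ?_)
    simp only [Pi.mul_apply]
    ring
  have hi : Integrable (fun p : T × (Eu n × Eu n) =>
      q p.1 p.2 * osc p.2.1 p.2.2 * 𝓕 f p.2.2 * (starRingEnd ℂ) (g p.2.1)) (ν.prod volume) := by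
    refine (hQi.mul_prod (integrable_schwartz_prod f g)).mono' hm (Eventually.of_forall fun p => ?_)
    simp only [norm_mul, norm_osc, mul_one, RCLike.norm_conj]
    rw [mul_assoc]
    gcongr
    exact hQ _ _
  have h2 : form c f g = ∫ t, form (q t) f g ∂ν := by
    simp only [form]
    rw [← integral_integral_swap (f := fun (z : Eu n × Eu n) t =>
      q t z * osc z.1 z.2 * 𝓕 f z.2 * (starRingEnd ℂ) (g z.1)) hi.swap]
    congr 1; funext z
    rw [hc, ← integral_mul_const, ← integral_mul_const, ← integral_mul_const]
  rw [h2]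
  exact norm_integral_le_of_norm_le hPi hP

end

section

/-! ### Boundedness of the interpolating symbols -/

variable {n : ℕ}

open Filter Topology

/-- The number of derivatives used in the composition estimate. -/
def compOrder (n : ℕ) : ℕ := cvOrder n + 2 * (n + 1)

/-- The symbol `A(x, ξ + sv)` with the weight `⟨v⟩^{-2(n+1)}`. -/
def shearSym (s : ℝ) (A : Eu n × Eu n → ℂ) (p : Eu n × Eu n × Eu n) : ℂ :=
  A (p.1, p.2.1 + s • p.2.2) * brC (-(2 * ((n + 1 : ℕ) : ℝ))) p.2.2

theorem exists_derivBound_shearSym (n N : ℕ) : ∃ K : ℝ, 0 < K ∧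
    ∀ (s M : ℝ) (A : Eu n × Eu n → ℂ), |s| ≤ 1 → DerivBound N (fun _ => M) A →
      DerivBound N (fun p => K * M * bracket p.2.2 ^ (-(2 * ((n + 1 : ℕ) : ℝ)))) (shearSym s A) := by
  obtain ⟨K, hK, hw⟩ := exists_derivBound_brC n (-(2 * ((n + 1 : ℕ) : ℝ))) N
  refine ⟨2 ^ N * (2 ^ N * K), by positivity, fun s M A hs hA => ?_⟩
  let L : Eu n × Eu n × Eu n →L[ℝ] Eu n × Eu n :=
    (ContinuousLinearMap.fst ℝ _ _).prod
      ((ContinuousLinearMap.fst ℝ (Eu n) (Eu n) + s • ContinuousLinearMap.snd ℝ (Eu n) (Eu n)) ∘L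
        ContinuousLinearMap.snd ℝ (Eu n) (Eu n × Eu n))
  -- The restriction |s| ≤ 1 keeps the shear (x,ξ,v) ↦ (x, ξ+sv) bounded, so the constants are
  -- uniform in s.
  have hL : ‖L‖ ≤ 2 := by
    refine L.opNorm_le_bound zero_le_two fun p => ?_
    have h1 : ‖p.1‖ ≤ ‖p‖ := _root_.norm_fst_le p
    have h2 : ‖p.2‖ ≤ ‖p‖ := norm_snd_le p
    have h3 : ‖p.2.1‖ ≤ ‖p.2‖ := _root_.norm_fst_le p.2
    have h4 : ‖p.2.2‖ ≤ ‖p.2‖ := norm_snd_le p.2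
    change ‖(p.1, p.2.1 + s • p.2.2)‖ ≤ _
    rw [Prod.norm_def]
    refine max_le (by simp only; linarith [norm_nonneg p]) ?_
    refine (norm_add_le _ _).trans ?_
    rw [norm_smul, Real.norm_eq_abs]
    have := mul_le_of_le_one_left (norm_nonneg p.2.2) hs
    linarith
  let S : Eu n × Eu n × Eu n →L[ℝ] Eu n :=
    ContinuousLinearMap.snd ℝ (Eu n) (Eu n) ∘L ContinuousLinearMap.snd ℝ (Eu n) (Eu n × Eu n)
  have hS : ‖S‖ ≤ 1 := S.opNorm_le_bound zero_le_one fun p => by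
    rw [one_mul]; exact (norm_snd_le p.2).trans (norm_snd_le p)
  have h1 := (hA.comp_affine L 0 one_le_two hL).mul (hw.comp_linear S hS)
  refine (h1.congr fun p => ?_).mono fun p => le_of_eq ?_
  · rw [add_zero]; rfl
  · change _ * (_ * (K * bracket p.2.2 ^ _)) = _
    ring

theorem norm_inl_le : ‖ContinuousLinearMap.inl ℝ (Eu n) (Eu n)‖ ≤ 1 :=
  ContinuousLinearMap.norm_inl_le_one ..

/-- The elementary symbols whose superposition is `compSym s A B`. -/
def elemSym (s : ℝ) (A B : Eu n × Eu n → ℂ) (t z : Eu n × Eu n) : ℂ :=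
  (brC (-(2 * ((n + 1 : ℕ) : ℝ))) t.1 * osc (-t.2) t.1) *
    ((lam (fun j : Fin n => ((0 : Eu n), ((0 : Eu n), (eb j : Eu n)))))^[n + 1] (shearSym s A)
        (z.1, z.2, t.2) *
      (lam (fun j : Fin n => ((eb j : Eu n), (0 : Eu n))))^[n + 1] B (t.1 + z.1, z.2))

theorem norm_dir_fst (j : Fin n) : ‖((eb j : Eu n), (0 : Eu n))‖ ≤ 1 := by
  rw [Prod.norm_def, norm_eb]; simp

theorem norm_dir_snd (j : Fin n) : ‖((0 : Eu n), (eb j : Eu n))‖ ≤ 1 := by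
  rw [Prod.norm_def, norm_eb]; simp

theorem norm_dir_thd (j : Fin n) : ‖((0 : Eu n), ((0 : Eu n), (eb j : Eu n)))‖ ≤ 1 := by
  rw [Prod.norm_def]; simp

theorem two_mul_order_pos : (n : ℝ) < 2 * ((n + 1 : ℕ) : ℝ) := by
  push_cast; linarith [(Nat.cast_nonneg n : (0 : ℝ) ≤ n)]

/-- With t = (u,v), the symbol is a product of a derivative of A at the sheared point and a
derivative of B translated by u. The decay in u comes from the prefactor, the decay in v from the
weight built into `shearSym`. Each factor spends 2(n+1) derivatives on `lam`, which leaves `cvOrder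
n` of `compOrder n`. -/
theorem exists_derivBound_elemSym (n : ℕ) : ∃ K : ℝ, 0 < K ∧
    ∀ (s M M' : ℝ) (A B : Eu n × Eu n → ℂ), |s| ≤ 1 → DerivBound (compOrder n) (fun _ => M) A →
      DerivBound (compOrder n) (fun _ => M') B → ∀ t : Eu n × Eu n,
      DerivBound (cvOrder n) (fun _ => K * (M * M') *
        (bracket t.1 ^ (-(2 * ((n + 1 : ℕ) : ℝ))) * bracket t.2 ^ (-(2 * ((n + 1 : ℕ) : ℝ)))))
        (elemSym s A B t) := by
  obtain ⟨K, hK, h⟩ := exists_derivBound_shearSym n (compOrder n)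
  set k : ℝ := -(2 * ((n + 1 : ℕ) : ℝ)) with hk
  set c : ℝ := ((n : ℝ) + 1) ^ (n + 1) with hc
  have hc0 : 0 < c := by positivity
  refine ⟨2 ^ cvOrder n * (c * K * c), by positivity, fun s M M' A B hs hA hB t => ?_⟩
  have h1 := derivBound_lam_iterate norm_dir_thd (n + 1) (h s M A hs hA)
  have h2 := derivBound_lam_iterate norm_dir_fst (n + 1) hB
  let L : Eu n × Eu n →L[ℝ] Eu n × Eu n × Eu n :=
    (ContinuousLinearMap.fst ℝ _ _).prod ((ContinuousLinearMap.snd ℝ (Eu n) (Eu n)).prod 0)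
  have hL : ‖L‖ ≤ 1 := by
    refine L.opNorm_le_bound zero_le_one fun p => ?_
    change ‖(p.1, p.2, (0 : Eu n))‖ ≤ _
    rw [one_mul, Prod.norm_def, Prod.norm_def]
    simpa using ⟨_root_.norm_fst_le p, norm_snd_le p⟩
  have h3 := h1.comp_affine L (0, 0, t.2) le_rfl hL
  have h4 := h2.translate (t.1, 0)
  have h5 := (h3.mul h4).const_mul (brC k t.1 * osc (-t.2) t.1)
  refine (h5.congr fun z => ?_).mono fun z => le_of_eq ?_
  · simp only [elemSym, L, ContinuousLinearMap.prod_apply, ContinuousLinearMap.coe_fst',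
      ContinuousLinearMap.coe_snd', Prod.mk_add_mk, add_zero, _root_.zero_apply, zero_add]
    rw [← hk, show z + (t.1, 0) = (t.1 + z.1, z.2) from Prod.ext (add_comm _ _) (add_zero _)]
  · rw [norm_mul, norm_osc, mul_one, norm_brC]
    simp only [L, ContinuousLinearMap.prod_apply, ContinuousLinearMap.coe_fst',
      ContinuousLinearMap.coe_snd', Prod.mk_add_mk, add_zero, _root_.zero_apply, zero_add,
      one_pow, one_mul]
    rw [← hc]
    ring

theorem continuous_elemSym (s : ℝ) {A B : Eu n × Eu n → ℂ} (hA : ContDiff ℝ ∞ A)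
    (hB : ContDiff ℝ ∞ B) :
    Continuous fun p : (Eu n × Eu n) × (Eu n × Eu n) => elemSym s A B p.1 p.2 := by
  have hs : ContDiff ℝ ∞ (shearSym s A) :=
    (hA.comp (by fun_prop)).mul ((contDiff_bracket_rpow _).comp (by fun_prop))
  have h1 := (contDiff_lam_iterate (fun j : Fin n => ((0 : Eu n), ((0 : Eu n), (eb j : Eu n)))) hs
    (n + 1)).continuous
  have h2 := (contDiff_lam_iterate (fun j : Fin n => ((eb j : Eu n), (0 : Eu n))) hB
    (n + 1)).continuous
  have h3 : Continuous (brC (-(2 * ((n + 1 : ℕ) : ℝ))) : Eu n → ℂ) :=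
    (contDiff_bracket_rpow _).continuous
  unfold elemSym
  exact ((h3.comp (by fun_prop)).mul (Continuous.osc (by fun_prop) (by fun_prop))).mul
    ((h1.comp (by fun_prop)).mul (h2.comp (by fun_prop)))

theorem integrable_double_weight :
    Integrable (fun t : Eu n × Eu n => bracket t.1 ^ (-(2 * ((n + 1 : ℕ) : ℝ))) *
      bracket t.2 ^ (-(2 * ((n + 1 : ℕ) : ℝ)))) := by
  rw [Measure.volume_eq_prod]
  exact (integrable_bracket_rpow two_mul_order_pos).mul_prod
    (integrable_bracket_rpow two_mul_order_pos)

set_option maxHeartbeats 1000000 in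
-- Regularization of an oscillatory integral by two integrations by parts: `lam` in x on B pays for
-- a weight ⟨v⟩^{-2(n+1)}, and `lam` in v on A pays for ⟨u⟩^{-2(n+1)}. The resulting (u,v) integral
-- converges absolutely with bounds depending only on derivatives of A and B; the compact support of
-- B is used only to justify the manipulations.
theorem compSym_eq_integral {s M M' : ℝ} {A B : Eu n × Eu n → ℂ} (hs : |s| ≤ 1)
    (hA : DerivBound (compOrder n) (fun _ => M) A) (hB : DerivBound (compOrder n) (fun _ => M') B)
    (hBc : HasCompactSupport B) (z : Eu n × Eu n) :
    compSym s A B z = ∫ t : Eu n × Eu n, elemSym s A B t z := by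
  obtain ⟨K, hK, h⟩ := exists_derivBound_shearSym n (compOrder n)
  obtain ⟨K₂, hK₂, hel⟩ := exists_derivBound_elemSym n
  obtain ⟨k, hk⟩ : ∃ k : ℝ, k = 2 * ((n + 1 : ℕ) : ℝ) := ⟨_, rfl⟩
  have hdw := integrable_double_weight (n := n)
  rw [← hk] at h hel hdw
  have hH := h s M A hs hA
  have hint : Integrable fun v : Eu n => bracket v ^ (-k) :=
    integrable_bracket_rpow (by rw [hk]; exact two_mul_order_pos)
  -- the function of `v`
  let P : Eu n → ℂ := fun v => shearSym s A (z.1, z.2, v)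
  let J : Eu n →L[ℝ] Eu n × Eu n × Eu n :=
    (ContinuousLinearMap.inr ℝ (Eu n) (Eu n × Eu n)) ∘L (ContinuousLinearMap.inr ℝ (Eu n) (Eu n))
  have hJ : ∀ v : Eu n, J v + (z.1, z.2, 0) = (z.1, z.2, v) := fun v => by
    simp [J]
  have hJn : ‖J‖ ≤ 1 := J.opNorm_le_bound zero_le_one fun v => by
    simp [J, Prod.norm_def]
  have hP : DerivBound (2 * (n + 1)) (fun v => K * M * bracket v ^ (-k)) P := by
    refine (((hH.comp_affine J (z.1, z.2, 0) le_rfl hJn).of_le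
      (by unfold compOrder; omega)).congr fun v => ?_).mono fun v => le_of_eq ?_
    · rw [hJ]
    · rw [hJ, one_pow, one_mul]
  have hPi := hint.const_mul (K * M)
  have hPl : (lam eb)^[n + 1] P = fun v =>
      (lam (fun j : Fin n => ((0 : Eu n), ((0 : Eu n), (eb j : Eu n)))))^[n + 1] (shearSym s A)
        (z.1, z.2, v) := by
    have := lam_comp_affine hH.1 J (z.1, z.2, 0) (e := fun j : Fin n =>
      ((0 : Eu n), ((0 : Eu n), (eb j : Eu n)))) (e' := eb) (fun j => rfl) (n + 1)
    simp only [hJ] at this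
    exact this
  -- the function of `u`
  let b : Eu n → ℂ := fun u => B (u + z.1, z.2)
  let I := ContinuousLinearMap.inl ℝ (Eu n) (Eu n)
  have hI : ∀ u : Eu n, I u + z = (u + z.1, z.2) := fun u => Prod.ext rfl (zero_add _)
  obtain ⟨M₂, hM₂, hdec⟩ := exists_derivBound_decay hB.1 hBc (2 * (n + 1)) k
  have hb : DerivBound (2 * (n + 1)) (fun u => M₂ * bracket z.2 ^ (-k) * bracket (u + z.1) ^ (-k)) b := by
    refine ((hdec.comp_affine I z le_rfl norm_inl_le).congr fun u => ?_).mono fun u => le_of_eq ?_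
    · rw [hI]
    · rw [hI, one_pow, one_mul]; ring
  have hbi : Integrable fun u => M₂ * bracket z.2 ^ (-k) * bracket (u + z.1) ^ (-k) :=
    (hint.comp_add_right z.1).const_mul _
  let Q : Eu n → ℂ := fun u =>
    (lam (fun j : Fin n => ((eb j : Eu n), (0 : Eu n))))^[n + 1] B (u + z.1, z.2)
  have hQ : (lam eb)^[n + 1] b = Q := by
    have := lam_comp_affine hB.1 I z (e := fun j : Fin n => ((eb j : Eu n), (0 : Eu n)))
      (e' := eb) (fun j => rfl) (n + 1)
    simp only [hI] at this
    exact this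
  have hlb := derivBound_lam_iterate (N := 0) (fun j : Fin n => (norm_eb j).le) (n + 1)
    (hb.of_le (by omega))
  have hlP := derivBound_lam_iterate (N := 0) (fun j : Fin n => (norm_eb j).le) (n + 1)
    (hP.of_le (by omega))
  rw [hQ] at hlb
  have hQi : Integrable Q := (hbi.const_mul _).mono' hlb.1.continuous.aestronglyMeasurable
    (Eventually.of_forall hlb.norm_le)
  have hPint : Integrable P := hPi.mono' hP.1.continuous.aestronglyMeasurable
    (Eventually.of_forall hP.norm_le)
  have hbF : ∀ v, 𝓕 b v = osc z.1 v * fourierFst B v z.2 := fun v => by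
    rw [fourierFst_eq, fourier_eq_osc, ← integral_const_mul,
      ← integral_add_right_eq_self (fun y => osc z.1 v * (osc (-y) v * B (y, z.2))) z.1]
    congr 1; funext u
    rw [neg_add, osc_add_left, show osc z.1 v * (osc (-u) v * osc (-z.1) v * B (u + z.1, z.2)) =
      (osc z.1 v * osc (-z.1) v) * (osc (-u) v * B (u + z.1, z.2)) by ring,
      ← osc_add_left, add_neg_cancel, osc_zero_left, one_mul]
  have hcancel : ∀ v : Eu n, brC (-k) v * brC k v = 1 := fun v => by
    rw [← brC_add, neg_add_cancel, brC_zero]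
  -- The inserted factor ⟨v⟩^{2(n+1)} ⟨v⟩^{-2(n+1)} = 1 is shared out: the negative power sits in P,
  -- the positive one is the multiplier of `lam^[n+1]` applied to the translate of B.
  have e1 : compSym s A B z = ∫ v, P v * 𝓕 Q v := by
    rw [compSym]
    congr 1; funext v
    rw [← hQ, fourier_lam_iterate (n + 1) hb hbi, hbF, ← hk]
    simp only [P, shearSym]
    rw [← hk]
    calc _ = (brC (-k) v * brC k v) * (A (z.1, z.2 + s • v) * fourierFst B v z.2 * osc z.1 v) := by
          rw [hcancel, one_mul]
      _ = _ := by ring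
  have e2 : ∀ u, 𝓕 P u = brC (-k) u * 𝓕 ((lam eb)^[n + 1] P) u := fun u => by
    rw [fourier_lam_iterate (n + 1) hP hPi, ← hk, ← mul_assoc, hcancel, one_mul]
  have hi : Integrable (fun t : Eu n × Eu n => elemSym s A B t z)
      ((volume : Measure (Eu n)).prod volume) := by
    rw [← Measure.volume_eq_prod]
    have hc : Continuous fun t : Eu n × Eu n => elemSym s A B t z :=
      (continuous_elemSym s hA.1 hB.1).comp (f := fun t : Eu n × Eu n => (t, z))
        (continuous_id.prodMk continuous_const)
    refine (hdw.const_mul (K₂ * (M * M'))).mono' hc.aestronglyMeasurable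
      (Eventually.of_forall fun t => ?_)
    exact (hel s M M' A B hs hA hB t).norm_le z
  -- The multiplication formula moves the Fourier transform from Q to P, where it can be turned into
  -- decay in u.
  rw [e1, ← integral_fourier_mul hPint hQi, Measure.volume_eq_prod, integral_prod _ hi]
  congr 1; funext u
  rw [e2, hPl, fourier_eq_osc, mul_assoc, ← integral_mul_const, ← integral_const_mul]
  congr 1; funext v
  rw [elemSym, ← hk]
  simp only [Q]
  ring

/-- The forms of the interpolating symbols are bounded uniformly in `s`. -/
theorem exists_formBound_compSym (n : ℕ) : ∃ K : ℝ, 0 < K ∧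
    ∀ (s M M' : ℝ) (A B : Eu n × Eu n → ℂ), |s| ≤ 1 → DerivBound (compOrder n) (fun _ => M) A →
      DerivBound (compOrder n) (fun _ => M') B → HasCompactSupport B →
      FormBound (K * (M * M')) (compSym s A B) := by
  obtain ⟨K₁, hK₁, hcv⟩ := exists_formBound n
  obtain ⟨K₂, hK₂, hel⟩ := exists_derivBound_elemSym n
  set I : ℝ := ∫ t : Eu n × Eu n, bracket t.1 ^ (-(2 * ((n + 1 : ℕ) : ℝ))) *
      bracket t.2 ^ (-(2 * ((n + 1 : ℕ) : ℝ))) with hI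
  have hI0 : 0 ≤ I := integral_nonneg fun t =>
    mul_nonneg (rpow_bracket_nonneg _ _) (rpow_bracket_nonneg _ _)
  refine ⟨K₁ * K₂ * (I + 1), by positivity, fun s M M' A B hs hA hB hBc f g => ?_⟩
  have hM := hA.nonneg 0
  have hM' := hB.nonneg 0
  have h := norm_form_le_of_superposition (c := compSym s A B) (q := elemSym s A B)
    (ν := (volume : Measure (Eu n × Eu n)))
    (fun z => compSym_eq_integral hs hA hB hBc z)
    (continuous_elemSym s hA.1 hB.1).aestronglyMeasurable
    (fun t z => (hel s M M' A B hs hA hB t).norm_le z) (integrable_double_weight.const_mul _) f g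
    (Eventually.of_forall fun t => hcv _ _ (hel s M M' A B hs hA hB t) f g)
    (((integrable_double_weight.const_mul _).const_mul K₁).mul_const _)
  refine h.trans ?_
  rw [integral_mul_const, integral_const_mul, integral_const_mul, ← hI]
  have h2 : K₁ * (K₂ * (M * M') * I) ≤ K₁ * K₂ * (I + 1) * (M * M') := by
    have : 0 ≤ K₁ * K₂ * (M * M') := by positivity
    nlinarith
  exact mul_le_mul_of_nonneg_right h2 (by positivity)

end

section

/-! ### The composition estimate -/

variable {n : ℕ}

open Filter Topology

/-- The derivative in the `j`-th frequency variable. -/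
abbrev dXi (j : Fin n) (a : Eu n × Eu n → ℂ) : Eu n × Eu n → ℂ := dirD ((0 : Eu n), (eb j : Eu n)) a

/-- The derivative in the `j`-th space variable. -/
abbrev dX (j : Fin n) (a : Eu n × Eu n → ℂ) : Eu n × Eu n → ℂ := dirD ((eb j : Eu n), (0 : Eu n)) a

theorem eu_eq_sum (v : Eu n) : v = ∑ j, v j • (eb j : Eu n) := by
  ext i
  simp [Finset.sum_apply, Pi.single_apply]

theorem dirD_snd_eq_sum (a : Eu n × Eu n → ℂ) (v : Eu n) (z : Eu n × Eu n) :
    dirD ((0 : Eu n), v) a z = ∑ j, (v j : ℂ) * dXi j a z := by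
  have h : ((0 : Eu n), v) = ∑ j, v j • ((0 : Eu n), (eb j : Eu n)) := by
    refine Prod.ext ?_ ?_
    · simp [Prod.fst_sum]
    · rw [Prod.snd_sum]
      simpa using eu_eq_sum v
  rw [dirD, h, map_sum]
  refine Finset.sum_congr rfl fun j _ => ?_
  rw [map_smul, Complex.real_smul]
  rfl

theorem fourierFst_dX {b : Eu n × Eu n → ℂ} (hb : ContDiff ℝ ∞ b) (hbc : HasCompactSupport b)
    (j : Fin n) (v ξ : Eu n) :
    fourierFst (dX j b) v ξ = 2 * π * Complex.I * (v j : ℂ) * fourierFst b v ξ := by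
  obtain ⟨M, hM, h⟩ := exists_derivBound_decay hb hbc 1 ((n + 1 : ℕ) : ℝ)
  have hi : Integrable fun y : Eu n => M * (bracket y ^ (-((n + 1 : ℕ) : ℝ)) *
      bracket ξ ^ (-((n + 1 : ℕ) : ℝ))) :=
    ((integrable_bracket_rpow (by push_cast; linarith)).mul_const _).const_mul M
  have h1 := fourier_dirD (N := 0) (derivBound_slice_left h ξ) hi (eb j) v
  rw [eb_inner] at h1
  rw [fourierFst, fourierFst, ← h1]
  refine congrArg (fun G : Eu n → ℂ => 𝓕 G v) (funext fun y => ?_)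
  have := dirD_comp_affine hb (ContinuousLinearMap.inl ℝ (Eu n) (Eu n)) (0, ξ) (eb j) y
  simp only [ContinuousLinearMap.inl_apply, Prod.mk_add_mk, add_zero, zero_add] at this
  exact this.symm

theorem exists_bound_compSym {A B : Eu n × Eu n → ℂ} {M : ℝ} (hA : ContDiff ℝ ∞ A)
    (hM : ∀ z, ‖A z‖ ≤ M) (hB : ContDiff ℝ ∞ B) (hBc : HasCompactSupport B) :
    (Continuous fun p : ℝ × (Eu n × Eu n) => compSym p.1 A B p.2) ∧
      ∃ C : ℝ, ∀ s z, ‖compSym s A B z‖ ≤ C := by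
  obtain ⟨M', hM', h⟩ := exists_norm_fourierFst_le hB hBc (n + 1)
  have hM0 : 0 ≤ M := (norm_nonneg _).trans (hM 0)
  have hi : Integrable fun v : Eu n => M * (M' * bracket v ^ (-((n + 1 : ℕ) : ℝ))) :=
    ((integrable_bracket_rpow (by push_cast; linarith)).const_mul _).const_mul M
  have hb : ∀ (s : ℝ) (z : Eu n × Eu n) (v : Eu n),
      ‖A (z.1, z.2 + s • v) * fourierFst B v z.2 * osc z.1 v‖ ≤
        M * (M' * bracket v ^ (-((n + 1 : ℕ) : ℝ))) := fun s z v => by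
    rw [norm_mul, norm_mul, norm_osc, mul_one]
    refine mul_le_mul (hM _) ((h v z.2).trans ?_) (norm_nonneg _) hM0
    refine mul_le_mul_of_nonneg_left (mul_le_of_le_one_right (rpow_bracket_nonneg _ _) ?_) hM'
    exact Real.rpow_le_one_of_one_le_of_nonpos (one_le_bracket _) (neg_nonpos.2 (Nat.cast_nonneg _))
  have hF := continuous_fourierFst hB hBc
  refine ⟨?_, ⟨_, fun s z => norm_integral_le_of_norm_le hi (Eventually.of_forall (hb s z))⟩⟩
  refine continuous_of_dominated (fun p => ?_) (fun p => Eventually.of_forall (hb p.1 p.2)) hi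
    (Eventually.of_forall fun v => ?_)
  · refine Continuous.aestronglyMeasurable ?_
    exact ((hA.continuous.comp (by fun_prop)).mul (hF.comp (f := fun v => (v, p.2.2))
      (by fun_prop))).mul (continuous_const.osc continuous_id)
  · exact ((hA.continuous.comp (by fun_prop)).mul (hF.comp
      (f := fun p : ℝ × (Eu n × Eu n) => (v, p.2.2)) (by fun_prop))).mul
      (Continuous.osc (by fun_prop) continuous_const)

/-- Differentiating a(x, ξ+sv) brings down v_j ∂_{ξ_j}a, and v_j b̂ is (2πi)^{-1} times the partial
Fourier transform of ∂_{x_j}b. The rapid decay of b̂ in v dominates the integrand. -/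
theorem hasDerivAt_compSym {a b : Eu n × Eu n → ℂ} (ha : ContDiff ℝ ∞ a)
    (hac : HasCompactSupport a) (hb : ContDiff ℝ ∞ b) (hbc : HasCompactSupport b)
    (z : Eu n × Eu n) (s : ℝ) :
    HasDerivAt (fun s => compSym s a b z)
      (∑ j, (2 * π * Complex.I)⁻¹ * compSym s (dXi j a) (dX j b) z) s := by
  have hr : (n : ℝ) < ((n + 1 : ℕ) : ℝ) := by push_cast; linarith
  have hA := fun j : Fin n => exists_bound_of_compact (contDiff_dirD ha ((0 : Eu n), (eb j : Eu n)))
    (hasCompactSupport_dirD hac _)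
  choose MA hMA using hA
  obtain ⟨M, hM⟩ := exists_bound_of_compact ha hac
  have hB := fun j : Fin n => exists_norm_fourierFst_le (contDiff_dirD hb ((eb j : Eu n), (0 : Eu n)))
    (hasCompactSupport_dirD hbc _) (n + 1)
  choose MB hMB0 hMB using hB
  obtain ⟨M', hM', hMb⟩ := exists_norm_fourierFst_le hb hbc (n + 1)
  have h1 : ∀ y : Eu n, bracket y ^ (-((n + 1 : ℕ) : ℝ)) ≤ 1 := fun y =>
    Real.rpow_le_one_of_one_le_of_nonpos (one_le_bracket _) (neg_nonpos.2 (Nat.cast_nonneg _))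
  have hcont : ∀ (A B : Eu n × Eu n → ℂ) (s : ℝ), ContDiff ℝ ∞ A → ContDiff ℝ ∞ B →
      HasCompactSupport B → Continuous fun v => A (z.1, z.2 + s • v) * fourierFst B v z.2 * osc z.1 v :=
    fun A B s hA hB hBc => ((hA.continuous.comp (by fun_prop)).mul
      ((continuous_fourierFst hB hBc).comp (f := fun v => (v, z.2)) (by fun_prop))).mul
      (continuous_const.osc continuous_id)
  have hbd : ∀ (A B : Eu n × Eu n → ℂ) (M M' : ℝ), (∀ z, ‖A z‖ ≤ M) → 0 ≤ M' → (∀ v ξ,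
      ‖fourierFst B v ξ‖ ≤ M' * (bracket v ^ (-((n + 1 : ℕ) : ℝ)) *
        bracket ξ ^ (-((n + 1 : ℕ) : ℝ)))) → ∀ (s : ℝ) v,
      ‖A (z.1, z.2 + s • v) * fourierFst B v z.2 * osc z.1 v‖ ≤
        M * M' * bracket v ^ (-((n + 1 : ℕ) : ℝ)) := fun A B M M' hA hM' hB s v => by
    have hM0 : 0 ≤ M := (norm_nonneg _).trans (hA 0)
    rw [norm_mul, norm_mul, norm_osc, mul_one, mul_assoc]
    refine mul_le_mul (hA _) ((hB v z.2).trans ?_) (norm_nonneg _) hM0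
    exact mul_le_mul_of_nonneg_left (mul_le_of_le_one_right (rpow_bracket_nonneg _ _) (h1 _)) hM'
  have hint : ∀ c : ℝ, Integrable fun v : Eu n => c * bracket v ^ (-((n + 1 : ℕ) : ℝ)) := fun c =>
    (integrable_bracket_rpow hr).const_mul c
  have hsum : ∀ s : ℝ, ∑ j, (2 * π * Complex.I)⁻¹ * compSym s (dXi j a) (dX j b) z =
      ∫ v, ∑ j, (2 * π * Complex.I)⁻¹ *
        (dXi j a (z.1, z.2 + s • v) * fourierFst (dX j b) v z.2 * osc z.1 v) := fun s => by
    rw [integral_finsetSum]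
    · refine Finset.sum_congr rfl fun j _ => ?_
      rw [compSym, integral_const_mul]
    · intro j _
      refine Integrable.const_mul ((hint (MA j * MB j)).mono' (hcont _ _ s (contDiff_dirD ha _)
        (contDiff_dirD hb _) (hasCompactSupport_dirD hbc _)).aestronglyMeasurable
        (Eventually.of_forall fun v => ?_)) _
      exact hbd _ _ _ _ (hMA j) (hMB0 j) (by exact_mod_cast hMB j) s v
  rw [hsum]
  refine (hasDerivAt_integral_of_dominated_loc_of_deriv_le (s := Set.univ) univ_mem
    (F := fun s v => a (z.1, z.2 + s • v) * fourierFst b v z.2 * osc z.1 v)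
    (F' := fun s v => ∑ j, (2 * π * Complex.I)⁻¹ *
        (dXi j a (z.1, z.2 + s • v) * fourierFst (dX j b) v z.2 * osc z.1 v))
    (bound := fun v => ∑ j, ‖(2 * π * Complex.I : ℂ)⁻¹‖ *
      (MA j * MB j * bracket v ^ (-((n + 1 : ℕ) : ℝ))))
    (Eventually.of_forall fun s => (hcont a b s ha hb hbc).aestronglyMeasurable) ?_ ?_ ?_ ?_ ?_).2
  · exact (hint (M * M')).mono' (hcont a b s ha hb hbc).aestronglyMeasurable
      (Eventually.of_forall fun v => hbd _ _ _ _ hM hM' (by exact_mod_cast hMb) s v)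
  · exact (continuous_finsetSum _ fun j _ => continuous_const.mul (hcont _ _ s (contDiff_dirD ha _)
        (contDiff_dirD hb _) (hasCompactSupport_dirD hbc _))).aestronglyMeasurable
  · refine Eventually.of_forall fun v s _ => (norm_sum_le _ _).trans ?_
    refine Finset.sum_le_sum fun j _ => ?_
    rw [norm_mul]
    exact mul_le_mul_of_nonneg_left (hbd _ _ _ _ (hMA j) (hMB0 j) (by exact_mod_cast hMB j) s v)
      (norm_nonneg _)
  · exact integrable_finsetSum _ fun j _ => (hint _).const_mul _
  · refine Eventually.of_forall fun v s _ => ?_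
    have hl : HasDerivAt (fun s : ℝ => (z.1, z.2 + s • v)) ((0 : Eu n), v) s := by
      have := ((hasDerivAt_id s).smul_const v).const_add z.2
      rw [one_smul] at this
      exact (hasDerivAt_const s z.1).prodMk this
    have h2 := ((ha.differentiable (by simp)) (z.1, z.2 + s • v)).hasFDerivAt.comp_hasDerivAt s hl
    have h3 : HasDerivAt (fun s : ℝ => a (z.1, z.2 + s • v))
        (∑ j, (v j : ℂ) * dXi j a (z.1, z.2 + s • v)) s := by
      rw [← dirD_snd_eq_sum]; exact h2
    have h4 := (h3.mul_const (fourierFst b v z.2)).mul_const (osc z.1 v)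
    refine h4.congr_deriv ?_
    rw [Finset.sum_mul, Finset.sum_mul]
    refine Finset.sum_congr rfl fun j _ => ?_
    rw [fourierFst_dX hb hbc]
    have : (π : ℂ) ≠ 0 := by exact_mod_cast Real.pi_ne_zero
    have hI := Complex.I_ne_zero
    field_simp

theorem compSym_one_sub {a b : Eu n × Eu n → ℂ} (ha : ContDiff ℝ ∞ a)
    (hac : HasCompactSupport a) (hb : ContDiff ℝ ∞ b) (hbc : HasCompactSupport b)
    (z : Eu n × Eu n) : compSym 1 a b z - a z * b z =
      ∫ s in Set.Ioc (0 : ℝ) 1, ∑ j, (2 * π * Complex.I)⁻¹ * compSym s (dXi j a) (dX j b) z := by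
  have hc : Continuous fun s => ∑ j : Fin n, (2 * π * Complex.I)⁻¹ *
      compSym s (dXi j a) (dX j b) z := by
    refine continuous_finsetSum _ fun j _ => continuous_const.mul ?_
    obtain ⟨M, hM⟩ := exists_bound_of_compact (contDiff_dirD ha ((0 : Eu n), (eb j : Eu n)))
      (hasCompactSupport_dirD hac _)
    exact (exists_bound_compSym (contDiff_dirD ha _) hM (contDiff_dirD hb _)
      (hasCompactSupport_dirD hbc _)).1.comp (f := fun s : ℝ => (s, z)) (by fun_prop)
  have h := intervalIntegral.integral_eq_sub_of_hasDerivAt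
    (fun s _ => hasDerivAt_compSym ha hac hb hbc z s) (hc.intervalIntegrable 0 1)
  rw [intervalIntegral.integral_of_le zero_le_one] at h
  rw [h, compSym_zero hb hbc]

theorem norm_form_sum_le {ι : Type*} (s : Finset ι) {c : ι → Eu n × Eu n → ℂ} {M : ι → ℝ}
    (hc : ∀ i, AEStronglyMeasurable (c i)) (hM : ∀ i z, ‖c i z‖ ≤ M i) {f g : 𝓢(Eu n, ℂ)}
    {P : ι → ℝ} (hP : ∀ i ∈ s, ‖form (c i) f g‖ ≤ P i) :
    ‖form (fun z => ∑ i ∈ s, c i z) f g‖ ≤ ∑ i ∈ s, P i := by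
  have : form (fun z => ∑ i ∈ s, c i z) f g = ∑ i ∈ s, form (c i) f g := by
    simp only [form]
    rw [← integral_finsetSum s fun i _ => integrable_form (hc i) (hM i) f g]
    congr 1; funext z
    simp only [Finset.sum_mul]
  rw [this]
  exact (norm_sum_le _ _).trans (Finset.sum_le_sum hP)

/-- The difference is the integral over s ∈ (0,1] of the s-derivative, a sum of n interpolating
symbols with bounds independent of s. Only differentiated symbols enter, with a constant blind to
the supports. -/
theorem exists_formBound_compSym_sub (n : ℕ) : ∃ K : ℝ, 0 < K ∧
    ∀ (M M' : ℝ) (a b : Eu n × Eu n → ℂ), 0 ≤ M → 0 ≤ M' → ContDiff ℝ ∞ a → HasCompactSupport a →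
      ContDiff ℝ ∞ b → HasCompactSupport b →
      (∀ j, DerivBound (compOrder n) (fun _ => M) (dXi j a)) →
      (∀ j, DerivBound (compOrder n) (fun _ => M') (dX j b)) →
      FormBound (K * (M * M')) (fun z => compSym 1 a b z - a z * b z) := by
  obtain ⟨K, hK, h⟩ := exists_formBound_compSym n
  refine ⟨(n + 1) * K, by positivity, fun M M' a b hM hM' ha hac hb hbc hA hB f g => ?_⟩
  have hbc' : ∀ j, HasCompactSupport (dX j b) := fun j => hasCompactSupport_dirD hbc _
  have hcs := fun j => exists_bound_compSym (hA j).1 (hA j).norm_le (hB j).1 (hbc' j)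
  choose hcont C hC using hcs
  have hcs : ∀ (j : Fin n) (s : ℝ), Continuous fun z => compSym s (dXi j a) (dX j b) z := fun j s =>
    (hcont j).comp (f := fun z => (s, z)) (by fun_prop)
  set X := ‖schwartzToL2 f‖ * ‖schwartzToL2 g‖ with hX
  have hX0 : 0 ≤ X := by positivity
  have key : ∀ s : ℝ, s ∈ Set.Ioc (0 : ℝ) 1 → ‖form (fun z => ∑ j : Fin n, (2 * π * Complex.I)⁻¹ *
      compSym s (dXi j a) (dX j b) z) f g‖ ≤ (n + 1) * K * (M * M') * X := fun s hs => by
    have h1 : ∀ j ∈ (Finset.univ : Finset (Fin n)), ‖form (fun z => (2 * π * Complex.I)⁻¹ *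
        compSym s (dXi j a) (dX j b) z) f g‖ ≤ K * (M * M') * X := fun j _ => by
      rw [form_const_mul, norm_mul]
      refine (mul_le_of_le_one_left (norm_nonneg _) ?_).trans (h s M M' _ _
        (abs_le.2 ⟨by linarith [hs.1], hs.2⟩) (hA j) (hB j) (hbc' j) f g)
      rw [norm_inv, norm_mul, norm_mul, Complex.norm_I, Complex.norm_real,
        Real.norm_of_nonneg pi_pos.le, RCLike.norm_ofNat]
      exact inv_le_one_of_one_le₀ (by linarith [Real.pi_gt_three])
    refine (norm_form_sum_le (M := fun j => ‖(2 * π * Complex.I : ℂ)⁻¹‖ * C j) _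
      (fun j => (continuous_const.mul (hcs j s)).aestronglyMeasurable) (fun j z => ?_) h1).trans ?_
    · exact (norm_mul _ (compSym s (dXi j a) (dX j b) z)).le.trans
        (mul_le_mul_of_nonneg_left (hC j s z) (norm_nonneg _))
    · rw [Finset.sum_const, Finset.card_univ, Fintype.card_fin, nsmul_eq_mul]
      have : 0 ≤ K * (M * M') * X := by positivity
      nlinarith
  have := norm_form_le_of_superposition (ν := volume.restrict (Set.Ioc (0 : ℝ) 1))
    (c := fun z => compSym 1 a b z - a z * b z)
    (q := fun s z => ∑ j : Fin n, (2 * π * Complex.I)⁻¹ * compSym s (dXi j a) (dX j b) z)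
    (Q := fun _ => ∑ j : Fin n, ‖(2 * π * Complex.I : ℂ)⁻¹‖ * C j)
    (P := fun _ => (n + 1) * K * (M * M') * X)
    (fun z => compSym_one_sub ha hac hb hbc z)
    (continuous_finsetSum _ fun j _ => continuous_const.mul (hcont j)).aestronglyMeasurable
    (fun s z => (norm_sum_le _ _).trans (Finset.sum_le_sum fun j _ => by
      rw [norm_mul]; exact mul_le_mul_of_nonneg_left (hC j s z) (norm_nonneg _)))
    (integrable_const _) f g ((ae_restrict_iff' measurableSet_Ioc).2 (Eventually.of_forall key))
    (integrable_const _)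
  simpa using this

theorem form_sub {c c' : Eu n × Eu n → ℂ} {M M' : ℝ} (hc : AEStronglyMeasurable c)
    (hM : ∀ z, ‖c z‖ ≤ M) (hc' : AEStronglyMeasurable c') (hM' : ∀ z, ‖c' z‖ ≤ M')
    (f g : 𝓢(Eu n, ℂ)) :
    form (fun z => c z - c' z) f g = form c f g - form c' f g := by
  rw [form, form, form, ← integral_sub (integrable_form hc hM f g) (integrable_form hc' hM' f g)]
  congr 1; funext z; ring

theorem exists_norm_comp_sub_le_of_hasCompactSupport (n : ℕ) : ∃ K : ℝ, 0 < K ∧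
    ∀ (M M' : ℝ) (a b : Eu n × Eu n → ℂ) (Ta Tb Tab : L2 n →L[ℂ] L2 n), 0 ≤ M → 0 ≤ M' →
      ContDiff ℝ ∞ a → HasCompactSupport a → ContDiff ℝ ∞ b → HasCompactSupport b →
      (∀ j, DerivBound (compOrder n) (fun _ => M) (dXi j a)) →
      (∀ j, DerivBound (compOrder n) (fun _ => M') (dX j b)) →
      Represents Ta a → Represents Tb b → Represents Tab (fun z => a z * b z) →
      ‖Ta ∘L Tb - Tab‖ ≤ K * (M * M') := by
  obtain ⟨K, hK, h⟩ := exists_formBound_compSym_sub n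
  refine ⟨K, hK, fun M M' a b Ta Tb Tab hM hM' ha hac hb hbc hA hB hTa hTb hTab => ?_⟩
  obtain ⟨C, hC⟩ := exists_bound_of_compact ha hac
  obtain ⟨C', hC'⟩ := exists_bound_of_compact hb hbc
  obtain ⟨hcs, C₁, hC₁⟩ := exists_bound_compSym ha hC hb hbc
  have hcs1 : Continuous (compSym 1 a b) := hcs.comp (f := fun z => ((1 : ℝ), z)) (by fun_prop)
  have hm : ∀ {c : Eu n × Eu n → ℂ}, Continuous c → AEStronglyMeasurable c :=
    fun h => h.aestronglyMeasurable
  have hab := ha.mul hb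
  obtain ⟨C₂, hC₂⟩ := exists_bound_of_compact hab hac.mul_right
  refine norm_le_of_inner_schwartz (by positivity) fun f g => ?_
  -- Compact support of b makes the image of f a Schwartz function, so the weak representation of
  -- `Ta` can be applied to it.
  have e1 : Tb (schwartzToL2 f) = schwartzToL2 (opSchwartz hb hbc f) := by
    refine Lp.ext ?_
    filter_upwards [hTb.ae_eq_opF (hm hb.continuous) hC' f,
      (opSchwartz hb hbc f).coeFn_toLp 2 volume] with x h1 h2
    rw [h1, schwartzToL2, h2, opSchwartz_apply]
  have e2 : inner ℂ (schwartzToL2 g) ((Ta ∘L Tb - Tab) (schwartzToL2 f)) =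
      form (fun z => compSym 1 a b z - a z * b z) f g := by
    rw [_root_.sub_apply, inner_sub_right, ContinuousLinearMap.comp_apply, e1, hTa, hTab,
      form_sub (hm hcs1) (hC₁ 1) (hm hab.continuous) hC₂, form_eq_integral_opF (hm ha.continuous) hC,
      form_eq_integral_opF (hm hcs1) (hC₁ 1)]
    congr 2
    funext x
    rw [opF_opSchwartz ha hac]
  rw [e2]
  exact h M M' a b hM hM' ha hac hb hbc hA hB f g

/-- In the product rule for χa, the undifferentiated a appears only next to a derivative of χ, hence
with the small factor r. -/
theorem derivBound_dirD_cutoff {N : ℕ} {K M A r : ℝ} {χ a : Eu n × Eu n → ℂ} {v : Eu n × Eu n}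
    (hv : ‖v‖ ≤ 1) (hr : 0 ≤ r) (hK : 0 ≤ K) (hχ : DerivBound N (fun _ => K) χ)
    (hχ' : DerivBound N (fun _ => ‖v‖ * K * r) (dirD v χ)) (ha : DerivBound N (fun _ => A) a)
    (ha' : DerivBound N (fun _ => M) (dirD v a)) :
    DerivBound N (fun _ => 2 ^ N * K * (M + A * r)) (dirD v fun z => χ z * a z) := by
  have hA := ha.nonneg 0
  refine (((hχ'.mul ha).add (hχ.mul ha')).congr fun z => dirD_mul hχ.1 ha.1 v z).mono fun z => ?_
  have h1 : ‖v‖ * K * r * A ≤ K * r * A := by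
    have : 0 ≤ K * r * A := by positivity
    nlinarith
  have h2 : (0 : ℝ) < 2 ^ N := by positivity
  nlinarith

/-- The composition estimate: only derivatives of `a` with at least one derivative in `ξ` and
derivatives of `b` with at least one derivative in `x` enter. -/
theorem exists_norm_comp_sub_le (n : ℕ) : ∃ K : ℝ, 0 < K ∧
    ∀ (M M' A B : ℝ) (a b : Eu n × Eu n → ℂ) (Ta Tb Tab : L2 n →L[ℂ] L2 n), 0 ≤ M → 0 ≤ M' →
      DerivBound (compOrder n) (fun _ => A) a → DerivBound (compOrder n) (fun _ => B) b →
      (∀ j, DerivBound (compOrder n) (fun _ => M) (dXi j a)) →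
      (∀ j, DerivBound (compOrder n) (fun _ => M') (dX j b)) →
      Represents Ta a → Represents Tb b → Represents Tab (fun z => a z * b z) →
      ‖Ta ∘L Tb - Tab‖ ≤ K * (M * M') := by
  obtain ⟨K, hK, h⟩ := exists_norm_comp_sub_le_of_hasCompactSupport n
  obtain ⟨Kc, χ, hKc, hχc, hχ, hχ', hχ1, hχt⟩ := exists_cutoff (Eu n × Eu n) (compOrder n)
  obtain ⟨K₀, hK₀, hrep⟩ := exists_represents n
  set D : ℝ := 2 ^ compOrder n * Kc with hD
  have hD0 : 0 < D := by positivity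
  refine ⟨K * (D * D), by positivity,
    fun M M' A B a b Ta Tb Tab hM hM' ha hb hda hdb hTa hTb hTab => ?_⟩
  have hA0 := ha.nonneg 0
  have hB0 := hb.nonneg 0
  have hcv : cvOrder n ≤ compOrder n := by unfold compOrder; omega
  have hlim : Tendsto (fun m : ℕ => 1 / ((m : ℝ) + 1)) atTop (𝓝 0) :=
    tendsto_one_div_add_atTop_nhds_zero_nat
  have hr : ∀ m : ℕ, (0 : ℝ) ≤ 1 / ((m : ℝ) + 1) := fun m => by positivity
  have hcut : ∀ {c : Eu n × Eu n → ℂ} {C : ℝ}, DerivBound (compOrder n) (fun _ => C) c → ∀ m,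
      DerivBound (compOrder n) (fun _ => D * C) (fun z => χ m z * c z) := fun hc m =>
    ((hχ m).mul hc).mono fun z => by rw [hD, mul_assoc]
  -- weak convergence of the operators with cut off symbols
  have hweak : ∀ {c : Eu n × Eu n → ℂ} {C : ℝ} {T : L2 n →L[ℂ] L2 n},
      DerivBound (compOrder n) (fun _ => C) c → Represents T c →
      ∃ S : ℕ → L2 n →L[ℂ] L2 n, (∀ m, Represents (S m) (fun z => χ m z * c z)) ∧
        WeakTendsto S T := fun {c C T} hc hT => by
    choose S hS hSn using fun m => hrep _ _ ((hcut hc m).of_le hcv)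
    refine ⟨S, hS, WeakTendsto.of_represents hSn hS hT (tendsto_form (M := D * C)
      (fun m => (hcut hc m).measurable) (fun m => (hcut hc m).norm_le)
      (Eventually.of_forall fun z => ?_))⟩
    simpa using (hχt z).mul_const (c z)
  have hab : DerivBound (compOrder n) (fun _ => 2 ^ compOrder n * (A * B)) fun z => a z * b z :=
    ha.mul hb
  -- one symbol with compact support
  have step : ∀ (b : Eu n × Eu n → ℂ) (B M' : ℝ) (Tb Tab : L2 n →L[ℂ] L2 n), 0 ≤ M' →
      DerivBound (compOrder n) (fun _ => B) b → HasCompactSupport b →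
      (∀ j, DerivBound (compOrder n) (fun _ => M') (dX j b)) → Represents Tb b →
      Represents Tab (fun z => a z * b z) → ‖Ta ∘L Tb - Tab‖ ≤ K * (D * M * M') := by
    intro b B M' Tb Tab hM' hb hbc hdb hTb hTab
    obtain ⟨S, hS, hSw⟩ := hweak ha hTa
    obtain ⟨R, hR, hRw⟩ := hweak (ha.mul hb) hTab
    -- The contribution A/(m+1) of the undifferentiated symbol disappears as the cutoff widens; A
    -- never enters the final bound.
    have hlim2 : Tendsto (fun m : ℕ => K * (D * (M + A * (1 / ((m : ℝ) + 1))) * M')) atTop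
        (𝓝 (K * (D * M * M'))) := by
      have := (((hlim.const_mul A).const_add M).const_mul D).mul_const M' |>.const_mul K
      simpa using this
    refine ((hSw.comp_right Tb).sub hRw).norm_le (fun m => ?_) hlim2
    have := hr m
    refine h (D * (M + A * (1 / ((m : ℝ) + 1)))) M' _ b (S m) Tb (R m) (by positivity) hM'
      (hcut ha m).1 (hχc m).mul_right hb.1 hbc (fun j => ?_) hdb (hS m) hTb
      ((hR m).congr fun z => by ring)
    exact derivBound_dirD_cutoff (norm_dir_snd j) (hr m) hKc.le (hχ m) (hχ' m _) ha (hda j)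
  -- The two cutoffs are removed one after the other: weak convergence passes through a composition
  -- only while the other factor is fixed.
  obtain ⟨S, hS, hSw⟩ := hweak hb hTb
  obtain ⟨R, hR, hRw⟩ := hweak hab hTab
  have hlim2 : Tendsto (fun m : ℕ => K * (D * M * (D * (M' + B * (1 / ((m : ℝ) + 1)))))) atTop
      (𝓝 (K * (D * D) * (M * M'))) := by
    have := (((hlim.const_mul B).const_add M').const_mul D).const_mul (D * M) |>.const_mul K
    simp only [mul_zero, add_zero] at this
    rwa [show K * (D * D) * (M * M') = K * (D * M * (D * M')) by ring]
  refine ((hSw.comp_left Ta).sub hRw).norm_le (fun m => ?_) hlim2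
  have := hr m
  refine step _ _ (D * (M' + B * (1 / ((m : ℝ) + 1)))) (S m) (R m) (by positivity) (hcut hb m)
    (hχc m).mul_right (fun j => ?_) (hS m) ((hR m).congr fun z => by ring)
  exact derivBound_dirD_cutoff (norm_dir_fst j) (hr m) hKc.le (hχ m) (hχ' m _) hb (hdb j)

end

section

/-! ### Scaling -/

variable {n : ℕ}

open Filter Topology

/-- The unitary dilation of a Schwartz function. -/
def dil (r : ℝˣ) : 𝓢(Eu n, ℂ) →ₗ[ℂ] 𝓢(Eu n, ℂ) :=
  ((|(r : ℝ)| ^ ((n : ℝ) / 2) : ℝ) : ℂ) • (SchwartzMap.compCLMOfContinuousLinearEquiv ℂ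
    (ContinuousLinearEquiv.smulLeft r : Eu n ≃L[ℝ] Eu n)).toLinearMap

theorem dil_apply (r : ℝˣ) (f : 𝓢(Eu n, ℂ)) (x : Eu n) :
    dil r f x = ((|(r : ℝ)| ^ ((n : ℝ) / 2) : ℝ) : ℂ) * f ((r : ℝ) • x) := rfl

theorem abs_units_pos (r : ℝˣ) : 0 < |(r : ℝ)| := abs_pos.2 r.ne_zero

theorem rpow_half_mul_self (r : ℝˣ) :
    |(r : ℝ)| ^ ((n : ℝ) / 2) * |(r : ℝ)| ^ ((n : ℝ) / 2) = |(r : ℝ)| ^ n := by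
  rw [← Real.rpow_add (abs_units_pos r), add_halves, Real.rpow_natCast]

theorem fourier_dil (r : ℝˣ) (f : 𝓢(Eu n, ℂ)) (ξ : Eu n) :
    𝓕 (dil r f) ξ = dil r⁻¹ (𝓕 f) ξ := by
  rw [dil_apply, SchwartzMap.fourier_coe, SchwartzMap.fourier_coe, fourier_eq_osc, fourier_eq_osc]
  have h := Measure.integral_comp_smul (volume : Measure (Eu n))
    (fun y => osc (-y) (((r⁻¹ : ℝˣ) : ℝ) • ξ) * f y) (r : ℝ)
  rw [finrank_euclideanSpace_fin] at h
  have h1 : (∫ y, osc (-y) ξ * dil r f y) = ((|(r : ℝ)| ^ ((n : ℝ) / 2) : ℝ) : ℂ) *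
      ∫ y, osc (-((r : ℝ) • y)) (((r⁻¹ : ℝˣ) : ℝ) • ξ) * f ((r : ℝ) • y) := by
    rw [← integral_const_mul]
    congr 1; funext y
    rw [dil_apply]
    have : osc (-((r : ℝ) • y)) (((r⁻¹ : ℝˣ) : ℝ) • ξ) = osc (-y) ξ := by
      rw [osc, osc, inner_neg_left, inner_neg_left, inner_smul_left, inner_smul_right]
      simp
    rw [this]; ring
  rw [h1, h, Complex.real_smul, ← mul_assoc]
  congr 1
  rw [← Complex.ofReal_mul]
  congr 1
  have h2 := rpow_half_mul_self (n := n) r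
  have h3 : 0 < |(r : ℝ)| ^ ((n : ℝ) / 2) := Real.rpow_pos_of_pos (abs_units_pos r) _
  rw [abs_inv, abs_pow, ← h2, Units.val_inv_eq_inv_val, abs_inv, Real.inv_rpow (abs_nonneg _)]
  field_simp

theorem norm_schwartzToL2_dil (r : ℝˣ) (f : 𝓢(Eu n, ℂ)) :
    ‖schwartzToL2 (dil r f)‖ = ‖schwartzToL2 f‖ := by
  rw [norm_schwartzToL2, norm_schwartzToL2]
  congr 1
  have h := Measure.integral_comp_smul (volume : Measure (Eu n)) (fun y => ‖f y‖ ^ 2) (r : ℝ)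
  rw [finrank_euclideanSpace_fin] at h
  have h1 : (∫ y, ‖dil r f y‖ ^ 2) = |(r : ℝ)| ^ n * ∫ y, ‖f ((r : ℝ) • y)‖ ^ 2 := by
    rw [← integral_const_mul]
    congr 1; funext y
    rw [dil_apply, norm_mul, mul_pow, Complex.norm_real,
      Real.norm_of_nonneg (Real.rpow_nonneg (abs_nonneg _) _), ← rpow_half_mul_self, sq]
  have := abs_units_pos r
  rw [h1, h, smul_eq_mul, abs_inv, abs_pow, ← mul_assoc, mul_inv_cancel₀ (by positivity), one_mul]

/-- The symplectic scaling of the phase space. -/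
def scaleMap (r : ℝˣ) (z : Eu n × Eu n) : Eu n × Eu n := ((r : ℝ) • z.1, ((r⁻¹ : ℝˣ) : ℝ) • z.2)

theorem scaleMap_inv (r : ℝˣ) (z : Eu n × Eu n) : scaleMap r⁻¹ (scaleMap r z) = z := by
  simp [scaleMap, smul_smul]

theorem measurePreserving_scaleMap (r : ℝˣ) :
    MeasurePreserving (scaleMap r : Eu n × Eu n → Eu n × Eu n) := by
  refine ⟨by unfold scaleMap; fun_prop, ?_⟩
  have h1 := Measure.map_addHaar_smul (volume : Measure (Eu n)) r.ne_zero
  have h2 := Measure.map_addHaar_smul (volume : Measure (Eu n)) (r⁻¹).ne_zero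
  have h3 := Measure.map_prod_map (volume : Measure (Eu n)) (volume : Measure (Eu n))
    (f := fun x : Eu n => (r : ℝ) • x) (g := fun x : Eu n => ((r⁻¹ : ℝˣ) : ℝ) • x)
    (by fun_prop) (by fun_prop)
  rw [h1, h2, Measure.prod_smul_left, Measure.prod_smul_right, smul_smul,
    ← ENNReal.ofReal_mul (abs_nonneg _), ← abs_mul, ← mul_inv, ← mul_pow] at h3
  rw [Measure.volume_eq_prod]
  change Measure.map (Prod.map _ _) _ = _
  rw [← h3]
  simp

/-- The symplectic scaling as a measurable equivalence. -/
def scaleEquiv (r : ℝˣ) : Eu n × Eu n ≃ᵐ Eu n × Eu n where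
  toFun := scaleMap r
  invFun := scaleMap r⁻¹
  left_inv := scaleMap_inv r
  right_inv z := by simpa using scaleMap_inv r⁻¹ z
  measurable_toFun := (measurePreserving_scaleMap r).measurable
  measurable_invFun := (measurePreserving_scaleMap r⁻¹).measurable

/-- Scaling x by r and ξ by 1/r preserves both the phase ⟨x,ξ⟩ and the measure, and the normalizing
powers of |r| from f̂ and g cancel. -/
theorem form_dil (c : Eu n × Eu n → ℂ) (r : ℝˣ) (f g : 𝓢(Eu n, ℂ)) :
    form (fun z => c (scaleMap r z)) (dil r f) (dil r g) = form c f g := by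
  rw [form, form, ← (measurePreserving_scaleMap r).integral_comp (scaleEquiv r).measurableEmbedding
    (fun z : Eu n × Eu n => c z * osc z.1 z.2 * 𝓕 f z.2 * (starRingEnd ℂ) (g z.1))]
  congr 1; funext z
  rw [fourier_dil, dil_apply, dil_apply, map_mul, Complex.conj_ofReal]
  have h1 : osc (scaleMap r z).1 (scaleMap r z).2 = osc z.1 z.2 := by
    rw [osc, osc, scaleMap, inner_smul_left, inner_smul_right]
    simp
  have h2 : ((|((r⁻¹ : ℝˣ) : ℝ)| ^ ((n : ℝ) / 2) : ℝ) : ℂ) *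
      ((|(r : ℝ)| ^ ((n : ℝ) / 2) : ℝ) : ℂ) = 1 := by
    rw [← Complex.ofReal_mul, ← Real.mul_rpow (abs_nonneg _) (abs_nonneg _), ← abs_mul]
    simp
  rw [h1, scaleMap]
  calc _ = (((|((r⁻¹ : ℝˣ) : ℝ)| ^ ((n : ℝ) / 2) : ℝ) : ℂ) *
      ((|(r : ℝ)| ^ ((n : ℝ) / 2) : ℝ) : ℂ)) * _ := by
        rw [show ∀ p q a b u v : ℂ, a * b * (p * u) * (q * v) = (p * q) * (a * b * u * v) from
          fun p q a b u v => by ring]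
    _ = _ := by rw [h2, one_mul]

theorem FormBound.of_scale {c : Eu n × Eu n → ℂ} {M : ℝ} (r : ℝˣ)
    (h : FormBound M fun z => c (scaleMap r z)) : FormBound M c := fun f g => by
  rw [← form_dil c r, ← norm_schwartzToL2_dil r f, ← norm_schwartzToL2_dil r g]
  exact h _ _

theorem dil_dil_inv (r : ℝˣ) (f : 𝓢(Eu n, ℂ)) : dil r (dil r⁻¹ f) = f := by
  ext x
  rw [dil_apply, dil_apply, ← mul_assoc, ← Complex.ofReal_mul,
    ← Real.mul_rpow (abs_nonneg _) (abs_nonneg _), ← abs_mul, smul_smul]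
  simp

/-- The unitary dilation of a Schwartz function as an equivalence. -/
def dilEquiv (r : ℝˣ) : 𝓢(Eu n, ℂ) ≃ₗ[ℂ] 𝓢(Eu n, ℂ) :=
  LinearEquiv.ofLinearMap (dil r) (dil r⁻¹) (LinearMap.ext fun f => dil_dil_inv r f)
    (LinearMap.ext fun f => by simpa using dil_dil_inv r⁻¹ f)

/-- The unitary dilation on `L²`. -/
theorem exists_dilation (r : ℝˣ) : ∃ U : L2 n ≃ₗᵢ[ℂ] L2 n, ∀ f,
    U (schwartzToL2 f) = schwartzToL2 (dil r f) :=
  ⟨(dilEquiv r).extendOfIsometry (schwartzToL2L n) (schwartzToL2L n) denseRange_schwartzToL2L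
    denseRange_schwartzToL2L (fun f => norm_schwartzToL2_dil r f), fun f =>
      (dilEquiv r).extendOfIsometry_eq (schwartzToL2L n) (schwartzToL2L n) denseRange_schwartzToL2L
        denseRange_schwartzToL2L (fun f => norm_schwartzToL2_dil r f) f⟩

/-- The operators with symbols `a`, `b`, `ab` are bounded and `‖Op(a)Op(b) - Op(ab)‖ ≤ M`. -/
def CompBound (M : ℝ) (a b : Eu n × Eu n → ℂ) : Prop :=
  ∃ Ta Tb Tab : L2 n →L[ℂ] L2 n, Represents Ta a ∧ Represents Tb b ∧
    Represents Tab (fun z => a z * b z) ∧ ‖Ta ∘L Tb - Tab‖ ≤ M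

/-- All three operators are conjugated by the same unitary dilation. Conjugation respects products,
so the norm of the composition error does not change. -/
theorem CompBound.of_scale {M : ℝ} {a b : Eu n × Eu n → ℂ} (r : ℝˣ)
    (h : CompBound M (fun z => a (scaleMap r z)) (fun z => b (scaleMap r z))) : CompBound M a b := by
  obtain ⟨Ta, Tb, Tab, ha, hb, hab, hM⟩ := h
  obtain ⟨U, hU⟩ := exists_dilation (n := n) r
  let V : L2 n →L[ℂ] L2 n := U.toContinuousLinearEquiv.toContinuousLinearMap
  let V' : L2 n →L[ℂ] L2 n := U.symm.toContinuousLinearEquiv.toContinuousLinearMap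
  have hV : ∀ u, V u = U u := fun u => rfl
  have hV' : ∀ u, V' u = U.symm u := fun u => rfl
  have hrep : ∀ {T : L2 n →L[ℂ] L2 n} {c : Eu n × Eu n → ℂ},
      Represents T (fun z => c (scaleMap r z)) → Represents (V' ∘L T ∘L V) c := fun {T c} hT f g => by
    rw [← form_dil c r, ← hT, ← hU, ← hU, ContinuousLinearMap.comp_apply,
      ContinuousLinearMap.comp_apply, hV, hV', ← U.inner_map_map, U.apply_symm_apply]
  refine ⟨V' ∘L Ta ∘L V, V' ∘L Tb ∘L V, V' ∘L Tab ∘L V, hrep ha, hrep hb, hrep hab, ?_⟩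
  have e : (V' ∘L Ta ∘L V) ∘L (V' ∘L Tb ∘L V) - V' ∘L Tab ∘L V = V' ∘L (Ta ∘L Tb - Tab) ∘L V := by
    ext1 u
    simp [hV, hV']
  rw [e]
  have hM0 : 0 ≤ M := (norm_nonneg _).trans hM
  refine ContinuousLinearMap.opNorm_le_bound _ hM0 fun u => ?_
  rw [ContinuousLinearMap.comp_apply, ContinuousLinearMap.comp_apply, hV, hV', U.symm.norm_map]
  refine (ContinuousLinearMap.le_of_opNorm_le _ hM _).trans ?_
  rw [U.norm_map]

end

section

/-! ### Symbols of negative order without regularity in `x` -/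

variable {n : ℕ}

open Filter Topology

theorem quasiMeasurePreserving_smul_snd {τ : ℝ} (hτ : τ ≠ 0) :
    Measure.QuasiMeasurePreserving (fun z : Eu n × Eu n => (z.1, τ • z.2)) := by
  have h1 : Measure.QuasiMeasurePreserving (fun x : Eu n => τ • x) volume volume := by
    refine ⟨by fun_prop, ?_⟩
    rw [Measure.map_addHaar_smul _ hτ]
    exact Measure.smul_absolutelyContinuous
  rw [Measure.volume_eq_prod]
  exact QuasiMeasurePreserving.prodMap (Measure.QuasiMeasurePreserving.id _) h1

theorem aestronglyMeasurable_comp_smul_snd {c : Eu n × Eu n → ℂ} (hc : AEStronglyMeasurable c)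
    {τ : ℝ} (hτ : τ ≠ 0) : AEStronglyMeasurable fun z : Eu n × Eu n => c (z.1, τ • z.2) :=
  hc.comp_quasiMeasurePreserving (quasiMeasurePreserving_smul_snd hτ)

/-- Boundedness of the quantization of a symbol which decays in `ξ`, by a kernel estimate. -/
theorem exists_formBound_of_decay_snd (n : ℕ) : ∃ K : ℝ, 0 < K ∧
    ∀ (M : ℝ) (c : Eu n × Eu n → ℂ), AEStronglyMeasurable c →
      (∀ x, DerivBound (n + 1) (fun ξ => M * bracket ξ ^ (-((n + 1 : ℕ) : ℝ))) fun ξ => c (x, ξ)) →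
      FormBound (K * M) c := by
  have hr : (n : ℝ) < ((n + 1 : ℕ) : ℝ) := by push_cast; linarith
  obtain ⟨I, hI⟩ : ∃ I : ℝ, I = ∫ x : Eu n, bracket x ^ (-((n + 1 : ℕ) : ℝ)) := ⟨_, rfl⟩
  have hI0 : 0 ≤ I := hI ▸ integral_nonneg fun x => rpow_bracket_nonneg _ x
  obtain ⟨K₀, hK₀⟩ : ∃ K₀ : ℝ, K₀ = 4 ^ (n + 1) * ((n + 1 : ℕ) + 2) := ⟨_, rfl⟩
  have hK₀0 : 0 < K₀ := by rw [hK₀]; positivity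
  have hint : Integrable fun x : Eu n => bracket x ^ (-((n + 1 : ℕ) : ℝ)) := integrable_bracket_rpow hr
  refine ⟨K₀ * (I + 1) * (I + 1), by positivity, fun M c hcm hc f g => ?_⟩
  have hM0 : 0 ≤ M := by
    have := (hc 0).nonneg 0
    have h2 : (0 : ℝ) < bracket (0 : Eu n) ^ (-((n + 1 : ℕ) : ℝ)) :=
      Real.rpow_pos_of_pos (bracket_pos _) _
    exact nonneg_of_mul_nonneg_left this h2
  have hw1 : ∀ y : Eu n, bracket y ^ (-((n + 1 : ℕ) : ℝ)) ≤ 1 := fun y =>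
    Real.rpow_le_one_of_one_le_of_nonpos (one_le_bracket _) (neg_nonpos.2 (Nat.cast_nonneg _))
  have hcb : ∀ z, ‖c z‖ ≤ M := fun z => ((hc z.1).norm_le z.2).trans
    (mul_le_of_le_one_right hM0 (hw1 _))
  -- The integral kernel at (x, x+t) is the Fourier transform of c(x,·) at t. The n + 1 derivatives
  -- in ξ give integrable decay in t, uniformly in x, without any regularity in x.
  have hop : ∀ x, ‖opF c f x‖ ≤ ∫ t, K₀ * (I + 1) * M * bracket t ^ (-((n + 1 : ℕ) : ℝ)) * ‖f (t + x)‖ := by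
    intro x
    have hci : Integrable fun ξ => c (x, ξ) := (hint.const_mul M).mono'
      (hc x).1.continuous.aestronglyMeasurable (Eventually.of_forall (hc x).norm_le)
    have hcoi : Integrable fun ξ => c (x, ξ) * osc x ξ := (hint.const_mul M).mono'
      ((hc x).1.continuous.mul (continuous_const.osc continuous_id)).aestronglyMeasurable
      (Eventually.of_forall fun ξ => by
        rw [norm_mul, norm_osc, mul_one]; exact (hc x).norm_le ξ)
    have e1 : opF c f x = ∫ y, 𝓕 (fun ξ => c (x, ξ) * osc x ξ) y * f y := by
      rw [integral_fourier_mul hcoi (f.integrable (μ := volume)), opF]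
      rfl
    have e2 : ∀ y, 𝓕 (fun ξ => c (x, ξ) * osc x ξ) y = 𝓕 (fun ξ => c (x, ξ)) (y - x) := fun y => by
      rw [fourier_eq_osc, fourier_eq_osc]
      congr 1; funext ξ
      rw [sub_eq_add_neg, osc_add_right, osc_neg_left ξ (-x), neg_neg, osc_comm x ξ]
      ring
    have e3 : ∀ t, ‖𝓕 (fun ξ => c (x, ξ)) t‖ ≤
        K₀ * (I + 1) * M * bracket t ^ (-((n + 1 : ℕ) : ℝ)) := fun t => by
      refine (norm_fourier_le_of_derivBound (hc x) (hint.const_mul M) t).trans ?_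
      rw [integral_const_mul, ← hI, ← hK₀]
      refine mul_le_mul_of_nonneg_right ?_ (rpow_bracket_nonneg _ _)
      have : 0 ≤ K₀ * M := by positivity
      nlinarith
    rw [e1, ← integral_add_right_eq_self _ x]
    have hfb : ∃ C, ∀ y, ‖f y‖ ≤ C := ⟨_, fun y => f.toBoundedContinuousFunction.norm_coe_le_norm y⟩
    obtain ⟨C, hC⟩ := hfb
    refine norm_integral_le_of_norm_le ?_ (Eventually.of_forall fun t => ?_)
    · refine (((hint.const_mul (K₀ * (I + 1) * M)).norm).mul_const C).mono'
        ((((continuous_bracket_rpow _).const_mul _).mul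
          (f.continuous.comp (by fun_prop)).norm).aestronglyMeasurable)
        (Eventually.of_forall fun t => ?_)
      rw [norm_mul, norm_norm]
      gcongr
      exact hC _
    · rw [norm_mul, e2, add_sub_cancel_right]
      gcongr
      exact e3 t
  rw [form_eq_integral_opF hcm hcb]
  set w : Eu n → ℝ := fun t => K₀ * (I + 1) * M * bracket t ^ (-((n + 1 : ℕ) : ℝ)) with hw
  have hwi : Integrable w := hint.const_mul _
  have hw0 : ∀ t, 0 ≤ w t := fun t => mul_nonneg (by positivity) (rpow_bracket_nonneg _ _)
  have hwc : Continuous w := (continuous_bracket_rpow _).const_mul _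
  have hprod : Integrable (fun p : Eu n × Eu n => w p.2 * ‖f (p.2 + p.1)‖ * ‖g p.1‖)
      ((volume : Measure (Eu n)).prod volume) := by
    obtain ⟨C, hC⟩ : ∃ C, ∀ y, ‖f y‖ ≤ C :=
      ⟨_, fun y => f.toBoundedContinuousFunction.norm_coe_le_norm y⟩
    refine (((g.integrable (μ := volume)).norm.const_mul C).mul_prod hwi).mono' ?_
      (Eventually.of_forall fun p => ?_)
    · exact (((hwc.comp continuous_snd).mul (f.continuous.comp (by fun_prop)).norm).mul
        (g.continuous.comp continuous_fst).norm).aestronglyMeasurable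
    · rw [norm_mul, norm_mul, norm_norm, norm_norm, Real.norm_of_nonneg (hw0 _)]
      have := mul_le_mul_of_nonneg_left (hC (p.2 + p.1)) (mul_nonneg (hw0 p.2) (norm_nonneg (g p.1)))
      nlinarith
  have hW : ∫ t, w t ≤ K₀ * (I + 1) * (I + 1) * M := by
    rw [hw, integral_const_mul, ← hI]
    have : 0 ≤ K₀ * (I + 1) * M := by positivity
    nlinarith
  -- With a kernel dominated by an integrable function of t, the operator is dominated by an average
  -- of translations, each of norm one on L².
  calc ‖∫ x, opF c f x * (starRingEnd ℂ) (g x)‖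
      ≤ ∫ x, ∫ t, w t * ‖f (t + x)‖ * ‖g x‖ := by
        refine norm_integral_le_of_norm_le hprod.integral_prod_left (Eventually.of_forall fun x => ?_)
        rw [norm_mul, RCLike.norm_conj, integral_mul_const]
        exact mul_le_mul_of_nonneg_right (hop x) (norm_nonneg _)
    _ = ∫ t, w t * ∫ x, ‖g x‖ * ‖f (x + t)‖ := by
        rw [integral_integral_swap hprod]
        congr 1; funext t
        rw [← integral_const_mul]
        congr 1; funext x
        rw [add_comm t x]; ring
    _ ≤ ∫ t, w t * (‖schwartzToL2 f‖ * ‖schwartzToL2 g‖) := by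
        refine integral_mono_of_nonneg (Eventually.of_forall fun t => mul_nonneg (hw0 t)
          (integral_nonneg fun x => by positivity)) (hwi.mul_const _) (Eventually.of_forall fun t => ?_)
        refine mul_le_mul_of_nonneg_left ?_ (hw0 t)
        rw [mul_comm ‖schwartzToL2 f‖]
        exact (integral_schwartz_mul_translate_le g f t).2
    _ ≤ _ := by
        rw [integral_mul_const]
        exact mul_le_mul_of_nonneg_right hW (by positivity)

/-- Dilation invariance: the constant does not see the frequency scale r, so every dyadic piece may
be examined at unit scale. -/
theorem exists_formBound_of_decay_snd_scaled (n : ℕ) : ∃ K : ℝ, 0 < K ∧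
    ∀ (M r : ℝ) (c : Eu n × Eu n → ℂ), r ≠ 0 → AEStronglyMeasurable c →
      (∀ x, DerivBound (n + 1) (fun ξ => M * bracket ξ ^ (-((n + 1 : ℕ) : ℝ)))
        fun ξ => c (x, r • ξ)) → FormBound (K * M) c := by
  obtain ⟨K, hK, h⟩ := exists_formBound_of_decay_snd n
  refine ⟨K, hK, fun M r c hr hcm hc => ?_⟩
  refine FormBound.of_scale (Units.mk0 r hr)⁻¹ (h M _ ?_ fun x => ?_)
  · exact hcm.comp_measurePreserving (measurePreserving_scaleMap _)
  · simpa [scaleMap] using hc ((((Units.mk0 r hr)⁻¹ : ℝˣ) : ℝ) • x)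

theorem exists_derivBound_decay_single {θ : Eu n → ℂ} (hθ : ContDiff ℝ ∞ θ)
    (hc : HasCompactSupport θ) (N : ℕ) (r : ℝ) :
    ∃ M : ℝ, 0 ≤ M ∧ DerivBound N (fun ξ => M * bracket ξ ^ (-r)) θ := by
  obtain ⟨M, hM, hd⟩ := exists_derivBound_of_hasCompactSupport
    (G := fun z : Eu n => brC r z * θ z) ((contDiff_bracket_rpow r).mul hθ) hc.mul_left N
  obtain ⟨K, hK, hw⟩ := exists_derivBound_brC n (-r) N
  refine ⟨2 ^ N * (K * M), by positivity, ((hw.mul hd).congr fun z => ?_).mono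
    fun z => le_of_eq (by ring)⟩
  rw [← mul_assoc, ← brC_add, neg_add_cancel, brC_zero, one_mul]

/-- A smooth cutoff function, equal to `1` on the unit ball. -/
theorem exists_bump (n : ℕ) : ∃ φ : Eu n → ℂ, ContDiff ℝ ∞ φ ∧ HasCompactSupport φ ∧
    (∀ ξ, ‖ξ‖ ≤ 1 → φ ξ = 1) ∧ ∀ ξ, ‖φ ξ‖ ≤ 1 := by
  let φ : ContDiffBump (0 : Eu n) := ⟨1, 2, one_pos, one_lt_two⟩
  refine ⟨fun z => ((φ z : ℝ) : ℂ), Complex.ofRealCLM.contDiff.comp φ.contDiff,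
    φ.hasCompactSupport.comp_left (g := fun t : ℝ => (t : ℂ)) Complex.ofReal_zero, fun ξ hξ => ?_,
    fun ξ => ?_⟩
  · change ((φ ξ : ℝ) : ℂ) = 1
    rw [φ.one_of_mem_closedBall (by simpa using hξ), Complex.ofReal_one]
  · rw [Complex.norm_real, Real.norm_of_nonneg φ.nonneg]
    exact φ.le_one

/-- `a(x, ·)` is a symbol of order `k` with constant `C`, up to `n + 1` derivatives. -/
def FreqSymbol (k C : ℝ) (a : Eu n × Eu n → ℂ) : Prop :=
  ∀ x, ContDiff ℝ ∞ (fun ξ => a (x, ξ)) ∧ ∀ m ≤ n + 1, ∀ ξ,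
    ‖iteratedFDeriv ℝ m (fun ξ => a (x, ξ)) ξ‖ ≤ C * bracket ξ ^ (k - m)

theorem FreqSymbol.nonneg {k C : ℝ} {a : Eu n × Eu n → ℂ} (h : FreqSymbol k C a) : 0 ≤ C := by
  have h1 := (norm_nonneg _).trans ((h 0).2 0 (Nat.zero_le _) 0)
  exact nonneg_of_mul_nonneg_left h1 (Real.rpow_pos_of_pos (bracket_pos _) _)

theorem FreqSymbol.norm_le {k C : ℝ} {a : Eu n × Eu n → ℂ} (h : FreqSymbol k C a) (z : Eu n × Eu n) :
    ‖a z‖ ≤ C * bracket z.2 ^ k := by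
  simpa using (h z.1).2 0 (Nat.zero_le _) z.2

theorem FreqSymbol.norm_le_of_nonpos {k C : ℝ} {a : Eu n × Eu n → ℂ} (h : FreqSymbol k C a)
    (hk : k ≤ 0) (z : Eu n × Eu n) : ‖a z‖ ≤ C :=
  (h.norm_le z).trans (mul_le_of_le_one_right h.nonneg
    (Real.rpow_le_one_of_one_le_of_nonpos (one_le_bracket _) hk))

/-- Away from the origin R^m ⟨Rη⟩^{k-m} is comparable to R^k for every m, so a piece at frequency R
gains R^k. The poor bound in |η| < 1/2 is harmless: there the cutoff of a dyadic piece vanishes, or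
R = 1. -/
theorem FreqSymbol.derivBound_dilate {k C R : ℝ} {a : Eu n × Eu n → ℂ} (h : FreqSymbol k C a)
    (hR : 1 ≤ R) (hk : k ≤ 0) (x : Eu n) :
    DerivBound (n + 1) (fun η => if ‖η‖ < 1 / 2 then C * R ^ (n + 1) else
      C * (2 ^ ((n : ℝ) + 1 - k) * R ^ k)) (fun η => a (x, R • η)) := by
  have hR0 : 0 < R := by linarith
  have hs := (h x).1
  refine ⟨hs.comp (contDiff_const_smul R), fun m hm η => ?_⟩
  have h1 : iteratedFDeriv ℝ m (fun η => a (x, R • η)) η =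
      R ^ m • iteratedFDeriv ℝ m (fun ξ => a (x, ξ)) (R • η) := by
    have := iteratedFDeriv_comp_const_smul (𝕜 := ℝ) (i := m)
      (f := fun ξ => a (x, ξ)) R (hs.of_le (by exact_mod_cast le_top))
    exact congrFun this η
  have hC := h.nonneg
  rw [h1]
  refine (ContinuousMultilinearMap.opNorm_smul_le _ _).trans ?_
  rw [Real.norm_of_nonneg (by positivity)]
  refine (mul_le_mul_of_nonneg_left ((h x).2 m hm (R • η)) (by positivity)).trans ?_
  have hkm : k - m ≤ 0 := by linarith [(Nat.cast_nonneg m : (0 : ℝ) ≤ m)]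
  beta_reduce
  split_ifs with hη
  · have h2 : bracket (R • η) ^ (k - m) ≤ 1 :=
      Real.rpow_le_one_of_one_le_of_nonpos (one_le_bracket _) hkm
    have h3 : R ^ m ≤ R ^ (n + 1) := pow_le_pow_right₀ hR hm
    calc R ^ m * (C * bracket (R • η) ^ (k - m)) ≤ R ^ (n + 1) * (C * 1) :=
          mul_le_mul h3 (mul_le_mul_of_nonneg_left h2 hC)
            (mul_nonneg hC (rpow_bracket_nonneg _ _)) (by positivity)
      _ = _ := by ring
  · have h2 : R / 2 ≤ bracket (R • η) := by
      refine le_trans ?_ (norm_le_bracket _)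
      rw [norm_smul, Real.norm_of_nonneg hR0.le]
      push Not at hη
      nlinarith
    have h3 : bracket (R • η) ^ (k - m) ≤ (R / 2) ^ (k - m) :=
      Real.rpow_le_rpow_of_nonpos (by positivity) h2 hkm
    have h4 : R ^ m * (R / 2) ^ (k - m) = 2 ^ ((m : ℝ) - k) * R ^ k := by
      rw [Real.div_rpow hR0.le zero_le_two, Real.rpow_sub hR0, Real.rpow_natCast,
        show (m : ℝ) - k = -(k - m) by ring, Real.rpow_neg zero_le_two]
      field_simp
    have h5 : (2 : ℝ) ^ ((m : ℝ) - k) ≤ 2 ^ ((n : ℝ) + 1 - k) := by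
      refine Real.rpow_le_rpow_of_exponent_le one_le_two ?_
      have : (m : ℝ) ≤ n + 1 := by exact_mod_cast hm
      linarith
    calc R ^ m * (C * bracket (R • η) ^ (k - m)) ≤ R ^ m * (C * (R / 2) ^ (k - m)) := by gcongr
      _ = C * (R ^ m * (R / 2) ^ (k - m)) := by ring
      _ = C * (2 ^ ((m : ℝ) - k) * R ^ k) := by rw [h4]
      _ ≤ _ := by gcongr

/-- Symbols of negative order have bounded quantizations, without any regularity in `x`. -/
theorem exists_formBound_of_freqSymbol (n : ℕ) {k : ℝ} (hk : k < 0) : ∃ K : ℝ, 0 < K ∧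
    ∀ (C τ : ℝ) (a : Eu n × Eu n → ℂ), τ ≠ 0 → AEStronglyMeasurable a → FreqSymbol k C a →
      FormBound (K * C) fun z => a (z.1, τ • z.2) := by
  obtain ⟨K, hK, hbd⟩ := exists_formBound_of_decay_snd_scaled n
  obtain ⟨φ, hφ, hφc, hφ1, hφn⟩ := exists_bump n
  -- the dyadic pieces on the unit scale
  let ψ : Eu n → ℂ := fun ξ => φ ξ - φ ((2 : ℝ) • ξ)
  have hφ2c : HasCompactSupport fun ξ : Eu n => φ ((2 : ℝ) • ξ) :=
    hφc.comp_homeomorph (Homeomorph.smulOfNeZero (2 : ℝ) two_ne_zero)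
  have hψ : ContDiff ℝ ∞ ψ := hφ.sub (hφ.comp (contDiff_const_smul _))
  have hψc : HasCompactSupport ψ := hφc.sub hφ2c
  have hψ0 : ∀ ξ, ‖ξ‖ < 1 / 2 → ψ ξ = 0 := fun ξ hξ => by
    have h2 : ‖(2 : ℝ) • ξ‖ ≤ 1 := by
      rw [norm_smul, Real.norm_of_nonneg zero_le_two]; linarith
    simp only [ψ]
    rw [hφ1 ξ (by linarith), hφ1 _ h2, sub_self]
  obtain ⟨M₁, hM₁, hb₁⟩ := exists_derivBound_decay_single hφ hφc (n + 1) ((n + 1 : ℕ) : ℝ)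
  obtain ⟨M₂, hM₂, hb₂⟩ := exists_derivBound_decay_single hψ hψc (n + 1) ((n + 1 : ℕ) : ℝ)
  -- The weight is set to zero where ψ vanishes, so that in the product with the dilated symbol the
  -- region without gain drops out.
  have hb₂' : DerivBound (n + 1) (fun ξ => if ‖ξ‖ < 1 / 2 then 0 else
      M₂ * bracket ξ ^ (-((n + 1 : ℕ) : ℝ))) ψ := by
    refine ⟨hψ, fun m hm ξ => ?_⟩
    beta_reduce
    split_ifs with hξ
    · have : ψ =ᶠ[𝓝 ξ] fun _ => 0 := by
        filter_upwards [(isOpen_lt continuous_norm continuous_const).mem_nhds hξ] with η hη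
        exact hψ0 η hη
      rw [(this.iteratedFDeriv ℝ m).eq_of_nhds]
      simp
    · exact hb₂.2 m hm ξ
  -- the pieces
  let θ : ℕ → Eu n → ℂ := fun j ξ =>
    if j = 0 then φ ξ else ψ (((2 : ℝ) ^ j)⁻¹ • ξ)
  have hθc : ∀ j, Continuous (θ j) := fun j => by
    by_cases hj : j = 0
    · simp only [θ, hj, if_true]; exact hφ.continuous
    · simp only [θ, hj, if_false]; exact hψ.continuous.comp (by fun_prop)
  have hsum : ∀ J ξ, ∑ j ∈ Finset.range (J + 1), θ j ξ = φ (((2 : ℝ) ^ J)⁻¹ • ξ) := fun J ξ => by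
    induction J with
    | zero => simp [θ]
    | succ J ih =>
      rw [Finset.sum_range_succ, ih]
      simp only [θ, ψ, Nat.succ_ne_zero, if_false, smul_smul]
      rw [show (2 : ℝ) * (2 ^ (J + 1))⁻¹ = (2 ^ J)⁻¹ by rw [pow_succ]; field_simp]
      ring
  have hθn : ∀ j ξ, ‖θ j ξ‖ ≤ 2 := fun j ξ => by
    by_cases hj : j = 0
    · simp only [θ, hj, if_true]; exact (hφn ξ).trans one_le_two
    · simp only [θ, hj, if_false, ψ]
      refine (norm_sub_le _ _).trans ?_
      linarith [hφn (((2 : ℝ) ^ j)⁻¹ • ξ), hφn ((2 : ℝ) • ((2 : ℝ) ^ j)⁻¹ • ξ)]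
  -- The piece at frequency 2^j gains (2^j)^k = q^j. The negative order gives q < 1, hence a
  -- summable series with total (1-q)^{-1}.
  set q : ℝ := 2 ^ k with hq
  have hq0 : 0 < q := by positivity
  have hq1 : q < 1 := Real.rpow_lt_one_of_one_lt_of_neg one_lt_two hk
  set D : ℝ := 2 ^ (n + 1) * (2 ^ ((n : ℝ) + 1 - k) * (M₁ + M₂) + M₁ + M₂) with hD
  have hD0 : 0 ≤ D := by positivity
  refine ⟨K * (D + 1) * (1 - q)⁻¹, by
    have : 0 < (1 - q)⁻¹ := inv_pos.2 (by linarith)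
    positivity, fun C τ a hτ ham ha => ?_⟩
  have hC := ha.nonneg
  have hpiece : ∀ j : ℕ, FormBound (K * (D * C) * q ^ j)
      (fun z : Eu n × Eu n => a (z.1, τ • z.2) * θ j (τ • z.2)) := by
    intro j
    have hR : (1 : ℝ) ≤ 2 ^ j := one_le_pow₀ one_le_two
    have hR0 : (0 : ℝ) < 2 ^ j := by positivity
    have hqj : ((2 : ℝ) ^ j) ^ k = q ^ j := by
      rw [hq, ← Real.rpow_natCast, ← Real.rpow_natCast, ← Real.rpow_mul zero_le_two,
        ← Real.rpow_mul zero_le_two, mul_comm]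
    rw [mul_assoc]
    refine hbd (D * C * q ^ j) (2 ^ j / τ) _ (div_ne_zero hR0.ne' hτ) ?_ fun x => ?_
    · exact (aestronglyMeasurable_comp_smul_snd ham hτ).mul
        ((hθc j).comp (by fun_prop)).aestronglyMeasurable
    · have hτs : ∀ ξ : Eu n, τ • ((2 : ℝ) ^ j / τ) • ξ = (2 : ℝ) ^ j • ξ := fun ξ => by
        rw [smul_smul, mul_div_cancel₀ _ hτ]
      simp only [hτs]
      have hb := ha.derivBound_dilate hR hk.le x
      by_cases hj : j = 0
      · subst hj
        simp only [θ, if_true, pow_zero, one_smul, mul_one] at hb ⊢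
        refine ((hb.mul hb₁)).mono fun ξ => ?_
        have hw := rpow_bracket_nonneg (-((n + 1 : ℕ) : ℝ)) ξ
        simp only [one_pow, Real.one_rpow, mul_one]
        have h2 : (if ‖ξ‖ < 1 / 2 then C else C * 2 ^ ((n : ℝ) + 1 - k)) ≤
            C * (2 ^ ((n : ℝ) + 1 - k) + 1) := by
          split_ifs
          · have : (0 : ℝ) ≤ 2 ^ ((n : ℝ) + 1 - k) := by positivity
            nlinarith
          · nlinarith
        calc _ ≤ 2 ^ (n + 1) * (C * (2 ^ ((n : ℝ) + 1 - k) + 1) *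
              (M₁ * bracket ξ ^ (-((n + 1 : ℕ) : ℝ)))) := by
              refine mul_le_mul_of_nonneg_left (mul_le_mul_of_nonneg_right h2 ?_) (by positivity)
              exact mul_nonneg hM₁ hw
          _ = (2 ^ (n + 1) * (2 ^ ((n : ℝ) + 1 - k) * M₁ + M₁)) * C *
              bracket ξ ^ (-((n + 1 : ℕ) : ℝ)) := by ring
          _ ≤ _ := by
              refine mul_le_mul_of_nonneg_right (mul_le_mul_of_nonneg_right ?_ hC) hw
              rw [hD]
              refine mul_le_mul_of_nonneg_left ?_ (by positivity)
              have : (0 : ℝ) ≤ 2 ^ ((n : ℝ) + 1 - k) * M₂ := by positivity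
              nlinarith
      · have hθj : ∀ ξ : Eu n, θ j ((2 : ℝ) ^ j • ξ) = ψ ξ := fun ξ => by
          simp only [θ, hj, if_false, smul_smul]
          rw [inv_mul_cancel₀ hR0.ne', one_smul]
        simp only [hθj]
        refine ((hb.mul hb₂')).mono fun ξ => ?_
        have hw := rpow_bracket_nonneg (-((n + 1 : ℕ) : ℝ)) ξ
        rw [hqj]
        split_ifs with hξ
        · rw [mul_zero, mul_zero]; positivity
        · calc _ = (2 ^ (n + 1) * (2 ^ ((n : ℝ) + 1 - k) * M₂)) * (C * q ^ j *
              bracket ξ ^ (-((n + 1 : ℕ) : ℝ))) := by ring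
            _ ≤ D * (C * q ^ j * bracket ξ ^ (-((n + 1 : ℕ) : ℝ))) := by
              refine mul_le_mul_of_nonneg_right ?_ (by positivity)
              rw [hD]
              refine mul_le_mul_of_nonneg_left ?_ (by positivity)
              have : (0 : ℝ) ≤ 2 ^ ((n : ℝ) + 1 - k) * M₁ := by positivity
              nlinarith
            _ = _ := by ring
  have hmeas := aestronglyMeasurable_comp_smul_snd ham hτ
  have han : ∀ z : Eu n × Eu n, ‖a (z.1, τ • z.2)‖ ≤ C := fun z => ha.norm_le_of_nonpos hk.le _
  -- The first J + 1 pieces telescope to a φ(2^{-J}·). These truncations have uniformly bounded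
  -- forms and converge pointwise to a.
  refine FormBound.of_tendsto (c := fun J (z : Eu n × Eu n) =>
    a (z.1, τ • z.2) * φ (((2 : ℝ) ^ J)⁻¹ • τ • z.2)) (M := fun _ => K * (D + 1) * (1 - q)⁻¹ * C)
    (fun J f g => ?_) tendsto_const_nhds (tendsto_form (M := C * 1) (fun J => ?_) (fun J z => ?_)
      (Eventually.of_forall fun z => ?_))
  · have h1 : ‖form (fun z : Eu n × Eu n => ∑ j ∈ Finset.range (J + 1),
        a (z.1, τ • z.2) * θ j (τ • z.2)) f g‖ ≤ ∑ j ∈ Finset.range (J + 1),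
          K * (D * C) * q ^ j * (‖schwartzToL2 f‖ * ‖schwartzToL2 g‖) := by
      refine norm_form_sum_le (M := fun _ => C * 2) _ (fun j => ?_) (fun j z => ?_)
        fun j _ => hpiece j f g
      · exact hmeas.mul ((hθc j).comp (by fun_prop)).aestronglyMeasurable
      · exact (norm_mul (a (z.1, τ • z.2)) (θ j (τ • z.2))).le.trans
          (mul_le_mul (han z) (hθn j _) (norm_nonneg _) hC)
    rw [form_congr (c' := fun z : Eu n × Eu n => ∑ j ∈ Finset.range (J + 1),
        a (z.1, τ • z.2) * θ j (τ • z.2)) fun z => by rw [← Finset.mul_sum, hsum]]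
    refine h1.trans ?_
    rw [← Finset.sum_mul, ← Finset.mul_sum]
    refine mul_le_mul_of_nonneg_right ?_ (by positivity)
    have hgeo : ∑ j ∈ Finset.range (J + 1), q ^ j ≤ (1 - q)⁻¹ := by
      rw [← tsum_geometric_of_lt_one hq0.le hq1]
      exact (summable_geometric_of_lt_one hq0.le hq1).sum_le_tsum _ fun _ _ => by positivity
    have h0 : 0 ≤ (1 - q)⁻¹ := inv_nonneg.2 (by linarith)
    calc K * (D * C) * ∑ j ∈ Finset.range (J + 1), q ^ j ≤ K * ((D + 1) * C) * (1 - q)⁻¹ := by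
          gcongr; linarith
      _ = _ := by ring
  · exact hmeas.mul (hφ.continuous.comp (by fun_prop)).aestronglyMeasurable
  · rw [norm_mul]
    exact mul_le_mul (han z) (hφn _) (norm_nonneg _) hC
  · have h1 : Tendsto (fun J : ℕ => ((2 : ℝ) ^ J)⁻¹ • τ • z.2) atTop (𝓝 0) := by
      have : Tendsto (fun J : ℕ => ((2 : ℝ) ^ J)⁻¹) atTop (𝓝 0) :=
        tendsto_inv_atTop_zero.comp (tendsto_pow_atTop_atTop_of_one_lt one_lt_two)
      simpa using this.smul_const (τ • z.2)
    have h2 := (hφ.continuous.tendsto 0).comp h1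
    rw [hφ1 0 (by simp)] at h2
    simpa using h2.const_mul (a (z.1, τ • z.2))

end

section

/-! ### Iterated directional derivatives -/

section Words

variable {V V' ι : Type*} [NormedAddCommGroup V] [NormedSpace ℝ V]
  [NormedAddCommGroup V'] [NormedSpace ℝ V']

/-- The iterated derivative of `F` in the directions `e i`, with `i` running through a list. -/
def dirs (e : ι → V) (u : List ι) (F : V → ℂ) : V → ℂ := u.foldr (fun i G => dirD (e i) G) F

theorem dirs_nil (e : ι → V) (F : V → ℂ) : dirs e [] F = F := rfl

theorem dirs_cons (e : ι → V) (i : ι) (u : List ι) (F : V → ℂ) :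
    dirs e (i :: u) F = dirD (e i) (dirs e u F) := rfl

theorem dirs_append (e : ι → V) (u w : List ι) (F : V → ℂ) :
    dirs e (u ++ w) F = dirs e u (dirs e w F) := by
  simp [dirs, List.foldr_append]

theorem contDiff_dirs (e : ι → V) {F : V → ℂ} (hF : ContDiff ℝ ∞ F) (u : List ι) :
    ContDiff ℝ ∞ (dirs e u F) := by
  induction u with
  | nil => exact hF
  | cons i u ih => exact contDiff_dirD ih _

theorem hasCompactSupport_dirs (e : ι → V) {F : V → ℂ} (hF : HasCompactSupport F) (u : List ι) :
    HasCompactSupport (dirs e u F) := by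
  induction u with
  | nil => exact hF
  | cons i u ih => exact hasCompactSupport_dirD ih _

theorem dirD_comm {F : V → ℂ} (hF : ContDiff ℝ ∞ F) (v w : V) :
    dirD v (dirD w F) = dirD w (dirD v F) := by
  have h1 : Differentiable ℝ (fderiv ℝ F) :=
    (hF.fderiv_right (m := ∞) (by simp)).differentiable (by simp)
  have h2 : ∀ a b z, dirD a (dirD b F) z = fderiv ℝ (fderiv ℝ F) z a b := fun a b z => by
    have := ((h1 z).hasFDerivAt.clm_apply (hasFDerivAt_const b z)).fderiv
    change fderiv ℝ (fun y => fderiv ℝ F y b) z a = _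
    rw [this]
    simp
  funext z
  rw [h2, h2]
  have hs : IsSymmSndFDerivAt ℝ F z :=
    hF.contDiffAt.isSymmSndFDerivAt (by
      rw [minSmoothness_of_isRCLikeNormedField]
      exact WithTop.coe_le_coe.2 (le_top : (2 : ℕ∞) ≤ ⊤))
  exact hs v w

theorem dirs_dirD (e : ι → V) {F : V → ℂ} (hF : ContDiff ℝ ∞ F) (u : List ι) (v : V) :
    dirs e u (dirD v F) = dirD v (dirs e u F) := by
  induction u with
  | nil => rfl
  | cons i u ih => rw [dirs_cons, ih, dirs_cons, dirD_comm (contDiff_dirs e hF u)]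

theorem dirs_comm {ι' : Type*} (e : ι → V) (e' : ι' → V) {F : V → ℂ} (hF : ContDiff ℝ ∞ F)
    (u : List ι) (w : List ι') : dirs e u (dirs e' w F) = dirs e' w (dirs e u F) := by
  induction w with
  | nil => rfl
  | cons j w ih => rw [dirs_cons, dirs_dirD e (contDiff_dirs e' hF w), ih, dirs_cons]

theorem dirs_perm (e : ι → V) {F : V → ℂ} (hF : ContDiff ℝ ∞ F) {u w : List ι}
    (h : u.Perm w) : dirs e u F = dirs e w F := by
  induction h with
  | nil => rfl
  | cons x _ ih => rw [dirs_cons, ih, dirs_cons]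
  | swap x y l => exact dirD_comm (contDiff_dirs e hF l) _ _
  | trans _ _ h1 h2 => exact h1.trans h2

theorem dirD_const_mul {F : V → ℂ} (hF : ContDiff ℝ ∞ F) (c : ℂ) (v : V) :
    dirD v (fun z => c * F z) = fun z => c * dirD v F z := by
  funext z
  rw [dirD, fderiv_const_mul ((hF.differentiable (by simp)) z)]
  rfl

theorem dirs_comp_affine (e : ι → V') (e' : ι → V) {F : V → ℂ} (hF : ContDiff ℝ ∞ F)
    (L : V' →L[ℝ] V) (p : V) (t : ℝ) (hL : ∀ i, L (e i) = t • e' i) (u : List ι) (z : V') :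
    dirs e u (fun z => F (L z + p)) z = (t : ℂ) ^ u.length * dirs e' u F (L z + p) := by
  induction u generalizing z with
  | nil => simp [dirs_nil]
  | cons i u ih =>
    rw [dirs_cons, show dirs e u (fun z => F (L z + p)) = fun z => (t : ℂ) ^ u.length *
      (fun z => dirs e' u F (L z + p)) z from funext ih]
    have hs := contDiff_dirs e' hF u
    rw [dirD_const_mul (by fun_prop)]
    beta_reduce
    rw [dirD_comp_affine hs, hL, dirs_cons, List.length_cons]
    simp only [dirD, map_smul, Complex.real_smul]
    ring

theorem norm_dirs_le (e : ι → V) (he : ∀ i, ‖e i‖ ≤ 1) {F : V → ℂ} (hF : ContDiff ℝ ∞ F)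
    (u : List ι) (m : ℕ) (z : V) :
    ‖iteratedFDeriv ℝ m (dirs e u F) z‖ ≤ ‖iteratedFDeriv ℝ (m + u.length) F z‖ := by
  induction u generalizing m with
  | nil => simp [dirs_nil]
  | cons i u ih =>
    have h1 : DerivBound (m + 1) (fun z => ‖iteratedFDeriv ℝ m (fderiv ℝ (dirs e u F)) z‖ +
      ∑ j ∈ Finset.range (m + 2), ‖iteratedFDeriv ℝ j (dirs e u F) z‖) (dirs e u F) :=
      ⟨contDiff_dirs e hF u, fun j hj z => (Finset.single_le_sum
        (f := fun j => ‖iteratedFDeriv ℝ j (dirs e u F) z‖) (fun _ _ => norm_nonneg _)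
        (Finset.mem_range.2 (by omega))).trans (le_add_of_nonneg_left (norm_nonneg _))⟩
    have hs : ContDiff ℝ ∞ (fderiv ℝ (dirs e u F)) :=
      (contDiff_dirs e hF u).fderiv_right (m := ∞) (by simp)
    let A : (V →L[ℝ] ℂ) →L[ℝ] ℂ := ContinuousLinearMap.apply ℝ ℂ (e i)
    have h2 : dirs e (i :: u) F = A ∘ fderiv ℝ (dirs e u F) := rfl
    rw [h2, A.iteratedFDeriv_comp_left (hs.contDiffAt (x := z)) (by exact_mod_cast le_top)]
    refine (ContinuousLinearMap.norm_compContinuousMultilinearMap_le _ _).trans ?_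
    have hA : ‖A‖ ≤ 1 := ContinuousLinearMap.opNorm_le_bound _ zero_le_one fun T => by
      rw [one_mul]
      exact (T.le_opNorm _).trans (mul_le_of_le_one_right (norm_nonneg _) (he i))
    refine (mul_le_of_le_one_left (norm_nonneg _) hA).trans ?_
    rw [norm_iteratedFDeriv_fderiv]
    refine (ih (m + 1)).trans (le_of_eq ?_)
    rw [List.length_cons, add_right_comm, add_assoc]

/-- Iterated derivatives are controlled by the derivatives in the directions of a frame. -/
theorem norm_iteratedFDeriv_succ_le [Fintype ι] (e : ι → V) (p : ι → V →L[ℝ] ℝ)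
    (hp : ∀ i, ‖p i‖ ≤ 1) (he : ∀ v, v = ∑ i, p i v • e i) {F : V → ℂ} (hF : ContDiff ℝ ∞ F)
    (m : ℕ) (z : V) :
    ‖iteratedFDeriv ℝ (m + 1) F z‖ ≤ ∑ i, ‖iteratedFDeriv ℝ m (dirD (e i) F) z‖ := by
  let L : ι → ℂ →L[ℝ] (V →L[ℝ] ℂ) := fun i => ContinuousLinearMap.smulRightL ℝ V ℂ (p i)
  have hL : ∀ i, ‖L i‖ ≤ 1 := fun i =>
    ContinuousLinearMap.opNorm_le_bound _ zero_le_one fun c => by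
      change ‖(p i).smulRight c‖ ≤ _
      rw [ContinuousLinearMap.norm_smulRight_apply]
      exact mul_le_mul_of_nonneg_right (hp i) (norm_nonneg _)
  have h1 : fderiv ℝ F = fun z => ∑ i, (L i ∘ dirD (e i) F) z := by
    funext z
    ext v
    rw [_root_.sum_apply]
    conv_lhs => rw [he v, map_sum]
    refine Finset.sum_congr rfl fun i _ => ?_
    rw [map_smul]
    rfl
  have hs : ∀ i, ContDiff ℝ ∞ (dirD (e i) F) := fun i => contDiff_dirD hF _
  rw [← norm_iteratedFDeriv_fderiv, h1, iteratedFDeriv_fun_sum_apply fun i _ =>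
    (((L i).contDiff.comp (hs i)).of_le (by exact_mod_cast le_top)).contDiffAt]
  refine (norm_sum_le _ _).trans (Finset.sum_le_sum fun i _ => ?_)
  rw [(L i).iteratedFDeriv_comp_left ((hs i).contDiffAt (x := z)) (by exact_mod_cast le_top)]
  exact (ContinuousLinearMap.norm_compContinuousMultilinearMap_le _ _).trans
    (mul_le_of_le_one_left (norm_nonneg _) (hL i))

theorem norm_iteratedFDeriv_le_of_dirs [Fintype ι] (e : ι → V) (p : ι → V →L[ℝ] ℝ)
    (hp : ∀ i, ‖p i‖ ≤ 1) (he : ∀ v, v = ∑ i, p i v • e i) {F : V → ℂ} (hF : ContDiff ℝ ∞ F)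
    (m : ℕ) (z : V) {B : ℝ} (hB : ∀ u : List ι, u.length = m → ‖dirs e u F z‖ ≤ B) :
    ‖iteratedFDeriv ℝ m F z‖ ≤ (Fintype.card ι : ℝ) ^ m * B := by
  induction m generalizing F with
  | zero => simpa [dirs_nil] using hB [] rfl
  | succ m ih =>
    refine (norm_iteratedFDeriv_succ_le e p hp he hF m z).trans ?_
    refine (Finset.sum_le_sum fun i _ => ih (contDiff_dirD hF (e i)) fun u hu => ?_).trans ?_
    · have := hB (u ++ [i]) (by simp [hu])
      rwa [dirs_append] at this
    · rw [Finset.sum_const, Finset.card_univ, nsmul_eq_mul, pow_succ]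
      exact le_of_eq (by ring)

end Words

/-! ### Words in the coordinates and their relation to multi-indices. -/

variable {n : ℕ}

/-- Derivatives in `x` along a list of coordinates. -/
def dXs (w : List (Fin n)) (F : Eu n × Eu n → ℂ) : Eu n × Eu n → ℂ :=
  dirs (fun j => ((eb j : Eu n), (0 : Eu n))) w F

/-- Derivatives in `ξ` along a list of coordinates. -/
def dXis (u : List (Fin n)) (F : Eu n × Eu n → ℂ) : Eu n × Eu n → ℂ :=
  dirs (fun j => ((0 : Eu n), (eb j : Eu n))) u F

/-- Derivatives on `ℝⁿ` along a list of coordinates. -/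
def dE (u : List (Fin n)) (f : Eu n → ℂ) : Eu n → ℂ := dirs (fun j => (eb j : Eu n)) u f

theorem dXis_apply {F : Eu n × Eu n → ℂ} (hF : ContDiff ℝ ∞ F) (u : List (Fin n)) (x ξ : Eu n) :
    dXis u F (x, ξ) = dE u (fun η => F (x, η)) ξ := by
  have h := dirs_comp_affine (fun j => (eb j : Eu n)) (fun j => ((0 : Eu n), (eb j : Eu n))) hF
    (ContinuousLinearMap.inr ℝ (Eu n) (Eu n)) (x, 0) 1 (fun i => by simp) u ξ
  simpa [dXis, dE] using h.symm

theorem dXs_apply {F : Eu n × Eu n → ℂ} (hF : ContDiff ℝ ∞ F) (u : List (Fin n)) (x ξ : Eu n) :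
    dXs u F (x, ξ) = dE u (fun y => F (y, ξ)) x := by
  have h := dirs_comp_affine (fun j => (eb j : Eu n)) (fun j => ((eb j : Eu n), (0 : Eu n))) hF
    (ContinuousLinearMap.inl ℝ (Eu n) (Eu n)) (0, ξ) 1 (fun i => by simp) u x
  simpa [dXs, dE] using h.symm

/-- Partial derivatives commute, so only the multiplicities in the word matter. Words are convenient
for induction; the symbol classes are stated with multi-indices. -/
theorem dE_eq_multiD {f : Eu n → ℂ} (hf : ContDiff ℝ ∞ f) (u : List (Fin n)) :
    dE u f = multiD (fun i => u.count i) f := by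
  have h1 : ∀ (α : MIdx n) (l : List (Fin n)),
      l.foldr (fun i g => (partialD i)^[α i] g) f =
        dE (l.flatMap fun i => List.replicate (α i) i) f := by
    intro α l
    induction l with
    | nil => rfl
    | cons i l ih =>
      rw [List.foldr_cons, ih, List.flatMap_cons]
      unfold dE
      rw [dirs_append]
      generalize dirs (fun j => (eb j : Eu n)) (l.flatMap fun i => List.replicate (α i) i) f = g
      induction α i with
      | zero => rfl
      | succ k ihk => rw [Function.iterate_succ_apply', ihk]; rfl
  rw [multiD, h1]
  refine dirs_perm _ hf (List.perm_iff_count.2 fun i => ?_)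
  rw [List.count_flatMap]
  simp only [Function.comp_def, List.count_replicate]
  rw [← Fin.sum_univ_def]
  simp

theorem len_count (u : List (Fin n)) : len (fun i => u.count i) = u.length := by
  unfold len
  simpa using (Multiset.sum_count_eq_card (s := Finset.univ) (m := (u : Multiset (Fin n)))
    (fun _ _ => Finset.mem_univ _))

/-- Bounds for all partial derivatives up to some order give bounds on iterated derivatives. -/
theorem derivBound_of_words {N : ℕ} {W : Eu n × Eu n → ℝ} {F : Eu n × Eu n → ℂ}
    (hF : ContDiff ℝ ∞ F)
    (h : ∀ u w : List (Fin n), u.length + w.length ≤ N → ∀ z, ‖dXis u (dXs w F) z‖ ≤ W z) :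
    DerivBound N (fun z => (2 * n + 1) ^ N * W z) F := by
  induction N generalizing F with
  | zero =>
    refine ⟨hF, fun m hm z => ?_⟩
    obtain rfl : m = 0 := by omega
    simpa [dXis, dXs, dirs_nil] using h [] [] (by simp) z
  | succ N ih =>
    have h1 : ∀ j, DerivBound N (fun z => (2 * n + 1) ^ N * W z) (dX j F) := fun j =>
      ih (contDiff_dirD hF _) fun u w huw z => by
        have := h u (w ++ [j]) (by simp; omega) z
        rwa [dXs, dirs_append] at this
    have h2 : ∀ j, DerivBound N (fun z => (2 * n + 1) ^ N * W z) (dXi j F) := fun j =>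
      ih (contDiff_dirD hF _) fun u w huw z => by
        have := h (u ++ [j]) w (by simp; omega) z
        rw [dXis, dirs_append] at this
        rwa [dXs, dXi, dirs_dirD _ hF]
    refine ⟨hF, fun m hm z => ?_⟩
    have hW : 0 ≤ W z := (norm_nonneg _).trans (h [] [] (by simp) z)
    have hn : (1 : ℝ) ≤ (2 * n + 1) := by
      have : (0 : ℝ) ≤ n := Nat.cast_nonneg n
      linarith
    rcases m with _ | m
    · have := h [] [] (by simp) z
      rw [norm_iteratedFDeriv_zero]
      exact this.trans (le_mul_of_one_le_left hW (one_le_pow₀ hn))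
    · have hm : m ≤ N := by omega
      let e : Fin n ⊕ Fin n → Eu n × Eu n := Sum.elim (fun j => (eb j, 0)) (fun j => (0, eb j))
      let p : Fin n ⊕ Fin n → (Eu n × Eu n) →L[ℝ] ℝ := Sum.elim
        (fun j => (EuclideanSpace.proj j).comp (ContinuousLinearMap.fst ℝ (Eu n) (Eu n)))
        (fun j => (EuclideanSpace.proj j).comp (ContinuousLinearMap.snd ℝ (Eu n) (Eu n)))
      have hp : ∀ i, ‖p i‖ ≤ 1 := by
        rintro (j | j) <;> refine ContinuousLinearMap.opNorm_le_bound _ zero_le_one fun v => ?_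
        · rw [one_mul]
          exact (PiLp.norm_apply_le v.1 j).trans (_root_.norm_fst_le v)
        · rw [one_mul]
          exact (PiLp.norm_apply_le v.2 j).trans (_root_.norm_snd_le v)
      have he : ∀ v, v = ∑ i, p i v • e i := fun v => by
        rw [Fintype.sum_sum_type]
        refine Prod.ext ?_ ?_
        · simp only [Prod.fst_add, Prod.fst_sum]
          simpa [p, e] using eu_eq_sum v.1
        · simp only [Prod.snd_add, Prod.snd_sum]
          simpa [p, e] using eu_eq_sum v.2
      refine (norm_iteratedFDeriv_succ_le e p hp he hF m z).trans ?_
      rw [Fintype.sum_sum_type]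
      refine (add_le_add (Finset.sum_le_sum fun j _ => (h1 j).2 m hm z)
        (Finset.sum_le_sum fun j _ => (h2 j).2 m hm z)).trans ?_
      simp only [Finset.sum_const, Finset.card_univ, Fintype.card_fin, nsmul_eq_mul]
      have : (0 : ℝ) ≤ (2 * n + 1) ^ N * W z := by positivity
      rw [pow_succ]
      nlinarith

theorem norm_iteratedFDeriv_le_of_dE {f : Eu n → ℂ} (hf : ContDiff ℝ ∞ f) (m : ℕ) (ξ : Eu n)
    {B : ℝ} (hB : ∀ u : List (Fin n), u.length = m → ‖dE u f ξ‖ ≤ B) :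
    ‖iteratedFDeriv ℝ m f ξ‖ ≤ (n : ℝ) ^ m * B := by
  have := norm_iteratedFDeriv_le_of_dirs (fun j => (eb j : Eu n)) (fun j => EuclideanSpace.proj j)
    (fun j => ContinuousLinearMap.opNorm_le_bound _ zero_le_one fun v => by
      rw [one_mul]; exact PiLp.norm_apply_le v j) (fun v => eu_eq_sum v) hf m ξ hB
  simpa using this

theorem norm_dE_le {f : Eu n → ℂ} (hf : ContDiff ℝ ∞ f) (u : List (Fin n)) (ξ : Eu n) :
    ‖dE u f ξ‖ ≤ ‖iteratedFDeriv ℝ u.length f ξ‖ := by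
  have := norm_dirs_le (fun j => (eb j : Eu n)) (fun j => (norm_eb j).le) hf u 0 ξ
  rwa [zero_add, norm_iteratedFDeriv_zero] at this

end

section

/-! ### Regularization in the space variable -/

variable {n : ℕ}

open Filter Topology

/-- Families `b y` of smooth functions, measurable in `y`, with locally uniform bounds. -/
structure FreqFamily (b : Eu n → Eu n → ℂ) : Prop where
  smooth : ∀ y, ContDiff ℝ ∞ (b y)
  meas : ∀ ξ, AEStronglyMeasurable fun y => b y ξ
  bdd : ∀ (m : ℕ) (ξ₀ : Eu n), ∃ B : ℝ, ∀ᶠ ξ in 𝓝 ξ₀, ∀ y, ‖iteratedFDeriv ℝ m (b y) ξ‖ ≤ B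

theorem FreqFamily.dirD {b : Eu n → Eu n → ℂ} (hb : FreqFamily b) (v : Eu n) (hv : ‖v‖ ≤ 1) :
    FreqFamily fun y => dirD v (b y) := by
  refine ⟨fun y => contDiff_dirD (hb.smooth y) v, fun ξ => ?_, fun m ξ₀ => ?_⟩
  · exact (ContinuousLinearMap.apply ℝ ℂ v).continuous.comp_aestronglyMeasurable
      (aestronglyMeasurable_fderiv_param (F := fun ξ y => b y ξ)
        (fun y => (hb.smooth y).differentiable (by simp)) hb.meas ξ)
  · obtain ⟨B, hB⟩ := hb.bdd (m + 1) ξ₀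
    refine ⟨B, hB.mono fun ξ hξ y => ?_⟩
    exact (norm_dirs_le (fun _ : Unit => v) (fun _ => hv) (hb.smooth y) [()] m ξ).trans (hξ y)

theorem FreqFamily.dE {b : Eu n → Eu n → ℂ} (hb : FreqFamily b) (u : List (Fin n)) :
    FreqFamily fun y => dE u (b y) := by
  induction u with
  | nil => exact hb
  | cons j u ih => exact ih.dirD (eb j) (norm_eb j).le

theorem exists_derivBound_indicator {ρ : Eu n → ℂ} (hρ : ContDiff ℝ ∞ ρ) (hc : HasCompactSupport ρ)
    (N : ℕ) : ∃ M : ℝ, 0 ≤ M ∧ DerivBound N ((tsupport ρ).indicator fun _ => M) ρ := by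
  obtain ⟨M, hM, h⟩ := exists_derivBound_of_hasCompactSupport hρ hc N
  refine ⟨M, hM, hρ, fun m hm z => ?_⟩
  by_cases hz : z ∈ tsupport ρ
  · rw [Set.indicator_of_mem hz]
    exact h.2 m hm z
  · rw [Set.indicator_of_notMem hz, image_eq_zero_of_notMem_tsupport
      (fun h' => hz (tsupport_iteratedFDeriv_subset m h')), norm_zero]

/-- Regularization of `b` in the first variable by convolution with `ρ`. -/
def mollX (ρ : Eu n → ℂ) (b : Eu n → Eu n → ℂ) (z : Eu n × Eu n) : ℂ :=
  ∫ y, ρ (z.1 - y) * b y z.2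

section

variable {ρ : Eu n → ℂ} {b : Eu n → Eu n → ℂ}

theorem contDiff_mollX_integrand (hρ : ContDiff ℝ ∞ ρ) (hb : FreqFamily b) (y : Eu n) :
    ContDiff ℝ ∞ fun z : Eu n × Eu n => ρ (z.1 - y) * b y z.2 :=
  (hρ.comp (contDiff_fst.sub contDiff_const)).mul ((hb.smooth y).comp contDiff_snd)

theorem aestronglyMeasurable_mollX_integrand (hρ : ContDiff ℝ ∞ ρ) (hb : FreqFamily b)
    (z : Eu n × Eu n) : AEStronglyMeasurable fun y => ρ (z.1 - y) * b y z.2 :=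
  (hρ.continuous.comp (by fun_prop)).aestronglyMeasurable.mul (hb.meas z.2)

/-- For z near z₀ the integrand lives in a fixed ball of y, and the ξ-derivatives of b are bounded
there locally uniformly in ξ. This is the domination that allows differentiation under the integral.
-/
theorem exists_bound_mollX_integrand (hρ : ContDiff ℝ ∞ ρ) (hc : HasCompactSupport ρ)
    (hb : FreqFamily b) (m : ℕ) (z₀ : Eu n × Eu n) :
    ∃ s ∈ 𝓝 z₀, ∃ bound : Eu n → ℝ, Integrable bound ∧ ∀ z ∈ s, ∀ y,
      ‖iteratedFDeriv ℝ m (fun z : Eu n × Eu n => ρ (z.1 - y) * b y z.2) z‖ ≤ bound y := by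
  obtain ⟨M, hM, hρM⟩ := exists_derivBound_indicator hρ hc m
  choose B hB using fun i => hb.bdd i z₀.2
  obtain ⟨R, hR⟩ := hc.isBounded.subset_closedBall (0 : Eu n)
  obtain ⟨D, hD⟩ : ∃ D : ℝ, D = ∑ i ∈ Finset.range (m + 1), (m.choose i : ℝ) * M * |B (m - i)| :=
    ⟨_, rfl⟩
  refine ⟨{z | dist z.1 z₀.1 < 1 ∧ ∀ i ∈ Finset.range (m + 1), ∀ y,
      ‖iteratedFDeriv ℝ i (b y) z.2‖ ≤ B i}, ?_,
    (Metric.closedBall z₀.1 (R + 1)).indicator fun _ => D, ?_, fun z hz y => ?_⟩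
  · have h1 : ∀ᶠ z in 𝓝 z₀, dist z.1 z₀.1 < 1 :=
      continuous_fst.continuousAt.eventually (Metric.ball_mem_nhds z₀.1 one_pos)
    have h2 : ∀ᶠ z in 𝓝 z₀, ∀ i ∈ Finset.range (m + 1), ∀ y,
        ‖iteratedFDeriv ℝ i (b y) z.2‖ ≤ B i :=
      (Finset.eventually_all _).2 fun i _ => continuous_snd.continuousAt.eventually (hB i)
    exact h1.and h2
  · exact (integrable_indicator_iff measurableSet_closedBall).2
      (integrableOn_const (measure_closedBall_lt_top.ne))
  · obtain ⟨hz1, hz2⟩ := hz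
    have d1 := hρM.comp_affine (ContinuousLinearMap.fst ℝ (Eu n) (Eu n)) (-y) le_rfl
      (ContinuousLinearMap.norm_fst_le ..)
    have hs1 : ContDiff ℝ ∞ fun z : Eu n × Eu n => ρ (z.1 - y) :=
      hρ.comp (contDiff_fst.sub contDiff_const)
    have hs2 : ContDiff ℝ ∞ fun z : Eu n × Eu n => b y z.2 := (hb.smooth y).comp contDiff_snd
    have h2 : ∀ i, ‖iteratedFDeriv ℝ i (fun z : Eu n × Eu n => b y z.2) z‖ ≤
        ‖iteratedFDeriv ℝ i (b y) z.2‖ := fun i => by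
      have := ContinuousLinearMap.iteratedFDeriv_comp_right (ContinuousLinearMap.snd ℝ (Eu n) (Eu n))
        (hb.smooth y) z (i := i) (by exact_mod_cast le_top)
      rw [show (fun z : Eu n × Eu n => b y z.2) = b y ∘ ContinuousLinearMap.snd ℝ (Eu n) (Eu n) from rfl,
        this]
      refine (ContinuousMultilinearMap.norm_compContinuousLinearMap_le _ _).trans ?_
      refine mul_le_of_le_one_right (norm_nonneg _) (Finset.prod_le_one (fun _ _ => norm_nonneg _)
        fun _ _ => ContinuousLinearMap.norm_snd_le ..)
    have h3 := norm_iteratedFDeriv_mul_le hs1 hs2 z (n := m) (by exact_mod_cast le_top)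
    refine h3.trans ?_
    have h1 : ∀ i ≤ m, ‖iteratedFDeriv ℝ i (fun z : Eu n × Eu n => ρ (z.1 - y)) z‖ ≤
        (tsupport ρ).indicator (fun _ => M) (z.1 - y) := fun i hi => by
      have := d1.2 i hi z
      simpa [sub_eq_add_neg] using this
    by_cases hy : z.1 - y ∈ tsupport ρ
    · have hy' : y ∈ Metric.closedBall z₀.1 (R + 1) := by
        have h4 := hR hy
        rw [mem_closedBall_zero_iff] at h4
        rw [Metric.mem_closedBall, dist_comm]
        have h5 : dist z₀.1 y ≤ dist z₀.1 z.1 + dist z.1 y := dist_triangle _ _ _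
        rw [dist_eq_norm z.1 y, dist_comm z₀.1 z.1] at h5
        linarith
      rw [Set.indicator_of_mem hy', hD]
      rw [Set.indicator_of_mem hy] at h1
      refine Finset.sum_le_sum fun i hi => ?_
      have hi' : i ≤ m := by simpa [Nat.lt_succ_iff] using hi
      rw [mul_assoc, mul_assoc]
      refine mul_le_mul_of_nonneg_left (mul_le_mul (h1 i hi') ?_ (norm_nonneg _) hM)
        (Nat.cast_nonneg _)
      exact (h2 _).trans ((hz2 _ (Finset.mem_range.2 (by omega)) y).trans (le_abs_self _))
    · rw [Set.indicator_of_notMem hy] at h1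
      refine (Finset.sum_nonpos fun i hi => ?_).trans
        (Set.indicator_nonneg (fun _ _ => hD ▸ Finset.sum_nonneg fun i _ => by positivity) _)
      have hi' : i ≤ m := by simpa [Nat.lt_succ_iff] using hi
      rw [le_antisymm (h1 i hi') (norm_nonneg _)]
      simp

theorem contDiff_mollX (hρ : ContDiff ℝ ∞ ρ) (hc : HasCompactSupport ρ) (hb : FreqFamily b) :
    ContDiff ℝ ∞ (mollX ρ b) :=
  contDiff_integral_param (contDiff_mollX_integrand hρ hb)
    (aestronglyMeasurable_mollX_integrand hρ hb) (exists_bound_mollX_integrand hρ hc hb)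

theorem dX_mollX (hρ : ContDiff ℝ ∞ ρ) (hc : HasCompactSupport ρ) (hb : FreqFamily b) (j : Fin n) :
    dX j (mollX ρ b) = mollX (dirD (eb j) ρ) b := by
  funext z
  refine (dirD_integral_param (contDiff_mollX_integrand hρ hb)
    (aestronglyMeasurable_mollX_integrand hρ hb) (exists_bound_mollX_integrand hρ hc hb) _ z).trans ?_
  refine integral_congr_ae (Eventually.of_forall fun y => ?_)
  beta_reduce
  have h1 : HasFDerivAt (fun z : Eu n × Eu n => ρ (z.1 - y))
      ((fderiv ℝ ρ (z.1 - y)).comp (ContinuousLinearMap.fst ℝ (Eu n) (Eu n))) z :=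
    ((hρ.differentiable (by simp)) (z.1 - y)).hasFDerivAt.comp z (hasFDerivAt_fst.sub_const y)
  have h2 : HasFDerivAt (fun z : Eu n × Eu n => b y z.2)
      ((fderiv ℝ (b y) z.2).comp (ContinuousLinearMap.snd ℝ (Eu n) (Eu n))) z :=
    (((hb.smooth y).differentiable (by simp)) z.2).hasFDerivAt.comp z hasFDerivAt_snd
  have h3 : HasFDerivAt (fun z : Eu n × Eu n => ρ (z.1 - y) * b y z.2) _ z := h1.mul h2
  rw [dirD, h3.fderiv]
  simp [dirD, mul_comm]

theorem dXi_mollX (hρ : ContDiff ℝ ∞ ρ) (hc : HasCompactSupport ρ) (hb : FreqFamily b) (j : Fin n) :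
    dXi j (mollX ρ b) = mollX ρ fun y => dirD (eb j) (b y) := by
  funext z
  refine (dirD_integral_param (contDiff_mollX_integrand hρ hb)
    (aestronglyMeasurable_mollX_integrand hρ hb) (exists_bound_mollX_integrand hρ hc hb) _ z).trans ?_
  refine integral_congr_ae (Eventually.of_forall fun y => ?_)
  beta_reduce
  have h1 : HasFDerivAt (fun z : Eu n × Eu n => ρ (z.1 - y))
      ((fderiv ℝ ρ (z.1 - y)).comp (ContinuousLinearMap.fst ℝ (Eu n) (Eu n))) z :=
    ((hρ.differentiable (by simp)) (z.1 - y)).hasFDerivAt.comp z (hasFDerivAt_fst.sub_const y)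
  have h2 : HasFDerivAt (fun z : Eu n × Eu n => b y z.2)
      ((fderiv ℝ (b y) z.2).comp (ContinuousLinearMap.snd ℝ (Eu n) (Eu n))) z :=
    (((hb.smooth y).differentiable (by simp)) z.2).hasFDerivAt.comp z hasFDerivAt_snd
  have h3 : HasFDerivAt (fun z : Eu n × Eu n => ρ (z.1 - y) * b y z.2) _ z := h1.mul h2
  rw [dirD, h3.fderiv]
  simp [dirD]

theorem dXs_mollX (hρ : ContDiff ℝ ∞ ρ) (hc : HasCompactSupport ρ) (hb : FreqFamily b)
    (w : List (Fin n)) : dXs w (mollX ρ b) = mollX (dE w ρ) b := by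
  induction w with
  | nil => rfl
  | cons j w ih =>
    rw [dXs, dirs_cons, ← dXs, ih]
    exact dX_mollX (contDiff_dirs _ hρ w) (hasCompactSupport_dirs _ hc w) hb j

theorem dXis_mollX (hρ : ContDiff ℝ ∞ ρ) (hc : HasCompactSupport ρ) (hb : FreqFamily b)
    (u : List (Fin n)) : dXis u (mollX ρ b) = mollX ρ fun y => dE u (b y) := by
  induction u with
  | nil => rfl
  | cons j u ih =>
    rw [dXis, dirs_cons, ← dXis, ih]
    exact dXi_mollX hρ hc (hb.dE u) j

theorem norm_mollX_le (hρ : ContDiff ℝ ∞ ρ) (hc : HasCompactSupport ρ) (z : Eu n × Eu n) {B : ℝ}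
    (hB : ∀ y, ‖b y z.2‖ ≤ B) : ‖mollX ρ b z‖ ≤ (∫ y, ‖ρ y‖) * B := by
  have hi : Integrable ρ := hρ.continuous.integrable_of_hasCompactSupport hc
  rw [← integral_sub_left_eq_self (fun y => ‖ρ y‖) volume z.1, ← integral_mul_const]
  refine norm_integral_le_of_norm_le ((hi.norm.comp_sub_left z.1).mul_const B)
    (Eventually.of_forall fun y => ?_)
  rw [norm_mul]
  exact mul_le_mul_of_nonneg_left (hB y) (norm_nonneg _)

theorem dE_comp_sub (hρ : ContDiff ℝ ∞ ρ) (w : List (Fin n)) (x y : Eu n) :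
    dE w (fun y => ρ (x - y)) y = (-1) ^ w.length * dE w ρ (x - y) := by
  have h := dirs_comp_affine (fun j => (eb j : Eu n)) (fun j => (eb j : Eu n)) hρ
    (-ContinuousLinearMap.id ℝ (Eu n)) x (-1) (fun i => by simp) w y
  simp only [_root_.neg_apply, ContinuousLinearMap.id_apply, neg_add_eq_sub] at h
  rw [dE, h]
  push_cast
  rfl

/-- Derivatives of the regularization fall on the weak derivatives. -/
theorem mollX_dE_eq (hρ : ContDiff ℝ ∞ ρ) (hc : HasCompactSupport ρ) (w : List (Fin n))
    {A : Eu n → Eu n → ℂ}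
    (hA : ∀ ξ, IsWeakDeriv (fun i => w.count i) (fun y => b y ξ) fun y => A y ξ) :
    mollX (dE w ρ) b = mollX ρ A := by
  funext z
  have hφ : ContDiff ℝ ∞ fun y => ρ (z.1 - y) := hρ.comp (contDiff_const.sub contDiff_id)
  have hφc : HasCompactSupport fun y => ρ (z.1 - y) :=
    hc.comp_homeomorph (Homeomorph.subLeft z.1)
  have h := (hA z.2).2.2 _ hφ hφc
  rw [← dE_eq_multiD hφ, len_count] at h
  simp only [dE_comp_sub hρ] at h
  have h2 : ∫ y, b y z.2 * ((-1) ^ w.length * dE w ρ (z.1 - y)) =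
      (-1) ^ w.length * mollX (dE w ρ) b z := by
    rw [mollX, ← integral_const_mul]
    congr 1; funext y; ring
  rw [h2] at h
  have h3 := mul_left_cancel₀ (pow_ne_zero _ (by norm_num)) h
  rw [h3, mollX]
  congr 1; funext y; ring

end

end

section

/-! ### Smooth symbols and their smoothing at a given scale -/

variable {n : ℕ}

open Filter Topology

section

variable {V ι : Type*} [NormedAddCommGroup V] [NormedSpace ℝ V]

theorem dirs_const_mul (e : ι → V) {F : V → ℂ} (hF : ContDiff ℝ ∞ F) (c : ℂ) (u : List ι) :
    dirs e u (fun z => c * F z) = fun z => c * dirs e u F z := by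
  induction u with
  | nil => rfl
  | cons i u ih => rw [dirs_cons, ih, dirD_const_mul (contDiff_dirs e hF u)]; rfl

theorem dirD_add {F G : V → ℂ} (hF : ContDiff ℝ ∞ F) (hG : ContDiff ℝ ∞ G) (v : V) :
    dirD v (fun z => F z + G z) = fun z => dirD v F z + dirD v G z := by
  funext z
  rw [dirD, fderiv_fun_add ((hF.differentiable (by simp)) z) ((hG.differentiable (by simp)) z)]
  rfl

theorem dirs_add (e : ι → V) {F G : V → ℂ} (hF : ContDiff ℝ ∞ F) (hG : ContDiff ℝ ∞ G)
    (u : List ι) : dirs e u (fun z => F z + G z) = fun z => dirs e u F z + dirs e u G z := by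
  induction u with
  | nil => rfl
  | cons i u ih =>
    rw [dirs_cons, ih, dirD_add (contDiff_dirs e hF u) (contDiff_dirs e hG u)]; rfl

end

/-- `F` is smooth and `|∂_ξ^u ∂_x^w F(x,ξ)| ≤ c |u| |w| ⟨ξ⟩^{k-|u|}`. -/
def SymBound (k : ℝ) (c : ℕ → ℕ → ℝ) (F : Eu n × Eu n → ℂ) : Prop :=
  ContDiff ℝ ∞ F ∧ ∀ (u w : List (Fin n)) (z : Eu n × Eu n),
    ‖dXis u (dXs w F) z‖ ≤ c u.length w.length * bracket z.2 ^ (k - u.length)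

/-- The curried form of a symbol. -/
abbrev cur (F : Eu n × Eu n → ℂ) : Eu n → Eu n → ℂ := fun y ξ => F (y, ξ)

namespace SymBound

variable {k : ℝ} {c c' : ℕ → ℕ → ℝ} {F G : Eu n × Eu n → ℂ}

theorem mono (h : SymBound k c F) (hc : ∀ i j, c i j ≤ c' i j) : SymBound k c' F :=
  ⟨h.1, fun u w z => (h.2 u w z).trans
    (mul_le_mul_of_nonneg_right (hc _ _) (rpow_bracket_nonneg _ _))⟩

theorem add (hF : SymBound k c F) (hG : SymBound k c' G) :
    SymBound k (fun i j => c i j + c' i j) fun z => F z + G z := by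
  refine ⟨hF.1.add hG.1, fun u w z => ?_⟩
  rw [dXs, dirs_add _ hF.1 hG.1, dXis, dirs_add _ (contDiff_dirs _ hF.1 w) (contDiff_dirs _ hG.1 w),
    add_mul]
  exact (norm_add_le _ _).trans (add_le_add (hF.2 u w z) (hG.2 u w z))

theorem neg (hF : SymBound k c F) : SymBound k c fun z => (-1 : ℂ) * F z := by
  refine ⟨contDiff_const.mul hF.1, fun u w z => ?_⟩
  rw [dXs, dirs_const_mul _ hF.1, dXis, dirs_const_mul _ (contDiff_dirs _ hF.1 w), norm_mul,
    norm_neg, norm_one, one_mul]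
  exact hF.2 u w z

theorem sub (hF : SymBound k c F) (hG : SymBound k c' G) :
    SymBound k (fun i j => c i j + c' i j) fun z => F z - G z := by
  have h := hF.add hG.neg
  rwa [show (fun z => F z + -1 * G z) = fun z => F z - G z from funext fun z => by ring] at h

theorem sum_range {m : ℕ} {G : ℕ → Eu n × Eu n → ℂ} (h : ∀ a ∈ Finset.range m, SymBound k c (G a)) :
    SymBound k (fun i j => m * c i j) fun z => ∑ a ∈ Finset.range m, G a z := by
  induction m with
  | zero =>
    refine ⟨by simpa using contDiff_const, fun u w z => ?_⟩
    have h0 : ∀ (e : Fin n → Eu n × Eu n) u, dirs e u (fun _ => (0 : ℂ)) = fun _ => 0 := fun e u => by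
      simpa using dirs_const_mul e (F := fun _ => (0 : ℂ)) contDiff_const 0 u
    simp [RoughPsiDO.dXs, RoughPsiDO.dXis, h0]
  | succ m ih =>
    simp only [Finset.sum_range_succ]
    refine ((ih fun a ha => h a (Finset.mem_range.2 (by have := Finset.mem_range.1 ha; omega))).add
      (h m (Finset.mem_range.2 (Nat.lt_succ_self m)))).mono fun i j => le_of_eq ?_
    push_cast; ring

theorem dXs (h : SymBound k c F) (w : List (Fin n)) :
    SymBound k (fun i j => c i (j + w.length)) (dXs w F) := by
  refine ⟨contDiff_dirs _ h.1 w, fun u w' z => ?_⟩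
  have := h.2 u (w' ++ w) z
  rwa [RoughPsiDO.dXs, dirs_append, List.length_append] at this

theorem dXis (h : SymBound k c F) (u : List (Fin n)) :
    SymBound (k - u.length) (fun i j => c (i + u.length) j) (dXis u F) := by
  refine ⟨contDiff_dirs _ h.1 u, fun u' w z => ?_⟩
  have := h.2 (u' ++ u) w z
  rw [RoughPsiDO.dXis, dirs_append, List.length_append] at this
  rw [RoughPsiDO.dXs, RoughPsiDO.dXis, RoughPsiDO.dXis, dirs_comm _ _ h.1]
  rwa [sub_sub, add_comm (u.length : ℝ), ← Nat.cast_add]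

theorem norm_iteratedFDeriv_le (h : SymBound k c F) (m : ℕ) (x ξ : Eu n) :
    ‖iteratedFDeriv ℝ m (fun η => F (x, η)) ξ‖ ≤ (n : ℝ) ^ m * (c m 0 * bracket ξ ^ (k - m)) := by
  have hs : ContDiff ℝ ∞ fun η => F (x, η) := h.1.comp (contDiff_const.prodMk contDiff_id)
  refine norm_iteratedFDeriv_le_of_dE hs m ξ fun u hu => ?_
  rw [← dXis_apply h.1, ← hu]
  exact h.2 u [] (x, ξ)

theorem freqFamily (h : SymBound k c F) : FreqFamily (cur F) := by
  refine ⟨fun y => h.1.comp (contDiff_const.prodMk contDiff_id), fun ξ =>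
    (h.1.continuous.comp (by fun_prop)).aestronglyMeasurable, fun m ξ₀ => ?_⟩
  have hcont : Continuous fun ξ : Eu n => (n : ℝ) ^ m * (c m 0 * bracket ξ ^ (k - m)) :=
    continuous_const.mul (continuous_const.mul (continuous_bracket_rpow _))
  refine ⟨(n : ℝ) ^ m * (c m 0 * bracket ξ₀ ^ (k - m)) + 1, ?_⟩
  filter_upwards [hcont.continuousAt.eventually_lt continuousAt_const (lt_add_one _)] with ξ hξ y
  exact (h.norm_iteratedFDeriv_le m y ξ).trans hξ.le

end SymBound

theorem integral_mul_dE {f g : Eu n → ℂ} (hf : ContDiff ℝ ∞ f) (hg : ContDiff ℝ ∞ g)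
    (hgc : HasCompactSupport g) (w : List (Fin n)) :
    ∫ x, f x * dE w g x = (-1) ^ w.length * ∫ x, dE w f x * g x := by
  induction w generalizing f with
  | nil => simp [dE, dirs_nil]
  | cons j w ih =>
    have hg' : ContDiff ℝ ∞ (dE w g) := contDiff_dirs _ hg w
    have hgc' : HasCompactSupport (dE w g) := hasCompactSupport_dirs _ hgc w
    have h1 : ∫ x, f x * dE (j :: w) g x = -∫ x, dirD (eb j) f x * dE w g x := by
      refine integral_mul_fderiv_eq_neg_fderiv_mul_of_integrable ?_ ?_ ?_
        (fun x _ => (hf.differentiable (by simp)) x) (fun x _ => (hg'.differentiable (by simp)) x)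
      · exact ((contDiff_dirD hf (eb j)).continuous.mul hg'.continuous).integrable_of_hasCompactSupport
          hgc'.mul_left
      · exact (hf.continuous.mul (contDiff_dirD hg' (eb j)).continuous).integrable_of_hasCompactSupport
          (hasCompactSupport_dirD hgc' _).mul_left
      · exact (hf.continuous.mul hg'.continuous).integrable_of_hasCompactSupport hgc'.mul_left
    rw [h1, ih (contDiff_dirD hf (eb j)), List.length_cons, pow_succ]
    have : dE w (dirD (eb j) f) = dE (j :: w) f := dirs_dirD _ hf w _
    rw [this]
    ring

theorem isWeakDeriv_dE {f : Eu n → ℂ} (hf : ContDiff ℝ ∞ f) (w : List (Fin n)) :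
    IsWeakDeriv (fun i => w.count i) f (dE w f) := by
  refine ⟨hf.continuous.locallyIntegrable, (contDiff_dirs _ hf w).continuous.locallyIntegrable,
    fun φ hφ hφc => ?_⟩
  rw [← dE_eq_multiD hφ, len_count]
  exact integral_mul_dE hf hφ hφc w

/-! ### Mollification at scale r and the resulting two-term decomposition. -/

section

variable {k r : ℝ} {c : ℕ → ℕ → ℝ} {F : Eu n × Eu n → ℂ} {ρ : Eu n → ℂ}

theorem dXs_mollX_cur (hρ : ContDiff ℝ ∞ ρ) (hc : HasCompactSupport ρ) (hF : SymBound k c F)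
    (w : List (Fin n)) : dXs w (mollX ρ (cur F)) = mollX ρ (cur (dXs w F)) := by
  rw [dXs_mollX hρ hc hF.freqFamily]
  refine mollX_dE_eq hρ hc w fun ξ => ?_
  have h := isWeakDeriv_dE (f := fun y => F (y, ξ))
    (hF.1.comp (contDiff_id.prodMk contDiff_const)) w
  rwa [show dE w (fun y => F (y, ξ)) = fun y => dXs w F (y, ξ) from
    funext fun y => (dXs_apply hF.1 w y ξ).symm] at h

theorem dXis_mollX_cur (hρ : ContDiff ℝ ∞ ρ) (hc : HasCompactSupport ρ) (hF : SymBound k c F)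
    (u : List (Fin n)) : dXis u (mollX ρ (cur F)) = mollX ρ (cur (dXis u F)) := by
  rw [dXis_mollX hρ hc hF.freqFamily]
  congr 1
  funext y ξ
  exact (dXis_apply hF.1 u y ξ).symm

theorem words_mollX (hρ : ContDiff ℝ ∞ ρ) (hc : HasCompactSupport ρ) (hF : SymBound k c F)
    (u w : List (Fin n)) :
    dXis u (dXs w (mollX ρ (cur F))) = mollX ρ (cur (dXis u (dXs w F))) := by
  rw [dXs_mollX_cur hρ hc hF, dXis_mollX_cur hρ hc (hF.dXs w)]

/-- `ρ` is a smooth probability density supported in the ball of radius `r`. -/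
structure Mollifier (r : ℝ) (ρ : Eu n → ℂ) : Prop where
  smooth : ContDiff ℝ ∞ ρ
  compact : HasCompactSupport ρ
  supp : ∀ y, ρ y ≠ 0 → ‖y‖ ≤ r
  integral : ∫ y, ρ y = 1
  integral_norm : ∫ y, ‖ρ y‖ = 1

theorem mollifier_of_bump (φ : ContDiffBump (0 : Eu n)) :
    Mollifier φ.rOut fun y => ((φ.normed volume y : ℝ) : ℂ) where
  smooth := Complex.ofRealCLM.contDiff.comp φ.contDiff_normed
  compact := φ.hasCompactSupport_normed.comp_left (g := fun t : ℝ => (t : ℂ)) Complex.ofReal_zero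
  supp y hy := by
    have h : y ∈ Function.support (φ.normed volume) := fun h => hy (by simp [h])
    rw [φ.support_normed_eq] at h
    simpa using (Metric.ball_subset_closedBall h)
  integral := by rw [integral_complex_ofReal, φ.integral_normed, Complex.ofReal_one]
  integral_norm := by
    simp_rw [Complex.norm_real, Real.norm_of_nonneg (φ.nonneg_normed _)]
    exact φ.integral_normed

theorem Mollifier.integrable (h : Mollifier r ρ) : Integrable ρ :=
  h.smooth.continuous.integrable_of_hasCompactSupport h.compact

theorem integral_comp_inv_smul {E : Type*} [NormedAddCommGroup E] [NormedSpace ℝ E] (f : Eu n → E)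
    {t : ℝ} (ht : 0 < t) : ∫ y, f (t⁻¹ • y) = t ^ n • ∫ y, f y := by
  rw [Measure.integral_comp_smul, finrank_euclideanSpace_fin, inv_pow, inv_inv,
    abs_of_pos (by positivity)]

theorem dE_dilate (hρ : ContDiff ℝ ∞ ρ) (t : ℝ) (w : List (Fin n)) (y : Eu n) :
    dE w (fun y => ((t ^ n : ℝ) : ℂ)⁻¹ * ρ (t⁻¹ • y)) y =
      ((t ^ n : ℝ) : ℂ)⁻¹ * (((t⁻¹ : ℝ) : ℂ) ^ w.length * dE w ρ (t⁻¹ • y)) := by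
  have hs : ContDiff ℝ ∞ fun y : Eu n => ρ (t⁻¹ • y) := hρ.comp (contDiff_const_smul t⁻¹)
  rw [dE, dirs_const_mul _ hs]
  have h := dirs_comp_affine (fun j => (eb j : Eu n)) (fun j => (eb j : Eu n)) hρ
    (t⁻¹ • ContinuousLinearMap.id ℝ (Eu n)) 0 t⁻¹ (fun i => by simp) w y
  simp only [_root_.smul_apply, ContinuousLinearMap.id_apply, add_zero] at h
  beta_reduce
  rw [h]
  rfl

theorem integral_norm_dE_dilate (hρ : ContDiff ℝ ∞ ρ) {t : ℝ} (ht : 0 < t) (w : List (Fin n)) :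
    ∫ y, ‖dE w (fun y => ((t ^ n : ℝ) : ℂ)⁻¹ * ρ (t⁻¹ • y)) y‖ =
      (∫ y, ‖dE w ρ y‖) / t ^ w.length := by
  simp_rw [dE_dilate hρ, norm_mul, norm_inv, norm_pow, Complex.norm_real]
  rw [integral_const_mul, integral_const_mul, integral_comp_inv_smul (fun y => ‖dE w ρ y‖) ht,
    Real.norm_of_nonneg (by positivity), Real.norm_of_nonneg (by positivity), smul_eq_mul, inv_pow]
  have : t ^ n ≠ 0 := by positivity
  field_simp

theorem Mollifier.dilate (h : Mollifier r ρ) {t : ℝ} (ht : 0 < t) :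
    Mollifier (t * r) fun y => ((t ^ n : ℝ) : ℂ)⁻¹ * ρ (t⁻¹ • y) where
  smooth := contDiff_const.mul (h.smooth.comp (contDiff_const_smul t⁻¹))
  compact := (h.compact.comp_homeomorph (Homeomorph.smulOfNeZero t⁻¹ (inv_ne_zero ht.ne'))).mul_left
  supp y hy := by
    have := h.supp _ (right_ne_zero_of_mul hy)
    rw [norm_smul, Real.norm_of_nonneg (by positivity), inv_mul_le_iff₀ ht] at this
    exact this
  integral := by
    rw [integral_const_mul, integral_comp_inv_smul _ ht, h.integral, Complex.real_smul, mul_one,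
      inv_mul_cancel₀]
    exact_mod_cast (by positivity : t ^ n ≠ 0)
  integral_norm := by
    have := integral_norm_dE_dilate h.smooth ht []
    simpa [dE, dirs_nil, h.integral_norm] using this

/-- Dilates of one fixed bump: each derivative costs 1/r in L¹. There are finitely many words of a
given length, so the constant depends on the length alone. The radius 2r is the outer radius 2 of
the bump, dilated. -/
theorem exists_mollifier (n : ℕ) : ∃ (K : ℕ → ℝ), (∀ j, 0 < K j) ∧ ∀ r : ℝ, 0 < r →
    ∃ ρ : Eu n → ℂ, Mollifier (2 * r) ρ ∧ ∀ w : List (Fin n),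
      ∫ y, ‖dE w ρ y‖ ≤ K w.length / r ^ w.length := by
  let φ : ContDiffBump (0 : Eu n) := ⟨1, 2, one_pos, one_lt_two⟩
  have h := mollifier_of_bump φ
  set ρ : Eu n → ℂ := fun y => ((φ.normed volume y : ℝ) : ℂ)
  have hfin : ∀ j, ∃ K : ℝ, ∀ w : List (Fin n), w.length = j → ∫ y, ‖dE w ρ y‖ ≤ K := fun j => by
    obtain ⟨K, hK⟩ := ((List.finite_length_eq (Fin n) j).image
      (fun w => ∫ y, ‖dE w ρ y‖)).bddAbove
    exact ⟨K, fun w hw => hK ⟨w, hw, rfl⟩⟩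
  choose K hK using hfin
  refine ⟨fun j => |K j| + 1, fun j => by positivity, fun r hr =>
    ⟨fun y => ((r ^ n : ℝ) : ℂ)⁻¹ * ρ (r⁻¹ • y), ?_, fun w => ?_⟩⟩
  · have := h.dilate hr
    rwa [mul_comm] at this
  · rw [integral_norm_dE_dilate h.smooth hr]
    have := (hK _ w rfl).trans ((le_abs_self _).trans (lt_add_one _).le)
    gcongr

theorem SymBound.mollX (hF : SymBound k c F) (hρ : Mollifier r ρ) :
    SymBound k c (mollX ρ (cur F)) := by
  refine ⟨contDiff_mollX hρ.smooth hρ.compact hF.freqFamily, fun u w z => ?_⟩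
  rw [words_mollX hρ.smooth hρ.compact hF]
  refine (norm_mollX_le hρ.smooth hρ.compact z (b := cur (RoughPsiDO.dXis u (RoughPsiDO.dXs w F)))
    (B := c u.length w.length * bracket z.2 ^ (k - u.length))
    fun y => hF.2 u w (y, z.2)).trans (le_of_eq ?_)
  rw [hρ.integral_norm, one_mul]

/-- Further derivatives in `x` of the regularization may be put on the mollifier. -/
theorem norm_words_mollX_le (hF : SymBound k c F) (hρ : Mollifier r ρ) (u w w' : List (Fin n))
    (z : Eu n × Eu n) : ‖dXis u (dXs (w' ++ w) (RoughPsiDO.mollX ρ (cur F))) z‖ ≤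
      (∫ y, ‖dE w' ρ y‖) * (c u.length w.length * bracket z.2 ^ (k - u.length)) := by
  have h1 : dXs (w' ++ w) (RoughPsiDO.mollX ρ (cur F)) =
      RoughPsiDO.mollX (dE w' ρ) (cur (dXs w F)) := by
    rw [dXs, dirs_append, ← dXs, ← dXs, dXs_mollX_cur hρ.smooth hρ.compact hF,
      dXs_mollX hρ.smooth hρ.compact (hF.dXs w).freqFamily]
  have hs : ContDiff ℝ ∞ (dE w' ρ) := contDiff_dirs _ hρ.smooth w'
  have hc : HasCompactSupport (dE w' ρ) := hasCompactSupport_dirs _ hρ.compact w'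
  rw [h1, dXis_mollX_cur hs hc (hF.dXs w)]
  exact norm_mollX_le hs hc z fun y => hF.2 u w (y, z.2)

/-- The mean value inequality in x, averaged over the ball of radius r carrying ρ. The factor n
bounds the gradient by its components. -/
theorem norm_sub_mollX_le (hF : SymBound k c F) (hρ : Mollifier r ρ)
    (z : Eu n × Eu n) {B : ℝ} (hB : ∀ (j : Fin n) (y : Eu n), ‖dXs [j] F (y, z.2)‖ ≤ B)
    (hB0 : 0 ≤ B) : ‖F z - RoughPsiDO.mollX ρ (cur F) z‖ ≤ n * r * B := by
  have hs : ContDiff ℝ ∞ fun y => F (y, z.2) := hF.1.comp (contDiff_id.prodMk contDiff_const)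
  have hlip : ∀ y, ‖F z - F (y, z.2)‖ ≤ n * B * ‖z.1 - y‖ := fun y => by
    refine Convex.norm_image_sub_le_of_norm_fderiv_le (f := fun y => F (y, z.2)) (𝕜 := ℝ)
      (s := Set.univ) (x := y) (y := z.1) (fun x _ => (hs.differentiable (by simp)) x)
      (fun x _ => ?_) convex_univ trivial trivial
    rw [← norm_iteratedFDeriv_one]
    have := norm_iteratedFDeriv_le_of_dE hs 1 x (B := B) fun u hu => by
      obtain ⟨j, rfl⟩ := List.length_eq_one_iff.1 hu
      rw [← dXs_apply hF.1]
      exact hB j x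
    simpa using this
  have hi := hρ.integrable.comp_sub_left z.1
  have hi2 : Integrable fun y => ρ (z.1 - y) * F (y, z.2) :=
    ((hρ.smooth.continuous.comp (by fun_prop)).mul hs.continuous).integrable_of_hasCompactSupport
      (hρ.compact.comp_homeomorph (Homeomorph.subLeft z.1)).mul_right
  have e1 : F z - RoughPsiDO.mollX ρ (cur F) z = ∫ y, ρ (z.1 - y) * (F z - F (y, z.2)) := by
    have : ∫ y, ρ (z.1 - y) * F z = F z := by
      rw [integral_mul_const, integral_sub_left_eq_self, hρ.integral, one_mul]
    simp_rw [mul_sub]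
    rw [integral_sub (hi.mul_const _) hi2, this]
    rfl
  rw [e1]
  have e2 : n * r * B = ∫ y, ‖ρ (z.1 - y)‖ * (n * r * B) := by
    rw [integral_mul_const, integral_sub_left_eq_self (fun y => ‖ρ y‖), hρ.integral_norm, one_mul]
  rw [e2]
  refine norm_integral_le_of_norm_le (hi.norm.mul_const _) (Eventually.of_forall fun y => ?_)
  rw [norm_mul]
  by_cases hy : ρ (z.1 - y) = 0
  · simp [hy]
  · refine mul_le_mul_of_nonneg_left ((hlip y).trans ?_) (norm_nonneg _)
    have := hρ.supp _ hy
    have h0 : 0 ≤ n * B := by positivity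
    nlinarith

theorem words_sub {F G : Eu n × Eu n → ℂ} (hF : ContDiff ℝ ∞ F) (hG : ContDiff ℝ ∞ G)
    (u w : List (Fin n)) (z : Eu n × Eu n) : dXis u (dXs w fun z => F z - G z) z =
      dXis u (dXs w F) z - dXis u (dXs w G) z := by
  have e : (fun z => F z - G z) = fun z => F z + (-1 : ℂ) * G z := funext fun z => by ring
  have hG' : ContDiff ℝ ∞ fun z => (-1 : ℂ) * G z := contDiff_const.mul hG
  rw [e, dXs, dirs_add _ hF hG', dirs_const_mul _ hG, dXis, dirs_add _ (contDiff_dirs _ hF w)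
    (contDiff_const.mul (contDiff_dirs _ hG w)), dirs_const_mul _ (contDiff_dirs _ hG w)]
  change _ + -1 * _ = _
  rw [neg_one_mul, ← sub_eq_add_neg]
  rfl

/-- One application of 1 - ρ∗ trades one derivative in x for a factor nr, while derivatives in ξ are
unaffected. -/
theorem gain_sub_mollX (hF : SymBound k c F) (hρ : Mollifier r ρ) (p : ℕ) {B : ℕ → ℝ}
    (hB0 : ∀ i, 0 ≤ B i)
    (hB : ∀ (u w : List (Fin n)) z, w.length = p + 1 →
      ‖dXis u (dXs w F) z‖ ≤ B u.length * bracket z.2 ^ (k - u.length))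
    (u w : List (Fin n)) (z : Eu n × Eu n) (hw : w.length = p) :
    ‖dXis u (dXs w fun z => F z - RoughPsiDO.mollX ρ (cur F) z) z‖ ≤
      n * r * B u.length * bracket z.2 ^ (k - u.length) := by
  rw [words_sub hF.1 (hF.mollX hρ).1, words_mollX hρ.smooth hρ.compact hF]
  have h1 := (hF.dXs w).dXis u
  refine (norm_sub_mollX_le h1 hρ z (B := B u.length * bracket z.2 ^ (k - u.length))
    (fun j y => ?_) (mul_nonneg (hB0 _) (rpow_bracket_nonneg _ _))).trans (le_of_eq (by ring))
  have := hB u (j :: w) (y, z.2) (by simp [hw])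
  rwa [dXs, dXis, dXs, dirs_comm _ _ (contDiff_dirs _ hF.1 w)]

/-- Decomposition of a symbol into a symbol with good bounds on all derivatives and a small one. -/
theorem exists_decomposition (n μ : ℕ) : ∃ K : ℕ → ℝ, (∀ j, 0 < K j) ∧
    ∀ (r : ℝ), 0 < r → ∀ (k : ℝ) (c : ℕ → ℕ → ℝ) (F : Eu n × Eu n → ℂ), (∀ i j, 0 ≤ c i j) →
      SymBound k c F → ∃ F₁ F₂ : Eu n × Eu n → ℂ, (∀ z, F z = F₁ z + F₂ z) ∧
        SymBound k (fun i j => K j * (r ^ min j μ * c i (min j μ) / r ^ j)) F₁ ∧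
        SymBound k (fun i j => if j = 0 then K 0 * (r ^ μ * c i μ) else K 0 * c i j) F₂ := by
  obtain ⟨K, hK, hmol⟩ := exists_mollifier n
  -- For the small part: (2n)^μ comes from μ gains with mollifiers of radius 2r, and 2^μ is the
  -- trivial bound for (1 - ρ∗)^μ.
  obtain ⟨A, hA⟩ : ∃ A : ℝ, A = (n * 2) ^ μ + 2 ^ μ := ⟨_, rfl⟩
  have hA0 : 0 < A := by rw [hA]; positivity
  refine ⟨fun j => μ * 2 ^ μ * (K (j - μ) + 1) + A, fun j => by have := hK (j - μ); positivity,
    fun r hr k c F hc hF => ?_⟩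
  obtain ⟨ρ, hρ, hρw⟩ := hmol r hr
  -- Here `fl i` is (1 - ρ∗)^i F. Telescoping, F is the sum of ρ∗(1 - ρ∗)^a F over a < μ, plus (1 -
  -- ρ∗)^μ F. A single mollification would gain only one power of r.
  let fl : ℕ → Eu n × Eu n → ℂ := fun i => Nat.rec F (fun _ G z => G z - RoughPsiDO.mollX ρ (cur G) z) i
  have hfl : ∀ i, SymBound k (fun a b => 2 ^ i * c a b) (fl i) := fun i => by
    induction i with
    | zero => exact hF.mono fun a b => by simp
    | succ i ih => exact (ih.sub (ih.mollX hρ)).mono fun a b => le_of_eq (by ring)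
  -- The invariant: with i powers of r already gained, the p = μ - i remaining x-derivatives are
  -- still measured by ∂_x^μ F. At p = 0 this is the size of the remainder.
  have hgain : ∀ i p, i + p = μ → ∀ (u w : List (Fin n)) z, w.length = p →
      ‖dXis u (dXs w (fl i)) z‖ ≤
        (n * (2 * r)) ^ i * c u.length μ * bracket z.2 ^ (k - u.length) := fun i => by
    induction i with
    | zero =>
      intro p hp u w z hw
      have := hF.2 u w z
      rw [show w.length = μ by omega] at this
      rw [pow_zero, one_mul]
      exact this
    | succ i ih =>
      intro p hp u w z hw
      have := gain_sub_mollX (hfl i) hρ p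
        (B := fun a => (n * (2 * r)) ^ i * c a μ)
        (fun a => mul_nonneg (by positivity) (hc _ _)) (ih (p + 1) (by omega)) u w z hw
      refine this.trans (le_of_eq ?_)
      ring
  have hsum : ∀ i z, F z = ∑ a ∈ Finset.range i, RoughPsiDO.mollX ρ (cur (fl a)) z + fl i z := by
    intro i z
    induction i with
    | zero => simp [fl]
    | succ i ih =>
      rw [Finset.sum_range_succ]
      have : fl (i + 1) z = fl i z - RoughPsiDO.mollX ρ (cur (fl i)) z := rfl
      rw [this, ih]
      ring
  have hpow : ∀ a ∈ Finset.range μ, (2 : ℝ) ^ a ≤ 2 ^ μ := fun a ha =>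
    pow_le_pow_right₀ one_le_two (Finset.mem_range.1 ha).le
  have hpiece : ∀ a ∈ Finset.range μ, SymBound k (fun i j => 2 ^ μ * (K (j - μ) + 1) *
      (r ^ min j μ * c i (min j μ) / r ^ j)) (RoughPsiDO.mollX ρ (cur (fl a))) := by
    intro a ha
    have hm := (hfl a).mollX hρ
    refine ⟨hm.1, fun u w z => ?_⟩
    have hb := rpow_bracket_nonneg (k - u.length) z.2
    have hKj := hK (w.length - μ)
    rcases le_total w.length μ with hw | hw
    · refine (hm.2 u w z).trans (mul_le_mul_of_nonneg_right ?_ hb)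
      beta_reduce
      rw [min_eq_left hw, mul_div_assoc, mul_div_cancel₀ _ (by positivity)]
      refine mul_le_mul_of_nonneg_right ((hpow a ha).trans ?_) (hc _ _)
      nlinarith [(by positivity : (0 : ℝ) < 2 ^ μ)]
    -- Beyond order μ, exactly μ of the x-derivatives fall on the symbol and the others on the
    -- mollifier, at the price 1/r each.
    · obtain ⟨w', w'', rfl, hw''⟩ : ∃ w' w'' : List (Fin n), w = w' ++ w'' ∧ w''.length = μ :=
        ⟨w.take (w.length - μ), w.drop (w.length - μ), (List.take_append_drop _ _).symm, by
          rw [List.length_drop]; omega⟩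
      have hl : (w' ++ w'').length - μ = w'.length := by rw [List.length_append]; omega
      refine (norm_words_mollX_le (hfl a) hρ u w'' w' z).trans ?_
      beta_reduce
      rw [min_eq_right hw, hl, hw'', List.length_append, hw'', pow_add]
      have h1 := hρw w'
      have hcn := hc u.length μ
      have h2 := hK w'.length
      calc (∫ y, ‖dE w' ρ y‖) * (2 ^ a * c u.length μ * bracket z.2 ^ (k - u.length))
          ≤ (K w'.length / r ^ w'.length) *
            (2 ^ μ * c u.length μ * bracket z.2 ^ (k - u.length)) := by
            refine mul_le_mul h1 ?_ (by positivity) (by positivity)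
            exact mul_le_mul_of_nonneg_right (mul_le_mul_of_nonneg_right (hpow a ha) hcn) hb
        _ = 2 ^ μ * K w'.length * (r ^ μ * c u.length μ / (r ^ w'.length * r ^ μ)) *
            bracket z.2 ^ (k - u.length) := by
            field_simp
        _ ≤ _ := by
            refine mul_le_mul_of_nonneg_right (mul_le_mul_of_nonneg_right ?_ (by positivity)) hb
            nlinarith [(by positivity : (0 : ℝ) < 2 ^ μ)]
  refine ⟨fun z => ∑ a ∈ Finset.range μ, RoughPsiDO.mollX ρ (cur (fl a)) z, fl μ, hsum μ, ?_, ?_⟩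
  · refine (SymBound.sum_range hpiece).mono fun i j => ?_
    have h0 : 0 ≤ r ^ min j μ * c i (min j μ) / r ^ j :=
      div_nonneg (mul_nonneg (by positivity) (hc _ _)) (by positivity)
    nlinarith [mul_nonneg hA0.le h0]
  · refine ⟨(hfl μ).1, fun u w z => ?_⟩
    have hb := rpow_bracket_nonneg (k - u.length) z.2
    have hK0 : (0 : ℝ) ≤ μ * 2 ^ μ * (K (0 - μ) + 1) := by
      have := hK (0 - μ); positivity
    by_cases hw : w.length = 0
    · refine (hgain μ 0 rfl u w z hw).trans ?_
      beta_reduce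
      rw [if_pos hw]
      refine mul_le_mul_of_nonneg_right ?_ hb
      have h0 : 0 ≤ r ^ μ * c u.length μ := mul_nonneg (by positivity) (hc _ _)
      calc _ = (n * 2) ^ μ * (r ^ μ * c u.length μ) := by rw [mul_pow, mul_pow, mul_pow]; ring
        _ ≤ _ := mul_le_mul_of_nonneg_right (by rw [hA]; linarith [(by positivity : (0 : ℝ) < 2 ^ μ)]) h0
    · refine ((hfl μ).2 u w z).trans ?_
      beta_reduce
      rw [if_neg hw]
      refine mul_le_mul_of_nonneg_right ?_ hb
      exact mul_le_mul_of_nonneg_right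
        (by rw [hA]; linarith [(by positivity : (0 : ℝ) ≤ (n * 2) ^ μ)]) (hc _ _)

end

end

section

/-! ### Semiclassical operators with smooth symbols -/

variable {n : ℕ}

open Filter Topology

/-- The symbol of the semiclassical quantization with respect to the unscaled quantization. -/
def quant (h : ℝ) (a : Eu n × Eu n → ℂ) (z : Eu n × Eu n) : ℂ := a (z.1, (-(2 * π * h)) • z.2)

theorem words_scale {F : Eu n × Eu n → ℂ} (hF : ContDiff ℝ ∞ F) (p q : ℝ) (u w : List (Fin n))
    (z : Eu n × Eu n) : dXis u (dXs w fun z : Eu n × Eu n => F (p • z.1, q • z.2)) z =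
      (p : ℂ) ^ w.length * ((q : ℂ) ^ u.length * dXis u (dXs w F) (p • z.1, q • z.2)) := by
  let L : (Eu n × Eu n) →L[ℝ] (Eu n × Eu n) :=
    (p • ContinuousLinearMap.fst ℝ (Eu n) (Eu n)).prod (q • ContinuousLinearMap.snd ℝ (Eu n) (Eu n))
  have hL : ∀ z, L z + 0 = (p • z.1, q • z.2) := fun z => by rw [add_zero]; rfl
  have h1 := fun z => dirs_comp_affine (fun j => ((eb j : Eu n), (0 : Eu n)))
    (fun j => ((eb j : Eu n), (0 : Eu n))) hF L 0 p (fun i => by simp [L]) w z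
  have hs := contDiff_dirs (fun j => ((eb j : Eu n), (0 : Eu n))) hF w
  have h2 := fun z => dirs_comp_affine (fun j => ((0 : Eu n), (eb j : Eu n)))
    (fun j => ((0 : Eu n), (eb j : Eu n))) hs L 0 q (fun i => by simp [L]) u z
  simp only [hL] at h1 h2
  have hs2 : ContDiff ℝ ∞ fun z : Eu n × Eu n =>
      dirs (fun j => ((eb j : Eu n), (0 : Eu n))) w F (p • z.1, q • z.2) :=
    hs.comp ((contDiff_fst.const_smul p).prodMk (contDiff_snd.const_smul q))
  rw [dXs, funext h1, dXis, dirs_const_mul _ hs2]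
  beta_reduce
  rw [h2]
  rfl

/-- The sum of the constants of a symbol, weighted by the scale. -/
def wsum (N : ℕ) (r : ℝ) (c : ℕ → ℕ → ℝ) : ℝ :=
  ∑ i ∈ Finset.range (N + 1), ∑ j ∈ Finset.range (N + 1), r ^ (i + j) * c i j

theorem le_wsum {N : ℕ} {r : ℝ} {c : ℕ → ℕ → ℝ} (hr : 0 ≤ r) (hc : ∀ i j, 0 ≤ c i j) {i j : ℕ}
    (hi : i ≤ N) (hj : j ≤ N) : r ^ (i + j) * c i j ≤ wsum N r c := by
  have h0 : ∀ i j, 0 ≤ r ^ (i + j) * c i j := fun i j => mul_nonneg (pow_nonneg hr _) (hc i j)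
  refine le_trans ?_ (Finset.single_le_sum
    (f := fun i => ∑ j ∈ Finset.range (N + 1), r ^ (i + j) * c i j)
    (fun i _ => Finset.sum_nonneg fun j _ => h0 i j) (Finset.mem_range.2 (Nat.lt_succ_of_le hi)))
  exact Finset.single_le_sum (f := fun j => r ^ (i + j) * c i j) (fun j _ => h0 i j)
    (Finset.mem_range.2 (Nat.lt_succ_of_le hj))

theorem wsum_nonneg {N : ℕ} {r : ℝ} {c : ℕ → ℕ → ℝ} (hr : 0 ≤ r) (hc : ∀ i j, 0 ≤ c i j) :
    0 ≤ wsum N r c :=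
  Finset.sum_nonneg fun i _ => Finset.sum_nonneg fun j _ => mul_nonneg (pow_nonneg hr _) (hc i j)

theorem mul_wsum_le {N : ℕ} {r R A : ℝ} {c : ℕ → ℕ → ℝ}
    (h : ∀ i ≤ N, ∀ j ≤ N, A * (r ^ (i + j) * c i j) ≤ R) : A * wsum N r c ≤ (N + 1) ^ 2 * R := by
  rw [wsum, Finset.mul_sum]
  refine (Finset.sum_le_sum (g := fun _ => ∑ _j ∈ Finset.range (N + 1), R) fun i hi => ?_).trans
    (le_of_eq ?_)
  · rw [Finset.mul_sum]
    exact Finset.sum_le_sum fun j hj => h i (Nat.lt_succ_iff.1 (Finset.mem_range.1 hi)) j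
      (Nat.lt_succ_iff.1 (Finset.mem_range.1 hj))
  · simp only [Finset.sum_const, Finset.card_range, nsmul_eq_mul]
    push_cast; ring

theorem wsum_mul_wsum_le {N : ℕ} {r R : ℝ} {c c' : ℕ → ℕ → ℝ}
    (h : ∀ i ≤ N, ∀ j ≤ N, ∀ i' ≤ N, ∀ j' ≤ N,
      (r ^ (i + j) * c i j) * (r ^ (i' + j') * c' i' j') ≤ R) :
    wsum N r c * wsum N r c' ≤ (N + 1) ^ 4 * R := by
  have h1 := mul_wsum_le (N := N) (r := r) (A := wsum N r c) (c := c') (R := (N + 1) ^ 2 * R)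
    fun i' hi' j' hj' => by
      rw [mul_comm]
      exact mul_wsum_le fun i hi j hj => by
        rw [mul_comm]; exact h i hi j hj i' hi' j' hj'
  exact h1.trans (le_of_eq (by ring))

/-! ### Boundedness and composition at the scale √h. -/

section

variable {k k' h r : ℝ} {c c' : ℕ → ℕ → ℝ} {F a b : Eu n × Eu n → ℂ}

theorem SymBound.norm_le_of_nonpos (hF : SymBound k c F) (hk : k ≤ 0) (hc : ∀ i j, 0 ≤ c i j)
    (u w : List (Fin n)) (z : Eu n × Eu n) :
    ‖RoughPsiDO.dXis u (RoughPsiDO.dXs w F) z‖ ≤ c u.length w.length := by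
  refine (hF.2 u w z).trans (mul_le_of_le_one_right (hc _ _) ?_)
  exact Real.rpow_le_one_of_one_le_of_nonpos (one_le_bracket _)
    (by linarith [(Nat.cast_nonneg u.length : (0 : ℝ) ≤ u.length)])

/-- The symbol at the scale `√h`. -/
theorem SymBound.derivBound_scale (hF : SymBound k c F) (hk : k ≤ 0) (hc : ∀ i j, 0 ≤ c i j)
    (hr : 0 ≤ r) (N : ℕ) :
    DerivBound N (fun _ => (2 * n + 1) ^ N * ((2 * π) ^ N * wsum N r c))
      fun z : Eu n × Eu n => F (r • z.1, (-(2 * π * r)) • z.2) := by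
  refine derivBound_of_words (W := fun _ => (2 * π) ^ N * wsum N r c)
    (hF.1.comp ((contDiff_fst.const_smul _).prodMk (contDiff_snd.const_smul _))) fun u w huw z => ?_
  rw [words_scale hF.1, norm_mul, norm_mul, norm_pow, norm_pow, Complex.norm_real, Complex.norm_real,
    norm_neg, Real.norm_of_nonneg hr, Real.norm_of_nonneg (by positivity)]
  have h1 := hF.norm_le_of_nonpos hk hc u w (r • z.1, (-(2 * π * r)) • z.2)
  have h2 := le_wsum (N := N) hr hc (i := u.length) (j := w.length) (by omega) (by omega)
  have hpi : (1 : ℝ) ≤ 2 * π := by linarith [Real.pi_gt_three]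
  calc r ^ w.length * ((2 * π * r) ^ u.length * _)
      ≤ r ^ w.length * ((2 * π * r) ^ u.length * c u.length w.length) :=
        mul_le_mul_of_nonneg_left (mul_le_mul_of_nonneg_left h1 (by positivity)) (by positivity)
    _ = (2 * π) ^ u.length * (r ^ (u.length + w.length) * c u.length w.length) := by
        rw [mul_pow, pow_add]; ring
    _ ≤ _ := mul_le_mul (pow_le_pow_right₀ hpi (by omega)) h2
        (mul_nonneg (by positivity) (hc _ _)) (by positivity)

/-- Dilation by √h distributes the semiclassical parameter evenly between position and frequency,
since h/√h = √h. -/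
theorem quant_scaleMap (hh : 0 < h) (a : Eu n × Eu n → ℂ) (z : Eu n × Eu n) :
    quant h a (scaleMap (Units.mk0 (√h) (Real.sqrt_pos.2 hh).ne') z) =
      a (√h • z.1, (-(2 * π * √h)) • z.2) := by
  rw [quant, scaleMap]
  simp only [Units.val_mk0, Units.val_inv_eq_inv_val, smul_smul]
  congr 3
  have h1 : h = √h * √h := (Real.mul_self_sqrt hh.le).symm
  have h2 := (Real.sqrt_pos.2 hh).ne'
  field_simp
  rw [sq]
  exact congrArg _ h1

theorem SymBound.aestronglyMeasurable_quant (hF : SymBound k c F) (h : ℝ) :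
    AEStronglyMeasurable (quant h F) :=
  (hF.1.continuous.comp (by fun_prop : Continuous fun z : Eu n × Eu n =>
    (z.1, (-(2 * π * h)) • z.2))).aestronglyMeasurable

theorem SymBound.norm_quant_le (hF : SymBound k c F) (hk : k ≤ 0) (hc : ∀ i j, 0 ≤ c i j)
    (z : Eu n × Eu n) : ‖quant h F z‖ ≤ c 0 0 :=
  hF.norm_le_of_nonpos hk hc [] [] _

theorem exists_formBound_quant (n : ℕ) : ∃ K : ℝ, 0 < K ∧ ∀ (h : ℝ), 0 < h →
    ∀ (k : ℝ) (c : ℕ → ℕ → ℝ) (F : Eu n × Eu n → ℂ), k ≤ 0 → (∀ i j, 0 ≤ c i j) →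
      SymBound k c F → FormBound (K * wsum (cvOrder n) (√h) c) (quant h F) := by
  obtain ⟨K, hK, hcv⟩ := exists_formBound n
  refine ⟨K * ((2 * n + 1) ^ cvOrder n * (2 * π) ^ cvOrder n), by positivity,
    fun h hh k c F hk hc hF => ?_⟩
  refine FormBound.of_scale (Units.mk0 (√h) (Real.sqrt_pos.2 hh).ne') ?_
  simp only [quant_scaleMap hh]
  have := hcv _ _ (hF.derivBound_scale hk hc (Real.sqrt_nonneg h) (cvOrder n))
  rwa [show ∀ x y z w : ℝ, x * (y * z) * w = x * (y * (z * w)) from fun x y z w => by ring]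

theorem dXi_scale (hF : ContDiff ℝ ∞ F) (p q : ℝ) (j : Fin n) (z : Eu n × Eu n) :
    dXi j (fun z : Eu n × Eu n => F (p • z.1, q • z.2)) z =
      (q : ℂ) * dXis [j] F (p • z.1, q • z.2) := by
  have := words_scale hF p q [j] [] z
  simpa [dXs, dirs_nil, dXis, dirs_cons] using this

theorem dX_scale (hF : ContDiff ℝ ∞ F) (p q : ℝ) (j : Fin n) (z : Eu n × Eu n) :
    dX j (fun z : Eu n × Eu n => F (p • z.1, q • z.2)) z =
      (p : ℂ) * dXs [j] F (p • z.1, q • z.2) := by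
  have := words_scale hF p q [] [j] z
  simpa [dXs, dirs_nil, dXis, dirs_cons] using this

/-- The composition of two operators with smooth symbols. -/
theorem exists_compBound_quant (n : ℕ) : ∃ K : ℝ, 0 < K ∧ ∀ (h : ℝ), 0 < h →
    ∀ (k k' : ℝ) (c c' : ℕ → ℕ → ℝ) (a b : Eu n × Eu n → ℂ), k ≤ 0 → k' ≤ 0 →
      (∀ i j, 0 ≤ c i j) → (∀ i j, 0 ≤ c' i j) → SymBound k c a → SymBound k' c' b →
      CompBound (K * ((√h * wsum (compOrder n) (√h) fun i j => c (i + 1) j) *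
        (√h * wsum (compOrder n) (√h) fun i j => c' i (j + 1)))) (quant h a) (quant h b) := by
  obtain ⟨K, hK, hcomp⟩ := exists_norm_comp_sub_le n
  obtain ⟨L, hL, hcv⟩ := exists_represents n
  obtain ⟨D, hD⟩ : ∃ D : ℝ, D = (2 * n + 1) ^ compOrder n * (2 * π) ^ compOrder n := ⟨_, rfl⟩
  have hD0 : 0 < D := by rw [hD]; positivity
  refine ⟨K * (D * (2 * π)) * D, by positivity, fun h hh k k' c c' a b hk hk' hc hc' ha hb => ?_⟩
  have hr := Real.sqrt_nonneg h
  refine CompBound.of_scale (Units.mk0 (√h) (Real.sqrt_pos.2 hh).ne') ?_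
  simp only [quant_scaleMap hh]
  have hda : ∀ N, DerivBound N _ _ := fun N => ha.derivBound_scale hk hc hr N
  have hdb : ∀ N, DerivBound N _ _ := fun N => hb.derivBound_scale hk' hc' hr N
  obtain ⟨Ta, hTa, -⟩ := hcv _ _ (hda (cvOrder n))
  obtain ⟨Tb, hTb, -⟩ := hcv _ _ (hdb (cvOrder n))
  obtain ⟨Tab, hTab, -⟩ := hcv _ _ ((hda (cvOrder n)).mul (hdb (cvOrder n)))
  refine ⟨Ta, Tb, Tab, hTa, hTb, hTab, ?_⟩
  have hw1 := wsum_nonneg (N := compOrder n) hr (c := fun i j => c (i + 1) j) fun i j => hc _ _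
  have hw2 := wsum_nonneg (N := compOrder n) hr (c := fun i j => c' i (j + 1)) fun i j => hc' _ _
  -- The mandatory ξ-derivative contributes the chain rule factor 2π√h, and ∂_{ξ_j}a is again a
  -- symbol of nonpositive order, with constants shifted by one.
  have h1 : ∀ j, DerivBound (compOrder n) (fun _ => D * (2 * π) * (√h * wsum (compOrder n) (√h)
      fun i j => c (i + 1) j)) (dXi j fun z : Eu n × Eu n => a (√h • z.1, (-(2 * π * √h)) • z.2)) := by
    intro j
    have := ((ha.dXis [j]).derivBound_scale (by simp; linarith) (fun i j => hc _ _) hr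
      (compOrder n)).const_mul ((-(2 * π * √h) : ℝ) : ℂ)
    refine (this.congr fun z => dXi_scale ha.1 _ _ j z).mono fun z => le_of_eq ?_
    rw [Complex.norm_real, norm_neg, Real.norm_of_nonneg (by positivity), hD]
    simp only [List.length_singleton]
    ring
  have h2 : ∀ j, DerivBound (compOrder n) (fun _ => D * (√h * wsum (compOrder n) (√h)
      fun i j => c' i (j + 1))) (dX j fun z : Eu n × Eu n => b (√h • z.1, (-(2 * π * √h)) • z.2)) := by
    intro j
    have := ((hb.dXs [j]).derivBound_scale hk' (fun i j => hc' _ _) hr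
      (compOrder n)).const_mul ((√h : ℝ) : ℂ)
    refine (this.congr fun z => dX_scale hb.1 _ _ j z).mono fun z => le_of_eq ?_
    rw [Complex.norm_real, Real.norm_of_nonneg hr, hD]
    simp only [List.length_singleton]
    ring
  refine (hcomp _ _ _ _ _ _ _ _ _ (by positivity) (by positivity) (hda (compOrder n))
    (hdb (compOrder n)) h1 h2 hTa hTb hTab).trans (le_of_eq ?_)
  ring

end

/-! ### Operations on composition bounds -/

section

variable {A B D M M' Ba Bb : ℝ} {a a' b b' : Eu n × Eu n → ℂ}

theorem CompBound.mono (h : CompBound M a b) (hM : M ≤ M') : CompBound M' a b := by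
  obtain ⟨Ta, Tb, Tab, ha, hb, hab, hn⟩ := h
  exact ⟨Ta, Tb, Tab, ha, hb, hab, hn.trans hM⟩

theorem CompBound.congr (h : CompBound M a b) (ha' : ∀ z, a' z = a z) (hb' : ∀ z, b' z = b z) :
    CompBound M a' b' := by
  rwa [funext ha', funext hb']

/-- The triangle inequality, without cancellation between the composition and the product. It is
used for the remainder of the decomposition, which is small by itself. -/
theorem CompBound.of_formBound (hma : AEStronglyMeasurable a) (hmb : AEStronglyMeasurable b)
    (hba : ∀ z, ‖a z‖ ≤ Ba) (hbb : ∀ z, ‖b z‖ ≤ Bb) (hA : 0 ≤ A) (hB : 0 ≤ B) (hD : 0 ≤ D)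
    (ha : FormBound A a) (hb : FormBound B b) (hab : FormBound D fun z => a z * b z) :
    CompBound (A * B + D) a b := by
  obtain ⟨Ta, hTa, hna⟩ := ha.exists_represents hA hma hba
  obtain ⟨Tb, hTb, hnb⟩ := hb.exists_represents hB hmb hbb
  obtain ⟨Tab, hTab, hnab⟩ := hab.exists_represents hD (hma.mul hmb) (C := Ba * Bb) fun z =>
    (norm_mul (a z) (b z)).le.trans (mul_le_mul (hba z) (hbb z) (norm_nonneg _)
      ((norm_nonneg _).trans (hba z)))
  refine ⟨Ta, Tb, Tab, hTa, hTb, hTab, (norm_sub_le _ _).trans (add_le_add ?_ hnab)⟩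
  exact (Ta.opNorm_comp_le Tb).trans (mul_le_mul hna hnb (norm_nonneg _) hA)

theorem norm_mul_le_of_bounds (hba : ∀ z, ‖a z‖ ≤ Ba) (hbb : ∀ z, ‖b z‖ ≤ Bb) (z : Eu n × Eu n) :
    ‖a z * b z‖ ≤ Ba * Bb :=
  (norm_mul (a z) (b z)).le.trans (mul_le_mul (hba z) (hbb z) (norm_nonneg _)
    ((norm_nonneg _).trans (hba z)))

theorem CompBound.add_right {Bb' : ℝ} (h : CompBound M a b) (h' : CompBound M' a b')
    (hma : AEStronglyMeasurable a) (hmb : AEStronglyMeasurable b) (hmb' : AEStronglyMeasurable b')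
    (hba : ∀ z, ‖a z‖ ≤ Ba) (hbb : ∀ z, ‖b z‖ ≤ Bb) (hbb' : ∀ z, ‖b' z‖ ≤ Bb') :
    CompBound (M + M') a fun z => b z + b' z := by
  obtain ⟨Ta, Tb, Tab, ha, hb, hab, hn⟩ := h
  obtain ⟨Ta', Tb', Tab', ha', hb', hab', hn'⟩ := h'
  obtain rfl := ha.unique ha'
  refine ⟨Ta, Tb + Tb', Tab + Tab', ha, hb.add hb' hmb hbb hmb' hbb', ?_, ?_⟩
  · exact (hab.add hab' (hma.mul hmb) (norm_mul_le_of_bounds hba hbb) (hma.mul hmb')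
      (norm_mul_le_of_bounds hba hbb')).congr fun z => by ring
  · rw [ContinuousLinearMap.comp_add, add_sub_add_comm]
    exact (norm_add_le _ _).trans (add_le_add hn hn')

theorem CompBound.add_left {Ba' : ℝ} (h : CompBound M a b) (h' : CompBound M' a' b)
    (hma : AEStronglyMeasurable a) (hma' : AEStronglyMeasurable a') (hmb : AEStronglyMeasurable b)
    (hba : ∀ z, ‖a z‖ ≤ Ba) (hba' : ∀ z, ‖a' z‖ ≤ Ba') (hbb : ∀ z, ‖b z‖ ≤ Bb) :
    CompBound (M + M') (fun z => a z + a' z) b := by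
  obtain ⟨Ta, Tb, Tab, ha, hb, hab, hn⟩ := h
  obtain ⟨Ta', Tb', Tab', ha', hb', hab', hn'⟩ := h'
  obtain rfl := hb.unique hb'
  refine ⟨Ta + Ta', Tb, Tab + Tab', ha.add ha' hma hba hma' hba', hb, ?_, ?_⟩
  · exact (hab.add hab' (hma.mul hmb) (norm_mul_le_of_bounds hba hbb) (hma'.mul hmb)
      (norm_mul_le_of_bounds hba' hbb)).congr fun z => by ring
  · rw [ContinuousLinearMap.add_comp, add_sub_add_comm]
    exact (norm_add_le _ _).trans (add_le_add hn hn')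

theorem tendsto_form_mul_left {b : ℕ → Eu n × Eu n → ℂ} {b' : Eu n × Eu n → ℂ}
    (hma : AEStronglyMeasurable a) (hmb : ∀ m, AEStronglyMeasurable (b m)) (hba : ∀ z, ‖a z‖ ≤ Ba)
    (hbb : ∀ m z, ‖b m z‖ ≤ Bb) (hlim : ∀ᵐ z, Tendsto (fun m => b m z) atTop (𝓝 (b' z)))
    (f g : 𝓢(Eu n, ℂ)) : Tendsto (fun m => form (fun z => a z * b m z) f g) atTop
      (𝓝 (form (fun z => a z * b' z) f g)) := by
  refine tendsto_form (fun m => hma.mul (hmb m)) (fun m => norm_mul_le_of_bounds hba (hbb m)) ?_ f g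
  filter_upwards [hlim] with z hz
  exact hz.const_mul _

/-- The operator of a does not depend on m, by uniqueness, so weak convergence survives composition
with it. The operators of the products ab_m are bounded uniformly because they differ from
Op(a)Op(b_m) by at most M, and so they converge weakly too. The bound B is only qualitative. -/
theorem CompBound.of_tendsto_right {b : ℕ → Eu n × Eu n → ℂ} {b' : Eu n × Eu n → ℂ}
    (h : ∀ m, CompBound M a (b m)) (hma : AEStronglyMeasurable a)
    (hmb : ∀ m, AEStronglyMeasurable (b m)) (hba : ∀ z, ‖a z‖ ≤ Ba) (hbb : ∀ m z, ‖b m z‖ ≤ Bb)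
    (hbb' : ∀ z, ‖b' z‖ ≤ Bb) (hB : 0 ≤ B) (hb : ∀ m, FormBound B (b m))
    (hlim : ∀ᵐ z, Tendsto (fun m => b m z) atTop (𝓝 (b' z))) : CompBound M a b' := by
  have hmb' : AEStronglyMeasurable b' := aestronglyMeasurable_of_tendsto_ae atTop hmb hlim
  have hf1 := tendsto_form hmb hbb hlim
  have hf2 := tendsto_form_mul_left hma hmb hba hbb hlim
  choose Ta Tb Tab hTa hTb hTab hn using h
  have hTa0 : ∀ m, Ta m = Ta 0 := fun m => (hTa m).unique (hTa 0)
  have hnb : ∀ m, ‖Tb m‖ ≤ B := fun m => (hTb m).norm_le hB (hb m)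
  have hM0 : 0 ≤ M := (norm_nonneg _).trans (hn 0)
  have hnab : ∀ m, ‖Tab m‖ ≤ ‖Ta 0‖ * B + M := fun m => by
    have e : Tab m = Ta m ∘L Tb m - (Ta m ∘L Tb m - Tab m) := by abel
    rw [e]
    refine (norm_sub_le _ _).trans (add_le_add ?_ (hn m))
    rw [hTa0 m]
    exact ((Ta 0).opNorm_comp_le _).trans (mul_le_mul_of_nonneg_left (hnb m) (norm_nonneg _))
  obtain ⟨Tb', hTb', -⟩ := (FormBound.of_tendsto hb tendsto_const_nhds hf1).exists_represents
    hB hmb' hbb'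
  have hfab : ∀ m, FormBound (‖Ta 0‖ * B + M) fun z => a z * b m z := fun m f g =>
    ((hTab m).norm_form_le f g).trans (mul_le_mul_of_nonneg_right (hnab m) (by positivity))
  obtain ⟨Tab', hTab', -⟩ := (FormBound.of_tendsto hfab tendsto_const_nhds hf2).exists_represents
    (by positivity) (hma.mul hmb') (norm_mul_le_of_bounds hba hbb')
  refine ⟨Ta 0, Tb', Tab', hTa 0, hTb', hTab', ?_⟩
  have w1 := (WeakTendsto.of_represents hnb hTb hTb' hf1).comp_left (Ta 0)
  have w2 := WeakTendsto.of_represents hnab hTab hTab' hf2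
  exact (w1.sub w2).norm_le (M := fun _ => M) (fun m => by simpa only [hTa0 m] using hn m)
    tendsto_const_nhds

theorem CompBound.of_tendsto_left {a : ℕ → Eu n × Eu n → ℂ} {a' : Eu n × Eu n → ℂ}
    (h : ∀ m, CompBound M (a m) b) (hma : ∀ m, AEStronglyMeasurable (a m))
    (hmb : AEStronglyMeasurable b) (hba : ∀ m z, ‖a m z‖ ≤ Ba) (hba' : ∀ z, ‖a' z‖ ≤ Ba)
    (hbb : ∀ z, ‖b z‖ ≤ Bb) (hA : 0 ≤ A) (ha : ∀ m, FormBound A (a m))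
    (hlim : ∀ᵐ z, Tendsto (fun m => a m z) atTop (𝓝 (a' z))) : CompBound M a' b := by
  have hma' : AEStronglyMeasurable a' := aestronglyMeasurable_of_tendsto_ae atTop hma hlim
  have hf1 := tendsto_form hma hba hlim
  have hf2 := tendsto_form_mul_left hmb hma hbb hba hlim
  simp only [mul_comm (b _)] at hf2
  choose Ta Tb Tab hTa hTb hTab hn using h
  have hTb0 : ∀ m, Tb m = Tb 0 := fun m => (hTb m).unique (hTb 0)
  have hna : ∀ m, ‖Ta m‖ ≤ A := fun m => (hTa m).norm_le hA (ha m)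
  have hM0 : 0 ≤ M := (norm_nonneg _).trans (hn 0)
  have hnab : ∀ m, ‖Tab m‖ ≤ A * ‖Tb 0‖ + M := fun m => by
    have e : Tab m = Ta m ∘L Tb m - (Ta m ∘L Tb m - Tab m) := by abel
    rw [e]
    refine (norm_sub_le _ _).trans (add_le_add ?_ (hn m))
    rw [hTb0 m]
    exact ((Ta m).opNorm_comp_le _).trans (mul_le_mul_of_nonneg_right (hna m) (norm_nonneg _))
  obtain ⟨Ta', hTa', -⟩ := (FormBound.of_tendsto ha tendsto_const_nhds hf1).exists_represents
    hA hma' hba'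
  have hfab : ∀ m, FormBound (A * ‖Tb 0‖ + M) fun z => a m z * b z := fun m f g =>
    ((hTab m).norm_form_le f g).trans (mul_le_mul_of_nonneg_right (hnab m) (by positivity))
  obtain ⟨Tab', hTab', -⟩ := (FormBound.of_tendsto hfab tendsto_const_nhds hf2).exists_represents
    (by positivity) (hma'.mul hmb) (norm_mul_le_of_bounds hba' hbb)
  refine ⟨Ta', Tb 0, Tab', hTa', hTb 0, hTab', ?_⟩
  have w1 := (WeakTendsto.of_represents hna hTa hTa' hf1).comp_right (Tb 0)
  have w2 := WeakTendsto.of_represents hnab hTab hTab' hf2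
  exact (w1.sub w2).norm_le (M := fun _ => M) (fun m => by simpa only [hTb0 m] using hn m)
    tendsto_const_nhds

end

end

section

/-! ### Composition bounds which involve few derivatives in `x` of one of the symbols -/

variable {n : ℕ}

open Filter Topology

section

variable {k k' h r R : ℝ} {c c' : ℕ → ℕ → ℝ} {F G a b : Eu n × Eu n → ℂ}

theorem pow_le_succ_pow {m : ℕ} (hm : m ≤ n + 1) : (n : ℝ) ^ m ≤ (n + 1) ^ (n + 1) :=
  (pow_le_pow_left₀ (Nat.cast_nonneg _) (by linarith) m).trans
    (pow_le_pow_right₀ (by linarith [(Nat.cast_nonneg n : (0 : ℝ) ≤ n)]) hm)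

theorem SymBound.freqSymbol (hF : SymBound k c F) (hc : ∀ i j, 0 ≤ c i j)
    (hR : ∀ i ≤ n + 1, c i 0 ≤ R) : FreqSymbol k ((n + 1) ^ (n + 1) * R) F := by
  intro x
  refine ⟨hF.1.comp (contDiff_const.prodMk contDiff_id), fun m hm ξ => ?_⟩
  refine (hF.norm_iteratedFDeriv_le m x ξ).trans ?_
  rw [mul_assoc]
  exact mul_le_mul (pow_le_succ_pow hm) (mul_le_mul_of_nonneg_right (hR m hm)
    (rpow_bracket_nonneg _ _)) (mul_nonneg (hc _ _) (rpow_bracket_nonneg _ _)) (by positivity)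

/-- In the Leibniz rule the orders of the two factors add up to m ≤ n + 1. Keeping this constraint,
rather than multiplying separate bounds, produces the range |α₁| + |α₂| ≤ d of the last sum in the
theorem. -/
theorem SymBound.freqSymbol_mul (hF : SymBound k c F) (hG : SymBound k' c' G)
    (hc : ∀ i j, 0 ≤ c i j) (hc' : ∀ i j, 0 ≤ c' i j)
    (hR : ∀ i i', i + i' ≤ n + 1 → c i 0 * c' i' 0 ≤ R) :
    FreqSymbol (k + k') (2 ^ (n + 1) * (n + 1) ^ (n + 1) * R) fun z => F z * G z := by
  intro x
  have hs1 : ContDiff ℝ ∞ fun ξ => F (x, ξ) := hF.1.comp (contDiff_const.prodMk contDiff_id)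
  have hs2 : ContDiff ℝ ∞ fun ξ => G (x, ξ) := hG.1.comp (contDiff_const.prodMk contDiff_id)
  refine ⟨hs1.mul hs2, fun m hm ξ => ?_⟩
  have hR0 : 0 ≤ R := (mul_nonneg (hc 0 0) (hc' 0 0)).trans (hR 0 0 (Nat.zero_le _))
  refine (norm_iteratedFDeriv_mul_le hs1 hs2 ξ (n := m) (by exact_mod_cast le_top)).trans ?_
  have hterm : ∀ i ∈ Finset.range (m + 1), (m.choose i : ℝ) *
      ‖iteratedFDeriv ℝ i (fun ξ => F (x, ξ)) ξ‖ * ‖iteratedFDeriv ℝ (m - i) (fun ξ => G (x, ξ)) ξ‖ ≤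
      (m.choose i : ℝ) * ((n + 1) ^ (n + 1) * R * bracket ξ ^ (k + k' - m)) := fun i hi => by
    have hi' : i ≤ m := Nat.lt_succ_iff.1 (Finset.mem_range.1 hi)
    have hb1 := rpow_bracket_nonneg (k - i) ξ
    have hb2 := rpow_bracket_nonneg (k' - (m - i : ℕ)) ξ
    have hb := rpow_bracket_nonneg (k + k' - m) ξ
    rw [mul_assoc]
    refine mul_le_mul_of_nonneg_left ?_ (Nat.cast_nonneg _)
    have e1 : bracket ξ ^ (k - i) * bracket ξ ^ (k' - (m - i : ℕ)) = bracket ξ ^ (k + k' - m) := by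
      rw [← Real.rpow_add (bracket_pos ξ), Nat.cast_sub hi']
      congr 1; ring
    have e2 : (n : ℝ) ^ i * (n : ℝ) ^ (m - i) = (n : ℝ) ^ m := by
      rw [← pow_add, Nat.add_sub_cancel' hi']
    calc _ ≤ ((n : ℝ) ^ i * (c i 0 * bracket ξ ^ (k - i))) *
          ((n : ℝ) ^ (m - i) * (c' (m - i) 0 * bracket ξ ^ (k' - (m - i : ℕ)))) :=
          mul_le_mul (hF.norm_iteratedFDeriv_le i x ξ) (hG.norm_iteratedFDeriv_le _ x ξ)
            (norm_nonneg _) (mul_nonneg (by positivity) (mul_nonneg (hc _ _) hb1))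
      _ = (n : ℝ) ^ m * (c i 0 * c' (m - i) 0) * bracket ξ ^ (k + k' - m) := by
          rw [← e1, ← e2]; ring
      _ ≤ _ := mul_le_mul_of_nonneg_right (mul_le_mul (pow_le_succ_pow hm)
          (hR _ _ (by omega)) (mul_nonneg (hc _ _) (hc' _ _)) (by positivity)) hb
  refine (Finset.sum_le_sum hterm).trans ?_
  rw [← Finset.sum_mul]
  have h1 : ∑ i ∈ Finset.range (m + 1), (m.choose i : ℝ) = 2 ^ m := by
    exact_mod_cast Nat.sum_range_choose m
  rw [h1, show ∀ p q s t : ℝ, p * q * s * t = p * (q * s * t) from fun p q s t => by ring]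
  refine mul_le_mul_of_nonneg_right (pow_le_pow_right₀ one_le_two hm) ?_
  exact mul_nonneg (by positivity) (rpow_bracket_nonneg _ _)

theorem wsum_const_mul (N : ℕ) (r t : ℝ) (c : ℕ → ℕ → ℝ) :
    wsum N r (fun i j => t * c i j) = t * wsum N r c := by
  simp only [wsum, Finset.mul_sum]
  exact Finset.sum_congr rfl fun i _ => Finset.sum_congr rfl fun j _ => by ring

theorem le_sum_range {f : ℕ → ℝ} (hf : ∀ j, 0 ≤ f j) {N j : ℕ} (hj : j ≤ N) :
    f j ≤ ∑ i ∈ Finset.range (N + 1), f i :=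
  Finset.single_le_sum (fun i _ => hf i) (Finset.mem_range.2 (Nat.lt_succ_of_le hj))

theorem cvOrder_le_compOrder (n : ℕ) : cvOrder n ≤ compOrder n := Nat.le_add_right _ _

theorem sum_range_le_mul {f : ℕ → ℝ} {N : ℕ} {B : ℝ} (h : ∀ i ≤ N, f i ≤ B) :
    ∑ i ∈ Finset.range (N + 1), f i ≤ (N + 1) * B := by
  refine (Finset.sum_le_sum (g := fun _ => B) fun i hi =>
    h i (Nat.lt_succ_iff.1 (Finset.mem_range.1 hi))).trans (le_of_eq ?_)
  rw [Finset.sum_const, Finset.card_range, nsmul_eq_mul]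
  push_cast; ring

/-- Split b = b₁ + b₂ at the scale √h. The three hypotheses on R serve, in order, the smooth
composition with b₁, the composition of Op(a) with the small Op(b₂), and the small Op(ab₂). The last
two rely on the kernel bound for symbols of negative order and so take no x-derivatives of b₂. -/
theorem exists_compBound_right (n : ℕ) {μ : ℕ} (hμ : 1 ≤ μ) {k k' : ℝ} (hk : k ≤ 0) (hk' : k' < 0) :
    ∃ K : ℝ, 0 < K ∧ ∀ (h R : ℝ) (c c' : ℕ → ℕ → ℝ) (a b : Eu n × Eu n → ℂ), 0 < h →
      (∀ i j, 0 ≤ c i j) → (∀ i j, 0 ≤ c' i j) → SymBound k c a → SymBound k' c' b →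
      (∀ i ≤ compOrder n + 1, ∀ j ≤ compOrder n + 1, ∀ i' ≤ compOrder n + 1,
        ∀ j' ≤ compOrder n + 1, 1 ≤ i → 1 ≤ j' → j' ≤ μ →
          √h ^ (i + j) * c i j * (√h ^ (i' + j') * c' i' j') ≤ R) →
      (∀ i ≤ compOrder n, ∀ j ≤ compOrder n, ∀ i' ≤ n + 1,
          √h ^ (i + j) * c i j * (√h ^ μ * c' i' μ) ≤ R) →
      (∀ i i', i + i' ≤ n + 1 → c i 0 * (√h ^ μ * c' i' μ) ≤ R) →
      CompBound (K * R) (quant h a) (quant h b) := by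
  obtain ⟨Kd, hKd, hdec⟩ := exists_decomposition n μ
  obtain ⟨K₁, hK₁, hcomp⟩ := exists_compBound_quant n
  obtain ⟨K₂, hK₂, hcv⟩ := exists_formBound_quant n
  obtain ⟨K₃, hK₃, hf₃⟩ := exists_formBound_of_freqSymbol n hk'
  obtain ⟨K₄, hK₄, hf₄⟩ := exists_formBound_of_freqSymbol n (add_neg_of_nonpos_of_neg hk hk')
  obtain ⟨D, hD⟩ : ∃ D : ℝ, D = ∑ j ∈ Finset.range (compOrder n + 1 + 1), Kd j := ⟨_, rfl⟩
  have hKdD : ∀ j ≤ compOrder n + 1, Kd j ≤ D := fun j hj =>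
    hD ▸ le_sum_range (fun j => (hKd j).le) hj
  have hD0 : 0 < D := (hKd 0).trans_le (hKdD 0 (Nat.zero_le _))
  refine ⟨K₁ * ((compOrder n + 1) ^ 4 * D) + (K₂ * (K₃ * ((n + 1) ^ (n + 1) *
    (((n + 1 : ℕ) + 1) * ((cvOrder n + 1) ^ 2 * D)))) +
      K₄ * (2 ^ (n + 1) * (n + 1) ^ (n + 1) * D)), by positivity,
    fun h R c c' a b hh hc hc' ha hb H1 H2 H3 => ?_⟩
  have hr := Real.sqrt_pos.2 hh
  obtain ⟨r, hrh⟩ : ∃ r, r = √h := ⟨_, rfl⟩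
  rw [← hrh] at hr H1 H2 H3
  obtain ⟨b₁, b₂, hbb, hb₁, hb₂⟩ := hdec r hr k' c' b hc' hb
  have hR0 : 0 ≤ R := (mul_nonneg (hc 0 0) (mul_nonneg (by positivity) (hc' 0 μ))).trans
    (H3 0 0 (Nat.zero_le _))
  have hcc1 : ∀ i j, 0 ≤ Kd j * (r ^ min j μ * c' i (min j μ) / r ^ j) := fun i j =>
    mul_nonneg (hKd j).le (div_nonneg (mul_nonneg (by positivity) (hc' _ _)) (by positivity))
  have hcc2 : ∀ i j, 0 ≤ if j = 0 then Kd 0 * (r ^ μ * c' i μ) else Kd 0 * c' i j := fun i j => by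
    have h1 := mul_nonneg (hKd 0).le (mul_nonneg (by positivity : 0 ≤ r ^ μ) (hc' i μ))
    have h2 := mul_nonneg (hKd 0).le (hc' i j)
    split_ifs <;> assumption
  have p1 := hcomp h hh k k' _ _ a b₁ hk hk'.le hc hcc1 ha hb₁
  rw [← hrh] at p1
  have p1' : CompBound (K₁ * ((compOrder n + 1) ^ 4 * D) * R) (quant h a) (quant h b₁) := by
    refine p1.mono ?_
    rw [mul_assoc K₁]
    refine mul_le_mul_of_nonneg_left ?_ hK₁.le
    rw [← wsum_const_mul, ← wsum_const_mul, mul_assoc]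
    refine wsum_mul_wsum_le fun i hi j hj i' hi' j' hj' => ?_
    -- An x-derivative of b₁ of order j' + 1 is charged to order min(j'+1, μ) of b, the surplus
    -- powers of 1/√h cancelling against the accompanying √h. The capped order is still at least 1
    -- because μ ≥ 1.
    have h1 := H1 (i + 1) (by omega) j (by omega) i' (by omega) (min (j' + 1) μ) (by omega)
      (by omega) (by omega) (by omega)
    have h0 : 0 ≤ r ^ (i + 1 + j) * c (i + 1) j * (r ^ (i' + min (j' + 1) μ) *
      c' i' (min (j' + 1) μ)) := by
      have := hc (i + 1) j; have := hc' i' (min (j' + 1) μ); positivity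
    calc _ = Kd (j' + 1) * (r ^ (i + 1 + j) * c (i + 1) j * (r ^ (i' + min (j' + 1) μ) *
          c' i' (min (j' + 1) μ))) := by
          have : r ^ (j' + 1) ≠ 0 := by positivity
          rw [pow_add r i', pow_add r i', pow_succ r j'] at *
          field_simp
          ring
      _ ≤ D * R := mul_le_mul (hKdD _ (by omega)) h1 h0 hD0.le
  have f1 := hcv h hh k c a hk hc ha
  rw [← hrh] at f1
  have m1 := ha.aestronglyMeasurable_quant h
  have m2 := hb₁.aestronglyMeasurable_quant h
  have m3 := hb₂.aestronglyMeasurable_quant h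
  have hτ : -(2 * π * h) ≠ 0 := by
    have := Real.pi_pos
    exact neg_ne_zero.2 (by positivity)
  -- The kernel bound for b₂ needs one constant for all ξ-orders up to n + 1; their sum is taken.
  obtain ⟨S, hS⟩ : ∃ S : ℝ, S = ∑ i ∈ Finset.range (n + 1 + 1), Kd 0 * (r ^ μ * c' i μ) := ⟨_, rfl⟩
  have hS0 : ∀ i, 0 ≤ Kd 0 * (r ^ μ * c' i μ) := fun i =>
    mul_nonneg (hKd 0).le (mul_nonneg (by positivity) (hc' i μ))
  have hSn : 0 ≤ S := hS ▸ Finset.sum_nonneg fun i _ => hS0 i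
  have f2 := hf₃ _ _ b₂ hτ hb₂.1.continuous.aestronglyMeasurable
    (hb₂.freqSymbol hcc2 (R := S) fun i hi => by
      rw [if_pos rfl, hS]
      exact le_sum_range hS0 hi)
  have f3 := hf₄ _ _ _ hτ (ha.1.continuous.mul hb₂.1.continuous).aestronglyMeasurable
    (ha.freqSymbol_mul hb₂ hc hcc2 (R := D * R) fun i i' hi => by
      rw [if_pos rfl]
      calc _ = Kd 0 * (c i 0 * (r ^ μ * c' i' μ)) := by ring
        _ ≤ D * R := mul_le_mul (hKdD 0 (Nat.zero_le _)) (H3 i i' hi)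
          (mul_nonneg (hc _ _) (mul_nonneg (by positivity) (hc' _ _))) hD0.le)
  have hw := wsum_nonneg (N := cvOrder n) hr.le hc
  have p2 := CompBound.of_formBound m1 m3 (ha.norm_quant_le hk hc) (hb₂.norm_quant_le hk'.le hcc2)
    (mul_nonneg hK₂.le hw) (by positivity) (by positivity) f1 f2 f3
  have p3 := p1'.add_right p2 m1 m2 m3 (ha.norm_quant_le hk hc) (hb₁.norm_quant_le hk'.le hcc1)
    (hb₂.norm_quant_le hk'.le hcc2)
  refine (p3.congr (fun z => rfl) fun z => hbb _).mono ?_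
  have hWS : wsum (cvOrder n) r c * S ≤ ((n + 1 : ℕ) + 1) * ((cvOrder n + 1) ^ 2 * D) * R := by
    rw [hS, Finset.mul_sum, mul_assoc]
    refine sum_range_le_mul fun i' hi' => ?_
    rw [mul_comm, mul_assoc _ D]
    refine mul_wsum_le fun i hi j hj => ?_
    have hcv := cvOrder_le_compOrder n
    calc _ = Kd 0 * (r ^ (i + j) * c i j * (r ^ μ * c' i' μ)) := by ring
      _ ≤ D * R := mul_le_mul (hKdD 0 (Nat.zero_le _)) (H2 i (by omega) j (by omega) i' hi')
        (by have := hc i j; have := hc' i' μ; positivity) hD0.le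
  calc _ = K₁ * ((compOrder n + 1) ^ 4 * D) * R + (K₂ * (K₃ * ((n + 1) ^ (n + 1) *
        (wsum (cvOrder n) r c * S))) + K₄ * (2 ^ (n + 1) * (n + 1) ^ (n + 1) * D) * R) := by ring
    _ ≤ K₁ * ((compOrder n + 1) ^ 4 * D) * R + (K₂ * (K₃ * ((n + 1) ^ (n + 1) *
        (((n + 1 : ℕ) + 1) * ((cvOrder n + 1) ^ 2 * D) * R))) +
          K₄ * (2 ^ (n + 1) * (n + 1) ^ (n + 1) * D) * R) := by
        have : (0 : ℝ) ≤ (n + 1) ^ (n + 1) := by positivity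
        refine add_le_add le_rfl (add_le_add ?_ le_rfl)
        exact mul_le_mul_of_nonneg_left (mul_le_mul_of_nonneg_left
          (mul_le_mul_of_nonneg_left hWS this) hK₃.le) hK₂.le
    _ = _ := by ring

end

end

/-! ### The mirror image with a rough left factor, and functions of x as right factor. -/

section

variable {n : ℕ}

open Filter Topology

/-- As in `exists_compBound_right`, with a decomposed instead of b. The mandatory derivative of a is
in ξ, so the capped x-order min(j, μ) is free to be zero. -/
theorem exists_compBound_left (n μ : ℕ) {k k' : ℝ} (hk : k < 0) (hk' : k' ≤ 0) :
    ∃ K : ℝ, 0 < K ∧ ∀ (h R : ℝ) (c c' : ℕ → ℕ → ℝ) (a b : Eu n × Eu n → ℂ), 0 < h →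
      (∀ i j, 0 ≤ c i j) → (∀ i j, 0 ≤ c' i j) → SymBound k c a → SymBound k' c' b →
      (∀ i ≤ compOrder n + 1, ∀ j ≤ compOrder n + 1, ∀ i' ≤ compOrder n + 1,
        ∀ j' ≤ compOrder n + 1, 1 ≤ i → 1 ≤ j' → j ≤ μ →
          √h ^ (i + j) * c i j * (√h ^ (i' + j') * c' i' j') ≤ R) →
      (∀ i ≤ n + 1, ∀ i' ≤ compOrder n, ∀ j' ≤ compOrder n,
          √h ^ μ * c i μ * (√h ^ (i' + j') * c' i' j') ≤ R) →
      (∀ i i', i + i' ≤ n + 1 → √h ^ μ * c i μ * c' i' 0 ≤ R) →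
      CompBound (K * R) (quant h a) (quant h b) := by
  obtain ⟨Kd, hKd, hdec⟩ := exists_decomposition n μ
  obtain ⟨K₁, hK₁, hcomp⟩ := exists_compBound_quant n
  obtain ⟨K₂, hK₂, hcv⟩ := exists_formBound_quant n
  obtain ⟨K₃, hK₃, hf₃⟩ := exists_formBound_of_freqSymbol n hk
  obtain ⟨K₄, hK₄, hf₄⟩ := exists_formBound_of_freqSymbol n (add_neg_of_neg_of_nonpos hk hk')
  obtain ⟨D, hD⟩ : ∃ D : ℝ, D = ∑ j ∈ Finset.range (compOrder n + 1 + 1), Kd j := ⟨_, rfl⟩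
  have hKdD : ∀ j ≤ compOrder n + 1, Kd j ≤ D := fun j hj =>
    hD ▸ le_sum_range (fun j => (hKd j).le) hj
  have hD0 : 0 < D := (hKd 0).trans_le (hKdD 0 (Nat.zero_le _))
  refine ⟨K₁ * ((compOrder n + 1) ^ 4 * D) + (K₂ * (K₃ * ((n + 1) ^ (n + 1) *
    (((n + 1 : ℕ) + 1) * ((cvOrder n + 1) ^ 2 * D)))) +
      K₄ * (2 ^ (n + 1) * (n + 1) ^ (n + 1) * D)), by positivity,
    fun h R c c' a b hh hc hc' ha hb H1 H2 H3 => ?_⟩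
  have hr := Real.sqrt_pos.2 hh
  obtain ⟨r, hrh⟩ : ∃ r, r = √h := ⟨_, rfl⟩
  rw [← hrh] at hr H1 H2 H3
  obtain ⟨a₁, a₂, haa, ha₁, ha₂⟩ := hdec r hr k c a hc ha
  have hR0 : 0 ≤ R := (mul_nonneg (mul_nonneg (by positivity) (hc 0 μ)) (hc' 0 0)).trans
    (H3 0 0 (Nat.zero_le _))
  have hcc1 : ∀ i j, 0 ≤ Kd j * (r ^ min j μ * c i (min j μ) / r ^ j) := fun i j =>
    mul_nonneg (hKd j).le (div_nonneg (mul_nonneg (by positivity) (hc _ _)) (by positivity))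
  have hcc2 : ∀ i j, 0 ≤ if j = 0 then Kd 0 * (r ^ μ * c i μ) else Kd 0 * c i j := fun i j => by
    have h1 := mul_nonneg (hKd 0).le (mul_nonneg (by positivity : 0 ≤ r ^ μ) (hc i μ))
    have h2 := mul_nonneg (hKd 0).le (hc i j)
    split_ifs <;> assumption
  have p1 := hcomp h hh k k' _ _ a₁ b hk.le hk' hcc1 hc' ha₁ hb
  rw [← hrh] at p1
  have p1' : CompBound (K₁ * ((compOrder n + 1) ^ 4 * D) * R) (quant h a₁) (quant h b) := by
    refine p1.mono ?_
    rw [mul_assoc K₁]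
    refine mul_le_mul_of_nonneg_left ?_ hK₁.le
    rw [← wsum_const_mul, ← wsum_const_mul, mul_assoc]
    refine wsum_mul_wsum_le fun i hi j hj i' hi' j' hj' => ?_
    have h1 := H1 (i + 1) (by omega) (min j μ) (by omega) i' (by omega) (j' + 1) (by omega)
      (by omega) (by omega) (by omega)
    have h0 : 0 ≤ r ^ (i + 1 + min j μ) * c (i + 1) (min j μ) * (r ^ (i' + (j' + 1)) *
      c' i' (j' + 1)) := by
      have := hc (i + 1) (min j μ); have := hc' i' (j' + 1); positivity
    calc _ = Kd j * (r ^ (i + 1 + min j μ) * c (i + 1) (min j μ) * (r ^ (i' + (j' + 1)) *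
          c' i' (j' + 1))) := by
          have : r ^ j ≠ 0 := by positivity
          rw [pow_add r i j, pow_add r (i + 1), pow_succ r i]
          field_simp
          ring
      _ ≤ D * R := mul_le_mul (hKdD _ (by omega)) h1 h0 hD0.le
  have f1 := hcv h hh k' c' b hk' hc' hb
  rw [← hrh] at f1
  have m1 := hb.aestronglyMeasurable_quant h
  have m2 := ha₁.aestronglyMeasurable_quant h
  have m3 := ha₂.aestronglyMeasurable_quant h
  have hτ : -(2 * π * h) ≠ 0 := by
    have := Real.pi_pos
    exact neg_ne_zero.2 (by positivity)
  obtain ⟨S, hS⟩ : ∃ S : ℝ, S = ∑ i ∈ Finset.range (n + 1 + 1), Kd 0 * (r ^ μ * c i μ) := ⟨_, rfl⟩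
  have hS0 : ∀ i, 0 ≤ Kd 0 * (r ^ μ * c i μ) := fun i =>
    mul_nonneg (hKd 0).le (mul_nonneg (by positivity) (hc i μ))
  have hSn : 0 ≤ S := hS ▸ Finset.sum_nonneg fun i _ => hS0 i
  have f2 := hf₃ _ _ a₂ hτ ha₂.1.continuous.aestronglyMeasurable
    (ha₂.freqSymbol hcc2 (R := S) fun i hi => by
      rw [if_pos rfl, hS]
      exact le_sum_range hS0 hi)
  have f3 := hf₄ _ _ _ hτ (ha₂.1.continuous.mul hb.1.continuous).aestronglyMeasurable
    (ha₂.freqSymbol_mul hb hcc2 hc' (R := D * R) fun i i' hi => by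
      rw [if_pos rfl]
      calc _ = Kd 0 * (r ^ μ * c i μ * c' i' 0) := by ring
        _ ≤ D * R := mul_le_mul (hKdD 0 (Nat.zero_le _)) (H3 i i' hi)
          (mul_nonneg (mul_nonneg (by positivity) (hc _ _)) (hc' _ _)) hD0.le)
  have hw := wsum_nonneg (N := cvOrder n) hr.le hc'
  have p2 := CompBound.of_formBound m3 m1 (ha₂.norm_quant_le hk.le hcc2) (hb.norm_quant_le hk' hc')
    (by positivity) (mul_nonneg hK₂.le hw) (by positivity) f2 f1 f3
  have p3 := p1'.add_left p2 m2 m3 m1 (ha₁.norm_quant_le hk.le hcc1) (ha₂.norm_quant_le hk.le hcc2)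
    (hb.norm_quant_le hk' hc')
  refine (p3.congr (fun z => haa _) fun z => rfl).mono ?_
  have hWS : wsum (cvOrder n) r c' * S ≤ ((n + 1 : ℕ) + 1) * ((cvOrder n + 1) ^ 2 * D) * R := by
    rw [hS, Finset.mul_sum, mul_assoc]
    refine sum_range_le_mul fun i hi => ?_
    rw [mul_comm, mul_assoc _ D]
    refine mul_wsum_le fun i' hi' j' hj' => ?_
    have hcv := cvOrder_le_compOrder n
    calc _ = Kd 0 * (r ^ μ * c i μ * (r ^ (i' + j') * c' i' j')) := by ring
      _ ≤ D * R := mul_le_mul (hKdD 0 (Nat.zero_le _)) (H2 i hi i' (by omega) j' (by omega))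
        (by have := hc i μ; have := hc' i' j'; positivity) hD0.le
  calc _ = K₁ * ((compOrder n + 1) ^ 4 * D) * R + (K₂ * (K₃ * ((n + 1) ^ (n + 1) *
        (wsum (cvOrder n) r c' * S))) + K₄ * (2 ^ (n + 1) * (n + 1) ^ (n + 1) * D) * R) := by ring
    _ ≤ K₁ * ((compOrder n + 1) ^ 4 * D) * R + (K₂ * (K₃ * ((n + 1) ^ (n + 1) *
        (((n + 1 : ℕ) + 1) * ((cvOrder n + 1) ^ 2 * D) * R))) +
          K₄ * (2 ^ (n + 1) * (n + 1) ^ (n + 1) * D) * R) := by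
        have : (0 : ℝ) ≤ (n + 1) ^ (n + 1) := by positivity
        refine add_le_add le_rfl (add_le_add ?_ le_rfl)
        exact mul_le_mul_of_nonneg_left (mul_le_mul_of_nonneg_left
          (mul_le_mul_of_nonneg_left hWS this) hK₃.le) hK₂.le
    _ = _ := by ring


theorem derivBound_const (N : ℕ) (c : ℂ) {V : Type*} [NormedAddCommGroup V] [NormedSpace ℝ V] :
    DerivBound N (fun _ : V => ‖c‖) fun _ => c := by
  refine ⟨contDiff_const, fun m _ z => ?_⟩
  rcases m with _ | m
  · rw [norm_iteratedFDeriv_zero]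
  · rw [iteratedFDeriv_const_of_ne (Nat.succ_ne_zero m)]
    simp

/-- Multiplication by a bounded function of `x` on the left of an operator. -/
theorem FormBound.mul_fst {A B Ba : ℝ} {a : Eu n × Eu n → ℂ} (ha : FormBound A a) (hA : 0 ≤ A)
    (hma : AEStronglyMeasurable a) (hba : ∀ z, ‖a z‖ ≤ Ba) {m : Eu n → ℂ}
    (hm : AEStronglyMeasurable m) (hmB : ∀ x, ‖m x‖ ≤ B) :
    FormBound (A * B) fun z => a z * m z.1 := fun f g => by
  obtain ⟨T, hT, hTn⟩ := ha.exists_represents hA hma hba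
  have hB0 : 0 ≤ B := (norm_nonneg _).trans (hmB 0)
  have hm2 : AEStronglyMeasurable (fun z : Eu n × Eu n => m z.1) := by
    rw [Measure.volume_eq_prod]
    exact hm.comp_fst
  have hg : MemLp (fun x => (starRingEnd ℂ) (m x) * g x) 2 (volume : Measure (Eu n)) := by
    refine MemLp.of_le_mul (c := B) (g.memLp 2 volume) ?_ (Eventually.of_forall fun x => ?_)
    · exact (Complex.continuous_conj.comp_aestronglyMeasurable hm).mul g.continuous.aestronglyMeasurable
    · rw [norm_mul, RCLike.norm_conj]
      exact mul_le_mul_of_nonneg_right (hmB x) (norm_nonneg _)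
  have hgn : ‖hg.toLp‖ ≤ B * ‖schwartzToL2 g‖ := by
    refine Lp.norm_le_mul_norm_of_ae_le_mul ?_
    filter_upwards [hg.coeFn_toLp, g.coeFn_toLp 2 volume] with x hx hx'
    rw [hx, schwartzToL2, hx', norm_mul, RCLike.norm_conj]
    exact mul_le_mul_of_nonneg_right (hmB x) (norm_nonneg _)
  -- A factor depending on x only can be moved onto g, since the operator is followed by
  -- multiplication with m.
  have e : form (fun z => a z * m z.1) f g = inner ℂ hg.toLp (T (schwartzToL2 f)) := by
    have hc12 : AEStronglyMeasurable fun z : Eu n × Eu n => a z * m z.1 := hma.mul hm2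
    rw [form_eq_integral_opF hc12 (M := Ba * B) (fun z => (norm_mul (a z) (m z.1)).le.trans
      (mul_le_mul (hba z) (hmB z.1) (norm_nonneg _) ((norm_nonneg _).trans (hba z)))), L2.inner_def]
    refine integral_congr_ae ?_
    filter_upwards [hg.coeFn_toLp, hT.ae_eq_opF hma hba f] with x hx hx'
    rw [hx, hx', RCLike.inner_apply, map_mul, Complex.conj_conj]
    have : opF (fun z => a z * m z.1) f x = m x * opF a f x := by
      rw [opF, opF, ← integral_const_mul]
      congr 1; funext ξ
      ring
    rw [this]
    ring
  rw [e]
  refine (norm_inner_le_norm _ _).trans ?_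
  calc _ ≤ (B * ‖schwartzToL2 g‖) * (A * ‖schwartzToL2 f‖) :=
        mul_le_mul hgn (T.le_of_opNorm_le hTn _) (norm_nonneg _) (by positivity)
    _ = _ := by ring

theorem exists_formBound_fst (n : ℕ) : ∃ K : ℝ, 0 < K ∧ ∀ (B : ℝ) (m : Eu n → ℂ),
    AEStronglyMeasurable m → (∀ x, ‖m x‖ ≤ B) → FormBound (K * B) fun z => m z.1 := by
  obtain ⟨K, hK, hcv⟩ := exists_formBound n
  refine ⟨K, hK, fun B m hm hB => ?_⟩
  have h1 : FormBound (K * ‖(1 : ℂ)‖) fun _ : Eu n × Eu n => (1 : ℂ) :=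
    hcv _ _ (derivBound_const (cvOrder n) 1)
  rw [norm_one, mul_one] at h1
  simpa using h1.mul_fst hK.le aestronglyMeasurable_const (Ba := 1) (fun z => by simp) hm hB

theorem SymBound.eq_fst {k : ℝ} {c : ℕ → ℕ → ℝ} {F : Eu n × Eu n → ℂ} (hF : SymBound k c F)
    (hc : c 1 0 = 0) (x ξ : Eu n) : F (x, ξ) = F (x, 0) := by
  have hs : ContDiff ℝ ∞ fun ξ => F (x, ξ) := hF.1.comp (contDiff_const.prodMk contDiff_id)
  refine is_const_of_fderiv_eq_zero (f := fun ξ => F (x, ξ)) (𝕜 := ℝ)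
    (hs.differentiable (by simp)) (fun η => ?_) ξ 0
  have := hF.norm_iteratedFDeriv_le 1 x η
  rw [norm_iteratedFDeriv_one, hc] at this
  simpa using this

/-- The constants of b vanish for positive ξ-order, so the small part b₂ is again a function of x.
As a multiplication operator it is bounded by its supremum, which replaces the kernel bound: neither
negative order nor extra ξ-derivatives of the first symbol are needed. -/
theorem exists_compBound_fst (n : ℕ) {μ : ℕ} (hμ : 1 ≤ μ) :
    ∃ K : ℝ, 0 < K ∧ ∀ (h R : ℝ) (c c' : ℕ → ℕ → ℝ) (a b : Eu n × Eu n → ℂ), 0 < h →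
      (∀ i j, 0 ≤ c i j) → (∀ i j, 0 ≤ c' i j) → SymBound 0 c a → SymBound 0 c' b →
      (∀ i j, 1 ≤ i → c' i j = 0) →
      (∀ i ≤ compOrder n + 1, ∀ j ≤ compOrder n + 1, ∀ j' ≤ compOrder n + 1, 1 ≤ i → 1 ≤ j' →
          j' ≤ μ → √h ^ (i + j) * c i j * (√h ^ j' * c' 0 j') ≤ R) →
      (∀ i ≤ compOrder n, ∀ j ≤ compOrder n,
          √h ^ (i + j) * c i j * (√h ^ μ * c' 0 μ) ≤ R) →
      CompBound (K * R) (quant h a) (quant h b) := by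
  obtain ⟨Kd, hKd, hdec⟩ := exists_decomposition n μ
  obtain ⟨K₁, hK₁, hcomp⟩ := exists_compBound_quant n
  obtain ⟨K₂, hK₂, hcv⟩ := exists_formBound_quant n
  obtain ⟨K₃, hK₃, hf₃⟩ := exists_formBound_fst n
  obtain ⟨D, hD⟩ : ∃ D : ℝ, D = ∑ j ∈ Finset.range (compOrder n + 1 + 1), Kd j := ⟨_, rfl⟩
  have hKdD : ∀ j ≤ compOrder n + 1, Kd j ≤ D := fun j hj =>
    hD ▸ le_sum_range (fun j => (hKd j).le) hj
  have hD0 : 0 < D := (hKd 0).trans_le (hKdD 0 (Nat.zero_le _))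
  refine ⟨K₁ * ((compOrder n + 1) ^ 4 * D) + (K₂ * K₃ + K₂) * ((cvOrder n + 1) ^ 2 * D),
    by positivity, fun h R c c' a b hh hc hc' ha hb hz H1 H2 => ?_⟩
  have hr := Real.sqrt_pos.2 hh
  obtain ⟨r, hrh⟩ : ∃ r, r = √h := ⟨_, rfl⟩
  rw [← hrh] at hr H1 H2
  obtain ⟨b₁, b₂, hbb, hb₁, hb₂⟩ := hdec r hr 0 c' b hc' hb
  have hR0 : 0 ≤ R := (mul_nonneg (mul_nonneg (by positivity) (hc 0 0))
    (mul_nonneg (by positivity) (hc' 0 μ))).trans (H2 0 (Nat.zero_le _) 0 (Nat.zero_le _))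
  have hcc1 : ∀ i j, 0 ≤ Kd j * (r ^ min j μ * c' i (min j μ) / r ^ j) := fun i j =>
    mul_nonneg (hKd j).le (div_nonneg (mul_nonneg (by positivity) (hc' _ _)) (by positivity))
  have hcc2 : ∀ i j, 0 ≤ if j = 0 then Kd 0 * (r ^ μ * c' i μ) else Kd 0 * c' i j := fun i j => by
    have h1 := mul_nonneg (hKd 0).le (mul_nonneg (by positivity : 0 ≤ r ^ μ) (hc' i μ))
    have h2 := mul_nonneg (hKd 0).le (hc' i j)
    split_ifs <;> assumption
  have p1 := hcomp h hh 0 0 _ _ a b₁ le_rfl le_rfl hc hcc1 ha hb₁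
  rw [← hrh] at p1
  have p1' : CompBound (K₁ * ((compOrder n + 1) ^ 4 * D) * R) (quant h a) (quant h b₁) := by
    refine p1.mono ?_
    rw [mul_assoc K₁]
    refine mul_le_mul_of_nonneg_left ?_ hK₁.le
    rw [← wsum_const_mul, ← wsum_const_mul, mul_assoc]
    refine wsum_mul_wsum_le fun i hi j hj i' hi' j' hj' => ?_
    -- Only the terms without ξ-derivative on b₁ survive.
    rcases Nat.eq_zero_or_pos i' with rfl | hi0
    · have h1 := H1 (i + 1) (by omega) j (by omega) (min (j' + 1) μ) (by omega)
        (by omega) (by omega) (by omega)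
      have h0 : 0 ≤ r ^ (i + 1 + j) * c (i + 1) j * (r ^ min (j' + 1) μ *
        c' 0 (min (j' + 1) μ)) := by
        have := hc (i + 1) j; have := hc' 0 (min (j' + 1) μ); positivity
      calc _ = Kd (j' + 1) * (r ^ (i + 1 + j) * c (i + 1) j * (r ^ min (j' + 1) μ *
            c' 0 (min (j' + 1) μ))) := by
            have : r ^ (j' + 1) ≠ 0 := by positivity
            rw [zero_add, pow_succ r j'] at *
            field_simp
            ring
        _ ≤ D * R := mul_le_mul (hKdD _ (by omega)) h1 h0 hD0.le
    · rw [hz i' _ hi0]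
      simp only [mul_zero, zero_div]
      positivity
  have f1 := hcv h hh 0 c a le_rfl hc ha
  rw [← hrh] at f1
  have m1 := ha.aestronglyMeasurable_quant h
  have m2 := hb₁.aestronglyMeasurable_quant h
  have m3 := hb₂.aestronglyMeasurable_quant h
  have hind : ∀ x ξ, b₂ (x, ξ) = b₂ (x, 0) := hb₂.eq_fst (by rw [if_pos rfl, hz 1 μ le_rfl]; simp)
  have hq : quant h b₂ = fun z => b₂ (z.1, 0) := funext fun z => hind _ _
  have hb₂c : Continuous fun x => b₂ (x, 0) := hb₂.1.continuous.comp (by fun_prop)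
  have hb₂n : ∀ x, ‖b₂ (x, 0)‖ ≤ Kd 0 * (r ^ μ * c' 0 μ) := fun x => by
    have := hb₂.norm_le_of_nonpos le_rfl hcc2 [] [] (x, 0)
    simpa [dXis, dXs, dirs_nil] using this
  have hS0 : 0 ≤ Kd 0 * (r ^ μ * c' 0 μ) :=
    mul_nonneg (hKd 0).le (mul_nonneg (by positivity) (hc' 0 μ))
  have f2 := hf₃ _ _ hb₂c.aestronglyMeasurable hb₂n
  have hw := wsum_nonneg (N := cvOrder n) hr.le hc
  have f3 := f1.mul_fst (mul_nonneg hK₂.le hw) m1 (ha.norm_quant_le le_rfl hc)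
    hb₂c.aestronglyMeasurable hb₂n
  have p2 := CompBound.of_formBound (b := fun z => b₂ (z.1, 0)) m1 (hq ▸ m3)
    (ha.norm_quant_le le_rfl hc) (fun z => hb₂n z.1)
    (mul_nonneg hK₂.le hw) (by positivity) (by positivity) f1 f2 f3
  rw [← hq] at p2
  have p3 := p1'.add_right p2 m1 m2 m3 (ha.norm_quant_le le_rfl hc) (hb₁.norm_quant_le le_rfl hcc1)
    (hb₂.norm_quant_le le_rfl hcc2)
  refine (p3.congr (fun z => rfl) fun z => hbb _).mono ?_
  have hWS : Kd 0 * (r ^ μ * c' 0 μ) * wsum (cvOrder n) r c ≤ (cvOrder n + 1) ^ 2 * (D * R) := by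
    refine mul_wsum_le fun i hi j hj => ?_
    have hcv := cvOrder_le_compOrder n
    calc _ = Kd 0 * (r ^ (i + j) * c i j * (r ^ μ * c' 0 μ)) := by ring
      _ ≤ D * R := mul_le_mul (hKdD 0 (Nat.zero_le _)) (H2 i (by omega) j (by omega))
        (by have := hc i j; have := hc' 0 μ; positivity) hD0.le
  calc _ = K₁ * ((compOrder n + 1) ^ 4 * D) * R + (K₂ * K₃ + K₂) *
        (Kd 0 * (r ^ μ * c' 0 μ) * wsum (cvOrder n) r c) := by ring
    _ ≤ K₁ * ((compOrder n + 1) ^ 4 * D) * R + (K₂ * K₃ + K₂) *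
        ((cvOrder n + 1) ^ 2 * (D * R)) :=
        add_le_add le_rfl (mul_le_mul_of_nonneg_left hWS (by positivity))
    _ = _ := by ring

end

section

/-! ### Approximation of rough symbols -/

variable {n : ℕ}

open Filter Topology

/-- The sum of the constants `C α β` over `|α| = i` and `|β| = j`. -/
def lsum (C : MIdx n → MIdx n → ℝ) (i j : ℕ) : ℝ := ∑ α ∈ midxEq n i, ∑ β ∈ midxEq n j, C α β

theorem lsum_nonneg {C : MIdx n → MIdx n → ℝ} {i j : ℕ}
    (hC : ∀ α β, len β = j → 0 ≤ C α β) : 0 ≤ lsum C i j :=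
  Finset.sum_nonneg fun α _ => Finset.sum_nonneg fun β hβ => hC α β (mem_midxEq.1 hβ)

theorem le_lsum {C : MIdx n → MIdx n → ℝ} {i j : ℕ} (hC : ∀ α β, len β = j → 0 ≤ C α β)
    {α β : MIdx n} (hα : len α = i) (hβ : len β = j) : C α β ≤ lsum C i j := by
  have h1 : C α β ≤ ∑ β ∈ midxEq n j, C α β :=
    Finset.single_le_sum (f := fun β => C α β) (fun β hβ => hC α β (mem_midxEq.1 hβ))
      (mem_midxEq.2 hβ)
  refine h1.trans (Finset.single_le_sum (f := fun α => ∑ β ∈ midxEq n j, C α β) (fun α _ => ?_)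
    (mem_midxEq.2 hα))
  exact Finset.sum_nonneg fun β hβ => hC α β (mem_midxEq.1 hβ)

theorem nonneg_of_le_mul_bracket {x C k : ℝ} {ξ : Eu n} (hx : 0 ≤ x) (h : x ≤ C * bracket ξ ^ k) :
    0 ≤ C :=
  nonneg_of_mul_nonneg_left (hx.trans h) (Real.rpow_pos_of_pos (bracket_pos _) _)

theorem IsSmoothSymbol.nonneg {k : ℝ} {C : MIdx n → MIdx n → ℝ} {a : Eu n → Eu n → ℂ}
    (h : IsSmoothSymbol k C a) (α β : MIdx n) : 0 ≤ C α β :=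
  nonneg_of_le_mul_bracket (norm_nonneg _) (h.2 α β 0 0)

theorem IsSmoothSymbol.symBound {k : ℝ} {C : MIdx n → MIdx n → ℝ} {a : Eu n → Eu n → ℂ}
    (h : IsSmoothSymbol k C a) : SymBound k (lsum C) fun z => a z.1 z.2 := by
  refine ⟨h.1, fun u w ⟨x, ξ⟩ => ?_⟩
  have hs : ContDiff ℝ ∞ (dXs w fun z : Eu n × Eu n => a z.1 z.2) := contDiff_dirs _ h.1 w
  have hs2 : ContDiff ℝ ∞ fun η => dXs w (fun z : Eu n × Eu n => a z.1 z.2) (x, η) :=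
    hs.comp (contDiff_const.prodMk contDiff_id)
  have e : (fun η => dXs w (fun z : Eu n × Eu n => a z.1 z.2) (x, η)) =
      fun η => multiD (fun i => w.count i) (fun y => a y η) x := by
    funext η
    have hy : ContDiff ℝ ∞ fun y => a y η :=
      h.1.comp (contDiff_id.prodMk contDiff_const : ContDiff ℝ ∞ fun y : Eu n => (y, η))
    rw [dXs_apply h.1, ← dE_eq_multiD hy]
  rw [dXis_apply hs, dE_eq_multiD hs2, e]
  have := h.2 (fun i => u.count i) (fun i => w.count i) x ξ
  rw [len_count] at this
  exact this.trans (mul_le_mul_of_nonneg_right (le_lsum (fun α β _ => h.nonneg α β)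
    (len_count u) (len_count w)) (rpow_bracket_nonneg _ _))

theorem freqFamily_of_bound {A : Eu n → Eu n → ℂ} {k : ℝ} {B : MIdx n → ℝ}
    (hs : ∀ x, ContDiff ℝ ∞ (A x)) (hm : ∀ ξ, AEStronglyMeasurable fun x => A x ξ)
    (hB : ∀ α x ξ, ‖multiD α (A x) ξ‖ ≤ B α * bracket ξ ^ (k - len α)) : FreqFamily A := by
  refine ⟨hs, hm, fun m ξ₀ => ?_⟩
  have hB0 : ∀ α, 0 ≤ B α := fun α => nonneg_of_le_mul_bracket (norm_nonneg _) (hB α 0 0)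
  have hcont : Continuous fun ξ : Eu n =>
      (n : ℝ) ^ m * ((∑ α ∈ midxEq n m, B α) * bracket ξ ^ (k - m)) :=
    continuous_const.mul (continuous_const.mul (continuous_bracket_rpow _))
  refine ⟨_, (hcont.continuousAt.eventually_lt continuousAt_const (lt_add_one _)).mono
    fun ξ hξ y => le_trans ?_ hξ.le⟩
  refine norm_iteratedFDeriv_le_of_dE (hs y) m ξ fun u hu => ?_
  rw [dE_eq_multiD (hs y)]
  refine (hB _ y ξ).trans ?_
  rw [len_count, hu]
  exact mul_le_mul_of_nonneg_right (Finset.single_le_sum (f := B) (fun α _ => hB0 α)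
    (mem_midxEq.2 ((len_count u).trans hu))) (rpow_bracket_nonneg _ _)

theorem IsRoughSymbol.nonneg {k : ℝ} {μ : ℕ} {C : MIdx n → MIdx n → ℝ} {a : Eu n → Eu n → ℂ}
    (h : IsRoughSymbol k μ C a) (α β : MIdx n) (hβ : len β ≤ μ) : 0 ≤ C α β := by
  obtain ⟨A, -, hA⟩ := h
  exact nonneg_of_le_mul_bracket (norm_nonneg _) ((hA β hβ).2.2 α 0 0)

theorem len_zero : len (0 : MIdx n) = 0 := by simp [len]

/-- Pointwise convergence almost everywhere of the regularizations. -/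
theorem ae_tendsto_mollX {a : Eu n → Eu n → ℂ} {k : ℝ}
    (φ : ℕ → ContDiffBump (0 : Eu n)) (hφ : Tendsto (fun m => (φ m).rOut) atTop (𝓝 0))
    (hφ' : ∀ m, (φ m).rOut ≤ 2 * (φ m).rIn) (hs : ∀ x, Continuous (a x))
    (hli : ∀ ξ, LocallyIntegrable fun x => a x ξ) {B : ℝ}
    (hb : ∀ m, ContDiff ℝ ∞ (mollX (fun y => (((φ m).normed volume y : ℝ) : ℂ)) a))
    (hbB : ∀ m x ξ, ‖iteratedFDeriv ℝ 1
      (fun ξ => mollX (fun y => (((φ m).normed volume y : ℝ) : ℂ)) a (x, ξ)) ξ‖ ≤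
        B * bracket ξ ^ k) :
    ∀ᵐ z : Eu n × Eu n, Tendsto (fun m => mollX (fun y => (((φ m).normed volume y : ℝ) : ℂ)) a z)
      atTop (𝓝 (a z.1 z.2)) := by
  -- Lebesgue differentiation gives convergence almost everywhere for each fixed frequency. A
  -- countable dense set of frequencies keeps the exceptional set null.
  have h1 : ∀ᵐ x : Eu n, ∀ q : ℕ, Tendsto (fun m =>
      mollX (fun y => (((φ m).normed volume y : ℝ) : ℂ)) a (x, TopologicalSpace.denseSeq (Eu n) q))
      atTop (𝓝 (a x (TopologicalSpace.denseSeq (Eu n) q))) := by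
    refine ae_all_iff.2 fun q => ?_
    have := ContDiffBump.ae_convolution_tendsto_right_of_locallyIntegrable hφ
      (Eventually.of_forall hφ') (hli (TopologicalSpace.denseSeq (Eu n) q))
    filter_upwards [this] with x hx
    simp only [convolution_eq_swap, ContinuousLinearMap.lsmul_apply, Complex.real_smul] at hx
    exact hx
  have h2 : ∀ᵐ x : Eu n, ∀ ξ, Tendsto (fun m =>
      mollX (fun y => (((φ m).normed volume y : ℝ) : ℂ)) a (x, ξ)) atTop (𝓝 (a x ξ)) := by
    filter_upwards [h1] with x hx ξ
    obtain ⟨D, hD⟩ := (isCompact_closedBall ξ 1).exists_bound_of_continuousOn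
      ((continuous_const.mul (continuous_bracket_rpow k) : Continuous fun η : Eu n =>
        B * bracket η ^ k).continuousOn)
    -- The uniform bound on the first ξ-derivative makes the regularizations equicontinuous in ξ, so
    -- convergence on the dense set of frequencies spreads to all of them with the same null set of
    -- x.
    have heq : EquicontinuousAt (fun m η =>
        mollX (fun y => (((φ m).normed volume y : ℝ) : ℂ)) a (x, η)) ξ := by
      refine Metric.equicontinuousAt_of_continuity_modulus (fun η => D * ‖ξ - η‖) ?_ _ ?_
      · have : Continuous fun η : Eu n => D * ‖ξ - η‖ := by fun_prop
        simpa using this.tendsto ξ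
      · filter_upwards [Metric.closedBall_mem_nhds ξ one_pos] with η hη m
        have hsm : ContDiff ℝ ∞ fun η =>
            mollX (fun y => (((φ m).normed volume y : ℝ) : ℂ)) a (x, η) :=
          (hb m).comp (contDiff_const.prodMk contDiff_id)
        rw [dist_eq_norm]
        refine Convex.norm_image_sub_le_of_norm_fderiv_le (𝕜 := ℝ) (s := Metric.closedBall ξ 1)
          (fun y _ => (hsm.differentiable (by simp)) y) (fun y hy => ?_) (convex_closedBall _ _) hη
          (Metric.mem_closedBall_self zero_le_one)
        rw [← norm_iteratedFDeriv_one]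
        exact (hbB m x y).trans ((le_abs_self _).trans (hD y hy))
    refine heq.tendsto_of_mem_closure (s := Set.range (TopologicalSpace.denseSeq (Eu n)))
      (f := a x) (((hs x).tendsto ξ).mono_left inf_le_left) ?_
      (TopologicalSpace.denseRange_denseSeq (Eu n) ξ)
    rintro _ ⟨q, rfl⟩
    exact hx q
  have h3 := Measure.quasiMeasurePreserving_fst (μ := (volume : Measure (Eu n)))
    (ν := (volume : Measure (Eu n))) |>.ae h2
  rw [Measure.volume_eq_prod]
  filter_upwards [h3] with z hz
  exact hz z.2

/-- Approximation of a rough symbol by smooth symbols, with uniform control of the derivatives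
which are controlled for the rough symbol. -/
theorem IsRoughSymbol.exists_approx {k : ℝ} {μ : ℕ} {C : MIdx n → MIdx n → ℝ}
    {a : Eu n → Eu n → ℂ} (h : IsRoughSymbol k μ C a) :
    ∃ b : ℕ → Eu n × Eu n → ℂ, (∀ m, ∃ c : ℕ → ℕ → ℝ, (∀ i, ∀ j ≤ μ, c i j = lsum C i j) ∧
      (∀ i j, 0 ≤ c i j) ∧ (∀ i, lsum C i 0 = 0 → ∀ j, j ≤ μ ∨ c i j = 0) ∧ SymBound k c (b m)) ∧
        ∀ᵐ z : Eu n × Eu n, Tendsto (fun m => b m z) atTop (𝓝 (a z.1 z.2)) := by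
  have hC := h.nonneg
  obtain ⟨A, hA0, hA⟩ := h
  have hfam : ∀ β, len β ≤ μ → FreqFamily (A β) := fun β hβ =>
    freqFamily_of_bound (hA β hβ).1 (fun ξ => ((hA β hβ).2.1 ξ).2.1.aestronglyMeasurable)
      (hA β hβ).2.2
  have h0 : len (0 : MIdx n) ≤ μ := by rw [len_zero]; exact Nat.zero_le _
  have hfa : FreqFamily a := hA0 ▸ hfam 0 h0
  let φ : ℕ → ContDiffBump (0 : Eu n) := fun m =>
    ⟨((m : ℝ) + 1)⁻¹, 2 * ((m : ℝ) + 1)⁻¹, by positivity, by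
      have : (0 : ℝ) < ((m : ℝ) + 1)⁻¹ := by positivity
      linarith⟩
  have hmol := fun m => mollifier_of_bump (φ m)
  have hlC : ∀ i j, j ≤ μ → 0 ≤ lsum C i j := fun i j hj =>
    lsum_nonneg fun α β hβ => hC α β (hβ ▸ hj)
  have hsym : ∀ m, ∃ c : ℕ → ℕ → ℝ, (∀ i, ∀ j ≤ μ, c i j = lsum C i j) ∧
      (∀ i j, 0 ≤ c i j) ∧ (∀ i, lsum C i 0 = 0 → ∀ j, j ≤ μ ∨ c i j = 0) ∧
        SymBound k c (mollX (fun y => (((φ m).normed volume y : ℝ) : ℂ)) a) := by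
    intro m
    have hρ := hmol m
    have hfin : ∀ j, ∃ K : ℝ, ∀ w : List (Fin n), w.length = j →
        ∫ y, ‖dE w (fun y => (((φ m).normed volume y : ℝ) : ℂ)) y‖ ≤ K := fun j => by
      obtain ⟨K, hK⟩ := ((List.finite_length_eq (Fin n) j).image
        (fun w => ∫ y, ‖dE w (fun y => (((φ m).normed volume y : ℝ) : ℂ)) y‖)).bddAbove
      exact ⟨K, fun w hw => hK ⟨w, hw, rfl⟩⟩
    choose D hD using hfin
    -- Up to x-order μ the constants are those of the rough symbol, uniformly in m. Higher orders
    -- fall on the mollifier and depend on m through `D`; they only witness smoothness. Being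
    -- proportional to the constant of x-order zero, they vanish whenever it does, which preserves
    -- independence of ξ.
    refine ⟨fun i j => if j ≤ μ then lsum C i j else |D j| * lsum C i 0, fun i j hj => if_pos hj,
      fun i j => ?_, fun i hi j => ?_, contDiff_mollX hρ.smooth hρ.compact hfa, fun u w z => ?_⟩
    · have h1 := hlC i 0 (Nat.zero_le _)
      beta_reduce
      split_ifs with hj
      · exact hlC i j hj
      · positivity
    · by_cases hj : j ≤ μ
      · exact Or.inl hj
      · right; beta_reduce; rw [if_neg hj, hi, mul_zero]
    · have hb := rpow_bracket_nonneg (k - u.length) z.2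
      rw [dXs_mollX hρ.smooth hρ.compact hfa]
      by_cases hw : w.length ≤ μ
      · beta_reduce
        rw [if_pos hw]
        have hwμ : len (fun i => w.count i) ≤ μ := by rwa [len_count]
        have hAw := hA _ hwμ
        rw [mollX_dE_eq hρ.smooth hρ.compact w hAw.2.1,
          dXis_mollX hρ.smooth hρ.compact (hfam _ hwμ)]
        refine (norm_mollX_le hρ.smooth hρ.compact z
          (B := lsum C u.length w.length * bracket z.2 ^ (k - u.length)) fun y => ?_).trans
          (le_of_eq (by rw [hρ.integral_norm, one_mul]))
        rw [dE_eq_multiD (hAw.1 y)]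
        refine (hAw.2.2 _ y z.2).trans ?_
        rw [len_count]
        exact mul_le_mul_of_nonneg_right (le_lsum (fun α β hβ => hC α β (hβ ▸ hw)) (len_count u)
          (len_count w)) hb
      · beta_reduce
        rw [if_neg hw]
        have hs : ContDiff ℝ ∞ (dE w fun y => (((φ m).normed volume y : ℝ) : ℂ)) :=
          contDiff_dirs _ hρ.smooth w
        have hc : HasCompactSupport (dE w fun y => (((φ m).normed volume y : ℝ) : ℂ)) :=
          hasCompactSupport_dirs _ hρ.compact w
        rw [dXis_mollX hs hc hfa]
        refine (norm_mollX_le hs hc z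
          (B := lsum C u.length 0 * bracket z.2 ^ (k - u.length)) fun y => ?_).trans ?_
        · rw [dE_eq_multiD (hfa.smooth y), ← hA0]
          refine ((hA 0 h0).2.2 _ y z.2).trans ?_
          rw [len_count]
          exact mul_le_mul_of_nonneg_right (le_lsum (fun α β hβ => hC α β (hβ ▸ Nat.zero_le _))
            (len_count u) len_zero) hb
        · rw [mul_assoc]
          exact mul_le_mul_of_nonneg_right ((hD _ w rfl).trans (le_abs_self _))
            (mul_nonneg (hlC _ 0 (Nat.zero_le _)) hb)
  refine ⟨_, hsym, ?_⟩
  choose c hc1 hc2 hc3 hc4 using hsym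
  refine ae_tendsto_mollX (k := k - (1 : ℕ)) (B := n ^ 1 * lsum C 1 0) φ ?_
    (fun m => le_rfl)
    (fun x => (hfa.smooth x).continuous) (fun ξ => ((hA 0 h0).2.1 ξ).1) (fun m => (hc4 m).1)
    fun m x ξ => ?_
  · have : Tendsto (fun m : ℕ => 2 * ((m : ℝ) + 1)⁻¹) atTop (𝓝 (2 * 0)) :=
      (tendsto_one_div_add_atTop_nhds_zero_nat (𝕜 := ℝ)).congr (fun m => by rw [one_div])
        |>.const_mul 2
    simpa using this
  · have := (hc4 m).norm_iteratedFDeriv_le 1 x ξ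
    rw [hc1 m 1 0 (Nat.zero_le _)] at this
    rwa [mul_assoc]

/-! ### Multiplication by the Sobolev weight -/

/-- The weight depends on ξ only, so the Leibniz rule leaves the x-order j alone, while ξ-order i
collects the constants of all lower orders i'. -/
theorem exists_symBound_weight (n : ℕ) (l : ℝ) : ∃ K : ℕ → ℝ, (∀ i, 0 < K i) ∧
    ∀ (k : ℝ) (c : ℕ → ℕ → ℝ) (F : Eu n × Eu n → ℂ), (∀ i j, 0 ≤ c i j) → SymBound k c F →
      SymBound (k + l) (fun i j => K i * ∑ i' ∈ Finset.range (i + 1), c i' j)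
        fun z => brC l z.2 * F z := by
  choose L hL0 hL using exists_norm_iteratedFDeriv_bracket_rpow_le n l
  refine ⟨fun i => ∑ i' ∈ Finset.range (i + 1), (i.choose i' : ℝ) * L i' * (n : ℝ) ^ (i - i') + 1,
    fun i => ?_, fun k c F hc hF => ?_⟩
  · have : 0 ≤ ∑ i' ∈ Finset.range (i + 1), (i.choose i' : ℝ) * L i' * (n : ℝ) ^ (i - i') :=
      Finset.sum_nonneg fun i' _ => by have := hL0 i'; positivity
    linarith
  have hw : ContDiff ℝ ∞ (brC l : Eu n → ℂ) := contDiff_bracket_rpow l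
  have hs : ContDiff ℝ ∞ fun z : Eu n × Eu n => brC l z.2 * F z :=
    (hw.comp contDiff_snd).mul hF.1
  refine ⟨hs, fun u w ⟨x, ξ⟩ => ?_⟩
  have hG := hF.dXs w
  have e : dXs w (fun z : Eu n × Eu n => brC l z.2 * F z) = fun z => brC l z.2 * dXs w F z := by
    funext ⟨y, η⟩
    have hy : ContDiff ℝ ∞ fun y => F (y, η) :=
      hF.1.comp (contDiff_id.prodMk contDiff_const : ContDiff ℝ ∞ fun y : Eu n => (y, η))
    rw [dXs_apply hs, dXs_apply hF.1]
    change dirs _ w (fun y => brC l η * F (y, η)) y = brC l η * dirs _ w (fun y => F (y, η)) y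
    rw [dirs_const_mul _ hy]
  have hGs : ContDiff ℝ ∞ fun η => dXs w F (x, η) := hG.1.comp (contDiff_const.prodMk contDiff_id)
  have hprod : ContDiff ℝ ∞ fun z : Eu n × Eu n => brC l z.2 * dXs w F z :=
    (hw.comp contDiff_snd).mul hG.1
  rw [e, dXis_apply hprod]
  refine (norm_dE_le (hw.mul hGs) u ξ).trans ?_
  generalize hm : u.length = m
  refine (norm_iteratedFDeriv_mul_le hw hGs ξ (n := m) (by exact_mod_cast le_top)).trans ?_
  have hb := rpow_bracket_nonneg (k + l - m) ξ
  have hcs : ∀ i ≤ m, c i w.length ≤ ∑ i' ∈ Finset.range (m + 1), c i' w.length := fun i hi =>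
    le_sum_range (fun i' => hc i' _) hi
  have hterm : ∀ i ∈ Finset.range (m + 1), (m.choose i : ℝ) *
      ‖iteratedFDeriv ℝ i (brC l) ξ‖ * ‖iteratedFDeriv ℝ (m - i) (fun η => dXs w F (x, η)) ξ‖ ≤
      (m.choose i : ℝ) * L i * (n : ℝ) ^ (m - i) *
        ((∑ i' ∈ Finset.range (m + 1), c i' w.length) * bracket ξ ^ (k + l - m)) := fun i hi => by
    have hi' : i ≤ m := Nat.lt_succ_iff.1 (Finset.mem_range.1 hi)
    have hb1 := rpow_bracket_nonneg (l - i) ξ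
    have hb2 := rpow_bracket_nonneg (k - (m - i : ℕ)) ξ
    have e1 : bracket ξ ^ (l - i) * bracket ξ ^ (k - (m - i : ℕ)) = bracket ξ ^ (k + l - m) := by
      rw [← Real.rpow_add (bracket_pos ξ), Nat.cast_sub hi']
      congr 1; ring
    have h1 := hG.norm_iteratedFDeriv_le (m - i) x ξ
    rw [zero_add] at h1
    have hLi := hL0 i
    have hci := hc (m - i) w.length
    calc _ ≤ (m.choose i : ℝ) * (L i * bracket ξ ^ (l - i)) *
          ((n : ℝ) ^ (m - i) * (c (m - i) w.length * bracket ξ ^ (k - (m - i : ℕ)))) :=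
          mul_le_mul (mul_le_mul_of_nonneg_left (hL i ξ) (Nat.cast_nonneg _)) h1 (norm_nonneg _)
            (by positivity)
      _ = (m.choose i : ℝ) * L i * (n : ℝ) ^ (m - i) *
          (c (m - i) w.length * bracket ξ ^ (k + l - m)) := by rw [← e1]; ring
      _ ≤ _ := mul_le_mul_of_nonneg_left (mul_le_mul_of_nonneg_right
          (hcs _ (Nat.sub_le _ _)) hb) (by positivity)
  refine (Finset.sum_le_sum hterm).trans ?_
  rw [← Finset.sum_mul, mul_assoc]
  refine mul_le_mul_of_nonneg_right (lt_add_one _).le ?_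
  exact mul_nonneg (Finset.sum_nonneg fun i _ => hc _ _) hb

end

section

/-! ### Composition of operators with rough symbols -/

variable {n : ℕ}

open Filter Topology

theorem neg_two_pi_mul_ne_zero {h : ℝ} (hh : 0 < h) : -(2 * π * h) ≠ 0 :=
  neg_ne_zero.2 (by positivity)

theorem ae_tendsto_quant {b : ℕ → Eu n × Eu n → ℂ} {b' : Eu n × Eu n → ℂ} {h : ℝ} (hh : 0 < h)
    (hlim : ∀ᵐ z, Tendsto (fun m => b m z) atTop (𝓝 (b' z))) :
    ∀ᵐ z, Tendsto (fun m => quant h (b m) z) atTop (𝓝 (quant h b' z)) :=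
  (quasiMeasurePreserving_smul_snd (neg_two_pi_mul_ne_zero hh)).ae hlim

theorem FreqSymbol.formBound_quant {k C K h : ℝ} {a : Eu n × Eu n → ℂ} (ha : FreqSymbol k C a)
    (hf : ∀ (C τ : ℝ) (a : Eu n × Eu n → ℂ), τ ≠ 0 → AEStronglyMeasurable a → FreqSymbol k C a →
      FormBound (K * C) fun z => a (z.1, τ • z.2)) (hh : 0 < h) (hac : Continuous a) :
    FormBound (K * C) (quant h a) := by
  have h1 := neg_two_pi_mul_ne_zero hh
  exact hf C (-(2 * π * h)) a h1 hac.aestronglyMeasurable ha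

/-- Absorbs the lower ξ-orders produced by the Sobolev weight. In the application X is a power of
√h: since h ≤ 1, replacing i by i' ≤ i can only increase it, and the bound R is available for every
i'. -/
theorem mul_weight_le {X f : ℕ → ℝ} {R κ : ℝ} {i : ℕ} (hκ : 0 ≤ κ) (hf : ∀ i, 0 ≤ f i)
    (hX : ∀ i' ≤ i, X i ≤ X i') (H : ∀ i' ≤ i, X i' * f i' ≤ R) :
    X i * (κ * ∑ i' ∈ Finset.range (i + 1), f i') ≤ κ * (i + 1) * R := by
  have h1 : ∑ i' ∈ Finset.range (i + 1), X i * f i' ≤ (i + 1) * R := sum_range_le_mul fun i' hi' =>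
    (mul_le_mul_of_nonneg_right (hX i' hi') (hf i')).trans (H i' hi')
  rw [← Finset.mul_sum] at h1
  calc _ = κ * (X i * ∑ i' ∈ Finset.range (i + 1), f i') := by ring
    _ ≤ κ * ((i + 1) * R) := mul_le_mul_of_nonneg_left h1 hκ
    _ = _ := by ring

theorem IsRoughSymbol.lsum_nonneg {k : ℝ} {μ : ℕ} {C : MIdx n → MIdx n → ℝ} {a : Eu n → Eu n → ℂ}
    (h : IsRoughSymbol k μ C a) (i : ℕ) {j : ℕ} (hj : j ≤ μ) : 0 ≤ lsum C i j :=
  RoughPsiDO.lsum_nonneg fun α β hβ => h.nonneg α β (hβ ▸ hj)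

theorem IsSmoothSymbol.lsum_nonneg {k : ℝ} {C : MIdx n → MIdx n → ℝ} {a : Eu n → Eu n → ℂ}
    (h : IsSmoothSymbol k C a) (i j : ℕ) : 0 ≤ lsum C i j :=
  RoughPsiDO.lsum_nonneg fun α β _ => h.nonneg α β

theorem IsRoughSymbol.norm_le {k : ℝ} {μ : ℕ} {C : MIdx n → MIdx n → ℝ} {a : Eu n → Eu n → ℂ}
    (h : IsRoughSymbol k μ C a) (x ξ : Eu n) : ‖a x ξ‖ ≤ lsum C 0 0 * bracket ξ ^ k := by
  have hC := h.nonneg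
  obtain ⟨A, rfl, hA⟩ := h
  have h0 : len (0 : MIdx n) ≤ μ := by rw [len_zero]; exact Nat.zero_le _
  have h1 := (hA 0 h0).2.2 0 x ξ
  have e : multiD 0 (A 0 x) = A 0 x := (dE_eq_multiD ((hA 0 h0).1 x) []).symm
  rw [e, len_zero, Nat.cast_zero, sub_zero] at h1
  exact h1.trans (mul_le_mul_of_nonneg_right
    (le_lsum (fun α β hβ => hC α β (hβ ▸ Nat.zero_le _)) len_zero len_zero)
    (rpow_bracket_nonneg _ _))

/-- The weight ⟨ξ⟩^{-k'} encodes the norm of H_h^{k'} and turns a₂ into a symbol of negative order k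
- k'. The mollified symbols satisfy the smooth estimate with constants independent of m, and the
limit is weak. -/
theorem exists_compBound_rough_right (n : ℕ) {μ : ℕ} (hμ : 1 ≤ μ) {k k' : ℝ} (hk : k < k') :
    ∃ K : ℝ, 0 < K ∧ ∀ (h R : ℝ) (C₁ C₂ : MIdx n → MIdx n → ℝ) (a₁ a₂ : Eu n → Eu n → ℂ),
      0 < h → h ≤ 1 → IsSmoothSymbol 0 C₁ a₁ → IsRoughSymbol k μ C₂ a₂ →
      (∀ i ≤ compOrder n + 1, ∀ j ≤ compOrder n + 1, ∀ i' ≤ compOrder n + 1,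
        ∀ j' ≤ compOrder n + 1, 1 ≤ i → 1 ≤ j' → j' ≤ μ →
          √h ^ (i + j) * lsum C₁ i j * (√h ^ (i' + j') * lsum C₂ i' j') ≤ R) →
      (∀ i ≤ compOrder n, ∀ j ≤ compOrder n, ∀ i' ≤ n + 1,
          √h ^ (i + j) * lsum C₁ i j * (√h ^ μ * lsum C₂ i' μ) ≤ R) →
      (∀ i i', i + i' ≤ n + 1 → lsum C₁ i 0 * (√h ^ μ * lsum C₂ i' μ) ≤ R) →
      CompBound (K * R) (quant h fun z => a₁ z.1 z.2)
        (quant h fun z => brC (-k') z.2 * a₂ z.1 z.2) := by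
  have hkk : k + -k' < 0 := by linarith
  obtain ⟨K₁, hK₁, hcomp⟩ := exists_compBound_right n hμ (le_refl (0 : ℝ)) hkk
  obtain ⟨K₂, hK₂, hf⟩ := exists_formBound_of_freqSymbol n hkk
  obtain ⟨κ, hκ, hw⟩ := exists_symBound_weight n (-k')
  obtain ⟨D, hD⟩ : ∃ D : ℝ, D = ∑ i ∈ Finset.range (compOrder n + n + 2 + 1), κ i * (i + 1) :=
    ⟨_, rfl⟩
  have hκ0 : ∀ i : ℕ, 0 ≤ κ i * (i + 1) := fun i => by have := hκ i; positivity
  have hκD : ∀ i ≤ compOrder n + n + 2, κ i * (i + 1) ≤ D := fun i hi => hD ▸ le_sum_range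
    (f := fun i : ℕ => κ i * (i + 1)) hκ0 hi
  have hD0 : 0 < D := (by have := hκ 0; positivity : 0 < κ 0 * ((0 : ℕ) + 1)).trans_le
    (hκD 0 (Nat.zero_le _))
  refine ⟨K₁ * D, by positivity, fun h R C₁ C₂ a₁ a₂ hh h1 ha₁ ha₂ H1 H2 H3 => ?_⟩
  obtain ⟨b, hb, hlim⟩ := ha₂.exists_approx
  choose c hc1 hc2 _ hc4 using hb
  have hr := Real.sqrt_pos.2 hh
  have hr1 : √h ≤ 1 := Real.sqrt_le_one.2 h1
  have hl1 := ha₁.lsum_nonneg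
  have hl2 := fun i {j} => ha₂.lsum_nonneg i (j := j)
  have hR0 : 0 ≤ R := (mul_nonneg (hl1 0 0) (mul_nonneg (by positivity) (hl2 0 le_rfl))).trans
    (H3 0 0 (Nat.zero_le _))
  have hDR : ∀ i ≤ compOrder n + n + 2, ∀ {x : ℝ}, x ≤ κ i * (i + 1) * R → x ≤ D * R :=
    fun i hi x hx => hx.trans (mul_le_mul_of_nonneg_right (hκD i hi) hR0)
  have hsb := fun m => hw k (c m) (b m) (hc2 m) (hc4 m)
  have hcw : ∀ m i j, 0 ≤ κ i * ∑ i' ∈ Finset.range (i + 1), c m i' j := fun m i j =>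
    mul_nonneg (hκ i).le (Finset.sum_nonneg fun i' _ => hc2 m i' j)
  have hbd : ∀ m, CompBound (K₁ * D * R) (quant h fun z => a₁ z.1 z.2)
      (quant h fun z => brC (-k') z.2 * b m z) := fun m => by
    rw [mul_assoc]
    refine hcomp h (D * R) _ _ _ _ hh hl1 (hcw m) ha₁.symBound (hsb m) ?_ ?_ ?_
    · intro i hi j hj i' hi' j' hj' h1i h1j hjμ
      refine hDR i' (by omega) ?_
      rw [← mul_assoc]
      refine mul_weight_le (X := fun i' => √h ^ (i + j) * lsum C₁ i j * √h ^ (i' + j'))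
        (hκ _).le (fun i => hc2 m i j') (fun i'' hi'' => ?_) fun i'' hi'' => ?_
      · exact mul_le_mul_of_nonneg_left (pow_le_pow_of_le_one hr.le hr1 (by omega))
          (mul_nonneg (by positivity) (hl1 i j))
      · rw [hc1 m _ _ hjμ, mul_assoc]
        exact H1 i hi j hj i'' (by omega) j' hj' h1i h1j hjμ
    · intro i hi j hj i' hi'
      refine hDR i' (by omega) ?_
      rw [← mul_assoc]
      refine mul_weight_le (X := fun _ => √h ^ (i + j) * lsum C₁ i j * √h ^ μ)
        (hκ _).le (fun i => hc2 m i μ) (fun _ _ => le_rfl) fun i'' hi'' => ?_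
      rw [hc1 m _ _ le_rfl, mul_assoc]
      exact H2 i hi j hj i'' (by omega)
    · intro i i' hi
      refine hDR i' (by omega) ?_
      rw [← mul_assoc]
      refine mul_weight_le (X := fun _ => lsum C₁ i 0 * √h ^ μ)
        (hκ _).le (fun i => hc2 m i μ) (fun _ _ => le_rfl) fun i'' hi'' => ?_
      rw [hc1 m _ _ le_rfl, mul_assoc]
      exact H3 i i'' (by omega)
  have hc0 : ∀ m i, κ i * ∑ i' ∈ Finset.range (i + 1), c m i' 0 =
      κ i * ∑ i' ∈ Finset.range (i + 1), lsum C₂ i' 0 := fun m i => by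
    simp only [hc1 m _ 0 (Nat.zero_le _)]
  have hl0 : ∀ i, 0 ≤ κ i * ∑ i' ∈ Finset.range (i + 1), lsum C₂ i' 0 := fun i =>
    mul_nonneg (hκ i).le (Finset.sum_nonneg fun i' _ => hl2 i' (Nat.zero_le _))
  -- An operator bound uniform in m, from constants of x-order zero. It is needed for the passage to
  -- the limit and leaves no trace in the estimate.
  obtain ⟨S, hS⟩ : ∃ S, S = ∑ i ∈ Finset.range (n + 1 + 1),
    κ i * ∑ i' ∈ Finset.range (i + 1), lsum C₂ i' 0 := ⟨_, rfl⟩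
  have hS0 : 0 ≤ S := hS ▸ Finset.sum_nonneg fun i _ => hl0 i
  have hfr : ∀ m, FreqSymbol (k + -k') ((n + 1) ^ (n + 1) * S) fun z => brC (-k') z.2 * b m z :=
    fun m => (hsb m).freqSymbol (hcw m) fun i hi => by
      rw [hc0, hS]
      exact le_sum_range hl0 hi
  have hfb : ∀ m, FormBound (K₂ * ((n + 1) ^ (n + 1) * S))
      (quant h fun z => brC (-k') z.2 * b m z) := fun m =>
    (hfr m).formBound_quant hf hh (hsb m).1.continuous
  have hlim' := ae_tendsto_quant (b := fun m z => brC (-k') z.2 * b m z)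
    (b' := fun z => brC (-k') z.2 * a₂ z.1 z.2) hh (hlim.mono fun z hz => hz.const_mul _)
  refine CompBound.of_tendsto_right hbd (ha₁.symBound.aestronglyMeasurable_quant h)
    (fun m => (hsb m).aestronglyMeasurable_quant h) (ha₁.symBound.norm_quant_le le_rfl hl1)
    (Bb := κ 0 * ∑ i' ∈ Finset.range (0 + 1), lsum C₂ i' 0 + lsum C₂ 0 0) (fun m z => ?_)
    (fun z => ?_) (by positivity) hfb hlim'
  · have := (hsb m).norm_quant_le (h := h) hkk.le (hcw m) z
    rw [hc0] at this
    exact this.trans (le_add_of_nonneg_right (hl2 0 (Nat.zero_le _)))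
  · refine le_trans ?_ (le_add_of_nonneg_left (hl0 0))
    rw [quant, norm_mul, norm_brC]
    have := ha₂.norm_le z.1 ((-(2 * π * h)) • z.2)
    calc _ ≤ bracket ((-(2 * π * h)) • z.2) ^ (-k') *
          (lsum C₂ 0 0 * bracket ((-(2 * π * h)) • z.2) ^ k) :=
          mul_le_mul_of_nonneg_left this (rpow_bracket_nonneg _ _)
      _ = lsum C₂ 0 0 * bracket ((-(2 * π * h)) • z.2) ^ (k + -k') := by
          rw [Real.rpow_add (bracket_pos _)]; ring
      _ ≤ _ := mul_le_of_le_one_right (hl2 0 (Nat.zero_le _))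
          (Real.rpow_le_one_of_one_le_of_nonpos (one_le_bracket _) hkk.le)

/-- Here the weight reduces the smooth symbol a₂ to order zero, and the negative order comes from
the rough a₁, whose mollifications converge. -/
theorem exists_compBound_rough_left (n μ : ℕ) {k : ℝ} (k' : ℝ) (hk : k < 0) :
    ∃ K : ℝ, 0 < K ∧ ∀ (h R : ℝ) (C₁ C₂ : MIdx n → MIdx n → ℝ) (a₁ a₂ : Eu n → Eu n → ℂ),
      0 < h → h ≤ 1 → IsRoughSymbol k μ C₁ a₁ → IsSmoothSymbol k' C₂ a₂ →
      (∀ i ≤ compOrder n + 1, ∀ j ≤ compOrder n + 1, ∀ i' ≤ compOrder n + 1,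
        ∀ j' ≤ compOrder n + 1, 1 ≤ i → 1 ≤ j' → j ≤ μ →
          √h ^ (i + j) * lsum C₁ i j * (√h ^ (i' + j') * lsum C₂ i' j') ≤ R) →
      (∀ i ≤ n + 1, ∀ i' ≤ compOrder n, ∀ j' ≤ compOrder n,
          √h ^ μ * lsum C₁ i μ * (√h ^ (i' + j') * lsum C₂ i' j') ≤ R) →
      (∀ i i', i + i' ≤ n + 1 → √h ^ μ * lsum C₁ i μ * lsum C₂ i' 0 ≤ R) →
      CompBound (K * R) (quant h fun z => a₁ z.1 z.2)
        (quant h fun z => brC (-k') z.2 * a₂ z.1 z.2) := by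
  obtain ⟨K₁, hK₁, hcomp⟩ := exists_compBound_left n μ hk (le_refl (0 : ℝ))
  obtain ⟨K₂, hK₂, hf⟩ := exists_formBound_of_freqSymbol n hk
  obtain ⟨κ, hκ, hw⟩ := exists_symBound_weight n (-k')
  obtain ⟨D, hD⟩ : ∃ D : ℝ, D = ∑ i ∈ Finset.range (compOrder n + n + 2 + 1), κ i * (i + 1) :=
    ⟨_, rfl⟩
  have hκ0 : ∀ i : ℕ, 0 ≤ κ i * (i + 1) := fun i => by have := hκ i; positivity
  have hκD : ∀ i ≤ compOrder n + n + 2, κ i * (i + 1) ≤ D := fun i hi => hD ▸ le_sum_range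
    (f := fun i : ℕ => κ i * (i + 1)) hκ0 hi
  have hD0 : 0 < D := (by have := hκ 0; positivity : 0 < κ 0 * ((0 : ℕ) + 1)).trans_le
    (hκD 0 (Nat.zero_le _))
  refine ⟨K₁ * D, by positivity, fun h R C₁ C₂ a₁ a₂ hh h1 ha₁ ha₂ H1 H2 H3 => ?_⟩
  obtain ⟨b, hb, hlim⟩ := ha₁.exists_approx
  choose c hc1 hc2 _ hc4 using hb
  have hr := Real.sqrt_pos.2 hh
  have hr1 : √h ≤ 1 := Real.sqrt_le_one.2 h1
  have hl1 := fun i {j} => ha₁.lsum_nonneg i (j := j)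
  have hl2 := ha₂.lsum_nonneg
  have hR0 : 0 ≤ R := (mul_nonneg (mul_nonneg (by positivity) (hl1 0 le_rfl)) (hl2 0 0)).trans
    (H3 0 0 (Nat.zero_le _))
  have hDR : ∀ i ≤ compOrder n + n + 2, ∀ {x : ℝ}, x ≤ κ i * (i + 1) * R → x ≤ D * R :=
    fun i hi x hx => hx.trans (mul_le_mul_of_nonneg_right (hκD i hi) hR0)
  have hsb := hw k' (lsum C₂) _ hl2 ha₂.symBound
  rw [add_neg_cancel] at hsb
  have hcw : ∀ i j, 0 ≤ κ i * ∑ i' ∈ Finset.range (i + 1), lsum C₂ i' j := fun i j =>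
    mul_nonneg (hκ i).le (Finset.sum_nonneg fun i' _ => hl2 i' j)
  have hbd : ∀ m, CompBound (K₁ * D * R) (quant h (b m))
      (quant h fun z => brC (-k') z.2 * a₂ z.1 z.2) := fun m => by
    rw [mul_assoc]
    refine hcomp h (D * R) _ _ _ _ hh (hc2 m) hcw (hc4 m) hsb ?_ ?_ ?_
    · intro i hi j hj i' hi' j' hj' h1i h1j hjμ
      refine hDR i' (by omega) ?_
      rw [← mul_assoc]
      refine mul_weight_le (X := fun i' => √h ^ (i + j) * c m i j * √h ^ (i' + j'))
        (hκ _).le (fun i => hl2 i j') (fun i'' hi'' => ?_) fun i'' hi'' => ?_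
      · exact mul_le_mul_of_nonneg_left (pow_le_pow_of_le_one hr.le hr1 (by omega))
          (mul_nonneg (by positivity) (hc2 m i j))
      · rw [hc1 m _ _ hjμ, mul_assoc]
        exact H1 i hi j hj i'' (by omega) j' hj' h1i h1j hjμ
    · intro i hi i' hi' j' hj'
      refine hDR i' (by omega) ?_
      rw [← mul_assoc]
      refine mul_weight_le (X := fun i' => √h ^ μ * c m i μ * √h ^ (i' + j'))
        (hκ _).le (fun i => hl2 i j') (fun i'' hi'' => ?_) fun i'' hi'' => ?_
      · exact mul_le_mul_of_nonneg_left (pow_le_pow_of_le_one hr.le hr1 (by omega))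
          (mul_nonneg (by positivity) (hc2 m i μ))
      · rw [hc1 m _ _ le_rfl, mul_assoc]
        exact H2 i hi i'' (by omega) j' hj'
    · intro i i' hi
      refine hDR i' (by omega) ?_
      refine mul_weight_le (X := fun _ => √h ^ μ * c m i μ)
        (hκ _).le (fun i => hl2 i 0) (fun _ _ => le_rfl) fun i'' hi'' => ?_
      rw [hc1 m _ _ le_rfl]
      exact H3 i i'' (by omega)
  obtain ⟨S, hS⟩ : ∃ S, S = ∑ i ∈ Finset.range (n + 1 + 1), lsum C₁ i 0 := ⟨_, rfl⟩
  have hS0 : 0 ≤ S := hS ▸ Finset.sum_nonneg fun i _ => hl1 i (Nat.zero_le _)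
  have hfr : ∀ m, FreqSymbol k ((n + 1) ^ (n + 1) * S) (b m) :=
    fun m => (hc4 m).freqSymbol (hc2 m) fun i hi => by
      rw [hc1 m _ _ (Nat.zero_le _), hS]
      exact le_sum_range (f := fun i => lsum C₁ i 0) (fun i => hl1 i (Nat.zero_le _)) hi
  have hfb : ∀ m, FormBound (K₂ * ((n + 1) ^ (n + 1) * S)) (quant h (b m)) := fun m =>
    (hfr m).formBound_quant hf hh (hc4 m).1.continuous
  have hlim' := ae_tendsto_quant (b := b) (b' := fun z => a₁ z.1 z.2) hh hlim
  refine CompBound.of_tendsto_left hbd (fun m => (hc4 m).aestronglyMeasurable_quant h)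
    (hsb.aestronglyMeasurable_quant h) (Ba := lsum C₁ 0 0) (fun m z => ?_)
    (fun z => ?_) (hsb.norm_quant_le le_rfl hcw) (by positivity) hfb hlim'
  · rw [← hc1 m 0 0 (Nat.zero_le _)]
    exact (hc4 m).norm_quant_le hk.le (hc2 m) z
  · exact (ha₁.norm_le z.1 _).trans (mul_le_of_le_one_right (hl1 0 (Nat.zero_le _))
      (Real.rpow_le_one_of_one_le_of_nonpos (one_le_bracket _) hk.le))

/-! ### Functions of x regarded as rough symbols of order zero. -/

theorem partialD_const (i : Fin n) (c : ℂ) : partialD i (fun _ => c) = fun _ => 0 := by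
  funext x
  simp [partialD]

theorem multiD_const (α : MIdx n) (c : ℂ) :
    multiD α (fun _ => c) = fun _ => if α = 0 then c else 0 := by
  have key : ∀ l : List (Fin n), l.foldr (fun i g => (partialD i)^[α i] g) (fun _ => c) =
      fun _ => if ∀ i ∈ l, α i = 0 then c else 0 := fun l => by
    induction l with
    | nil => simp
    | cons i l ih =>
      rw [List.foldr_cons, ih]
      rcases Nat.eq_zero_or_pos (α i) with h0 | h0
      · simp [h0]
      · obtain ⟨m, hm⟩ := Nat.exists_eq_succ_of_ne_zero h0.ne'
        have hne : ¬ ∀ i' ∈ i :: l, α i' = 0 := fun h => h0.ne' (h i (by simp))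
        rw [if_neg hne, hm, Function.iterate_succ_apply, partialD_const]
        exact Function.iterate_fixed (partialD_const i 0) m
  rw [multiD, key]
  simp [funext_iff]

theorem IsRoughFunction.nonneg {μ : ℕ} {C : MIdx n → ℝ} {b : Eu n → ℂ}
    (h : IsRoughFunction μ C b) {β : MIdx n} (hβ : len β ≤ μ) : 0 ≤ C β := by
  obtain ⟨B, -, hB⟩ := h
  exact (norm_nonneg _).trans ((hB β hβ).2 0)

/-- The constants of a function of `x`, considered as a symbol. -/
def fstConst (C : MIdx n → ℝ) (α β : MIdx n) : ℝ := if α = 0 then C β else 0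

theorem IsRoughFunction.isRoughSymbol {μ : ℕ} {C : MIdx n → ℝ} {b : Eu n → ℂ}
    (h : IsRoughFunction μ C b) : IsRoughSymbol 0 μ (fstConst C) fun x _ => b x := by
  obtain ⟨B, rfl, hB⟩ := h
  refine ⟨fun β x _ => B β x, rfl, fun β hβ => ⟨fun x => contDiff_const, fun ξ => (hB β hβ).1,
    fun α x ξ => ?_⟩⟩
  rw [multiD_const, fstConst]
  split_ifs with h0
  · rw [h0, len_zero, Nat.cast_zero, sub_zero, Real.rpow_zero, mul_one]
    exact (hB β hβ).2 x
  · simp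

theorem midxEq_zero : midxEq n 0 = {0} := by
  ext α
  rw [mem_midxEq, Finset.mem_singleton, len, Finset.sum_eq_zero_iff, funext_iff]
  simp

theorem lsum_fstConst_zero (C : MIdx n → ℝ) (j : ℕ) :
    lsum (fstConst C) 0 j = ∑ β ∈ midxEq n j, C β := by
  rw [lsum, midxEq_zero, Finset.sum_singleton]
  simp [fstConst]

theorem lsum_fstConst_of_pos (C : MIdx n → ℝ) {i : ℕ} (hi : 1 ≤ i) (j : ℕ) :
    lsum (fstConst C) i j = 0 := by
  refine Finset.sum_eq_zero fun α hα => Finset.sum_eq_zero fun β _ => if_neg fun h => ?_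
  rw [mem_midxEq, h, len_zero] at hα
  omega

theorem exists_compBound_rough_fst (n : ℕ) {μ : ℕ} (hμ : 1 ≤ μ) :
    ∃ K : ℝ, 0 < K ∧ ∀ (h R : ℝ) (C₁ : MIdx n → MIdx n → ℝ) (C₂ : MIdx n → ℝ)
      (a₁ : Eu n → Eu n → ℂ) (a₂ : Eu n → ℂ),
      0 < h → IsSmoothSymbol 0 C₁ a₁ → IsRoughFunction μ C₂ a₂ →
      (∀ i ≤ compOrder n + 1, ∀ j ≤ compOrder n + 1, ∀ j' ≤ compOrder n + 1, 1 ≤ i → 1 ≤ j' →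
          j' ≤ μ → √h ^ (i + j) * lsum C₁ i j * (√h ^ j' * ∑ β ∈ midxEq n j', C₂ β) ≤ R) →
      (∀ i ≤ compOrder n, ∀ j ≤ compOrder n,
          √h ^ (i + j) * lsum C₁ i j * (√h ^ μ * ∑ β ∈ midxEq n μ, C₂ β) ≤ R) →
      CompBound (K * R) (quant h fun z => a₁ z.1 z.2) (quant h fun z => a₂ z.1) := by
  obtain ⟨K₁, hK₁, hcomp⟩ := exists_compBound_fst n hμ
  obtain ⟨K₂, hK₂, hf⟩ := exists_formBound_fst n
  refine ⟨K₁, hK₁, fun h R C₁ C₂ a₁ a₂ hh ha₁ ha₂ H1 H2 => ?_⟩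
  have hr := ha₂.isRoughSymbol
  obtain ⟨b, hb, hlim⟩ := hr.exists_approx
  choose c hc1 hc2 hc3 hc4 using hb
  have hl1 := ha₁.lsum_nonneg
  have hl2 := hr.lsum_nonneg 0 (Nat.zero_le _)
  -- The approximations keep vanishing constants for positive ξ-order, so each of them is still a
  -- function of x.
  have hz : ∀ m i j, 1 ≤ i → c m i j = 0 := fun m i j hi => by
    rcases hc3 m i (lsum_fstConst_of_pos C₂ hi 0) j with hj | hj
    · rw [hc1 m i j hj, lsum_fstConst_of_pos C₂ hi]
    · exact hj
  have hc0 : ∀ m, ∀ j ≤ μ, c m 0 j = ∑ β ∈ midxEq n j, C₂ β := fun m j hj => by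
    rw [hc1 m 0 j hj, lsum_fstConst_zero]
  have hbd : ∀ m, CompBound (K₁ * R) (quant h fun z => a₁ z.1 z.2) (quant h (b m)) := fun m => by
    refine hcomp h R _ _ _ _ hh hl1 (hc2 m) ha₁.symBound (hc4 m) (hz m) ?_ ?_
    · intro i hi j hj j' hj' h1i h1j hjμ
      rw [hc0 m _ hjμ]
      exact H1 i hi j hj j' hj' h1i h1j hjμ
    · intro i hi j hj
      rw [hc0 m _ le_rfl]
      exact H2 i hi j hj
  have hbn : ∀ m z, ‖quant h (b m) z‖ ≤ lsum (fstConst C₂) 0 0 := fun m z => by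
    rw [← hc1 m 0 0 (Nat.zero_le _)]
    exact (hc4 m).norm_quant_le le_rfl (hc2 m) z
  have hq : ∀ m z, quant h (b m) z = b m (z.1, 0) := fun m z =>
    (hc4 m).eq_fst (hz m 1 0 le_rfl) _ _
  have hbc : ∀ m, Continuous fun x => b m (x, 0) := fun m => (hc4 m).1.continuous.comp (by fun_prop)
  have hfb : ∀ m, FormBound (K₂ * lsum (fstConst C₂) 0 0) (quant h (b m)) := fun m => by
    rw [funext (hq m)]
    exact hf (lsum (fstConst C₂) 0 0) (fun x => b m (x, 0)) (hbc m).aestronglyMeasurable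
      fun x => (congrArg norm (hq m (x, 0))).symm.trans_le (hbn m (x, 0))
  have hlim' := ae_tendsto_quant (b := b) (b' := fun z => a₂ z.1) hh hlim
  refine CompBound.of_tendsto_right hbd (ha₁.symBound.aestronglyMeasurable_quant h)
    (fun m => (hc4 m).aestronglyMeasurable_quant h) (ha₁.symBound.norm_quant_le le_rfl hl1)
    hbn (fun z => ?_) (by positivity) hfb hlim'
  have := hr.norm_le z.1 0
  rwa [Real.rpow_zero, mul_one] at this

end

section

/-! ### The semiclassical quantization and Sobolev spaces -/

variable {n : ℕ}

open Filter Topology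

/-- The substitution ξ = -2πhη: the sign comes from the phase e^{-(i/h)⟨x-y,ξ⟩}, and the Jacobian
(2πh)^n cancels the prefactor. -/
theorem opH_eq_opF {h : ℝ} (hh : 0 < h) (a : Eu n → Eu n → ℂ) (f : 𝓢(Eu n, ℂ)) (x : Eu n) :
    opH h a f x = opF (quant h fun z => a z.1 z.2) f x := by
  obtain ⟨G, hG⟩ : ∃ G : Eu n → ℂ, G = fun ξ => ∫ y : Eu n,
    Complex.exp (-(Complex.I / (h : ℂ)) * ((inner ℝ (x - y) ξ : ℝ) : ℂ)) * a x ξ * f y := ⟨_, rfl⟩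
  have h1 := Measure.integral_comp_smul (volume : Measure (Eu n)) G (-(2 * π * h))
  have hp : 0 < 2 * π * h := by positivity
  have habs : |((-(2 * π * h)) ^ n)⁻¹| = ((2 * π * h) ^ n)⁻¹ := by
    rw [abs_inv, abs_pow, abs_neg, abs_of_pos hp]
  have h2 : opH h a f x = ∫ η, G ((-(2 * π * h)) • η) := by
    rw [h1, finrank_euclideanSpace_fin, habs, Complex.real_smul, opH, hG, Complex.ofReal_inv]
  rw [h2, opF]
  refine integral_congr_ae (Eventually.of_forall fun η => ?_)
  have hF : 𝓕 f η = ∫ y, osc (-y) η * f y := by rw [SchwartzMap.fourier_coe, fourier_eq_osc]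
  beta_reduce
  rw [hF, hG]
  beta_reduce
  rw [← integral_const_mul]
  refine integral_congr_ae (Eventually.of_forall fun y => ?_)
  have e : Complex.exp (-(Complex.I / (h : ℂ)) *
      ((inner ℝ (x - y) ((-(2 * π * h)) • η) : ℝ) : ℂ)) = osc x η * osc (-y) η := by
    rw [← osc_add_left, osc, ← sub_eq_add_neg, inner_smul_right]
    congr 1
    have : (h : ℂ) ≠ 0 := by exact_mod_cast hh.ne'
    push_cast
    field_simp
  beta_reduce
  rw [e, quant]
  ring

/-- The map `u ↦ Op_h(⟨ξ⟩^k) u` as a bounded operator. -/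
def besselL (n : ℕ) (h k : ℝ) : SobolevH n h k →L[ℂ] L2 n :=
  (SobolevH.bessel n h k).mkContinuous 1 fun u => by rw [one_mul, SobolevH.norm_def]

theorem norm_besselL_le (n : ℕ) (h k : ℝ) : ‖besselL n h k‖ ≤ 1 :=
  LinearMap.mkContinuous_norm_le _ zero_le_one _

theorem besselL_schwartzToSobolev (h k : ℝ) (f : 𝓢(Eu n, ℂ)) :
    besselL n h k (schwartzToSobolev h k f) =
      schwartzToL2 (SchwartzMap.fourierMultiplierCLM ℂ (sobolevWeight h k) f) := rfl

theorem fourier_fourierMultiplier (h k : ℝ) (f : 𝓢(Eu n, ℂ)) (η : Eu n) :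
    𝓕 (SchwartzMap.fourierMultiplierCLM ℂ (sobolevWeight h k) f) η = sobolevWeight h k η * 𝓕 f η := by
  rw [SchwartzMap.fourierMultiplierCLM_apply, FourierTransform.fourier_fourierInv_eq,
    SchwartzMap.smulLeftCLM_apply_apply (sobolevWeight_temperate n h k), smul_eq_mul]

/-- The factor ⟨ξ⟩^{-k} in the symbol cancels the multiplier ⟨ξ⟩^k applied to f. Thus Op_h(a) on
H_h^k factors as an L² operator after the norm-one map u ↦ Op_h(⟨ξ⟩^k)u. -/
theorem opF_fourierMultiplier (h k : ℝ) (a : Eu n × Eu n → ℂ) (f : 𝓢(Eu n, ℂ)) (x : Eu n) :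
    opF (quant h fun z => brC (-k) z.2 * a z)
      (SchwartzMap.fourierMultiplierCLM ℂ (sobolevWeight h k) f) x = opF (quant h a) f x := by
  rw [opF, opF]
  refine integral_congr_ae (Eventually.of_forall fun η => ?_)
  have e : brC (-k) ((-(2 * π * h)) • η) * sobolevWeight h k η = 1 := by
    have : sobolevWeight h k η = brC k ((-(2 * π * h)) • η) := rfl
    rw [this, ← brC_add, neg_add_cancel, brC_zero]
  beta_reduce
  rw [fourier_fourierMultiplier, quant, quant]
  linear_combination (a (x, (-(2 * π * h)) • η) * osc x η * 𝓕 f η) * e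

section

variable {h k M B₁ B₂ : ℝ} {a₁ a₂ : Eu n → Eu n → ℂ}

theorem CompBound.compositionBound_sobolev (hh : 0 < h)
    (hc : CompBound M (quant h fun z => a₁ z.1 z.2) (quant h fun z => brC (-k) z.2 * a₂ z.1 z.2))
    (hm₁ : AEStronglyMeasurable (quant h fun z : Eu n × Eu n => a₁ z.1 z.2))
    (hb₁ : ∀ z, ‖quant h (fun z : Eu n × Eu n => a₁ z.1 z.2) z‖ ≤ B₁)
    (hm₂ : AEStronglyMeasurable (quant h fun z : Eu n × Eu n => brC (-k) z.2 * a₂ z.1 z.2))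
    (hb₂ : ∀ z, ‖quant h (fun z : Eu n × Eu n => brC (-k) z.2 * a₂ z.1 z.2) z‖ ≤ B₂) :
    CompositionBound (schwartzToSobolev h k) h a₁ a₂ M := by
  obtain ⟨Ta, Tb, Tab, hTa, hTb, hTab, hM⟩ := hc
  refine ⟨Ta, Tb ∘L besselL n h k, Tab ∘L besselL n h k, fun f => ?_, fun f => ?_, fun f => ?_, ?_⟩
  · rw [funext fun x => opH_eq_opF hh a₁ f x]
    exact hTa.ae_eq_opF hm₁ hb₁ f
  · rw [funext fun x => opH_eq_opF hh a₂ f x, ContinuousLinearMap.comp_apply,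
      besselL_schwartzToSobolev,
      ← funext fun x => opF_fourierMultiplier h k (fun z => a₂ z.1 z.2) f x]
    exact hTb.ae_eq_opF hm₂ hb₂ _
  · rw [funext fun x => opH_eq_opF hh (fun x ξ => a₁ x ξ * a₂ x ξ) f x, ContinuousLinearMap.comp_apply,
      besselL_schwartzToSobolev,
      ← funext fun x => opF_fourierMultiplier h k (fun z => a₁ z.1 z.2 * a₂ z.1 z.2) f x]
    have hTab' : Represents Tab (quant h fun z => brC (-k) z.2 * (a₁ z.1 z.2 * a₂ z.1 z.2)) :=
      hTab.congr fun z => by rw [quant, quant, quant]; ring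
    have e : (quant h fun z : Eu n × Eu n => brC (-k) z.2 * (a₁ z.1 z.2 * a₂ z.1 z.2)) = fun z =>
        quant h (fun z : Eu n × Eu n => a₁ z.1 z.2) z *
          quant h (fun z : Eu n × Eu n => brC (-k) z.2 * a₂ z.1 z.2) z :=
      funext fun z => by rw [quant, quant, quant]; ring
    exact hTab'.ae_eq_opF (e ▸ hm₁.mul hm₂)
      (fun z => (congrFun e z ▸ norm_mul_le_of_bounds hb₁ hb₂ z : _ ≤ B₁ * B₂)) _
  · rw [← ContinuousLinearMap.comp_assoc, ← ContinuousLinearMap.sub_comp]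
    refine (ContinuousLinearMap.opNorm_comp_le _ _).trans ?_
    exact (mul_le_of_le_one_right (norm_nonneg _) (norm_besselL_le n h k)).trans hM

theorem CompBound.compositionBound (hh : 0 < h)
    (hc : CompBound M (quant h fun z => a₁ z.1 z.2) (quant h fun z => a₂ z.1 z.2))
    (hm₁ : AEStronglyMeasurable (quant h fun z : Eu n × Eu n => a₁ z.1 z.2))
    (hb₁ : ∀ z, ‖quant h (fun z : Eu n × Eu n => a₁ z.1 z.2) z‖ ≤ B₁)
    (hm₂ : AEStronglyMeasurable (quant h fun z : Eu n × Eu n => a₂ z.1 z.2))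
    (hb₂ : ∀ z, ‖quant h (fun z : Eu n × Eu n => a₂ z.1 z.2) z‖ ≤ B₂) :
    CompositionBound schwartzToL2 h a₁ a₂ M := by
  obtain ⟨Ta, Tb, Tab, hTa, hTb, hTab, hM⟩ := hc
  refine ⟨Ta, Tb, Tab, fun f => ?_, fun f => ?_, fun f => ?_, hM⟩
  · rw [funext fun x => opH_eq_opF hh a₁ f x]
    exact hTa.ae_eq_opF hm₁ hb₁ f
  · rw [funext fun x => opH_eq_opF hh a₂ f x]
    exact hTb.ae_eq_opF hm₂ hb₂ _
  · rw [funext fun x => opH_eq_opF hh (fun x ξ => a₁ x ξ * a₂ x ξ) f x]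
    exact hTab.ae_eq_opF (hm₁.mul hm₂) (norm_mul_le_of_bounds hb₁ hb₂) _

end

theorem IsRoughSymbol.aestronglyMeasurable {k : ℝ} {μ : ℕ} {C : MIdx n → MIdx n → ℝ}
    {a : Eu n → Eu n → ℂ} (h : IsRoughSymbol k μ C a) :
    AEStronglyMeasurable fun z : Eu n × Eu n => a z.1 z.2 := by
  obtain ⟨b, hb, hlim⟩ := h.exists_approx
  refine aestronglyMeasurable_of_tendsto_ae atTop (fun m => ?_) hlim
  obtain ⟨c, -, -, -, hc⟩ := hb m
  exact hc.1.continuous.aestronglyMeasurable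

theorem continuous_brC (k : ℝ) : Continuous (brC k : Eu n → ℂ) :=
  Complex.continuous_ofReal.comp (continuous_bracket_rpow k)

theorem aestronglyMeasurable_quant {h : ℝ} (hh : 0 < h) {a : Eu n × Eu n → ℂ}
    (ha : AEStronglyMeasurable a) : AEStronglyMeasurable (quant h a) :=
  aestronglyMeasurable_comp_smul_snd ha (neg_two_pi_mul_ne_zero hh)

theorem aestronglyMeasurable_weight_mul (k : ℝ) {a : Eu n × Eu n → ℂ}
    (ha : AEStronglyMeasurable a) : AEStronglyMeasurable fun z : Eu n × Eu n => brC k z.2 * a z :=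
  ((continuous_brC k).comp continuous_snd).aestronglyMeasurable.mul ha

theorem norm_weight_mul_le {k k' C h : ℝ} {a : Eu n → Eu n → ℂ} (hC : 0 ≤ C) (hk : k ≤ k')
    (ha : ∀ x ξ, ‖a x ξ‖ ≤ C * bracket ξ ^ k) (z : Eu n × Eu n) :
    ‖quant h (fun z : Eu n × Eu n => brC (-k') z.2 * a z.1 z.2) z‖ ≤ C := by
  rw [quant, norm_mul, norm_brC]
  have := ha z.1 ((-(2 * π * h)) • z.2)
  calc _ ≤ bracket ((-(2 * π * h)) • z.2) ^ (-k') * (C * bracket ((-(2 * π * h)) • z.2) ^ k) :=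
        mul_le_mul_of_nonneg_left this (rpow_bracket_nonneg _ _)
    _ = C * bracket ((-(2 * π * h)) • z.2) ^ (k + -k') := by
        rw [Real.rpow_add (bracket_pos _)]; ring
    _ ≤ _ := mul_le_of_le_one_right hC
        (Real.rpow_le_one_of_one_le_of_nonpos (one_le_bracket _) (by linarith))

end

section

/-! ### Sums over multi-indices -/

variable {n : ℕ}

theorem sqrt_pow_eq {h : ℝ} (hh : 0 < h) (m : ℕ) : √h ^ m = h ^ ((m : ℝ) / 2) := by
  rw [Real.sqrt_eq_rpow, ← Real.rpow_natCast, ← Real.rpow_mul hh.le]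
  congr 1
  ring

theorem lsum_eq_sum_product (C : MIdx n → MIdx n → ℝ) (i j : ℕ) :
    lsum C i j = ∑ p ∈ midxEq n i ×ˢ midxEq n j, C p.1 p.2 := by
  rw [lsum, Finset.sum_product]

theorem lsum_zero_right (C : MIdx n → MIdx n → ℝ) (i : ℕ) :
    lsum C i 0 = ∑ α ∈ midxEq n i, C α 0 := by
  simp only [lsum, midxEq_zero, Finset.sum_singleton]

/-- The left side is the part of the right-hand sum with prescribed lengths. Nonnegativity is
required only under P, because the constants of a rough symbol with |β| > μ are arbitrary reals. -/
theorem mul_lsum_le_sum_prod {S : ℕ} {h : ℝ} {C C' : MIdx n → MIdx n → ℝ}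
    {P : (MIdx n × MIdx n) × (MIdx n × MIdx n) → Prop} [DecidablePred P] (hh : 0 < h)
    (hnn : ∀ z, P z → 0 ≤ C z.1.1 z.1.2 * C' z.2.1 z.2.2) {i j i' j' : ℕ}
    (hle : i + j + i' + j' ≤ S)
    (hP : ∀ z, len z.1.1 = i → len z.1.2 = j → len z.2.1 = i' → len z.2.2 = j' → P z) :
    √h ^ (i + j) * lsum C i j * (√h ^ (i' + j') * lsum C' i' j') ≤
      ∑ z ∈ (pairLE n S ×ˢ pairLE n S) with P z,
        h ^ (((len z.1.1 + len z.1.2 + len z.2.1 + len z.2.2 : ℕ) : ℝ) / 2) *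
          C z.1.1 z.1.2 * C' z.2.1 z.2.2 := by
  have hm : ∀ z ∈ (midxEq n i ×ˢ midxEq n j) ×ˢ (midxEq n i' ×ˢ midxEq n j'),
      len z.1.1 = i ∧ len z.1.2 = j ∧ len z.2.1 = i' ∧ len z.2.2 = j' := fun z hz => by
    simp only [Finset.mem_product, mem_midxEq] at hz
    exact ⟨hz.1.1, hz.1.2, hz.2.1, hz.2.2⟩
  have e₀ : ∑ z ∈ (midxEq n i ×ˢ midxEq n j) ×ˢ (midxEq n i' ×ˢ midxEq n j'),
      C z.1.1 z.1.2 * C' z.2.1 z.2.2 = lsum C i j * lsum C' i' j' := by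
    rw [lsum_eq_sum_product, lsum_eq_sum_product, Finset.sum_mul_sum, ← Finset.sum_product']
  have e : √h ^ (i + j) * lsum C i j * (√h ^ (i' + j') * lsum C' i' j') =
      ∑ z ∈ (midxEq n i ×ˢ midxEq n j) ×ˢ (midxEq n i' ×ˢ midxEq n j'),
        h ^ (((len z.1.1 + len z.1.2 + len z.2.1 + len z.2.2 : ℕ) : ℝ) / 2) *
          C z.1.1 z.1.2 * C' z.2.1 z.2.2 := by
    rw [Finset.sum_congr rfl fun z hz => by
      obtain ⟨h1, h2, h3, h4⟩ := hm z hz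
      rw [h1, h2, h3, h4, ← sqrt_pow_eq hh, mul_assoc], ← Finset.mul_sum, e₀,
      add_assoc (i + j), pow_add]
    ring
  rw [e]
  refine Finset.sum_le_sum_of_subset_of_nonneg (fun z hz => ?_) fun z hz _ => ?_
  · obtain ⟨h1, h2, h3, h4⟩ := hm z hz
    simp only [Finset.mem_filter, Finset.mem_product, mem_pairLE]
    exact ⟨⟨by omega, by omega⟩, hP z h1 h2 h3 h4⟩
  · rw [mul_assoc]
    exact mul_nonneg (Real.rpow_nonneg hh.le _) (hnn z (Finset.mem_filter.1 hz).2)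

theorem mul_lsum_le_sum_pairLE {s : ℕ} {h : ℝ} {C : MIdx n → MIdx n → ℝ} (hh : 0 < h)
    (hC : ∀ α β, 0 ≤ C α β) {i j : ℕ} (hij : i + j ≤ s) :
    √h ^ (i + j) * lsum C i j ≤
      ∑ p ∈ pairLE n s, h ^ (((len p.1 + len p.2 : ℕ) : ℝ) / 2) * C p.1 p.2 := by
  have hm : ∀ p ∈ midxEq n i ×ˢ midxEq n j, len p.1 = i ∧ len p.2 = j := fun p hp => by
    simpa only [Finset.mem_product, mem_midxEq] using hp
  rw [lsum_eq_sum_product, Finset.mul_sum, Finset.sum_congr rfl fun p hp => by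
    rw [sqrt_pow_eq hh, ← (hm p hp).1, ← (hm p hp).2]]
  refine Finset.sum_le_sum_of_subset_of_nonneg (fun p hp => ?_) fun p _ _ =>
    mul_nonneg (Real.rpow_nonneg hh.le _) (hC _ _)
  rw [mem_pairLE, (hm p hp).1, (hm p hp).2]
  exact hij

theorem lsum_le_sum_midxLE {d i j : ℕ} {C : MIdx n → MIdx n → ℝ}
    (hC : ∀ α β, len β = j → 0 ≤ C α β) (hi : i ≤ d) :
    lsum C i j ≤ ∑ α ∈ midxLE n d, ∑ β ∈ midxEq n j, C α β := by
  refine Finset.sum_le_sum_of_subset_of_nonneg (fun α hα => ?_) fun α _ _ =>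
    Finset.sum_nonneg fun β hβ => hC α β (mem_midxEq.1 hβ)
  rw [mem_midxLE, mem_midxEq.1 hα]
  exact hi

theorem mul_lsum_le_sum_sum {s d μ : ℕ} {h : ℝ} {C C' : MIdx n → MIdx n → ℝ} (hh : 0 < h)
    (hC : ∀ α β, 0 ≤ C α β) (hC' : ∀ α β, len β = μ → 0 ≤ C' α β) {i j i' : ℕ} (hij : i + j ≤ s)
    (hi' : i' ≤ d) : √h ^ (i + j) * lsum C i j * lsum C' i' μ ≤
      ∑ p ∈ pairLE n s, ∑ α ∈ midxLE n d, ∑ β ∈ midxEq n μ,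
        h ^ (((len p.1 + len p.2 : ℕ) : ℝ) / 2) * C p.1 p.2 * C' α β := by
  simp only [← Finset.mul_sum]
  rw [← Finset.sum_mul]
  exact mul_le_mul (mul_lsum_le_sum_pairLE hh hC hij) (lsum_le_sum_midxLE hC' hi')
    (lsum_nonneg hC') (Finset.sum_nonneg fun p _ => mul_nonneg (Real.rpow_nonneg hh.le _) (hC _ _))

theorem lsum_zero_mul_lsum_le {d μ : ℕ} {C C' : MIdx n → MIdx n → ℝ}
    (hC : ∀ α, 0 ≤ C α 0) (hC' : ∀ α β, len β = μ → 0 ≤ C' α β) {i i' : ℕ} (hi : i + i' ≤ d) :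
    lsum C i 0 * lsum C' i' μ ≤
      ∑ p ∈ pairLE n d, ∑ β ∈ midxEq n μ, C p.1 0 * C' p.2 β := by
  rw [lsum_zero_right, lsum, Finset.sum_mul_sum, ← Finset.sum_product']
  simp only [Finset.mul_sum]
  refine Finset.sum_le_sum_of_subset_of_nonneg (fun p hp => ?_) fun p _ _ =>
    Finset.sum_nonneg fun β hβ => mul_nonneg (hC _) (hC' _ _ (mem_midxEq.1 hβ))
  simp only [Finset.mem_product, mem_midxEq] at hp
  rw [mem_pairLE, hp.1, hp.2]
  exact hi

theorem sum_pairLE_swap {d μ : ℕ} (C C' : MIdx n → MIdx n → ℝ) :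
    ∑ p ∈ pairLE n d, ∑ β ∈ midxEq n μ, C p.1 β * C' p.2 0 =
      ∑ p ∈ pairLE n d, ∑ β ∈ midxEq n μ, C' p.1 0 * C p.2 β := by
  refine Finset.sum_bij' (fun p _ => p.swap) (fun p _ => p.swap) (fun p hp => ?_) (fun p hp => ?_)
    (fun p _ => p.swap_swap) (fun p _ => p.swap_swap) fun p _ =>
      Finset.sum_congr rfl fun β _ => mul_comm _ _
  all_goals
    rw [mem_pairLE] at hp ⊢
    rw [add_comm]
    exact hp

/-- The only property of the logarithm that enters: for h ≤ 1 it may be inserted into the bound at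
the price of a factor 2. -/
theorem half_le_log {h : ℝ} (hh : 0 < h) (h1 : h ≤ 1) : 1 / 2 ≤ Real.log (1 + h⁻¹) := by
  have h2 : 1 ≤ h⁻¹ := (one_le_inv₀ hh).2 h1
  have h3 : Real.log 2 ≤ Real.log (1 + h⁻¹) := Real.log_le_log (by norm_num) (by linarith)
  linarith [Real.log_two_gt_d9]

theorem le_two_mul_total {S₁ S₂ S₃ w L : ℝ} (h1 : 0 ≤ S₁) (h2 : 0 ≤ S₂) (h3 : 0 ≤ S₃) (hw : 0 ≤ w)
    (hL : 1 / 2 ≤ L) : S₁ ≤ 2 * (S₁ + w * L * S₂ + w * L * S₃) ∧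
      w * S₂ ≤ 2 * (S₁ + w * L * S₂ + w * L * S₃) ∧
      w * S₃ ≤ 2 * (S₁ + w * L * S₂ + w * L * S₃) := by
  have e2 : 0 ≤ (L - 1 / 2) * (w * S₂) := mul_nonneg (by linarith) (mul_nonneg hw h2)
  have e3 : 0 ≤ (L - 1 / 2) * (w * S₃) := mul_nonneg (by linarith) (mul_nonneg hw h3)
  have f2 := mul_nonneg hw h2
  have f3 := mul_nonneg hw h3
  refine ⟨?_, ?_, ?_⟩ <;> nlinarith

/-! ### The composition estimates -/

/-- Each of the three hypotheses of `exists_compBound_rough_left` is met with R twice the total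
right side, every block being part of one of its three sums. The threshold 4(`compOrder n` + 1)
arises because four lengths, each at most `compOrder n` + 1, occur in a product. -/
theorem exists_compositionBound_left (n : ℕ) (k₁ k : ℝ) (μ : ℕ) (hk₁ : k₁ < 0) :
    ∃ K : ℝ, 0 < K ∧ ∀ h : ℝ, 0 < h → h ≤ 1 → ∀ (a₁ a₂ : Eu n → Eu n → ℂ)
      (C₁ C₂ : MIdx n → MIdx n → ℝ), IsRoughSymbol k₁ μ C₁ a₁ → IsSmoothSymbol k C₂ a₂ →
      ∀ s S : ℕ, 4 * (compOrder n + 1) ≤ s → 4 * (compOrder n + 1) ≤ S →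
      CompositionBound (schwartzToSobolev h k) h a₁ a₂ (K * (
        (∑ z ∈ (pairLE n S ×ˢ pairLE n S) with
          (len z.1.1 + len z.1.2 + len z.2.1 + len z.2.2 ≤ S ∧ len z.1.2 ≤ μ ∧
            1 ≤ len z.1.1 + len z.1.2 ∧ 1 ≤ len z.2.1 + len z.2.2),
          h ^ (((len z.1.1 + len z.1.2 + len z.2.1 + len z.2.2 : ℕ) : ℝ) / 2) *
            C₁ z.1.1 z.1.2 * C₂ z.2.1 z.2.2)
        + h ^ ((μ : ℝ) / 2) * Real.log (1 + h⁻¹) *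
          (∑ α₁ ∈ midxLE n (n + 1), ∑ β₁ ∈ midxEq n μ, ∑ q ∈ pairLE n s,
            h ^ (((len q.1 + len q.2 : ℕ) : ℝ) / 2) * C₁ α₁ β₁ * C₂ q.1 q.2)
        + h ^ ((μ : ℝ) / 2) * Real.log (1 + h⁻¹) *
          (∑ p ∈ pairLE n (n + 1), ∑ β₁ ∈ midxEq n μ, C₁ p.1 β₁ * C₂ p.2 0))) := by
  obtain ⟨K, hK, hcomp⟩ := exists_compBound_rough_left n μ k hk₁
  refine ⟨K * 2, by positivity, fun h hh h1 a₁ a₂ C₁ C₂ ha₁ ha₂ s S hs hS => ?_⟩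
  have hC₂ := ha₂.nonneg
  have hC₁ : ∀ α β, len β = μ → 0 ≤ C₁ α β := fun α β hβ => ha₁.nonneg α β hβ.le
  have hw : 0 ≤ h ^ ((μ : ℝ) / 2) := Real.rpow_nonneg hh.le _
  have hnn : ∀ z : (MIdx n × MIdx n) × (MIdx n × MIdx n), (len z.1.1 + len z.1.2 + len z.2.1 +
      len z.2.2 ≤ S ∧ len z.1.2 ≤ μ ∧ 1 ≤ len z.1.1 + len z.1.2 ∧ 1 ≤ len z.2.1 + len z.2.2) →
      0 ≤ C₁ z.1.1 z.1.2 * C₂ z.2.1 z.2.2 := fun z hz =>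
    mul_nonneg (ha₁.nonneg _ _ hz.2.1) (hC₂ _ _)
  have eS₂ : (∑ α₁ ∈ midxLE n (n + 1), ∑ β₁ ∈ midxEq n μ, ∑ q ∈ pairLE n s,
      h ^ (((len q.1 + len q.2 : ℕ) : ℝ) / 2) * C₁ α₁ β₁ * C₂ q.1 q.2) =
      ∑ q ∈ pairLE n s, ∑ α₁ ∈ midxLE n (n + 1), ∑ β₁ ∈ midxEq n μ,
        h ^ (((len q.1 + len q.2 : ℕ) : ℝ) / 2) * C₂ q.1 q.2 * C₁ α₁ β₁ := by
    rw [Finset.sum_comm (s := pairLE n s)]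
    refine Finset.sum_congr rfl fun α _ => ?_
    rw [Finset.sum_comm (s := pairLE n s)]
    exact Finset.sum_congr rfl fun β _ => Finset.sum_congr rfl fun q _ => by ring
  -- The sums are rearranged so that the smooth symbol comes first; the summation lemmas then apply
  -- with the roles of the two symbols exchanged.
  rw [mul_assoc, eS₂, sum_pairLE_swap]
  have hT := le_two_mul_total
    (S₁ := ∑ z ∈ (pairLE n S ×ˢ pairLE n S) with
          (len z.1.1 + len z.1.2 + len z.2.1 + len z.2.2 ≤ S ∧ len z.1.2 ≤ μ ∧
            1 ≤ len z.1.1 + len z.1.2 ∧ 1 ≤ len z.2.1 + len z.2.2),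
          h ^ (((len z.1.1 + len z.1.2 + len z.2.1 + len z.2.2 : ℕ) : ℝ) / 2) *
            C₁ z.1.1 z.1.2 * C₂ z.2.1 z.2.2)
    (S₂ := ∑ q ∈ pairLE n s, ∑ α₁ ∈ midxLE n (n + 1), ∑ β₁ ∈ midxEq n μ,
        h ^ (((len q.1 + len q.2 : ℕ) : ℝ) / 2) * C₂ q.1 q.2 * C₁ α₁ β₁)
    (S₃ := ∑ p ∈ pairLE n (n + 1), ∑ β ∈ midxEq n μ, C₂ p.1 0 * C₁ p.2 β)
    (Finset.sum_nonneg fun z hz => by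
      rw [mul_assoc]
      exact mul_nonneg (Real.rpow_nonneg hh.le _) (hnn z (Finset.mem_filter.1 hz).2))
    (Finset.sum_nonneg fun q _ => Finset.sum_nonneg fun α _ => Finset.sum_nonneg fun β hβ =>
      mul_nonneg (mul_nonneg (Real.rpow_nonneg hh.le _) (hC₂ _ _)) (hC₁ _ _ (mem_midxEq.1 hβ)))
    (Finset.sum_nonneg fun p _ => Finset.sum_nonneg fun β hβ =>
      mul_nonneg (hC₂ _ _) (hC₁ _ _ (mem_midxEq.1 hβ))) hw (half_le_log hh h1)
  have hb := (hcomp h _ C₁ C₂ a₁ a₂ hh h1 ha₁ ha₂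
    (fun i hi j hj i' hi' j' hj' h1i h1j hjμ => le_trans (mul_lsum_le_sum_prod hh hnn (S := S)
      (by omega) fun z hz1 hz2 hz3 hz4 => by rw [hz1, hz2, hz3, hz4]; omega) hT.1)
    (fun i hi i' hi' j' hj' => ?_) (fun i i' hi => ?_))
  · refine hb.compositionBound_sobolev hh (aestronglyMeasurable_quant hh ha₁.aestronglyMeasurable)
      (B₁ := lsum C₁ 0 0) (fun z => ?_) (aestronglyMeasurable_quant hh
        (aestronglyMeasurable_weight_mul _ ha₂.1.continuous.aestronglyMeasurable))
      (norm_weight_mul_le (ha₂.lsum_nonneg 0 0) le_rfl fun x ξ => ?_)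
    · exact (ha₁.norm_le z.1 _).trans (mul_le_of_le_one_right (ha₁.lsum_nonneg 0 (Nat.zero_le _))
        (Real.rpow_le_one_of_one_le_of_nonpos (one_le_bracket _) hk₁.le))
    · simpa using ha₂.symBound.norm_iteratedFDeriv_le 0 x ξ
  · refine le_trans (le_of_eq ?_) ((mul_le_mul_of_nonneg_left (mul_lsum_le_sum_sum (s := s)
      (d := n + 1) hh hC₂ hC₁ (by omega : i' + j' ≤ s) hi) hw).trans hT.2.1)
    rw [sqrt_pow_eq hh μ]
    ring
  · refine le_trans (le_of_eq ?_) ((mul_le_mul_of_nonneg_left (lsum_zero_mul_lsum_le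
      (fun α => hC₂ α 0) hC₁ ((add_comm i' i).trans_le hi)) hw).trans hT.2.2)
    rw [sqrt_pow_eq hh μ]
    ring

theorem exists_compositionBound_right (n : ℕ) (k k' : ℝ) (μ : ℕ) (hk : k < k') (hμ : 1 ≤ μ) :
    ∃ K : ℝ, 0 < K ∧ ∀ h : ℝ, 0 < h → h ≤ 1 → ∀ (a₁ a₂ : Eu n → Eu n → ℂ)
      (C₁ C₂ : MIdx n → MIdx n → ℝ), IsSmoothSymbol 0 C₁ a₁ → IsRoughSymbol k μ C₂ a₂ →
      ∀ s S : ℕ, 4 * (compOrder n + 1) ≤ s → 4 * (compOrder n + 1) ≤ S →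
      CompositionBound (schwartzToSobolev h k') h a₁ a₂ (K * (
        (∑ z ∈ (pairLE n S ×ˢ pairLE n S) with
          (len z.1.1 + len z.1.2 + len z.2.1 + len z.2.2 ≤ S ∧ len z.2.2 ≤ μ ∧
            1 ≤ len z.1.1 + len z.1.2 ∧ 1 ≤ len z.2.1 + len z.2.2),
          h ^ (((len z.1.1 + len z.1.2 + len z.2.1 + len z.2.2 : ℕ) : ℝ) / 2) *
            C₁ z.1.1 z.1.2 * C₂ z.2.1 z.2.2)
        + h ^ ((μ : ℝ) / 2) * Real.log (1 + h⁻¹) *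
          (∑ p ∈ pairLE n s, ∑ α₂ ∈ midxLE n (n + 1), ∑ β₂ ∈ midxEq n μ,
            h ^ (((len p.1 + len p.2 : ℕ) : ℝ) / 2) * C₁ p.1 p.2 * C₂ α₂ β₂)
        + h ^ ((μ : ℝ) / 2) * Real.log (1 + h⁻¹) *
          (∑ p ∈ pairLE n (n + 1), ∑ β₂ ∈ midxEq n μ, C₁ p.1 0 * C₂ p.2 β₂))) := by
  obtain ⟨K, hK, hcomp⟩ := exists_compBound_rough_right n hμ hk
  refine ⟨K * 2, by positivity, fun h hh h1 a₁ a₂ C₁ C₂ ha₁ ha₂ s S hs hS => ?_⟩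
  have hC₁ := ha₁.nonneg
  have hC₂ : ∀ α β, len β = μ → 0 ≤ C₂ α β := fun α β hβ => ha₂.nonneg α β hβ.le
  have hw : 0 ≤ h ^ ((μ : ℝ) / 2) := Real.rpow_nonneg hh.le _
  have hnn : ∀ z : (MIdx n × MIdx n) × (MIdx n × MIdx n), (len z.1.1 + len z.1.2 + len z.2.1 +
      len z.2.2 ≤ S ∧ len z.2.2 ≤ μ ∧ 1 ≤ len z.1.1 + len z.1.2 ∧ 1 ≤ len z.2.1 + len z.2.2) →
      0 ≤ C₁ z.1.1 z.1.2 * C₂ z.2.1 z.2.2 := fun z hz =>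
    mul_nonneg (hC₁ _ _) (ha₂.nonneg _ _ hz.2.1)
  rw [mul_assoc]
  have hT := le_two_mul_total
    (S₁ := ∑ z ∈ (pairLE n S ×ˢ pairLE n S) with
          (len z.1.1 + len z.1.2 + len z.2.1 + len z.2.2 ≤ S ∧ len z.2.2 ≤ μ ∧
            1 ≤ len z.1.1 + len z.1.2 ∧ 1 ≤ len z.2.1 + len z.2.2),
          h ^ (((len z.1.1 + len z.1.2 + len z.2.1 + len z.2.2 : ℕ) : ℝ) / 2) *
            C₁ z.1.1 z.1.2 * C₂ z.2.1 z.2.2)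
    (S₂ := ∑ p ∈ pairLE n s, ∑ α₂ ∈ midxLE n (n + 1), ∑ β₂ ∈ midxEq n μ,
        h ^ (((len p.1 + len p.2 : ℕ) : ℝ) / 2) * C₁ p.1 p.2 * C₂ α₂ β₂)
    (S₃ := ∑ p ∈ pairLE n (n + 1), ∑ β ∈ midxEq n μ, C₁ p.1 0 * C₂ p.2 β)
    (Finset.sum_nonneg fun z hz => by
      rw [mul_assoc]
      exact mul_nonneg (Real.rpow_nonneg hh.le _) (hnn z (Finset.mem_filter.1 hz).2))
    (Finset.sum_nonneg fun q _ => Finset.sum_nonneg fun α _ => Finset.sum_nonneg fun β hβ =>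
      mul_nonneg (mul_nonneg (Real.rpow_nonneg hh.le _) (hC₁ _ _)) (hC₂ _ _ (mem_midxEq.1 hβ)))
    (Finset.sum_nonneg fun p _ => Finset.sum_nonneg fun β hβ =>
      mul_nonneg (hC₁ _ _) (hC₂ _ _ (mem_midxEq.1 hβ))) hw (half_le_log hh h1)
  have hb := (hcomp h _ C₁ C₂ a₁ a₂ hh h1 ha₁ ha₂
    (fun i hi j hj i' hi' j' hj' h1i h1j hjμ => le_trans (mul_lsum_le_sum_prod hh hnn (S := S)
      (by omega) fun z hz1 hz2 hz3 hz4 => by rw [hz1, hz2, hz3, hz4]; omega) hT.1)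
    (fun i hi j hj i' hi' => ?_) (fun i i' hi => ?_))
  · refine hb.compositionBound_sobolev hh (aestronglyMeasurable_quant hh
        ha₁.1.continuous.aestronglyMeasurable)
      (ha₁.symBound.norm_quant_le le_rfl ha₁.lsum_nonneg) (aestronglyMeasurable_quant hh
        (aestronglyMeasurable_weight_mul _ ha₂.aestronglyMeasurable))
      (norm_weight_mul_le (ha₂.lsum_nonneg 0 (Nat.zero_le _)) hk.le ha₂.norm_le)
  · refine le_trans (le_of_eq ?_) ((mul_le_mul_of_nonneg_left (mul_lsum_le_sum_sum (s := s)
      (d := n + 1) hh hC₁ hC₂ (by omega : i + j ≤ s) hi') hw).trans hT.2.1)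
    rw [sqrt_pow_eq hh μ]
    ring
  · refine le_trans (le_of_eq ?_) ((mul_le_mul_of_nonneg_left (lsum_zero_mul_lsum_le
      (fun α => hC₁ α 0) hC₂ hi) hw).trans hT.2.2)
    rw [sqrt_pow_eq hh μ]
    ring

theorem exists_compositionBound_fst (n : ℕ) (μ : ℕ) (hμ : 1 ≤ μ) :
    ∃ K : ℝ, 0 < K ∧ ∀ h : ℝ, 0 < h → ∀ (a₁ : Eu n → Eu n → ℂ) (a₂ : Eu n → ℂ)
      (C₁ : MIdx n → MIdx n → ℝ) (C₂ : MIdx n → ℝ), IsSmoothSymbol 0 C₁ a₁ →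
      IsRoughFunction μ C₂ a₂ →
      ∀ s S : ℕ, 4 * (compOrder n + 1) ≤ s → 4 * (compOrder n + 1) ≤ S →
      CompositionBound schwartzToL2 h a₁ (fun x _ => a₂ x) (K * (
        (∑ z ∈ (pairLE n S ×ˢ midxLE n S) with
          (len z.1.1 + len z.1.2 + len z.2 ≤ S ∧ 1 ≤ len z.1.1 + len z.1.2 ∧
            1 ≤ len z.2 ∧ len z.2 ≤ μ),
          h ^ (((len z.1.1 + len z.1.2 + len z.2 : ℕ) : ℝ) / 2) * C₁ z.1.1 z.1.2 * C₂ z.2)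
        + h ^ ((μ : ℝ) / 2) *
          (∑ p ∈ pairLE n s, ∑ β₂ ∈ midxEq n μ,
            h ^ (((len p.1 + len p.2 : ℕ) : ℝ) / 2) * C₁ p.1 p.2 * C₂ β₂))) := by
  obtain ⟨K, hK, hcomp⟩ := exists_compBound_rough_fst n hμ
  refine ⟨K, hK, fun h hh a₁ a₂ C₁ C₂ ha₁ ha₂ s S hs hS => ?_⟩
  have hC₁ := ha₁.nonneg
  have hw : 0 ≤ h ^ ((μ : ℝ) / 2) := Real.rpow_nonneg hh.le _
  have hnn : ∀ z : (MIdx n × MIdx n) × MIdx n, len z.2 ≤ μ →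
      0 ≤ h ^ (((len z.1.1 + len z.1.2 + len z.2 : ℕ) : ℝ) / 2) * C₁ z.1.1 z.1.2 * C₂ z.2 :=
    fun z hz => mul_nonneg (mul_nonneg (Real.rpow_nonneg hh.le _) (hC₁ _ _)) (ha₂.nonneg hz)
  have hC₂ : 0 ≤ ∑ β ∈ midxEq n μ, C₂ β :=
    Finset.sum_nonneg fun β hβ => ha₂.nonneg (mem_midxEq.1 hβ).le
  have e : ∑ p ∈ pairLE n s, ∑ β₂ ∈ midxEq n μ,
      h ^ (((len p.1 + len p.2 : ℕ) : ℝ) / 2) * C₁ p.1 p.2 * C₂ β₂ =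
      (∑ p ∈ pairLE n s, h ^ (((len p.1 + len p.2 : ℕ) : ℝ) / 2) * C₁ p.1 p.2) *
        ∑ β ∈ midxEq n μ, C₂ β := by
    simp only [← Finset.mul_sum]
    rw [← Finset.sum_mul]
  rw [e]
  have hp : 0 ≤ ∑ p ∈ pairLE n s, h ^ (((len p.1 + len p.2 : ℕ) : ℝ) / 2) * C₁ p.1 p.2 :=
    Finset.sum_nonneg fun p _ => mul_nonneg (Real.rpow_nonneg hh.le _) (hC₁ _ _)
  have hS₁ : 0 ≤ ∑ z ∈ (pairLE n S ×ˢ midxLE n S) with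
      (len z.1.1 + len z.1.2 + len z.2 ≤ S ∧ 1 ≤ len z.1.1 + len z.1.2 ∧
        1 ≤ len z.2 ∧ len z.2 ≤ μ),
      h ^ (((len z.1.1 + len z.1.2 + len z.2 : ℕ) : ℝ) / 2) * C₁ z.1.1 z.1.2 * C₂ z.2 :=
    Finset.sum_nonneg fun z hz => hnn z (Finset.mem_filter.1 hz).2.2.2.2
  have hb := hcomp h _ C₁ C₂ a₁ a₂ hh ha₁ ha₂
    (fun i hi j hj j' hj' h1i h1j hjμ => le_trans ?_ (le_add_of_nonneg_right
      (a := ∑ z ∈ (pairLE n S ×ˢ midxLE n S) with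
        (len z.1.1 + len z.1.2 + len z.2 ≤ S ∧ 1 ≤ len z.1.1 + len z.1.2 ∧
          1 ≤ len z.2 ∧ len z.2 ≤ μ),
        h ^ (((len z.1.1 + len z.1.2 + len z.2 : ℕ) : ℝ) / 2) * C₁ z.1.1 z.1.2 * C₂ z.2)
      (mul_nonneg hw (mul_nonneg hp hC₂))))
    (fun i hi j hj => le_trans ?_ (le_add_of_nonneg_left hS₁))
  · exact hb.compositionBound hh (aestronglyMeasurable_quant hh
        ha₁.1.continuous.aestronglyMeasurable)
      (ha₁.symBound.norm_quant_le le_rfl ha₁.lsum_nonneg) (aestronglyMeasurable_quant hh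
        ha₂.isRoughSymbol.aestronglyMeasurable) (B₂ := lsum (fstConst C₂) 0 0) fun z => by
          have := ha₂.isRoughSymbol.norm_le z.1 0
          rwa [Real.rpow_zero, mul_one] at this
  · have hm : ∀ z ∈ (midxEq n i ×ˢ midxEq n j) ×ˢ midxEq n j',
        len z.1.1 = i ∧ len z.1.2 = j ∧ len z.2 = j' := fun z hz => by
      simp only [Finset.mem_product, mem_midxEq] at hz
      exact ⟨hz.1.1, hz.1.2, hz.2⟩
    have e₀ : ∑ z ∈ (midxEq n i ×ˢ midxEq n j) ×ˢ midxEq n j', C₁ z.1.1 z.1.2 * C₂ z.2 =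
        lsum C₁ i j * ∑ β ∈ midxEq n j', C₂ β := by
      rw [lsum_eq_sum_product, Finset.sum_mul_sum, ← Finset.sum_product']
    have e' : √h ^ (i + j) * lsum C₁ i j * (√h ^ j' * ∑ β ∈ midxEq n j', C₂ β) =
        ∑ z ∈ (midxEq n i ×ˢ midxEq n j) ×ˢ midxEq n j',
          h ^ (((len z.1.1 + len z.1.2 + len z.2 : ℕ) : ℝ) / 2) * C₁ z.1.1 z.1.2 * C₂ z.2 := by
      refine Eq.symm ((Finset.sum_congr rfl (g := fun z =>
        √h ^ (i + j + j') * (C₁ z.1.1 z.1.2 * C₂ z.2)) fun z hz => ?_).trans ?_)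
      · obtain ⟨h1, h2, h3⟩ := hm z hz
        rw [h1, h2, h3, ← sqrt_pow_eq hh, mul_assoc]
      · rw [← Finset.mul_sum, e₀, pow_add]
        ring
    rw [e']
    refine Finset.sum_le_sum_of_subset_of_nonneg (fun z hz => ?_) fun z hz _ =>
      hnn z (Finset.mem_filter.1 hz).2.2.2.2
    obtain ⟨h1, h2, h3⟩ := hm z hz
    simp only [Finset.mem_filter, Finset.mem_product, mem_pairLE, mem_midxLE, h1, h2, h3]
    omega
  · rw [sqrt_pow_eq hh μ]
    have := mul_le_mul_of_nonneg_right (mul_lsum_le_sum_pairLE (s := s) hh hC₁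
      (by omega : i + j ≤ s)) hC₂
    calc _ = h ^ ((μ : ℝ) / 2) * (√h ^ (i + j) * lsum C₁ i j * ∑ β ∈ midxEq n μ, C₂ β) := by ring
      _ ≤ _ := mul_le_mul_of_nonneg_left this hw

end

end RoughPsiDO

end

/-! ### Assembly of the three cases. -/

theorem proposition2p5 (d : ℕ) (hd : 2 ≤ d) :
    ∃ s : ℕ,
      -- the first symbol is of class `C^μ` in `x`, of negative order
      (∀ (k₁ k : ℝ) (μ : ℕ), k₁ < 0 → 1 ≤ μ → ∃ K : ℝ, 0 < K ∧
        ∀ (h : ℝ), 0 < h → h ≤ 1 →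
        ∀ (a₁ a₂ : RoughPsiDO.Eu (d - 1) → RoughPsiDO.Eu (d - 1) → ℂ)
          (C₁ C₂ : RoughPsiDO.MIdx (d - 1) → RoughPsiDO.MIdx (d - 1) → ℝ),
        RoughPsiDO.IsRoughSymbol k₁ μ C₁ a₁ → RoughPsiDO.IsSmoothSymbol k C₂ a₂ →
        RoughPsiDO.CompositionBound (RoughPsiDO.schwartzToSobolev h k) h a₁ a₂
          (K * (
            (∑ z ∈ (RoughPsiDO.pairLE (d - 1) (2 * d + 5 + s) ×ˢ
                RoughPsiDO.pairLE (d - 1) (2 * d + 5 + s)) with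
              (RoughPsiDO.len z.1.1 + RoughPsiDO.len z.1.2 + RoughPsiDO.len z.2.1 +
                  RoughPsiDO.len z.2.2 ≤ 2 * d + 5 + s ∧
                RoughPsiDO.len z.1.2 ≤ μ ∧
                1 ≤ RoughPsiDO.len z.1.1 + RoughPsiDO.len z.1.2 ∧
                1 ≤ RoughPsiDO.len z.2.1 + RoughPsiDO.len z.2.2),
              h ^ (((RoughPsiDO.len z.1.1 + RoughPsiDO.len z.1.2 + RoughPsiDO.len z.2.1 +
                  RoughPsiDO.len z.2.2 : ℕ) : ℝ) / 2) * C₁ z.1.1 z.1.2 * C₂ z.2.1 z.2.2)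
            + h ^ ((μ : ℝ) / 2) * Real.log (1 + h⁻¹) *
              (∑ α₁ ∈ RoughPsiDO.midxLE (d - 1) d, ∑ β₁ ∈ RoughPsiDO.midxEq (d - 1) μ,
                ∑ q ∈ RoughPsiDO.pairLE (d - 1) s,
                  h ^ (((RoughPsiDO.len q.1 + RoughPsiDO.len q.2 : ℕ) : ℝ) / 2) *
                    C₁ α₁ β₁ * C₂ q.1 q.2)
            + h ^ ((μ : ℝ) / 2) * Real.log (1 + h⁻¹) *
              (∑ p ∈ RoughPsiDO.pairLE (d - 1) d, ∑ β₁ ∈ RoughPsiDO.midxEq (d - 1) μ,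
                C₁ p.1 β₁ * C₂ p.2 0)))) ∧
      -- the second symbol is of class `C^μ` in `x`
      (∀ (k k' : ℝ) (μ : ℕ), k < k' → 1 ≤ μ → ∃ K : ℝ, 0 < K ∧
        ∀ (h : ℝ), 0 < h → h ≤ 1 →
        ∀ (a₁ a₂ : RoughPsiDO.Eu (d - 1) → RoughPsiDO.Eu (d - 1) → ℂ)
          (C₁ C₂ : RoughPsiDO.MIdx (d - 1) → RoughPsiDO.MIdx (d - 1) → ℝ),
        RoughPsiDO.IsSmoothSymbol 0 C₁ a₁ → RoughPsiDO.IsRoughSymbol k μ C₂ a₂ →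
        RoughPsiDO.CompositionBound (RoughPsiDO.schwartzToSobolev h k') h a₁ a₂
          (K * (
            (∑ z ∈ (RoughPsiDO.pairLE (d - 1) (2 * d + 5 + s) ×ˢ
                RoughPsiDO.pairLE (d - 1) (2 * d + 5 + s)) with
              (RoughPsiDO.len z.1.1 + RoughPsiDO.len z.1.2 + RoughPsiDO.len z.2.1 +
                  RoughPsiDO.len z.2.2 ≤ 2 * d + 5 + s ∧
                RoughPsiDO.len z.2.2 ≤ μ ∧
                1 ≤ RoughPsiDO.len z.1.1 + RoughPsiDO.len z.1.2 ∧
                1 ≤ RoughPsiDO.len z.2.1 + RoughPsiDO.len z.2.2),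
              h ^ (((RoughPsiDO.len z.1.1 + RoughPsiDO.len z.1.2 + RoughPsiDO.len z.2.1 +
                  RoughPsiDO.len z.2.2 : ℕ) : ℝ) / 2) * C₁ z.1.1 z.1.2 * C₂ z.2.1 z.2.2)
            + h ^ ((μ : ℝ) / 2) * Real.log (1 + h⁻¹) *
              (∑ p ∈ RoughPsiDO.pairLE (d - 1) s, ∑ α₂ ∈ RoughPsiDO.midxLE (d - 1) d,
                ∑ β₂ ∈ RoughPsiDO.midxEq (d - 1) μ,
                  h ^ (((RoughPsiDO.len p.1 + RoughPsiDO.len p.2 : ℕ) : ℝ) / 2) *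
                    C₁ p.1 p.2 * C₂ α₂ β₂)
            + h ^ ((μ : ℝ) / 2) * Real.log (1 + h⁻¹) *
              (∑ p ∈ RoughPsiDO.pairLE (d - 1) d, ∑ β₂ ∈ RoughPsiDO.midxEq (d - 1) μ,
                C₁ p.1 0 * C₂ p.2 β₂)))) ∧
      -- the second symbol is a function of `x` of class `C^μ`
      (∀ (μ : ℕ), 1 ≤ μ → ∃ K : ℝ, 0 < K ∧
        ∀ (h : ℝ), 0 < h → h ≤ 1 →
        ∀ (a₁ : RoughPsiDO.Eu (d - 1) → RoughPsiDO.Eu (d - 1) → ℂ)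
          (a₂ : RoughPsiDO.Eu (d - 1) → ℂ)
          (C₁ : RoughPsiDO.MIdx (d - 1) → RoughPsiDO.MIdx (d - 1) → ℝ)
          (C₂ : RoughPsiDO.MIdx (d - 1) → ℝ),
        RoughPsiDO.IsSmoothSymbol 0 C₁ a₁ → RoughPsiDO.IsRoughFunction μ C₂ a₂ →
        RoughPsiDO.CompositionBound RoughPsiDO.schwartzToL2 h a₁ (fun x _ => a₂ x)
          (K * (
            (∑ z ∈ (RoughPsiDO.pairLE (d - 1) (2 * d + 5 + s) ×ˢ
                RoughPsiDO.midxLE (d - 1) (2 * d + 5 + s)) with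
              (RoughPsiDO.len z.1.1 + RoughPsiDO.len z.1.2 + RoughPsiDO.len z.2 ≤ 2 * d + 5 + s ∧
                1 ≤ RoughPsiDO.len z.1.1 + RoughPsiDO.len z.1.2 ∧
                1 ≤ RoughPsiDO.len z.2 ∧ RoughPsiDO.len z.2 ≤ μ),
              h ^ (((RoughPsiDO.len z.1.1 + RoughPsiDO.len z.1.2 + RoughPsiDO.len z.2 : ℕ) : ℝ) / 2)
                * C₁ z.1.1 z.1.2 * C₂ z.2)
            + h ^ ((μ : ℝ) / 2) *
              (∑ p ∈ RoughPsiDO.pairLE (d - 1) s, ∑ β₂ ∈ RoughPsiDO.midxEq (d - 1) μ,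
                h ^ (((RoughPsiDO.len p.1 + RoughPsiDO.len p.2 : ℕ) : ℝ) / 2) *
                  C₁ p.1 p.2 * C₂ β₂)))) := by
  -- With d = n + 1, the bound d on the ξ-orders is the number n + 1 of derivatives in the kernel
  -- estimate.
  obtain ⟨n, hn⟩ : ∃ n, n = d - 1 := ⟨_, rfl⟩
  have hd' : d = n + 1 := by omega
  rw [← hn]
  subst hd'
  -- Four derivative orders of at most `compOrder n` + 1 each. This depends on d alone, and the
  -- range 2d + 5 + s of the first sum exceeds it.
  refine ⟨4 * (RoughPsiDO.compOrder n + 1), fun k₁ k μ hk₁ _ => ?_, fun k k' μ hk hμ => ?_,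
    fun μ hμ => ?_⟩
  · obtain ⟨K, hK, H⟩ := RoughPsiDO.exists_compositionBound_left n k₁ k μ hk₁
    exact ⟨K, hK, fun h hh h1 a₁ a₂ C₁ C₂ ha₁ ha₂ =>
      H h hh h1 a₁ a₂ C₁ C₂ ha₁ ha₂ _ _ le_rfl (by omega)⟩
  · obtain ⟨K, hK, H⟩ := RoughPsiDO.exists_compositionBound_right n k k' μ hk hμ
    exact ⟨K, hK, fun h hh h1 a₁ a₂ C₁ C₂ ha₁ ha₂ =>
      H h hh h1 a₁ a₂ C₁ C₂ ha₁ ha₂ _ _ le_rfl (by omega)⟩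
  · obtain ⟨K, hK, H⟩ := RoughPsiDO.exists_compositionBound_fst n μ hμ
    exact ⟨K, hK, fun h hh _ a₁ a₂ C₁ C₂ ha₁ ha₂ =>
      H h hh a₁ a₂ C₁ C₂ ha₁ ha₂ _ _ le_rfl (by omega)⟩
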